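/- Let $m\ge 1$ and let $\kappa=(k_0,k_1,\dots,k_m)$ be a vector of positive integers. For $\mu=(\eta_0,a_1,r_2,\eta_2,\dots,r_m,\eta_m)\in\mathbb R^{2m}$ with $a_1>1$ and $r_j>1$, put $a_j=r_je^{2\pi i\eta_j}$ ($2\le j\le m$) and $$B_\mu(z)=e^{2\pi i\eta_0}z^{k_0}\prod_{j=1}^m\left(\frac{z-a_j}{1-\overline{a_j}z}\right)^{k_j}.$$ $B_\mu$ maps the unit circle $\mathbb S^1$ to itself, with degree $d=k_0-\sum_{j=1}^m k_j$. Let $\Delta$ be the set of those $\mu$ for which $B_\mu|_{\mathbb S^1}$ is $2m$-multimodal, i.e. has exactly $2m$ turning points, and let $cc(\Delta)$ be a connected component of $\Delta$. For $\mu\in\Delta$ let $\hat D_j(\mu)$ be the connected component of $\{z: |z|>1,\ |B_\mu(z)|<1\}$ containing $a_j$. A lift family is a jointly continuous function $(\mu,t)\mapsto F_\mu(t)$ on $cc(\Delta)\times\mathbb R$ with $B_\mu(e^{2\pi i t})=e^{2\pi i F_\mu(t)}$. Given a lift family and a permutation $\sigma$ of $\{1,\dots,m\}$ with $\sigma(1)=1$,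 a critical labelling of type $\sigma$ consists of continuous functions $C_1,\dots,C_{2m}:cc(\Delta)\to\mathbb R$ with $$C_1(\mu)<C_2(\mu)<\dots<C_{2m}(\mu)<C_1(\mu)+1\qquad(\mu\in cc(\Delta))$$ such that, for all $\mu$ and $j$, $C_{2j-1}(\mu)$ is a local maximum and $C_{2j}(\mu)$ a local minimum point of $F_\mu$, and both $e^{2\pi i C_{2j-1}(\mu)}$ and $e^{2\pi i C_{2j}(\mu)}$ lie on the boundary of $\hat D_{\sigma(j)}(\mu)$. Let $$V_\sigma=\left\{v\in\mathbb R^{2m}:\ (-1)^i(v_{i+1}-v_i)>0\ (1\le i<2m),\ \ 0<v_{2j-1}-v_{2j}<k_{\sigma(j)}\ (1\le j\le m),\ \ v_{2m}<v_1+d\right\}.$$ Then there is exactly one permutation $\sigma$ (depending only on $cc(\Delta)$) with the following two properties: a lift family with a critical labelling of type $\sigma$ exists; and, for every lift family $F$ and every critical labelling $C_1,\dots,C_{2m}$ of type $\sigma$, the map $$\phi(\mu)=\bigl(F_\mu(C_1(\mu)),\dots,F_\mu(C_{2m}(\mu))\bigr)$$ is a $C^\infty$ diffeomorphism from the open set $cc(\Delta)$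 onto the open set $V_\sigma$. In particular, if the zeros $a_1,\dots,a_m$ are numbered on $cc(\Delta)$ in the cyclic order of their pairs of turning points ($\sigma=\mathrm{id}$), then $\phi$ is a diffeomorphism onto $$V=\{v:\ (-1)^i(v_{i+1}-v_i)>0,\ 0<v_{2j-1}-v_{2j}<k_j,\ v_{2m}<v_1+d\}.$$ -/

import Mathlib

open Set

open scoped ContDiff

noncomputable section

namespace BlaschkeFamily

/-- Position `2 j - 1` (counting both `j` and positions from one) in a vector of length `2 m`. -/
def fstIdx {m : ℕ} (j : Fin m) : Fin (2 * m) := ⟨2 * (j : ℕ), by omega⟩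

/-- Position `2 j` (counting both `j` and positions from one) in a vector of length `2 m`. -/
def sndIdx {m : ℕ} (j : Fin m) : Fin (2 * m) := ⟨2 * (j : ℕ) + 1, by omega⟩

/-- The ambient space `ℝ^{2m}`; a parameter is written `(η₀, a₁, r₂, η₂, …, r_m, η_m)`. -/
abbrev RealVec (m : ℕ) := Fin (2 * m) → ℝ

/-- The rotation parameter `η₀`. -/
def eta0 {m : ℕ} [NeZero m] (μ : RealVec m) : ℝ := μ (fstIdx 0)

/-- The moduli `r₁ = a₁, r₂, …, r_m`. -/
def radius {m : ℕ} [NeZero m] (μ : RealVec m) (j : Fin m) : ℝ :=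
  if j = 0 then μ (sndIdx 0) else μ (fstIdx j)

/-- The angles `η₁ = 0, η₂, …, η_m`. -/
def angle {m : ℕ} [NeZero m] (μ : RealVec m) (j : Fin m) : ℝ :=
  if j = 0 then 0 else μ (sndIdx j)

/-- The covering map `t ↦ e^{2 π i t}` of the unit circle. -/
def circleCover (t : ℝ) : ℂ := Complex.exp (2 * Real.pi * Complex.I * t)

/-- The zeros `a_j = r_j e^{2 π i η_j}`. -/
def zeroPt {m : ℕ} [NeZero m] (μ : RealVec m) (j : Fin m) : ℂ :=
  (radius μ j : ℂ) * circleCover (angle μ j)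

/-- The Blaschke-type product
`B(z) = e^{2 π i η₀} z^{k₀} ∏_j ((z - a_j) / (1 - conj a_j z))^{k_j}`. -/
def blaschke {m : ℕ} [NeZero m] (κ : Fin (m + 1) → ℕ) (μ : RealVec m) (z : ℂ) : ℂ :=
  circleCover (eta0 μ) * z ^ κ 0 *
    ∏ j : Fin m, ((z - zeroPt μ j) / (1 - star (zeroPt μ j) * z)) ^ κ j.succ

/-- `F : ℝ → ℝ` is a (continuous) lift, with respect to `circleCover`, of the restriction of `g`
to the unit circle; in particular `g` maps the unit circle to itself. -/
def IsCircleLift (g : ℂ → ℂ) (F : ℝ → ℝ) : Prop :=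
  Continuous F ∧ ∀ t : ℝ, g (circleCover t) = circleCover (F t)

/-- The restriction of `g` to the unit circle is a continuous circle map with exactly `n` turning
points, a turning point being (the image of) a local extremum of a lift. A continuous function with
finitely many local extrema per period is strictly monotone between consecutive ones. -/
def IsMultimodal (n : ℕ) (g : ℂ → ℂ) : Prop :=
  ∃ F : ℝ → ℝ, IsCircleLift g F ∧ {t ∈ Ico (0 : ℝ) 1 | IsLocalExtr F t}.encard = n

/-- The set `Δ` of parameters (with `a₁ > 1` and `r_j > 1`) for which the restriction of the
Blaschke-type product to the unit circle is `2m`-multimodal. -/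
def multimodalParams {m : ℕ} [NeZero m] (κ : Fin (m + 1) → ℕ) : Set (RealVec m) :=
  {μ | (∀ j, 1 < radius μ j) ∧ IsMultimodal (2 * m) (blaschke κ μ)}

/-- The topological degree `d = k₀ - ∑_j k_j` of the circle map. -/
def circleDegree {m : ℕ} (κ : Fin (m + 1) → ℕ) : ℤ := (κ 0 : ℤ) - ∑ j : Fin m, (κ j.succ : ℤ)

/-- The domain `D̂_j`: the component containing `a_j` of the set of points outside the closed unit
disc that the Blaschke-type product maps into the open unit disc. -/
def outerDomain {m : ℕ} [NeZero m] (κ : Fin (m + 1) → ℕ) (μ : RealVec m) (j : Fin m) : Set ℂ :=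
  connectedComponentIn {z : ℂ | 1 < ‖z‖ ∧ ‖blaschke κ μ z‖ < 1} (zeroPt μ j)

/-- A choice of lifts `F_μ` of the circle maps that is jointly continuous in `μ ∈ U` and `t`. -/
structure IsLiftFamily {m : ℕ} [NeZero m] (κ : Fin (m + 1) → ℕ) (U : Set (RealVec m))
    (F : RealVec m → ℝ → ℝ) : Prop where
  continuousOn : ContinuousOn (fun p : RealVec m × ℝ => F p.1 p.2) (U ×ˢ univ)
  isCircleLift : ∀ μ ∈ U, IsCircleLift (blaschke κ μ) (F μ)

/-- A choice of continuous functions `C_1 < C_2 < ⋯ < C_{2m} < C_1 + 1` on `U` which are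
alternately local maxima and local minima of `F_μ`, the pair `C_{2j-1}, C_{2j}` being associated
with the zero `a_{σ j}`: both points lie on the boundary curve of `D̂_{σ j}`.
The labelling starts at `a_1`. -/
structure IsCriticalLabelling {m : ℕ} [NeZero m] (κ : Fin (m + 1) → ℕ) (U : Set (RealVec m))
    (σ : Equiv.Perm (Fin m)) (F : RealVec m → ℝ → ℝ) (C : Fin (2 * m) → RealVec m → ℝ) :
    Prop where
  continuousOn : ∀ i, ContinuousOn (C i) U
  strictMono : ∀ μ ∈ U, StrictMono fun i => C i μ
  lt_add_one : ∀ μ ∈ U, ∀ i, C i μ < C (fstIdx 0) μ + 1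
  isLocalMax : ∀ μ ∈ U, ∀ j, IsLocalMax (F μ) (C (fstIdx j) μ)
  isLocalMin : ∀ μ ∈ U, ∀ j, IsLocalMin (F μ) (C (sndIdx j) μ)
  perm_zero : σ 0 = 0
  fst_mem_frontier : ∀ μ ∈ U, ∀ j,
    circleCover (C (fstIdx j) μ) ∈ frontier (outerDomain κ μ (σ j))
  snd_mem_frontier : ∀ μ ∈ U, ∀ j,
    circleCover (C (sndIdx j) μ) ∈ frontier (outerDomain κ μ (σ j))

/-- The region `V` of vectors `v` with `(-1)^i (v_{i+1} - v_i) > 0` for `1 ≤ i < 2m`,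
`0 < v_{2j-1} - v_{2j} < k_{σ j}` for all `j`, and `v_{2m} < v_1 + d`. -/
def valueRegion {m : ℕ} [NeZero m] (κ : Fin (m + 1) → ℕ) (σ : Equiv.Perm (Fin m)) :
    Set (RealVec m) :=
  {v | (∀ (i : ℕ) (h : i + 1 < 2 * m),
          0 < (-1 : ℝ) ^ (i + 1) * (v ⟨i + 1, h⟩ - v ⟨i, by omega⟩)) ∧
       (∀ j : Fin m, 0 < v (fstIdx j) - v (sndIdx j) ∧
          v (fstIdx j) - v (sndIdx j) < κ (σ j).succ) ∧
       (∀ j : Fin m, (j : ℕ) + 1 = m → v (sndIdx j) < v (fstIdx 0) + circleDegree κ)}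

/-- The map `φ` sending `μ` to the vector of critical values `(F_μ(C_1(μ)), …, F_μ(C_{2m}(μ)))`. -/
def criticalValues {m : ℕ} (F : RealVec m → ℝ → ℝ) (C : Fin (2 * m) → RealVec m → ℝ)
    (μ : RealVec m) : RealVec m :=
  fun i => F μ (C i μ)

/-- `f` restricts to a smooth diffeomorphism from the open set `U` onto the open set `W`. -/
def IsDiffeoBetween {E : Type*} [NormedAddCommGroup E] [NormedSpace ℝ E] (f : E → E)
    (U W : Set E) : Prop :=
  IsOpen U ∧ IsOpen W ∧ BijOn f U W ∧ ContDiffOn ℝ ∞ f U ∧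
    ∃ g : E → E, InvOn g f U W ∧ ContDiffOn ℝ ∞ g W

end BlaschkeFamily

end

/-! Put b_j = 1/a_j. On the circle the map has a real-analytic lift `lr`, whose derivative `rr` is
the restriction of zB'/B. This is a rational function with poles only at 1/b_j and conj b_j, so its
numerator has degree at most 2m (`exists_pf_numerator`). A 2m-multimodal map exhausts this bound:
the b_j are distinct and nonzero, the turning points are nondegenerate, and B has no critical points
off the circle except among its zeros and poles (`rr_eq_zero_or_injective`, `IsLab.pf_simple`).
Everything rests on this exhaustion.

Topology. Without free critical points, B is an unramified covering of the punctured disc away from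
its zeros, so the components of {|z|>1, |B|<1} correspond to the zeros, and each punctured component
is the image of the left half-plane under a lift of `exp` with period 2πi k_j
(`DiscMap.exists_uniformization`). Inside the unit disc the only zero is the origin, so {|z|<1,
|B|<1} is connected. An exterior component that failed to reach the circle would, after reflection,
disconnect the part of this set near |B|=1; so every component touches the circle
(`IsLab.exists_touch`). There are m descending arcs and m components, each arc bounds one component
and each component is met, which gives the permutation σ (`IsLab.exists_isType`). Descending by k_j
or more along an arc would make the uniformization repeat a point of the arc too early; hence the
upper bounds in V (`IsLab.descent_le`, made strict in `IsLab.descent_lt`).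

Local coordinates. A deformation that fixes all critical values to first order has a variation with
2m zeros and the same poles as `rr`; it is therefore a multiple of `rr`, that is, an infinitesimal
rotation (`IsLab.exists_rotation`). After normalizing the rotation, the inverse function theorem
makes the critical values smooth local coordinates.

Properness. If b_i approaches the circle, its Poisson kernel produces a descent close to k_i, so
over a compact part of V the b_i stay in a compact part of the disc (`exists_radius_bound`). The
critical value map on labelled maps of type σ is then a proper local homeomorphism, hence a
covering, and the convex set V lifts through it (`exists_section`). Rotating a_1 back to the
positive axis turns the lift into a section with values in the parameter space
(`exists_param_section`). Its image is open and closed in the component of Δ, and it is injective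
because a labelling starting at a_1 is unique up to an integer translation; so it inverts the
critical value map on the whole component (`exists_smooth_coordinates`). Other lifts and labellings
change the values only by a common constant, which preserves V. -/

open Set Filter Topology
open scoped ContDiff
noncomputable section
namespace BlaschkeFamily
-- Coverings, lifts and their uniqueness.
section

/-- A proper local homeomorphism between Hausdorff spaces is a covering map. -/
theorem isCoveringMap_of_isProperMap {Y X : Type*} [TopologicalSpace Y] [TopologicalSpace X]
    [T2Space Y] [T2Space X] {p : Y → X} (hp : IsProperMap p) (hl : IsLocalHomeomorph p) :
    IsCoveringMap p := by
  rw [isCoveringMap_iff_isCoveringMapOn_univ]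
  refine hp.isClosedMap.isCoveringMapOn_of_isLocalHomeomorphOn (fun x _ => ?_)
    (hl.isLocalHomeomorphOn.mono (subset_univ _))
  -- A fibre is compact by properness and discrete by local injectivity, hence finite.
  refine (hp.isCompact_preimage isCompact_singleton).finite ?_
  refine IsDiscrete.of_openPartialHomeomorph p subset_rfl fun e _ => ?_
  obtain ⟨φ, h1, h2⟩ := hl e
  exact ⟨φ, h1, h2.symm⟩

/-- Lifting a continuous function on a convex open set through a map between subsets that is proper
and a local homeomorphism. -/
theorem exists_lift_of_proper {E B F : Type*} [TopologicalSpace E] [T2Space E]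
    [TopologicalSpace B] [T2Space B] [NormedAddCommGroup F] [NormedSpace ℝ F]
    {p : E → B} {Y : Set E} {X : Set B} [LocallyCompactSpace X] (hm : MapsTo p Y X)
    (hl : IsLocalHomeomorph (hm.restrict p Y X))
    (hc : ∀ K ⊆ X, IsCompact K → IsCompact (Y ∩ p ⁻¹' K))
    {A : Set F} (hA : Convex ℝ A) (hAo : IsOpen A) {h : F → B} (hh : ContinuousOn h A)
    (hhX : MapsTo h A X) {a : F} (ha : a ∈ A) {y : E} (hy : y ∈ Y) (hay : p y = h a) :
    ∃ s : F → E, ContinuousOn s A ∧ MapsTo s A Y ∧ (∀ x ∈ A, p (s x) = h x) ∧ s a = y := by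
  have hprop : IsProperMap (hm.restrict p Y X) := by
    rw [isProperMap_iff_isCompact_preimage]
    refine ⟨hl.continuous, fun K hK => ?_⟩
    rw [Subtype.isCompact_iff]
    have h1 := hc (Subtype.val '' K) (by rintro _ ⟨x, _, rfl⟩; exact x.2)
      (hK.image continuous_subtype_val)
    convert h1 using 1
    ext z
    constructor
    · rintro ⟨z, hz, rfl⟩
      exact ⟨z.2, _, hz, rfl⟩
    · rintro ⟨hz, x, hx, hxz⟩
      refine ⟨⟨z, hz⟩, ?_, rfl⟩
      have : hm.restrict p Y X ⟨z, hz⟩ = x := Subtype.ext hxz.symm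
      simpa [this] using hx
  have hcov := isCoveringMap_of_isProperMap hprop hl
  -- Convexity makes `A` simply connected and openness makes it locally path connected, so the
  -- lifting criterion for coverings applies.
  have : ContractibleSpace A := hA.contractibleSpace ⟨a, ha⟩
  have : LocallyPathConnectedSpace A := hAo.locallyPathConnectedSpace
  obtain ⟨s, ⟨hs1, hs2⟩, -⟩ := hcov.existsUnique_continuousMap_lifts
    (⟨hhX.restrict h A X, hh.mapsToRestrict hhX⟩ : C(A, X)) ⟨a, ha⟩ ⟨y, hy⟩ (Subtype.ext hay)
  classical
  refine ⟨fun x => if hx : x ∈ A then (s ⟨x, hx⟩ : E) else y, ?_, ?_, ?_, ?_⟩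
  · rw [continuousOn_iff_continuous_domRestrict]
    have : (A.domRestrict fun x => if hx : x ∈ A then (s ⟨x, hx⟩ : E) else y) =
        fun x => (s x : E) := by
      ext x; simp
    rw [this]
    exact continuous_subtype_val.comp s.continuous
  · intro x hx
    simp only [hx, dif_pos]
    exact (s ⟨x, hx⟩).2
  · intro x hx
    simp only [hx, dif_pos]
    exact congrArg Subtype.val (congrFun hs2 ⟨x, hx⟩)
  · simp only [ha, dif_pos, hs1]

/-- Two continuous lifts through a locally injective map which agree at a point of a preconnected
set agree on the set. -/
theorem eqOn_of_locally_injOn {A E B : Type*} [TopologicalSpace A] [TopologicalSpace E] [T2Space E]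
    {p : E → B} {S : Set A} (hS : IsPreconnected S) {u v : A → E} (hu : ContinuousOn u S)
    (hv : ContinuousOn v S) (hp : ∀ x ∈ S, ∃ N ∈ 𝓝 (u x), InjOn p N)
    (huv : ∀ x ∈ S, p (u x) = p (v x)) {a : A} (ha : a ∈ S) (hav : u a = v a) : EqOn u v S := by
  have : PreconnectedSpace S := isPreconnected_iff_preconnectedSpace.1 hS
  have hu' := continuousOn_iff_continuous_domRestrict.1 hu
  have hv' := continuousOn_iff_continuous_domRestrict.1 hv
  -- The coincidence set is closed by the Hausdorff property and open by local injectivity.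
  have hcl : IsClopen {x : S | S.domRestrict u x = S.domRestrict v x} := by
    refine ⟨isClosed_eq hu' hv', isOpen_iff_mem_nhds.2 fun x hx => ?_⟩
    obtain ⟨N, hN, hinj⟩ := hp x x.2
    have h1 : ∀ᶠ y in 𝓝 x, S.domRestrict u y ∈ N := hu'.continuousAt hN
    have h2 : ∀ᶠ y in 𝓝 x, S.domRestrict v y ∈ N := by
      apply hv'.continuousAt
      have : S.domRestrict v x = u x := hx.symm
      rwa [this]
    filter_upwards [h1, h2] with y hy1 hy2
    exact hinj hy1 hy2 (huv y y.2)
  have := hcl.eq_univ ⟨⟨a, ha⟩, hav⟩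
  intro x hx
  have h : (⟨x, hx⟩ : S) ∈ {x : S | S.domRestrict u x = S.domRestrict v x} := by rw [this]; trivial
  exact h

theorem injOn_nhds_of_deriv_ne_zero {f : ℂ → ℂ} {z : ℂ} (hf : AnalyticAt ℂ f z)
    (h : deriv f z ≠ 0) : ∃ N ∈ 𝓝 z, InjOn f N := by
  obtain h1 := (hf.hasStrictDerivAt).hasStrictFDerivAt_equiv h
  exact ⟨_, (h1.toOpenPartialHomeomorph f).open_source.mem_nhds
    h1.mem_toOpenPartialHomeomorph_source, (h1.toOpenPartialHomeomorph f).injOn⟩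

end

/-! ### Proper holomorphic maps to the disc, unramified off their zeros. -/

section

/-- The open left half-plane. -/
def leftHalf : Set ℂ := {w | w.re < 0}

theorem convex_re_lt (r : ℝ) : Convex ℝ {w : ℂ | w.re < r} := by
  have := (convex_Iio r).linear_preimage Complex.reLm
  exact this

theorem isOpen_re_lt (r : ℝ) : IsOpen {w : ℂ | w.re < r} :=
  isOpen_lt Complex.continuous_re continuous_const

/-- A holomorphic map `f` from the open set `Ω` to the unit disc, proper, with zero set `Z`, with
multiplicities `k`, and without critical points off `Z`. -/
structure DiscMap (f : ℂ → ℂ) (Ω : Set ℂ) (Z : Finset ℂ) (k : ℂ → ℕ) : Prop where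
  isOpen : IsOpen Ω
  analytic : ∀ z ∈ Ω, AnalyticAt ℂ f z
  lt_one : ∀ z ∈ Ω, ‖f z‖ < 1
  isCompact : ∀ r < 1, IsCompact (Ω ∩ {z | ‖f z‖ ≤ r})
  mem : ∀ a ∈ Z, a ∈ Ω
  eq_zero_iff : ∀ z ∈ Ω, f z = 0 ↔ z ∈ Z
  deriv_ne_zero : ∀ z ∈ Ω, f z ≠ 0 → deriv f z ≠ 0
  factor : ∀ a ∈ Z, 0 < k a ∧ ∃ g : ℂ → ℂ, AnalyticAt ℂ g a ∧ g a ≠ 0 ∧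
    ∀ᶠ z in 𝓝 a, f z = (z - a) ^ k a * g z

/-- A lift of the exponential function through `f`. -/
structure IsExpLift (f : ℂ → ℂ) (Ω : Set ℂ) (E : ℂ → ℂ) : Prop where
  continuousOn : ContinuousOn E leftHalf
  mem : ∀ w ∈ leftHalf, E w ∈ Ω
  map : ∀ w ∈ leftHalf, f (E w) = Complex.exp w

variable {f : ℂ → ℂ} {Ω : Set ℂ} {Z : Finset ℂ} {k : ℂ → ℕ}

theorem DiscMap.lift_unique (D : DiscMap f Ω Z k) {A : Type*} [TopologicalSpace A] {S : Set A}
    (hS : IsPreconnected S) {u v : A → ℂ} (hu : ContinuousOn u S) (hv : ContinuousOn v S)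
    (huΩ : ∀ x ∈ S, u x ∈ Ω ∧ f (u x) ≠ 0) (huv : ∀ x ∈ S, f (u x) = f (v x))
    {a : A} (ha : a ∈ S) (hav : u a = v a) : EqOn u v S :=
  eqOn_of_locally_injOn hS hu hv (fun x hx => injOn_nhds_of_deriv_ne_zero
    (D.analytic _ (huΩ x hx).1) (D.deriv_ne_zero _ (huΩ x hx).1 (huΩ x hx).2)) huv ha hav

/-- Off its zeros `f` is a proper local homeomorphism into the punctured disc, and `exp` maps the
convex left half-plane to the punctured disc; so `exp` lifts through `f`, with any admissible base
point. -/
theorem DiscMap.exists_lift (D : DiscMap f Ω Z k) {y w : ℂ} (hy : y ∈ Ω) (hw : w ∈ leftHalf)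
    (hyw : f y = Complex.exp w) : ∃ E, IsExpLift f Ω E ∧ E w = y := by
  set Y : Set ℂ := {z | z ∈ Ω ∧ f z ≠ 0} with hYdef
  set X : Set ℂ := {w | w ≠ 0 ∧ ‖w‖ < 1} with hXdef
  have hfc : ContinuousOn f Ω := fun z hz => (D.analytic z hz).continuousAt.continuousWithinAt
  have hXo : IsOpen X := isOpen_ne.inter (isOpen_lt continuous_norm continuous_const)
  have hm : MapsTo f Y X := fun z hz => ⟨hz.2, D.lt_one z hz.1⟩
  have : LocallyCompactSpace X := hXo.locallyCompactSpace
  have hYo : IsOpen Y := hfc.isOpen_inter_preimage D.isOpen isOpen_ne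
  have hl : IsLocalHomeomorph (hm.restrict f Y X) := by
    refine IsLocalHomeomorph.of_comp (g := (Subtype.val : X → ℂ)) ?_
      hXo.isOpenEmbedding_subtypeVal.isLocalHomeomorph
      ((hfc.mono fun z hz => hz.1).mapsToRestrict hm)
    have h1 : IsLocalHomeomorphOn f Y := by
      intro z hz
      have h1 := ((D.analytic z hz.1).hasStrictDerivAt).hasStrictFDerivAt_equiv
        (D.deriv_ne_zero z hz.1 hz.2)
      exact ⟨h1.toOpenPartialHomeomorph f, h1.mem_toOpenPartialHomeomorph_source, rfl⟩
    have h2 : IsLocalHomeomorphOn (Subtype.val : Y → ℂ) univ :=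
      (hYo.isOpenEmbedding_subtypeVal.isLocalHomeomorph).isLocalHomeomorphOn
    have h3 := h1.comp h2 (fun x _ => x.2)
    exact isLocalHomeomorph_iff_isLocalHomeomorphOn_univ.2 h3
  have hc : ∀ K ⊆ X, IsCompact K → IsCompact (Y ∩ f ⁻¹' K) := by
    intro K hKX hK
    obtain ⟨r, hr, hKr⟩ : ∃ r < 1, ∀ w ∈ K, ‖w‖ ≤ r := by
      rcases K.eq_empty_or_nonempty with rfl | hne
      · exact ⟨0, one_pos, by simp⟩
      · obtain ⟨w, hw, hmax⟩ := hK.exists_isMaxOn hne continuous_norm.continuousOn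
        exact ⟨‖w‖, (hKX hw).2, fun v hv => hmax hv⟩
    have h1 := D.isCompact r hr
    have h2 : Y ∩ f ⁻¹' K = (Ω ∩ {z | ‖f z‖ ≤ r}) ∩ f ⁻¹' K := by
      ext z
      constructor
      · rintro ⟨hz, hzK⟩
        exact ⟨⟨hz.1, hKr _ hzK⟩, hzK⟩
      · rintro ⟨⟨hz, _⟩, hzK⟩
        exact ⟨⟨hz, (hKX hzK).1⟩, hzK⟩
    rw [h2]
    have h3 := (hfc.mono (inter_subset_left : Ω ∩ {z | ‖f z‖ ≤ r} ⊆ Ω)).preimage_isClosed_of_isClosed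
      h1.isClosed hK.isClosed
    exact h1.of_isClosed_subset h3 inter_subset_left
  obtain ⟨s, hs1, hs2, hs3, hs4⟩ := exists_lift_of_proper hm hl hc (convex_re_lt 0)
    (isOpen_re_lt 0) (h := Complex.exp) Complex.continuous_exp.continuousOn
    (fun v hv => ⟨Complex.exp_ne_zero v, by rw [Complex.norm_exp]; simpa using Real.exp_lt_exp.2 hv⟩)
    hw (y := y) ⟨hy, by rw [hyw]; exact Complex.exp_ne_zero w⟩ hyw
  exact ⟨s, ⟨hs1, fun v hv => (hs2 hv).1, hs3⟩, hs4⟩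

/-- Near a zero of order `k`, a holomorphic function is the `k`-th power of an injective one. -/
theorem exists_injective_root {g : ℂ → ℂ} {a : ℂ} {n : ℕ} (hn : 0 < n) (hg : AnalyticAt ℂ g a)
    (hga : g a ≠ 0) : ∃ ρ : ℂ → ℂ, ∃ N ∈ 𝓝 a, ContinuousOn ρ N ∧ InjOn ρ N ∧
      ∀ z ∈ N, ρ z ^ n = (z - a) ^ n * g z := by
  have hn' : (n : ℂ) ≠ 0 := by exact_mod_cast hn.ne'
  -- `c` is an `n`-th root of `g a`. The remaining factor `g z / g a` is close to 1, where the
  -- principal logarithm is holomorphic.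
  set c : ℂ := Complex.exp (Complex.log (g a) / n) with hc
  set h : ℂ → ℂ := fun z => c * Complex.exp (Complex.log (g z / g a) / n) with hh
  have hslit : g a / g a ∈ Complex.slitPlane := by
    rw [div_self hga]; exact Complex.one_mem_slitPlane
  have hq : AnalyticAt ℂ (fun z => g z / g a) a := hg.div_const
  have hha : AnalyticAt ℂ h a := by
    refine analyticAt_const.mul ?_
    exact ((hq.clog hslit).div_const).cexp
  have hhne : h a ≠ 0 := mul_ne_zero (Complex.exp_ne_zero _) (Complex.exp_ne_zero _)
  have hρa : AnalyticAt ℂ (fun z => (z - a) * h z) a := (analyticAt_id.sub analyticAt_const).mul hha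
  have hd : deriv (fun z => (z - a) * h z) a ≠ 0 := by
    have h1 : HasDerivAt (fun z => (z - a) * h z) (1 * h a + (a - a) * deriv h a) a :=
      ((hasDerivAt_id a).sub_const a).mul hha.differentiableAt.hasDerivAt
    rw [h1.deriv]; simpa using hhne
  obtain ⟨N, hN, hinj⟩ := injOn_nhds_of_deriv_ne_zero hρa hd
  have hga' : ∀ᶠ z in 𝓝 a, g z ≠ 0 := hg.continuousAt.eventually_ne hga
  have hev := (hρa.eventually_analyticAt.and hga').and hN
  refine ⟨fun z => (z - a) * h z, _, hev, fun z hz => hz.1.1.continuousAt.continuousWithinAt,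
    hinj.mono fun z hz => hz.2, fun z hz => ?_⟩
  have hz0 : g z / g a ≠ 0 := div_ne_zero hz.1.2 hga
  have h1 : Complex.exp (Complex.log (g z / g a) / n) ^ n = g z / g a := by
    rw [← Complex.exp_nat_mul, mul_div_cancel₀ _ hn', Complex.exp_log hz0]
  have h2 : c ^ n = g a := by
    rw [hc, ← Complex.exp_nat_mul, mul_div_cancel₀ _ hn', Complex.exp_log hga]
  rw [mul_pow, hh, mul_pow, h1, h2, mul_div_cancel₀ _ hga]

/-- Disjoint neighbourhoods of the zeros on which `f` has an injective root, and which trap the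
points with small values. -/
structure IsTrap (f : ℂ → ℂ) (Ω : Set ℂ) (Z : Finset ℂ) (k : ℂ → ℕ) (N : ℂ → Set ℂ)
    (ρ : ℂ → ℂ → ℂ) (δ : ℝ) : Prop where
  pos : 0 < δ
  lt_one : δ < 1
  isOpen : ∀ a ∈ Z, IsOpen (N a)
  mem : ∀ a ∈ Z, a ∈ N a
  subset : ∀ a ∈ Z, N a ⊆ Ω
  continuousOn : ∀ a ∈ Z, ContinuousOn (ρ a) (N a)
  injOn : ∀ a ∈ Z, InjOn (ρ a) (N a)
  root : ∀ a ∈ Z, ∀ z ∈ N a, ρ a z ^ k a = f z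
  disjoint : ∀ a ∈ Z, ∀ b ∈ Z, a ≠ b → Disjoint (N a) (N b)
  trap : ∀ z ∈ Ω, ‖f z‖ < δ → ∃ a ∈ Z, z ∈ N a

/-- Shrink the root neighbourhoods of the zeros until they are disjoint. What is left of {|f| ≤ 1/2}
is compact and free of zeros, so |f| has a positive minimum δ there, and any point with a smaller
value is trapped. -/
theorem DiscMap.exists_traps (D : DiscMap f Ω Z k) : ∃ N ρ δ, IsTrap f Ω Z k N ρ δ := by
  classical
  have hfc : ContinuousOn f Ω := fun z hz => (D.analytic z hz).continuousAt.continuousWithinAt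
  have h1 : ∀ a, ∃ ρ : ℂ → ℂ, ∃ M : Set ℂ, a ∈ Z → M ∈ 𝓝 a ∧ M ⊆ Ω ∧ ContinuousOn ρ M ∧
      InjOn ρ M ∧ ∀ z ∈ M, ρ z ^ k a = f z := by
    intro a
    by_cases ha : a ∈ Z
    · obtain ⟨hk, g, hg, hga, hfg⟩ := D.factor a ha
      obtain ⟨ρ, M, hM, h1, h2, h3⟩ := exists_injective_root hk hg hga
      refine ⟨ρ, M ∩ ({z | f z = (z - a) ^ k a * g z} ∩ Ω), fun _ => ⟨?_, ?_, ?_, ?_, ?_⟩⟩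
      · exact inter_mem hM (inter_mem hfg (D.isOpen.mem_nhds (D.mem a ha)))
      · exact fun z hz => hz.2.2
      · exact h1.mono inter_subset_left
      · exact h2.mono inter_subset_left
      · intro z hz
        rw [h3 z hz.1, ← hz.2.1]
    · exact ⟨id, ∅, fun h => absurd h ha⟩
  choose ρ M hM using h1
  obtain ⟨V, hV, hdis⟩ := Z.finite_toSet.t2_separation
  set N : ℂ → Set ℂ := fun a => interior (M a) ∩ V a with hN
  have hNo : ∀ a, IsOpen (N a) := fun a => isOpen_interior.inter (hV a).2
  have haN : ∀ a ∈ Z, a ∈ N a := fun a ha => ⟨mem_interior_iff_mem_nhds.2 (hM a ha).1, (hV a).1⟩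
  have hsub : ∀ a, N a ⊆ M a := fun a z hz => interior_subset hz.1
  have hK : IsCompact ((Ω ∩ {z | ‖f z‖ ≤ 1 / 2}) \ ⋃ a ∈ Z, N a) :=
    (D.isCompact (1 / 2) (by norm_num)).diff (isOpen_biUnion fun a _ => hNo a)
  obtain ⟨δ, hδ0, hδ1, hδ⟩ : ∃ δ : ℝ, 0 < δ ∧ δ ≤ 1 / 2 ∧
      ∀ z ∈ (Ω ∩ {z | ‖f z‖ ≤ 1 / 2}) \ ⋃ a ∈ Z, N a, δ ≤ ‖f z‖ := by
    rcases ((Ω ∩ {z | ‖f z‖ ≤ 1 / 2}) \ ⋃ a ∈ Z, N a).eq_empty_or_nonempty with he | hne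
    · exact ⟨1 / 2, by norm_num, le_rfl, by rw [he]; simp⟩
    · obtain ⟨w, hw, hmin⟩ := hK.exists_isMinOn hne
        ((hfc.mono fun z hz => hz.1.1).norm)
      have hw0 : f w ≠ 0 := by
        intro h0
        have := (D.eq_zero_iff w hw.1.1).1 h0
        exact hw.2 (mem_biUnion this (haN w this))
      exact ⟨‖f w‖, norm_pos_iff.2 hw0, hw.1.2, fun z hz => hmin hz⟩
  refine ⟨N, ρ, δ, hδ0, by linarith, fun a _ => hNo a, haN, fun a ha => (hsub a).trans (hM a ha).2.1,
    fun a ha => (hM a ha).2.2.1.mono (hsub a), fun a ha => (hM a ha).2.2.2.1.mono (hsub a),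
    fun a ha z hz => (hM a ha).2.2.2.2 z (hsub a hz), ?_, ?_⟩
  · intro a ha b hb hab
    exact (hdis ha hb hab).mono inter_subset_right inter_subset_right
  · intro z hz hzδ
    by_contra hcon
    have : z ∉ ⋃ a ∈ Z, N a := by
      simpa using hcon
    exact absurd (hδ z ⟨⟨hz, by simp only [mem_ofPred_eq]; linarith⟩, this⟩) (not_le.2 hzδ)

end

/-! ### Uniformization of the components by the left half-plane. -/

section

/-- The form in which "a locally constant label is constant on a connected set" is used below, for
zeros, arcs and permutations alike. -/
theorem subset_of_mem_of_disjoint_cover {X ι : Type*} [TopologicalSpace X] {N : ι → Set X}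
    {Z : Finset ι} (ho : ∀ a ∈ Z, IsOpen (N a))
    (hd : ∀ a ∈ Z, ∀ b ∈ Z, a ≠ b → Disjoint (N a) (N b)) {S : Set X} (hS : IsPreconnected S)
    (hc : ∀ x ∈ S, ∃ a ∈ Z, x ∈ N a) {a : ι} (ha : a ∈ Z) {x : X} (hx : x ∈ S) (hxa : x ∈ N a) :
    S ⊆ N a := by
  classical
  refine hS.subset_left_of_subset_union (v := ⋃ b ∈ Z.erase a, N b) (ho a ha)
    (isOpen_biUnion fun b hb => ho b (Finset.mem_of_mem_erase hb)) ?_ ?_ ⟨x, hx, hxa⟩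
  · rw [disjoint_iUnion₂_right]
    intro b hb
    exact hd a ha b (Finset.mem_of_mem_erase hb) (Finset.ne_of_mem_erase hb).symm
  · intro y hy
    obtain ⟨b, hb, hyb⟩ := hc y hy
    by_cases hba : b = a
    · subst hba; exact Or.inl hyb
    · exact Or.inr (mem_biUnion (Finset.mem_erase.2 ⟨hba, hb⟩) hyb)

variable {f : ℂ → ℂ} {Ω : Set ℂ} {Z : Finset ℂ} {k : ℂ → ℕ} {N : ℂ → Set ℂ} {ρ : ℂ → ℂ → ℂ} {δ : ℝ}

theorem IsExpLift.ne_zero {E : ℂ → ℂ} (hE : IsExpLift f Ω E) {w : ℂ} (hw : w ∈ leftHalf) :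
    f (E w) ≠ 0 := by
  rw [hE.map w hw]; exact Complex.exp_ne_zero w

theorem IsTrap.re_lt_mem (T : IsTrap f Ω Z k N ρ δ) {w : ℂ} (hw : w.re < Real.log δ) :
    w ∈ leftHalf :=
  lt_trans hw (Real.log_neg T.pos T.lt_one)

theorem IsTrap.norm_exp_lt (T : IsTrap f Ω Z k N ρ δ) {w : ℂ} (hw : w.re < Real.log δ) :
    ‖Complex.exp w‖ < δ := by
  rw [Complex.norm_exp]
  calc Real.exp w.re < Real.exp (Real.log δ) := Real.exp_lt_exp.2 hw
    _ = δ := Real.exp_log T.pos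

/-- A lift is trapped near a single zero. -/
theorem IsTrap.mapsTo (T : IsTrap f Ω Z k N ρ δ) {E : ℂ → ℂ} (hE : IsExpLift f Ω E) {a : ℂ}
    (ha : a ∈ Z) {w : ℂ} (hw : w.re < Real.log δ) (hwa : E w ∈ N a) :
    ∀ v : ℂ, v.re < Real.log δ → E v ∈ N a := by
  have h1 : E '' {v : ℂ | v.re < Real.log δ} ⊆ N a := by
    refine subset_of_mem_of_disjoint_cover T.isOpen T.disjoint
      ((convex_re_lt _).isPreconnected.image E (hE.continuousOn.mono fun v hv => T.re_lt_mem hv))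
      ?_ ha (mem_image_of_mem E hw) hwa
    rintro _ ⟨v, hv, rfl⟩
    refine T.trap _ (hE.mem v (T.re_lt_mem hv)) ?_
    rw [hE.map v (T.re_lt_mem hv)]
    exact T.norm_exp_lt hv
  exact fun v hv => h1 (mem_image_of_mem E hv)

theorem IsTrap.exists_landing (T : IsTrap f Ω Z k N ρ δ) {E : ℂ → ℂ} (hE : IsExpLift f Ω E) :
    ∃ a ∈ Z, ∀ v : ℂ, v.re < Real.log δ → E v ∈ N a := by
  set w : ℂ := ((Real.log δ - 1 : ℝ) : ℂ) with hw
  have hw1 : w.re < Real.log δ := by rw [hw, Complex.ofReal_re]; linarith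
  obtain ⟨a, ha, hwa⟩ := T.trap (E w) (hE.mem w (T.re_lt_mem hw1)) (by
    rw [hE.map w (T.re_lt_mem hw1)]; exact T.norm_exp_lt hw1)
  exact ⟨a, ha, T.mapsTo hE ha hw1 hwa⟩

/-- Far to the left both `ρ a ∘ E` and `exp (v / k a)` are lifts of `exp` through the `k a`-th
power, so they differ by a constant root of unity. This reduces comparison of lifts near a zero to
comparison of roots of unity. -/
theorem IsTrap.exists_root_form (D : DiscMap f Ω Z k) (T : IsTrap f Ω Z k N ρ δ) {E : ℂ → ℂ}
    (hE : IsExpLift f Ω E) {a : ℂ} (ha : a ∈ Z) (hEa : ∀ v : ℂ, v.re < Real.log δ → E v ∈ N a) :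
    ∃ ε : ℂ, ε ^ k a = 1 ∧
      ∀ v : ℂ, v.re < Real.log δ → ρ a (E v) = ε * Complex.exp (v / k a) := by
  have hk := (D.factor a ha).1
  have hk' : (k a : ℂ) ≠ 0 := by exact_mod_cast hk.ne'
  have hexp : ∀ v : ℂ, Complex.exp (v / k a) ^ k a = Complex.exp v := fun v => by
    rw [← Complex.exp_nat_mul, mul_div_cancel₀ _ hk']
  set w : ℂ := ((Real.log δ - 1 : ℝ) : ℂ) with hw
  have hw1 : w.re < Real.log δ := by rw [hw, Complex.ofReal_re]; linarith
  have hroot : ∀ v : ℂ, v.re < Real.log δ → ρ a (E v) ^ k a = Complex.exp v := fun v hv => by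
    rw [T.root a ha _ (hEa v hv), hE.map v (T.re_lt_mem hv)]
  set ε := ρ a (E w) / Complex.exp (w / k a) with hε
  have hε1 : ε ^ k a = 1 := by
    rw [hε, div_pow, hexp, hroot w hw1, div_self (Complex.exp_ne_zero w)]
  refine ⟨ε, hε1, ?_⟩
  have hEc : ContinuousOn (fun v => ρ a (E v)) {v : ℂ | v.re < Real.log δ} :=
    (T.continuousOn a ha).comp (hE.continuousOn.mono fun v hv => T.re_lt_mem hv) hEa
  refine eqOn_of_locally_injOn (p := fun z : ℂ => z ^ k a) (convex_re_lt _).isPreconnected hEc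
    (by fun_prop) (fun v hv => ?_) (fun v hv => ?_) hw1 ?_
  · refine injOn_nhds_of_deriv_ne_zero (by fun_prop) ?_
    have hne : ρ a (E v) ≠ 0 := by
      intro h0
      have := hroot v hv
      rw [h0, zero_pow hk.ne'] at this
      exact Complex.exp_ne_zero v this.symm
    rw [(hasDerivAt_pow (k a) (ρ a (E v))).deriv]
    exact mul_ne_zero hk' (pow_ne_zero _ hne)
  · rw [hroot v hv, mul_pow, hε1, hexp, one_mul]
  · rw [hε, div_mul_cancel₀ _ (Complex.exp_ne_zero _)]

theorem leftHalf_add_im {w : ℂ} (hw : w ∈ leftHalf) (x : ℝ) :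
    w + 2 * Real.pi * Complex.I * x ∈ leftHalf := by
  have : (w + 2 * Real.pi * Complex.I * x).re = w.re := by simp
  simpa [leftHalf, this] using hw

theorem exp_add_int (w : ℂ) (l : ℤ) :
    Complex.exp (w + 2 * Real.pi * Complex.I * (l : ℝ)) = Complex.exp w := by
  rw [Complex.exp_eq_exp_iff_exists_int]
  exact ⟨l, by push_cast; ring⟩

theorem IsExpLift.shift {E : ℂ → ℂ} (hE : IsExpLift f Ω E) (l : ℤ) :
    IsExpLift f Ω fun w => E (w + 2 * Real.pi * Complex.I * (l : ℝ)) where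
  continuousOn := hE.continuousOn.comp (by fun_prop) fun w hw => leftHalf_add_im hw _
  mem w hw := hE.mem _ (leftHalf_add_im hw _)
  map w hw := by rw [hE.map _ (leftHalf_add_im hw _), exp_add_int]

theorem IsExpLift.eqOn (D : DiscMap f Ω Z k) {E E' : ℂ → ℂ} (hE : IsExpLift f Ω E)
    (hE' : IsExpLift f Ω E') {w : ℂ} (hw : w ∈ leftHalf) (h : E w = E' w) : EqOn E E' leftHalf :=
  D.lift_unique (convex_re_lt 0).isPreconnected hE.continuousOn hE'.continuousOn
    (fun x hx => ⟨hE.mem x hx, hE.ne_zero hx⟩) (fun x hx => by rw [hE.map x hx, hE'.map x hx]) hw h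

/-- Two lifts landing at the same zero differ by a translation. -/
theorem IsTrap.exists_shift (D : DiscMap f Ω Z k) (T : IsTrap f Ω Z k N ρ δ) {E E' : ℂ → ℂ}
    (hE : IsExpLift f Ω E) (hE' : IsExpLift f Ω E') {a : ℂ} (ha : a ∈ Z)
    (hEa : ∀ v : ℂ, v.re < Real.log δ → E v ∈ N a)
    (hEa' : ∀ v : ℂ, v.re < Real.log δ → E' v ∈ N a) :
    ∃ l : ℤ, ∀ w ∈ leftHalf, E' w = E (w + 2 * Real.pi * Complex.I * (l : ℝ)) := by
  have hk := (D.factor a ha).1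
  have hk' : (k a : ℂ) ≠ 0 := by exact_mod_cast hk.ne'
  obtain ⟨ε, hε, h1⟩ := T.exists_root_form D hE ha hEa
  obtain ⟨ε', hε', h1'⟩ := T.exists_root_form D hE' ha hEa'
  have hε0 : ε ≠ 0 := by rintro rfl; rw [zero_pow hk.ne'] at hε; exact zero_ne_one hε
  have hε0' : ε' ≠ 0 := by rintro rfl; rw [zero_pow hk.ne'] at hε'; exact zero_ne_one hε'
  have hq : ε' / ε ≠ 0 := div_ne_zero hε0' hε0
  -- Both constants are `k a`-th roots of unity, so `k a * log (ε' / ε)` equals 2πi l for an integer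
  -- `l`. Translation by 2πi l multiplies `exp (v / k a)` by exactly `ε' / ε`.
  have h2 : Complex.exp (k a * Complex.log (ε' / ε)) = 1 := by
    rw [Complex.exp_nat_mul, Complex.exp_log hq, div_pow, hε, hε', div_one]
  obtain ⟨l, hl⟩ := Complex.exp_eq_one_iff.1 h2
  refine ⟨l, ?_⟩
  set w : ℂ := ((Real.log δ - 1 : ℝ) : ℂ) with hw
  have hw1 : w.re < Real.log δ := by rw [hw, Complex.ofReal_re]; linarith
  have hw2 : (w + 2 * Real.pi * Complex.I * (l : ℝ)).re < Real.log δ := by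
    have : (w + 2 * Real.pi * Complex.I * (l : ℝ)).re = w.re := by simp
    rwa [this]
  refine IsExpLift.eqOn D hE' (hE.shift l) (T.re_lt_mem hw1) ?_
  refine T.injOn a ha (hEa' w hw1) (hEa _ hw2) ?_
  rw [h1' w hw1, h1 _ hw2]
  have h3 : (w + 2 * Real.pi * Complex.I * (l : ℝ)) / k a = w / k a + Complex.log (ε' / ε) := by
    field_simp
    push_cast
    rw [hl]; ring
  rw [h3, Complex.exp_add, Complex.exp_log hq]
  field_simp

/-- Translation by 2πi `k a` fixes `exp (v / k a)`, so by injectivity of the root the lift and its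
translate agree at one point far to the left, hence everywhere. -/
theorem IsTrap.periodic (D : DiscMap f Ω Z k) (T : IsTrap f Ω Z k N ρ δ) {E : ℂ → ℂ}
    (hE : IsExpLift f Ω E) {a : ℂ} (ha : a ∈ Z)
    (hEa : ∀ v : ℂ, v.re < Real.log δ → E v ∈ N a) :
    ∀ w ∈ leftHalf, E (w + 2 * Real.pi * Complex.I * (k a : ℝ)) = E w := by
  have hk := (D.factor a ha).1
  have hk' : (k a : ℂ) ≠ 0 := by exact_mod_cast hk.ne'
  obtain ⟨ε, hε, h1⟩ := T.exists_root_form D hE ha hEa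
  set w : ℂ := ((Real.log δ - 1 : ℝ) : ℂ) with hw
  have hw1 : w.re < Real.log δ := by rw [hw, Complex.ofReal_re]; linarith
  have hw2 : (w + 2 * Real.pi * Complex.I * ((k a : ℤ) : ℝ)).re < Real.log δ := by
    have : (w + 2 * Real.pi * Complex.I * ((k a : ℤ) : ℝ)).re = w.re := by simp
    rwa [this]
  have := IsExpLift.eqOn D (hE.shift (k a)) hE (T.re_lt_mem hw1) ?_
  · intro v hv
    have h := this hv
    simpa using h
  refine T.injOn a ha (hEa _ hw2) (hEa w hw1) ?_
  rw [h1 w hw1, h1 _ hw2]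
  have h3 : (w + 2 * Real.pi * Complex.I * ((k a : ℤ) : ℝ)) / k a =
      w / k a + 2 * Real.pi * Complex.I := by
    field_simp
    push_cast
    ring
  rw [h3, Complex.exp_periodic]

/-- The components of the domain of a proper map onto the disc which is unramified off its zeros:
there is one for each zero, and it is uniformized by the left half-plane. -/
theorem DiscMap.exists_uniformization (D : DiscMap f Ω Z k) : ∃ E : ℂ → ℂ → ℂ,
    (∀ a ∈ Z, IsExpLift f Ω (E a) ∧
      (∀ w ∈ leftHalf, E a (w + 2 * Real.pi * Complex.I * (k a : ℝ)) = E a w) ∧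
      connectedComponentIn Ω a = insert a (E a '' leftHalf)) ∧
    (∀ a ∈ Z, ∀ b ∈ Z, a ≠ b → Disjoint (connectedComponentIn Ω a) (connectedComponentIn Ω b)) ∧
    ∀ z ∈ Ω, ∃ a ∈ Z, z ∈ connectedComponentIn Ω a := by
  classical
  obtain ⟨N, ρ, δ, T⟩ := D.exists_traps
  have hfc : ContinuousOn f Ω := fun z hz => (D.analytic z hz).continuousAt.continuousWithinAt
  have hlog : ∀ y : ℂ, f y ≠ 0 → ‖f y‖ < δ → (Complex.log (f y)).re < Real.log δ := by
    intro y h0 hy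
    rw [Complex.log_re]
    exact Real.log_lt_log (norm_pos_iff.2 h0) hy
  have hzero : ∀ a ∈ Z, ∀ b ∈ Z, b ∈ N a → b = a := by
    intro a ha b hb hba
    by_contra hne
    exact (T.disjoint b hb a ha hne).le_bot ⟨T.mem b hb, hba⟩
  have hnear : ∀ a ∈ Z, ∀ᶠ y in 𝓝[≠] a, y ∈ N a ∧ f y ≠ 0 ∧ ‖f y‖ < δ := by
    intro a ha
    have h1 : ∀ᶠ y in 𝓝 a, y ∈ N a ∧ ‖f y‖ < δ := by
      refine Eventually.and ((T.isOpen a ha).mem_nhds (T.mem a ha)) ?_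
      have : Tendsto (fun y => ‖f y‖) (𝓝 a) (𝓝 ‖f a‖) :=
        (D.analytic a (D.mem a ha)).continuousAt.norm
      rw [(D.eq_zero_iff a (D.mem a ha)).2 ha, norm_zero] at this
      exact this.eventually_lt_const T.pos
    rw [eventually_nhdsWithin_iff]
    filter_upwards [h1] with y hy hya
    refine ⟨hy.1, fun h0 => hya ?_, hy.2⟩
    exact hzero a ha y ((D.eq_zero_iff y (T.subset a ha hy.1)).1 h0) hy.1
  have hex : ∀ a, ∃ E : ℂ → ℂ, a ∈ Z → IsExpLift f Ω E ∧
      ∀ v : ℂ, v.re < Real.log δ → E v ∈ N a := by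
    intro a
    by_cases ha : a ∈ Z
    · obtain ⟨y, hy1, hy2, hy3⟩ := (hnear a ha).exists
      have hl := hlog y hy2 hy3
      obtain ⟨E, hE, hEy⟩ := D.exists_lift (T.subset a ha hy1) (T.re_lt_mem hl)
        (Complex.exp_log hy2).symm
      exact ⟨E, fun _ => ⟨hE, T.mapsTo hE ha hl (by rwa [hEy])⟩⟩
    · exact ⟨id, fun h => absurd h ha⟩
  choose E hE using hex
  -- Through each point of a punctured trap passes a lift landing at `a`, and all such lifts are
  -- translates of `E a`.
  have hkey : ∀ a ∈ Z, ∀ y ∈ N a, f y ≠ 0 → ‖f y‖ < δ → y ∈ E a '' leftHalf := by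
    intro a ha y hy h0 hyδ
    have hl := hlog y h0 hyδ
    obtain ⟨E', hE', hEy⟩ := D.exists_lift (T.subset a ha hy) (T.re_lt_mem hl)
      (Complex.exp_log h0).symm
    obtain ⟨l, hl'⟩ := T.exists_shift D (hE a ha).1 hE' ha (hE a ha).2
      (T.mapsTo hE' ha hl (by rwa [hEy]))
    exact ⟨_, leftHalf_add_im (T.re_lt_mem hl) _, by rw [← hl' _ (T.re_lt_mem hl), hEy]⟩
  -- The candidates for the components: the image of the half-plane with the zero filled in.
  set C : ℂ → Set ℂ := fun a => insert a (E a '' leftHalf) with hC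
  have hCsub : ∀ a ∈ Z, C a ⊆ Ω := by
    intro a ha z hz
    rcases hz with rfl | ⟨w, hw, rfl⟩
    · exact D.mem z ha
    · exact (hE a ha).1.mem w hw
  have hCpre : ∀ a ∈ Z, IsPreconnected (C a) := by
    intro a ha
    have h1 : IsPreconnected (E a '' leftHalf) :=
      (convex_re_lt 0).isPreconnected.image _ (hE a ha).1.continuousOn
    refine h1.subset_closure (subset_insert _ _) (insert_subset ?_ subset_closure)
    have h2 : ∃ᶠ y in 𝓝[≠] a, y ∈ E a '' leftHalf := by
      refine Eventually.frequently ?_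
      filter_upwards [hnear a ha] with y hy
      exact hkey a ha y hy.1 hy.2.1 hy.2.2
    exact mem_closure_iff_frequently.2 (h2.filter_mono nhdsWithin_le_nhds)
  have hCopen : ∀ a ∈ Z, IsOpen (C a) := by
    intro a ha
    rw [isOpen_iff_mem_nhds]
    rintro z (rfl | ⟨w, hw, rfl⟩)
    · have := hnear z ha
      rw [eventually_nhdsWithin_iff] at this
      filter_upwards [this] with y hy
      by_cases hyz : y = z
      · exact Or.inl hyz
      · have := hy hyz
        exact Or.inr (hkey z ha y this.1 this.2.1 this.2.2)
    -- Since `exp` is open, a point near `E a w` has the same `f`-value as a nearby point of the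
    -- lift; local injectivity of `f` identifies the two.
    · obtain ⟨M, hM, hinj⟩ := injOn_nhds_of_deriv_ne_zero (D.analytic _ ((hE a ha).1.mem w hw))
        (D.deriv_ne_zero _ ((hE a ha).1.mem w hw) ((hE a ha).1.ne_zero hw))
      have hEc : ContinuousAt (E a) w :=
        (hE a ha).1.continuousOn.continuousAt ((isOpen_re_lt 0).mem_nhds hw)
      have h1 : ∀ᶠ v in 𝓝 w, v ∈ leftHalf ∧ E a v ∈ M :=
        Eventually.and ((isOpen_re_lt 0).mem_nhds hw) (hEc hM)
      have h2 : Complex.exp '' {v | v ∈ leftHalf ∧ E a v ∈ M} ∈ 𝓝 (f (E a w)) := by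
        rw [(hE a ha).1.map w hw]
        exact Complex.isOpenMap_exp.image_mem_nhds h1
      have h3 := (D.analytic _ ((hE a ha).1.mem w hw)).continuousAt h2
      filter_upwards [h3, hM] with y hy hyM
      obtain ⟨v, ⟨hv, hvM⟩, hvy⟩ := hy
      rw [← (hE a ha).1.map v hv] at hvy
      exact Or.inr ⟨v, hv, hinj hvM hyM hvy⟩
  have hcover : ∀ z ∈ Ω, ∃ a ∈ Z, z ∈ C a := by
    intro z hz
    by_cases h0 : f z = 0
    · exact ⟨z, (D.eq_zero_iff z hz).1 h0, mem_insert _ _⟩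
    · have hl : Complex.log (f z) ∈ leftHalf := by
        change (Complex.log (f z)).re < 0
        rw [Complex.log_re]
        exact Real.log_neg (norm_pos_iff.2 h0) (D.lt_one z hz)
      obtain ⟨E', hE', hEy⟩ := D.exists_lift hz hl (Complex.exp_log h0).symm
      obtain ⟨a, ha, hEa'⟩ := T.exists_landing hE'
      obtain ⟨l, hl'⟩ := T.exists_shift D (hE a ha).1 hE' ha (hE a ha).2 hEa'
      exact ⟨a, ha, Or.inr ⟨_, leftHalf_add_im hl _, by rw [← hl' _ hl, hEy]⟩⟩
  have hCdisj : ∀ a ∈ Z, ∀ b ∈ Z, a ≠ b → Disjoint (C a) (C b) := by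
    intro a ha b hb hab
    have hz : ∀ a ∈ Z, f a = 0 := fun a ha => (D.eq_zero_iff a (D.mem a ha)).2 ha
    rw [Set.disjoint_left]
    rintro z (rfl | ⟨w, hw, rfl⟩) (h | ⟨v, hv, h⟩)
    · exact hab h
    · exact (hE b hb).1.ne_zero hv (by rw [h]; exact hz z ha)
    · exact (hE a ha).1.ne_zero hw (by rw [h]; exact hz b hb)
    -- If two images meet, one lift is a translate of the other; but far to the left they lie in
    -- disjoint traps.
    · have hexp : Complex.exp v = Complex.exp w := by
        rw [← (hE a ha).1.map w hw, ← (hE b hb).1.map v hv, h]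
      obtain ⟨l, hl⟩ := Complex.exp_eq_exp_iff_exists_int.1 hexp
      have hvw : v = w + 2 * Real.pi * Complex.I * (l : ℝ) := by rw [hl]; push_cast; ring
      have heq := IsExpLift.eqOn D (hE a ha).1 ((hE b hb).1.shift l) hw (by rw [← hvw, h])
      set x : ℂ := ((Real.log δ - 1 : ℝ) : ℂ) with hx
      have hx1 : x.re < Real.log δ := by rw [hx, Complex.ofReal_re]; linarith
      have hx2 : (x + 2 * Real.pi * Complex.I * (l : ℝ)).re < Real.log δ := by
        have : (x + 2 * Real.pi * Complex.I * (l : ℝ)).re = x.re := by simp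
        rwa [this]
      refine (T.disjoint a ha b hb hab).le_bot ⟨(hE a ha).2 x hx1, ?_⟩
      rw [heq (T.re_lt_mem hx1)]
      exact (hE b hb).2 _ hx2
  -- The `C a` are connected, open, disjoint and cover `Ω`, so they are its components.
  have hcomp : ∀ a ∈ Z, connectedComponentIn Ω a = C a := by
    intro a ha
    refine subset_antisymm ?_ ((hCpre a ha).subset_connectedComponentIn (mem_insert _ _)
      (hCsub a ha))
    exact subset_of_mem_of_disjoint_cover hCopen hCdisj isPreconnected_connectedComponentIn
      (fun x hx => hcover x (connectedComponentIn_subset _ _ hx)) ha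
      (mem_connectedComponentIn (D.mem a ha)) (mem_insert _ _)
  refine ⟨E, fun a ha => ⟨(hE a ha).1, T.periodic D (hE a ha).1 ha (hE a ha).2, hcomp a ha⟩, ?_, ?_⟩
  · intro a ha b hb hab
    rw [hcomp a ha, hcomp b hb]
    exact hCdisj a ha b hb hab
  · intro z hz
    obtain ⟨a, ha, h⟩ := hcover z hz
    exact ⟨a, ha, by rwa [hcomp a ha]⟩

end

/-! ### The lift of the Blaschke-type product and its derivative. -/

section

/-- The complexified covering map `τ ↦ e^{2 π i τ}`. -/
def ce (τ : ℂ) : ℂ := Complex.exp (2 * Real.pi * Complex.I * τ)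

theorem ce_ofReal (t : ℝ) : ce t = circleCover t := rfl

theorem ce_add (s t : ℂ) : ce (s + t) = ce s * ce t := by
  rw [ce, mul_add, Complex.exp_add]; rfl

theorem ce_neg (t : ℂ) : ce (-t) = (ce t)⁻¹ := by
  rw [ce, mul_neg, Complex.exp_neg]; rfl

theorem ce_ne_zero (t : ℂ) : ce t ≠ 0 := Complex.exp_ne_zero _

theorem norm_ce (τ : ℂ) : ‖ce τ‖ = Real.exp (-(2 * Real.pi * τ.im)) := by
  rw [ce, Complex.norm_exp]
  congr 1
  simp

theorem one_lt_norm_ce {τ : ℂ} : 1 < ‖ce τ‖ ↔ τ.im < 0 := by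
  rw [norm_ce, Real.one_lt_exp_iff]
  have := Real.pi_pos
  constructor <;> intro h <;> nlinarith

theorem norm_ce_lt_one {τ : ℂ} : ‖ce τ‖ < 1 ↔ 0 < τ.im := by
  rw [norm_ce, Real.exp_lt_one_iff]
  have := Real.pi_pos
  constructor <;> intro h <;> nlinarith

theorem norm_circleCover (t : ℝ) : ‖circleCover t‖ = 1 := by
  rw [← ce_ofReal, norm_ce]; simp

theorem circleCover_add (s t : ℝ) : circleCover (s + t) = circleCover s * circleCover t := by
  rw [← ce_ofReal, Complex.ofReal_add, ce_add]; rfl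

theorem circleCover_ne_zero (t : ℝ) : circleCover t ≠ 0 := ce_ne_zero t

theorem ce_eq_ce_iff {s t : ℂ} : ce s = ce t ↔ ∃ n : ℤ, s = t + n := by
  rw [ce, ce, Complex.exp_eq_exp_iff_exists_int]
  refine exists_congr fun n => ?_
  have := Complex.two_pi_I_ne_zero
  constructor
  · intro h
    refine mul_left_cancel₀ this ?_
    rw [h]; ring
  · rintro rfl; ring

theorem circleCover_eq_iff {s t : ℝ} : circleCover s = circleCover t ↔ ∃ n : ℤ, s = t + n := by
  rw [← ce_ofReal, ← ce_ofReal, ce_eq_ce_iff]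
  refine exists_congr fun n => ?_
  constructor
  · intro h; exact_mod_cast h
  · intro h; rw [h]; push_cast; rfl

theorem circleCover_add_int (t : ℝ) (n : ℤ) : circleCover (t + n) = circleCover t :=
  circleCover_eq_iff.2 ⟨n, rfl⟩

theorem hasDerivAt_ce (τ : ℂ) : HasDerivAt ce (2 * Real.pi * Complex.I * ce τ) τ := by
  have := ((hasDerivAt_id τ).const_mul (2 * Real.pi * Complex.I)).cexp
  refine this.congr_deriv ?_
  simp only [ce, id, mul_one]; ring

theorem continuous_ce : Continuous ce := by unfold ce; fun_prop

theorem continuous_circleCover : Continuous circleCover := by unfold circleCover; fun_prop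

theorem contDiff_circleCover : ContDiff ℝ ∞ circleCover := by
  unfold circleCover
  exact Complex.contDiff_exp.comp (contDiff_const.mul Complex.ofRealCLM.contDiff)

theorem star_ce (τ : ℂ) : star (ce τ) = ce (-star τ) := by
  have h2 : (starRingEnd ℂ) 2 = 2 := Complex.conj_ofNat 2
  simp only [ce, Complex.star_def, ← Complex.exp_conj]
  simp [h2]

theorem star_circleCover (t : ℝ) : star (circleCover t) = circleCover (-t) := by
  rw [← ce_ofReal, star_ce, ← ce_ofReal]; simp

theorem exists_ce_eq {z : ℂ} (hz : z ≠ 0) : ∃ τ, ce τ = z := by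
  refine ⟨Complex.log z / (2 * Real.pi * Complex.I), ?_⟩
  rw [ce, mul_div_cancel₀ _ Complex.two_pi_I_ne_zero, Complex.exp_log hz]

theorem exists_circleCover_eq {z : ℂ} (hz : ‖z‖ = 1) : ∃ t, circleCover t = z := by
  obtain ⟨τ, rfl⟩ := exists_ce_eq (z := z) (by rintro rfl; simp at hz)
  refine ⟨τ.re, ?_⟩
  have him : τ.im = 0 := by
    rw [norm_ce, Real.exp_eq_one_iff] at hz
    have := Real.pi_pos
    nlinarith
  rw [← ce_ofReal]
  congr 1
  exact Complex.ext rfl (by simp [him])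

variable {m : ℕ} (κ : Fin (m + 1) → ℕ)

/-- The Blaschke-type product in terms of the reciprocals `b_j` of its zeros. -/
def bl (η : ℝ) (b : Fin m → ℂ) (z : ℂ) : ℂ :=
  circleCover η * z ^ κ 0 * ∏ j : Fin m, ((1 - b j * z) / (z - star (b j))) ^ κ j.succ

/-- The lift of the Blaschke-type product to the universal cover of a neighbourhood of the
circle. -/
def lc (η : ℝ) (b : Fin m → ℂ) (τ : ℂ) : ℂ :=
  η + circleDegree κ * τ + 1 / (2 * Real.pi * Complex.I) * ∑ j : Fin m, (κ j.succ : ℂ) *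
    (Complex.log (1 - b j * ce τ) - Complex.log (1 - star (b j) * ce (-τ)))

/-- The lift of the Blaschke-type product on the circle. -/
def lr (η : ℝ) (b : Fin m → ℂ) (t : ℝ) : ℝ :=
  η + circleDegree κ * t + 1 / Real.pi * ∑ j : Fin m, (κ j.succ : ℝ) *
    (Complex.log (1 - b j * circleCover t)).im

/-- The derivative of the lift, as a rational function. -/
def rc (b : Fin m → ℂ) (z : ℂ) : ℂ :=
  κ 0 - ∑ j : Fin m, (κ j.succ : ℂ) * (b j * z / (1 - b j * z) + z / (z - star (b j)))

/-- The derivative of the lift on the real line. -/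
def rr (b : Fin m → ℂ) (t : ℝ) : ℝ :=
  circleDegree κ - 2 * ∑ j : Fin m, (κ j.succ : ℝ) *
    (b j * circleCover t / (1 - b j * circleCover t)).re

/-- The domain of the complexified lift. -/
def strip (b : Fin m → ℂ) : Set ℂ := {τ | ∀ j, ‖b j * ce τ‖ < 1 ∧ ‖b j * ce (-τ)‖ < 1}

theorem isOpen_strip (b : Fin m → ℂ) : IsOpen (strip b) := by
  have : strip b = ⋂ j, {τ | ‖b j * ce τ‖ < 1 ∧ ‖b j * ce (-τ)‖ < 1} := by
    ext τ; simp [strip]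
  rw [this]
  refine isOpen_iInter_of_finite fun j => ?_
  have := continuous_ce
  have h1 : Continuous fun τ => ‖b j * ce τ‖ := by fun_prop
  have h2 : Continuous fun τ => ‖b j * ce (-τ)‖ := by fun_prop
  exact (isOpen_lt h1 continuous_const).inter (isOpen_lt h2 continuous_const)

variable {κ}

theorem ofReal_mem_strip {b : Fin m → ℂ} (hb : ∀ j, ‖b j‖ < 1) (t : ℝ) : (t : ℂ) ∈ strip b := by
  intro j
  simp [norm_ce, hb j]

theorem slit_of_norm_lt {w : ℂ} (hw : ‖w‖ < 1) : 1 - w ∈ Complex.slitPlane := by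
  rw [sub_eq_add_neg]
  exact Complex.mem_slitPlane_of_norm_lt_one (by rwa [norm_neg])

theorem one_sub_ne_zero {w : ℂ} (hw : ‖w‖ < 1) : 1 - w ≠ 0 :=
  Complex.slitPlane_ne_zero (slit_of_norm_lt hw)

theorem norm_star_mul (b z : ℂ) : ‖star b * z‖ = ‖b * z‖ := by
  rw [norm_mul, norm_mul, norm_star]

theorem sub_star_eq (b τ : ℂ) : ce τ - star b = ce τ * (1 - star b * ce (-τ)) := by
  rw [ce_neg]
  have := ce_ne_zero τ
  field_simp

theorem sub_star_ne_zero {b : Fin m → ℂ} {τ : ℂ} (hτ : τ ∈ strip b) (j : Fin m) :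
    ce τ - star (b j) ≠ 0 := by
  rw [sub_star_eq]
  refine mul_ne_zero (ce_ne_zero _) (one_sub_ne_zero ?_)
  rw [norm_star_mul]; exact (hτ j).2

theorem circleDegree_cast : ((circleDegree κ : ℤ) : ℂ) = κ 0 - ∑ j : Fin m, (κ j.succ : ℂ) := by
  simp [circleDegree]

/-- Each factor is e^{-2πiτ} times a quotient of exponentials of logarithms; the ∑ k_j copies of
e^{-2πiτ} combine with z^{k₀} to give the linear term of slope d. -/
theorem bl_ce (η : ℝ) {b : Fin m → ℂ} {τ : ℂ} (hτ : τ ∈ strip b) :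
    bl κ η b (ce τ) = ce (lc κ η b τ) := by
  have h2 : ∀ j, (1 - b j * ce τ) / (ce τ - star (b j)) = Complex.exp (-(2 * Real.pi * Complex.I * τ)
      + (Complex.log (1 - b j * ce τ) - Complex.log (1 - star (b j) * ce (-τ)))) := by
    intro j
    have h3 : ‖star (b j) * ce (-τ)‖ < 1 := by rw [norm_star_mul]; exact (hτ j).2
    rw [Complex.exp_add, Complex.exp_sub, Complex.exp_log (one_sub_ne_zero (hτ j).1),
      Complex.exp_log (one_sub_ne_zero h3), Complex.exp_neg, sub_star_eq]
    have h4 := ce_ne_zero τ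
    have h5 := one_sub_ne_zero h3
    change _ = (ce τ)⁻¹ * _
    field_simp
  rw [bl]
  simp_rw [h2, ← Complex.exp_nat_mul]
  rw [← Complex.exp_sum]
  have h6 : ce τ ^ κ 0 = Complex.exp (κ 0 * (2 * Real.pi * Complex.I * τ)) := by
    rw [ce, ← Complex.exp_nat_mul]
  have h7 : ce (lc κ η b τ) = Complex.exp (2 * Real.pi * Complex.I * lc κ η b τ) := rfl
  rw [h6, circleCover, ← Complex.exp_add, ← Complex.exp_add, h7]
  congr 1
  rw [lc, circleDegree_cast]
  have hpi := Complex.two_pi_I_ne_zero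
  simp_rw [mul_add, Finset.sum_add_distrib]
  rw [← mul_assoc (2 * Real.pi * Complex.I) (1 / _), mul_one_div_cancel hpi, one_mul]
  rw [← Finset.sum_mul]
  ring

/-- On the real line the second logarithm is the conjugate of the first, so their difference is 2i
times an imaginary part and the lift is real. -/
theorem lc_ofReal (η : ℝ) {b : Fin m → ℂ} (t : ℝ) (hb : ∀ j, ‖b j‖ < 1) :
    lc κ η b t = lr κ η b t := by
  rw [lc, lr]
  push_cast
  congr 1
  have h : ∀ j, Complex.log (1 - b j * ce t) - Complex.log (1 - star (b j) * ce (-t)) =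
      2 * Complex.I * (Complex.log (1 - b j * circleCover t)).im := by
    intro j
    have h1 : 1 - star (b j) * ce (-t) = (starRingEnd ℂ) (1 - b j * ce t) := by
      have : ce (-t) = star (ce t) := by rw [star_ce]; simp
      rw [this]; simp
    have hs := slit_of_norm_lt ((ofReal_mem_strip hb t) j).1
    rw [h1, Complex.log_conj _ (Complex.slitPlane_arg_ne_pi hs), Complex.sub_conj, ce_ofReal]
    push_cast; ring
  simp_rw [h]
  rw [Finset.mul_sum, Finset.mul_sum]
  refine Finset.sum_congr rfl fun j _ => ?_
  have := Complex.I_ne_zero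
  have : (Real.pi : ℂ) ≠ 0 := by exact_mod_cast Real.pi_ne_zero
  field_simp

theorem bl_circleCover (η : ℝ) {b : Fin m → ℂ} (hb : ∀ j, ‖b j‖ < 1) (t : ℝ) :
    bl κ η b (circleCover t) = circleCover (lr κ η b t) := by
  rw [← ce_ofReal, bl_ce η (ofReal_mem_strip hb t), lc_ofReal η t hb, ce_ofReal]

/-- The derivative of a lift is the logarithmic derivative zB'/B, a rational function of z: the lift
itself is transcendental, but its critical points can be counted algebraically. -/
theorem hasDerivAt_lc (η : ℝ) {b : Fin m → ℂ} {τ : ℂ} (hτ : τ ∈ strip b) :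
    HasDerivAt (lc κ η b) (rc κ b (ce τ)) τ := by
  have h : ∀ j, HasDerivAt (fun τ => (κ j.succ : ℂ) *
      (Complex.log (1 - b j * ce τ) - Complex.log (1 - star (b j) * ce (-τ))))
      ((κ j.succ : ℂ) * ((-(b j * (2 * Real.pi * Complex.I * ce τ))) / (1 - b j * ce τ) -
        (-(star (b j) * (2 * Real.pi * Complex.I * ce (-τ) * (-1)))) / (1 - star (b j) * ce (-τ))))
      τ := by
    intro j
    have h3 : ‖star (b j) * ce (-τ)‖ < 1 := by rw [norm_star_mul]; exact (hτ j).2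
    refine HasDerivAt.const_mul _ (HasDerivAt.sub ?_ ?_)
    · exact ((((hasDerivAt_ce τ).const_mul (b j)).const_sub 1)).clog (slit_of_norm_lt (hτ j).1)
    · exact (((((hasDerivAt_ce (-τ)).comp τ (hasDerivAt_neg τ)).const_mul (star (b j))).const_sub
        1)).clog (slit_of_norm_lt h3)
  have h1 := (HasDerivAt.fun_sum fun j (_ : j ∈ Finset.univ) => h j).const_mul
    (1 / (2 * Real.pi * Complex.I))
  have h2 := (((hasDerivAt_id τ).const_mul ((circleDegree κ : ℤ) : ℂ)).const_add (η : ℂ)).add h1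
  refine h2.congr_deriv ?_
  rw [rc, circleDegree_cast, Finset.mul_sum, mul_one, sub_add, ← Finset.sum_sub_distrib]
  congr 1
  refine Finset.sum_congr rfl fun j _ => ?_
  have h3 : ‖star (b j) * ce (-τ)‖ < 1 := by rw [norm_star_mul]; exact (hτ j).2
  have h4 := one_sub_ne_zero h3
  have h5 := one_sub_ne_zero (hτ j).1
  have h6 := ce_ne_zero τ
  have hpi := Complex.two_pi_I_ne_zero
  rw [sub_star_eq]
  have h7 : ce τ / (ce τ * (1 - star (b j) * ce (-τ))) = 1 / (1 - star (b j) * ce (-τ)) := by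
    field_simp
  rw [h7]
  set x := star (b j) * ce (-τ) with hx
  set y := b j * ce τ with hy
  have e1 : -(b j * (2 * Real.pi * Complex.I * ce τ)) = -(2 * Real.pi * Complex.I) * y := by
    rw [hy]; ring
  have e2 : -(star (b j) * (2 * Real.pi * Complex.I * ce (-τ) * (-1))) =
      (2 * Real.pi * Complex.I) * x := by
    rw [hx]; ring
  rw [e1, e2]
  have : (Real.pi : ℂ) ≠ 0 := by exact_mod_cast Real.pi_ne_zero
  field_simp
  ring

/-- On the circle z / (z - conj b) = 1 + conj (bz / (1 - bz)), so the two polar terms of each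
parameter add up to 1 plus twice a real part. -/
theorem rc_circleCover {b : Fin m → ℂ} (t : ℝ) (hb : ∀ j, ‖b j‖ < 1) :
    rc κ b (circleCover t) = rr κ b t := by
  rw [rc, rr]
  push_cast
  rw [circleDegree_cast, Finset.mul_sum, sub_sub, ← Finset.sum_add_distrib]
  congr 1
  refine Finset.sum_congr rfl fun j _ => ?_
  have h5 := one_sub_ne_zero (ofReal_mem_strip hb t j).1
  rw [ce_ofReal] at h5
  have h1 : circleCover t / (circleCover t - star (b j)) =
      1 + (starRingEnd ℂ) (b j * circleCover t / (1 - b j * circleCover t)) := by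
    have h2 : (starRingEnd ℂ) (b j * circleCover t) * circleCover t = star (b j) := by
      have : (starRingEnd ℂ) (circleCover t) * circleCover t = 1 := by
        rw [← Complex.star_def, star_circleCover, ← circleCover_add]; simp [circleCover]
      rw [map_mul, mul_assoc, this, mul_one]; rfl
    rw [map_div₀, map_sub, map_one, ← h2]
    have h6 : 1 - (starRingEnd ℂ) (b j * circleCover t) ≠ 0 := by
      rw [← map_one (starRingEnd ℂ), ← map_sub]
      exact (map_ne_zero _).2 h5
    have h7 := circleCover_ne_zero t
    have h8 : circleCover t - (starRingEnd ℂ) (b j * circleCover t) * circleCover t =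
      circleCover t * (1 - (starRingEnd ℂ) (b j * circleCover t)) := by ring
    rw [h8]
    generalize (starRingEnd ℂ) (b j * circleCover t) = w at h6
    field_simp
    ring
  rw [h1]
  have h9 := Complex.add_conj (b j * circleCover t / (1 - b j * circleCover t))
  push_cast at h9
  linear_combination (-(κ j.succ : ℂ)) * (-1 : ℂ) * h9

theorem hasDerivAt_lr (η : ℝ) {b : Fin m → ℂ} (hb : ∀ j, ‖b j‖ < 1) (t : ℝ) :
    HasDerivAt (lr κ η b) (rr κ b t) t := by
  have h := (hasDerivAt_lc (κ := κ) η (ofReal_mem_strip hb t)).real_of_complex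
  rw [ce_ofReal, rc_circleCover t hb, Complex.ofReal_re] at h
  refine h.congr_of_eventuallyEq (Eventually.of_forall fun s => ?_)
  simp only [lc_ofReal η s hb, Complex.ofReal_re]

theorem lr_add_int (η : ℝ) (b : Fin m → ℂ) (t : ℝ) (n : ℤ) :
    lr κ η b (t + n) = lr κ η b t + n * circleDegree κ := by
  simp only [lr, circleCover_add_int]; ring

theorem rr_add_int (b : Fin m → ℂ) (t : ℝ) (n : ℤ) : rr κ b (t + n) = rr κ b t := by
  simp only [rr, circleCover_add_int]

end

/-! ### Counting zeros of partial fractions. -/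

section

section PartialFractions

variable {ι : Type*} [Fintype ι]

/-- A rational function in partial fraction form, with poles at `1 / β_i` and `conj β_i`. -/
def pf (β : ι → ℂ) (c : ℂ) (p q : ι → ℂ) (z : ℂ) : ℂ :=
  c + ∑ i, (p i * z / (1 - β i * z) + q i / (z - star (β i)))

/-- The common denominator of the partial fractions. -/
def pfDen (β : ι → ℂ) (z : ℂ) : ℂ := ∏ i, (1 - β i * z) * (z - star (β i))

variable {β : ι → ℂ} {c : ℂ} {p q : ι → ℂ}

-- Clearing denominators costs degree two per index. Evaluating the numerator at a pole kills all
-- terms but one, so a vanishing numerator forces each `q i` (pole conj β_i) and each `p i` (pole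
-- 1/β_i) to vanish; the value at 0 then gives the constant. Distinctness of the β_i and |β_i| < 1
-- keep the poles apart.
open Polynomial in
theorem exists_pf_numerator (hβ : ∀ i, ‖β i‖ < 1) (hβ0 : ∀ i, β i ≠ 0)
    (hinj : Function.Injective β) : ∃ P : ℂ[X], P.natDegree ≤ 2 * Fintype.card ι ∧
      (∀ z, (∀ i, 1 - β i * z ≠ 0 ∧ z - star (β i) ≠ 0) →
        P.eval z = pfDen β z * pf β c p q z) ∧
      (P = 0 → c = 0 ∧ (∀ i, p i = 0) ∧ ∀ i, q i = 0) := by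
  classical
  set A : ι → ℂ[X] := fun i => (1 - C (β i) * X) * (X - C (star (β i))) with hA
  have hAdeg : ∀ i, (A i).natDegree ≤ 2 := fun i => by
    change ((1 - C (β i) * X) * (X - C (star (β i)))).natDegree ≤ 2
    generalize star (β i) = w
    compute_degree
  have hAe : ∀ i z, (A i).eval z = (1 - β i * z) * (z - star (β i)) := fun i z => by simp [hA]
  set R : ι → ℂ[X] := fun i =>
    C (p i) * X * (X - C (star (β i))) + C (q i) * (1 - C (β i) * X) with hR
  have hRe : ∀ i z, (R i).eval z = p i * z * (z - star (β i)) + q i * (1 - β i * z) :=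
    fun i z => by simp [hR]
  set P : ℂ[X] := C c * ∏ i, A i + ∑ i, R i * ∏ j ∈ Finset.univ.erase i, A j with hP
  have hPe : ∀ z, P.eval z = c * ∏ i, (A i).eval z +
      ∑ i, (R i).eval z * ∏ j ∈ Finset.univ.erase i, (A j).eval z := by
    intro z
    simp [hP, eval_prod, eval_finsetSum]
  have hprod : ∀ (i : ι) (z : ℂ), (A i).eval z * ∏ j ∈ Finset.univ.erase i, (A j).eval z =
      ∏ j, (A j).eval z := fun i z => Finset.mul_prod_erase _ (fun j => (A j).eval z) (Finset.mem_univ i)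
  have hpole : ∀ i z, (A i).eval z = 0 →
      P.eval z = (R i).eval z * ∏ j ∈ Finset.univ.erase i, (A j).eval z := by
    intro i z hz
    rw [hPe, Finset.prod_eq_zero (Finset.mem_univ i) hz, mul_zero, zero_add,
      Finset.sum_eq_single_of_mem i (Finset.mem_univ i)]
    intro j _ hji
    rw [Finset.prod_eq_zero (Finset.mem_erase.2 ⟨hji.symm, Finset.mem_univ i⟩) hz, mul_zero]
  have hnn : ∀ i j, 1 - β i * star (β j) ≠ 0 := by
    intro i j
    refine one_sub_ne_zero ?_
    rw [norm_mul, norm_star]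
    calc ‖β i‖ * ‖β j‖ ≤ 1 * ‖β j‖ := by gcongr; exact (hβ i).le
      _ < 1 := by rw [one_mul]; exact hβ j
  refine ⟨P, ?_, ?_, ?_⟩
  · refine (natDegree_add_le _ _).trans (max_le ?_ ?_)
    · refine (natDegree_C_mul_le _ _).trans ((natDegree_prod_le _ _).trans ?_)
      calc ∑ i, (A i).natDegree ≤ ∑ _i : ι, 2 := Finset.sum_le_sum fun i _ => hAdeg i
        _ = 2 * Fintype.card ι := by simp [mul_comm]
    · refine natDegree_sum_le_of_forall_le _ _ fun i _ => ?_
      refine natDegree_mul_le.trans ?_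
      have h1 : (R i).natDegree ≤ 2 := by
        change (C (p i) * X * (X - C (star (β i))) + C (q i) * (1 - C (β i) * X)).natDegree ≤ 2
        generalize star (β i) = w
        compute_degree
      have h2 : (∏ j ∈ Finset.univ.erase i, A j).natDegree ≤ 2 * (Fintype.card ι - 1) := by
        refine (natDegree_prod_le _ _).trans ?_
        calc ∑ j ∈ Finset.univ.erase i, (A j).natDegree ≤ ∑ _j ∈ Finset.univ.erase i, 2 :=
              Finset.sum_le_sum fun j _ => hAdeg j
          _ = 2 * (Fintype.card ι - 1) := by
            rw [Finset.sum_const, Finset.card_erase_of_mem (Finset.mem_univ i), Finset.card_univ,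
              smul_eq_mul, mul_comm]
      have h3 : 0 < Fintype.card ι := Fintype.card_pos_iff.2 ⟨i⟩
      omega
  · intro z hz
    rw [hPe, pfDen, pf, mul_add, Finset.mul_sum]
    simp_rw [← hAe]
    congr 1
    · ring
    · refine Finset.sum_congr rfl fun i _ => ?_
      rw [← hprod i z, hRe, hAe]
      have h1 := (hz i).1
      have h2 := (hz i).2
      generalize 1 - β i * z = u at h1
      generalize z - star (β i) = v at h2
      field_simp
  · intro hP0
    have hq : ∀ i, q i = 0 := by
      intro i
      have h1 := hpole i (star (β i)) (by rw [hAe, sub_self, mul_zero])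
      rw [hP0, eval_zero, eq_comm, mul_eq_zero, Finset.prod_eq_zero_iff] at h1
      rcases h1 with h1 | ⟨j, hj, h1⟩
      · rw [hRe, sub_self, mul_zero, zero_add, mul_eq_zero] at h1
        exact h1.resolve_right (hnn i i)
      · rw [hAe, mul_eq_zero] at h1
        have h2 := sub_eq_zero.1 (h1.resolve_left (hnn j i))
        exact absurd (hinj (star_injective h2)).symm (Finset.ne_of_mem_erase hj)
    have hp : ∀ i, p i = 0 := by
      intro i
      have hi := hβ0 i
      have hnn' : ∀ j, (β i)⁻¹ - star (β j) ≠ 0 := by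
        intro j h
        refine hnn i j ?_
        rw [← sub_eq_zero.1 h, mul_inv_cancel₀ hi, sub_self]
      have h1 := hpole i (β i)⁻¹ (by rw [hAe, mul_inv_cancel₀ hi, sub_self, zero_mul])
      rw [hP0, eval_zero, eq_comm, mul_eq_zero, Finset.prod_eq_zero_iff] at h1
      rcases h1 with h1 | ⟨j, hj, h1⟩
      · rw [hRe, mul_inv_cancel₀ hi, sub_self, mul_zero, add_zero, mul_eq_zero, mul_eq_zero] at h1
        exact ((h1.resolve_right (hnn' i)).resolve_right (inv_ne_zero hi))
      · rw [hAe, mul_eq_zero] at h1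
        have h2 := sub_eq_zero.1 (h1.resolve_right (hnn' j))
        have h3 : β i = β j := by
          field_simp at h2
          exact h2
        exact absurd (hinj h3).symm (Finset.ne_of_mem_erase hj)
    refine ⟨?_, hp, hq⟩
    have h1 := hPe 0
    simp only [hP0, eval_zero, hRe, hp, hq, zero_mul, add_zero, Finset.sum_const_zero, hAe] at h1
    rw [eq_comm, mul_eq_zero] at h1
    refine h1.resolve_right (Finset.prod_ne_zero_iff.2 fun i _ => ?_)
    simpa using hβ0 i

theorem pf_eq_zero_of_card (hβ : ∀ i, ‖β i‖ < 1) (hβ0 : ∀ i, β i ≠ 0)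
    (hinj : Function.Injective β) (S : Finset ℂ)
    (hS : ∀ z ∈ S, (∀ i, 1 - β i * z ≠ 0 ∧ z - star (β i) ≠ 0) ∧ pf β c p q z = 0)
    (hcard : 2 * Fintype.card ι < S.card) : c = 0 ∧ (∀ i, p i = 0) ∧ ∀ i, q i = 0 := by
  obtain ⟨P, hdeg, heval, hzero⟩ := exists_pf_numerator (c := c) (p := p) (q := q) hβ hβ0 hinj
  refine hzero (Polynomial.eq_zero_of_natDegree_lt_card_of_eval_eq_zero' P S (fun z hz => ?_)
    (hdeg.trans_lt hcard))
  rw [heval z (hS z hz).1, (hS z hz).2, mul_zero]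

/-- A partial fraction with the maximal number of zeros has no other and no multiple zeros. -/
theorem pf_simple_zeros (hβ : ∀ i, ‖β i‖ < 1) (hβ0 : ∀ i, β i ≠ 0)
    (hinj : Function.Injective β) (S : Finset ℂ)
    (hS : ∀ z ∈ S, (∀ i, 1 - β i * z ≠ 0 ∧ z - star (β i) ≠ 0) ∧ pf β c p q z = 0)
    (hcard : S.card = 2 * Fintype.card ι) (hne : ¬ (c = 0 ∧ (∀ i, p i = 0) ∧ ∀ i, q i = 0)) :
    (∀ z, (∀ i, 1 - β i * z ≠ 0 ∧ z - star (β i) ≠ 0) → pf β c p q z = 0 → z ∈ S) ∧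
    ∀ z ∈ S, ¬ HasDerivAt (pf β c p q) 0 z := by
  classical
  obtain ⟨P, hdeg, heval, hzero⟩ := exists_pf_numerator (c := c) (p := p) (q := q) hβ hβ0 hinj
  have hP0 : P ≠ 0 := fun h => hne (hzero h)
  have hroot : ∀ z ∈ S, P.eval z = 0 := fun z hz => by
    rw [heval z (hS z hz).1, (hS z hz).2, mul_zero]
  have hle : ∀ M : Multiset ℂ, M ≤ P.roots → Multiset.card M ≤ S.card := fun M hM =>
    (Multiset.card_le_card hM).trans ((P.card_roots').trans (hdeg.trans hcard.ge))
  constructor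
  · intro z hz hz0
    by_contra hzS
    have h1 : insert z S ⊆ P.roots.toFinset := by
      intro w hw
      rw [Multiset.mem_toFinset, Polynomial.mem_roots hP0]
      rcases Finset.mem_insert.1 hw with rfl | hw
      · change P.eval w = 0
        rw [heval w hz, hz0, mul_zero]
      · exact hroot w hw
    have h2 := hle _ ((Multiset.le_iff_subset (insert z S).nodup).2 fun w hw =>
      Multiset.mem_toFinset.1 (h1 hw))
    have h3 : (insert z S).card = S.card + 1 := Finset.card_insert_of_notMem hzS
    have h4 : (insert z S).card = Multiset.card (insert z S).val := rfl
    omega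
  · intro z hz hd
    have hden : DifferentiableAt ℂ (pfDen β) z := by
      unfold pfDen
      fun_prop
    have h1 : HasDerivAt (fun w => pfDen β w * pf β c p q w)
        (deriv (pfDen β) z * pf β c p q z + pfDen β z * 0) z := hden.hasDerivAt.mul hd
    rw [(hS z hz).2, mul_zero, mul_zero, add_zero] at h1
    have hev : (fun w => pfDen β w * pf β c p q w) =ᶠ[𝓝 z] fun w => P.eval w := by
      have h2 : ∀ᶠ w in 𝓝 z, ∀ i, 1 - β i * w ≠ 0 ∧ w - star (β i) ≠ 0 := by
        rw [eventually_all]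
        intro i
        have ha : ContinuousAt (fun w => 1 - β i * w) z := by fun_prop
        have hb : ContinuousAt (fun w => w - star (β i)) z := by fun_prop
        exact (ha.eventually_ne ((hS z hz).1 i).1).and (hb.eventually_ne ((hS z hz).1 i).2)
      filter_upwards [h2] with w hw
      rw [heval w hw]
    have h3 := (h1.congr_of_eventuallyEq hev.symm).unique (P.hasDerivAt z)
    have h4 : 1 < P.rootMultiplicity z :=
      (Polynomial.one_lt_rootMultiplicity_iff_isRoot hP0).2 ⟨hroot z hz, h3.symm⟩
    -- With a double root at `z`, the set `S` with `z` repeated is part of the multiset of roots,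
    -- one more than the degree permits.
    have h5 : z ::ₘ S.val ≤ P.roots := by
      rw [Multiset.le_iff_count]
      intro w
      rw [Polynomial.count_roots]
      by_cases hw : w = z
      · subst hw
        rw [Multiset.count_cons_self, Multiset.count_eq_one_of_mem S.nodup hz]
        exact h4
      · rw [Multiset.count_cons_of_ne hw]
        by_cases hwS : w ∈ S
        · rw [Multiset.count_eq_one_of_mem S.nodup hwS]
          exact (Polynomial.rootMultiplicity_pos hP0).2 (hroot w hwS)
        · rw [Multiset.count_eq_zero_of_notMem hwS]
          exact Nat.zero_le _
    have h6 := hle _ h5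
    rw [Multiset.card_cons] at h6
    have : Multiset.card S.val = S.card := rfl
    omega

end PartialFractions

end

/-! ### Maximality of the number of critical points and its consequences. -/

section

variable {m : ℕ} {κ : Fin (m + 1) → ℕ}

theorem norm_mul_lt_one {x z : ℂ} (hx : ‖x‖ < 1) (hz : ‖z‖ = 1) : ‖x * z‖ < 1 := by
  rwa [norm_mul, hz, mul_one]

theorem sub_star_ne_zero_of_norm_eq {x z : ℂ} (hx : ‖x‖ < 1) (hz : ‖z‖ = 1) : z - star x ≠ 0 := by
  intro h
  rw [sub_eq_zero] at h
  rw [h, norm_star] at hz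
  exact hx.ne hz

theorem nonpole_of_norm_eq {ι : Type*} {b : ι → ℂ} (hb : ∀ j, ‖b j‖ < 1) {z : ℂ} (hz : ‖z‖ = 1)
    (j : ι) : 1 - b j * z ≠ 0 ∧ z - star (b j) ≠ 0 :=
  ⟨one_sub_ne_zero (norm_mul_lt_one (hb j) hz), sub_star_ne_zero_of_norm_eq (hb j) hz⟩

theorem rc_eq_pf {b : Fin m → ℂ} {z : ℂ} (hz : ∀ j, z - star (b j) ≠ 0) :
    rc κ b z = pf b (circleDegree κ) (fun j => -(κ j.succ * b j))
      (fun j => -(κ j.succ * star (b j))) z := by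
  rw [rc, pf, circleDegree_cast, sub_add, ← Finset.sum_sub_distrib]
  congr 1
  refine Finset.sum_congr rfl fun j _ => ?_
  have h := hz j
  have h1 : z / (z - star (b j)) = 1 + star (b j) / (z - star (b j)) := by
    field_simp
    ring
  rw [h1]
  ring

/-- The set of distinct non-zero values of the parameters. -/
def valueSet (b : Fin m → ℂ) : Finset ℂ := by
  classical exact (Finset.univ.image b).erase 0

/-- Coinciding parameters are merged and zero parameters dropped, so that the partial fraction
acquires distinct nonzero β_i, as the zero count requires. -/
theorem sum_fiber_eq (b : Fin m → ℂ) (w : Fin m → ℂ) (F : ℂ → ℂ) (hF : F 0 = 0) :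
    ∑ j, w j * F (b j) =
      ∑ x : valueSet b, (∑ j with b j = (x : ℂ), w j) * F x := by
  classical
  rw [Finset.sum_coe_sort (valueSet b) (fun x => (∑ j with b j = x, w j) * F x)]
  have h1 : valueSet b = (Finset.univ.image b).erase 0 := by unfold valueSet; congr
  rw [h1]
  have h2 : ∑ x ∈ (Finset.univ.image b).erase 0, (∑ j with b j = x, w j) * F x =
      ∑ x ∈ Finset.univ.image b, (∑ j with b j = x, w j) * F x := by
    refine Finset.sum_subset (Finset.erase_subset _ _) fun x hx hx' => ?_
    have : x = 0 := by
      by_contra hne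
      exact hx' (Finset.mem_erase.2 ⟨hne, hx⟩)
    rw [this, hF, mul_zero]
  rw [h2, ← Finset.sum_fiberwise_of_maps_to (g := b) (t := Finset.univ.image b)
    (fun j _ => Finset.mem_image_of_mem b (Finset.mem_univ j))]
  refine Finset.sum_congr rfl fun x _ => ?_
  rw [Finset.sum_mul]
  refine Finset.sum_congr rfl fun j hj => ?_
  rw [(Finset.mem_filter.1 hj).2]

/-- If the derivative of the lift has as many zeros as possible, then it vanishes identically or
the parameters are distinct and non-zero. -/
theorem rr_eq_zero_or_injective (hκ : ∀ i, 0 < κ i) {b : Fin m → ℂ} (hb : ∀ j, ‖b j‖ < 1)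
    (S : Finset ℂ) (hS : ∀ z ∈ S, ‖z‖ = 1 ∧ rc κ b z = 0) (hcard : 2 * m ≤ S.card) :
    (∀ t, rr κ b t = 0) ∨ (S.card = 2 * m ∧ Function.Injective b ∧ ∀ j, b j ≠ 0) := by
  classical
  have h1 : valueSet b = (Finset.univ.image b).erase 0 := by unfold valueSet; congr
  have hmem : ∀ x ∈ valueSet b, x ≠ 0 ∧ ∃ j, b j = x := by
    intro x hx
    rw [h1, Finset.mem_erase, Finset.mem_image] at hx
    obtain ⟨h0, j, -, hj⟩ := hx
    exact ⟨h0, j, hj⟩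
  -- Too few distinct nonzero parameters: the zero count kills every coefficient. As the merged
  -- multiplicities are positive, there can be no nonzero parameter at all, and the degree is 0 too.
  -- Otherwise there are at least m distinct nonzero values, hence exactly m.
  by_cases hlt : 2 * (valueSet b).card < S.card
  · left
    set K : ℂ → ℂ := fun x => ∑ j with b j = x, (κ j.succ : ℂ) with hK
    have hpf : ∀ z, ‖z‖ = 1 → rc κ b z = pf (fun x : valueSet b => (x : ℂ)) (circleDegree κ)
        (fun x => -(K x * x)) (fun x => -(K x * star (x : ℂ))) z := by
      intro z hz
      rw [rc_eq_pf fun j => (nonpole_of_norm_eq hb hz j).2, pf, pf]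
      congr 1
      have := sum_fiber_eq b (fun j => (κ j.succ : ℂ))
        (fun x => -(x * z / (1 - x * z) + star x / (z - star x))) (by simp)
      convert this using 1
      · exact Finset.sum_congr rfl fun j _ => by ring
      · exact Finset.sum_congr rfl fun j _ => by simp only [hK]; ring
    have hx : ∀ x : valueSet b, ‖(x : ℂ)‖ < 1 := by
      intro x
      obtain ⟨-, j, hj⟩ := hmem x x.2
      rw [← hj]; exact hb j
    obtain ⟨hd, hp, -⟩ := pf_eq_zero_of_card (β := fun x : valueSet b => (x : ℂ)) hx
      (fun x => (hmem x x.2).1) Subtype.val_injective S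
      (fun z hz => ⟨nonpole_of_norm_eq hx (hS z hz).1, by rw [← hpf z (hS z hz).1, (hS z hz).2]⟩)
      (by rw [Fintype.card_coe]; exact hlt)
    have hempty : ∀ x, x ∉ valueSet b := by
      intro x hx
      have h2 := hp ⟨x, hx⟩
      rw [neg_eq_zero, mul_eq_zero] at h2
      obtain ⟨h0, j, hj⟩ := hmem x hx
      refine h2.elim (fun h3 => ?_) h0
      have h4 : (0 : ℕ) < ∑ j with b j = x, κ j.succ :=
        Finset.sum_pos (fun j _ => hκ _) ⟨j, by simp [hj]⟩
      have h5 : K x = ((∑ j with b j = x, κ j.succ : ℕ) : ℂ) := by rw [hK]; push_cast; rfl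
      simp only at h3
      rw [h5] at h3
      have : (∑ j with b j = x, κ j.succ : ℕ) = 0 := by exact_mod_cast h3
      omega
    have hb0 : ∀ j, b j = 0 := by
      intro j
      by_contra hne
      refine hempty (b j) ?_
      rw [h1]
      exact Finset.mem_erase.2 ⟨hne, Finset.mem_image_of_mem b (Finset.mem_univ j)⟩
    intro t
    have hd' : circleDegree κ = 0 := by exact_mod_cast hd
    simp [rr, hb0, hd']
  · right
    have h2 : (valueSet b).card ≤ (Finset.univ.image b).card := by
      rw [h1]; exact Finset.card_le_card (Finset.erase_subset _ _)
    have h3 : (Finset.univ.image b).card ≤ m := by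
      simpa using Finset.card_image_le (s := Finset.univ) (f := b)
    have h4 : (Finset.univ.image b).card = (Finset.univ : Finset (Fin m)).card := by
      rw [Finset.card_univ, Fintype.card_fin]; omega
    refine ⟨by omega, fun i j hij => Finset.card_image_iff.1 h4 (by simp) (by simp) hij, fun j hj => ?_⟩
    have h5 : (0 : ℂ) ∈ Finset.univ.image b := Finset.mem_image.2 ⟨j, Finset.mem_univ j, hj⟩
    have h6 : (valueSet b).card = (Finset.univ.image b).card - 1 := by
      rw [h1, Finset.card_erase_of_mem h5]
    have h7 : 0 < (Finset.univ.image b).card := Finset.card_pos.2 ⟨0, h5⟩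
    omega

theorem fstIdx_lt_sndIdx (j : Fin m) : fstIdx j < sndIdx j := by
  simp [fstIdx, sndIdx, Fin.lt_def]

theorem eq_fstIdx_or_sndIdx (i : Fin (2 * m)) : ∃ j, i = fstIdx j ∨ i = sndIdx j := by
  refine ⟨⟨i / 2, by omega⟩, ?_⟩
  simp only [fstIdx, sndIdx, Fin.ext_iff]
  omega

/-- The critical points on the unit circle. -/
def critSet (c : Fin (2 * m) → ℝ) : Finset ℂ := by
  classical exact Finset.univ.image fun i => circleCover (c i)

theorem mem_critSet {c : Fin (2 * m) → ℝ} {z : ℂ} :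
    z ∈ critSet c ↔ ∃ i, circleCover (c i) = z := by
  simp [critSet]

theorem differentiableAt_rc {b : Fin m → ℂ} {z : ℂ}
    (hz : ∀ j, 1 - b j * z ≠ 0 ∧ z - star (b j) ≠ 0) : DifferentiableAt ℂ (rc κ b) z := by
  unfold rc
  refine (differentiableAt_const _).sub (DifferentiableAt.fun_sum fun j _ => ?_)
  have h1 := (hz j).1
  have h2 := (hz j).2
  fun_prop (disch := assumption)

theorem hasDerivAt_rc_ce {b : Fin m → ℂ} {τ : ℂ}
    (hz : ∀ j, 1 - b j * ce τ ≠ 0 ∧ ce τ - star (b j) ≠ 0) :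
    HasDerivAt (fun τ => rc κ b (ce τ)) (deriv (rc κ b) (ce τ) * (2 * Real.pi * Complex.I * ce τ))
      τ :=
  (differentiableAt_rc hz).hasDerivAt.comp τ (hasDerivAt_ce τ)

/-- The second derivative of the lift. -/
def rr2 (κ : Fin (m + 1) → ℕ) (b : Fin m → ℂ) (t : ℝ) : ℝ :=
  (deriv (rc κ b) (circleCover t) * (2 * Real.pi * Complex.I * circleCover t)).re

theorem hasDerivAt_rr {b : Fin m → ℂ} (hb : ∀ j, ‖b j‖ < 1) (t : ℝ) :
    HasDerivAt (rr κ b) (rr2 κ b t) t := by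
  have h := (hasDerivAt_rc_ce (κ := κ) (b := b) (τ := t)
    (nonpole_of_norm_eq hb (norm_circleCover t))).real_of_complex
  refine h.congr_of_eventuallyEq (Eventually.of_forall fun s => ?_)
  simp only [ce_ofReal, rc_circleCover s hb, Complex.ofReal_re]

/-- The second derivative of the lift, in complex form. -/
theorem ofReal_rr2 {b : Fin m → ℂ} (hb : ∀ j, ‖b j‖ < 1) (t : ℝ) :
    (rr2 κ b t : ℂ) = deriv (rc κ b) (circleCover t) * (2 * Real.pi * Complex.I * circleCover t) := by
  have h := (hasDerivAt_rc_ce (κ := κ) (b := b) (τ := t)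
    (nonpole_of_norm_eq hb (norm_circleCover t))).comp_ofReal
  refine (((hasDerivAt_rr hb t).ofReal_comp).congr_of_eventuallyEq
    (Eventually.of_forall fun s => ?_)).unique h
  simp only [ce_ofReal, rc_circleCover s hb]

theorem continuous_rr {b : Fin m → ℂ} (hb : ∀ j, ‖b j‖ < 1) : Continuous (rr κ b) :=
  continuous_iff_continuousAt.2 fun t => (hasDerivAt_rr hb t).continuousAt

variable [NeZero m]

theorem fstIdx_zero_le (i : Fin (2 * m)) : fstIdx (0 : Fin m) ≤ i := by
  simp [fstIdx]

/-- `c` lists the critical points of the lift in a period, alternately maxima and minima. -/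
structure IsLab (κ : Fin (m + 1) → ℕ) (b : Fin m → ℂ) (c : Fin (2 * m) → ℝ) : Prop where
  norm_lt : ∀ j, ‖b j‖ < 1
  strictMono : StrictMono c
  lt_add_one : ∀ i, c i < c (fstIdx 0) + 1
  crit : ∀ i, rr κ b (c i) = 0
  desc : ∀ j, lr κ 0 b (c (sndIdx j)) < lr κ 0 b (c (fstIdx j))

theorem circleCover_injOn_of_lt {n : ℕ} {c : Fin n → ℝ} (hc : Function.Injective c) {x : ℝ}
    (h : ∀ i, x ≤ c i ∧ c i < x + 1) : Function.Injective fun i => circleCover (c i) := by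
  intro i j hij
  obtain ⟨k, hk⟩ := circleCover_eq_iff.1 hij
  have h1 : ((k : ℤ) : ℝ) < 1 := by linarith [(h i).2, (h j).1]
  have h2 : (-1 : ℝ) < (k : ℤ) := by linarith [(h j).2, (h i).1]
  have : k = 0 := by
    have h1' : k < 1 := by exact_mod_cast h1
    have h2' : -1 < k := by exact_mod_cast h2
    omega
  rw [this, Int.cast_zero, add_zero] at hk
  exact hc hk

namespace IsLab

variable {b : Fin m → ℂ} {c : Fin (2 * m) → ℝ}

theorem le (h : IsLab κ b c) (i : Fin (2 * m)) : c (fstIdx 0) ≤ c i :=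
  h.strictMono.monotone (fstIdx_zero_le i)

theorem card_critSet (h : IsLab κ b c) : (critSet c).card = 2 * m := by
  classical
  rw [critSet, Finset.card_image_of_injective _
    (circleCover_injOn_of_lt h.strictMono.injective fun i => ⟨h.le i, h.lt_add_one i⟩)]
  simp

theorem critSet_zero (h : IsLab κ b c) : ∀ z ∈ critSet c, ‖z‖ = 1 ∧ rc κ b z = 0 := by
  intro z hz
  obtain ⟨i, rfl⟩ := mem_critSet.1 hz
  exact ⟨norm_circleCover _, by rw [rc_circleCover _ h.norm_lt, h.crit i, Complex.ofReal_zero]⟩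

theorem not_rr_eq_zero (h : IsLab κ b c) : ¬ ∀ t, rr κ b t = 0 := by
  intro h0
  have h1 : ∀ t, deriv (lr κ 0 b) t = 0 := fun t => by
    rw [(hasDerivAt_lr 0 h.norm_lt t).deriv, h0 t]
  have h2 := is_const_of_deriv_eq_zero
    (fun t => (hasDerivAt_lr 0 h.norm_lt t).differentiableAt) h1
  exact (h.desc 0).ne (h2 _ _)

theorem injective (hκ : ∀ i, 0 < κ i) (h : IsLab κ b c) : Function.Injective b ∧ ∀ j, b j ≠ 0 :=
  ((rr_eq_zero_or_injective hκ h.norm_lt _ h.critSet_zero h.card_critSet.ge).resolve_left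
    h.not_rr_eq_zero).2

/-- The 2m marked points already exhaust the degree of the numerator. So the logarithmic derivative
has no further zero anywhere in the plane, not merely on the circle, and these zeros are simple:
there are no free critical points and every turning point is nondegenerate. -/
theorem pf_simple (hκ : ∀ i, 0 < κ i) (h : IsLab κ b c) :
    (∀ z, (∀ j, 1 - b j * z ≠ 0 ∧ z - star (b j) ≠ 0) → rc κ b z = 0 → z ∈ critSet c) ∧
    ∀ z ∈ critSet c, ¬ HasDerivAt (rc κ b) 0 z := by
  have hmp := h.injective hκ
  have hp := pf_simple_zeros h.norm_lt hmp.2 hmp.1 (critSet c)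
    (c := circleDegree κ) (p := fun j => -(κ j.succ * b j)) (q := fun j => -(κ j.succ * star (b j)))
    (fun z hz => ⟨nonpole_of_norm_eq h.norm_lt (h.critSet_zero z hz).1, by
      rw [← rc_eq_pf fun j => (nonpole_of_norm_eq h.norm_lt (h.critSet_zero z hz).1 j).2]
      exact (h.critSet_zero z hz).2⟩) (by rw [h.card_critSet, Fintype.card_fin]) (by
      rintro ⟨-, h1, -⟩
      have h2 := h1 0
      rw [neg_eq_zero, mul_eq_zero] at h2
      refine h2.elim (fun h3 => ?_) (hmp.2 0)
      exact (hκ _).ne' (by exact_mod_cast h3))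
  refine ⟨fun z hz hz0 => hp.1 z hz (by rw [← rc_eq_pf fun j => (hz j).2]; exact hz0),
    fun z hz hd => hp.2 z hz (hd.congr_of_eventuallyEq ?_)⟩
  have hev : ∀ᶠ w in 𝓝 z, ∀ j, w - star (b j) ≠ 0 := by
    rw [eventually_all]
    intro j
    have hb : ContinuousAt (fun w => w - star (b j)) z := by fun_prop
    exact hb.eventually_ne (nonpole_of_norm_eq h.norm_lt (h.critSet_zero z hz).1 j).2
  filter_upwards [hev] with w hw
  exact (rc_eq_pf hw).symm

theorem rr_eq_zero_iff (hκ : ∀ i, 0 < κ i) (h : IsLab κ b c) {t : ℝ} :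
    rr κ b t = 0 ↔ ∃ i, ∃ n : ℤ, t = c i + n := by
  constructor
  · intro h0
    have h1 := (h.pf_simple hκ).1 (circleCover t) (nonpole_of_norm_eq h.norm_lt (norm_circleCover t))
      (by rw [rc_circleCover t h.norm_lt, h0, Complex.ofReal_zero])
    obtain ⟨i, hi⟩ := mem_critSet.1 h1
    exact ⟨i, circleCover_eq_iff.1 hi.symm⟩
  · rintro ⟨i, n, rfl⟩
    rw [rr_add_int, h.crit i]

theorem eq_of_rr_eq_zero (hκ : ∀ i, 0 < κ i) (h : IsLab κ b c) {t : ℝ} (ht : rr κ b t = 0)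
    (h1 : c (fstIdx 0) ≤ t) (h2 : t < c (fstIdx 0) + 1) : ∃ i, t = c i := by
  obtain ⟨i, n, hn⟩ := (h.rr_eq_zero_iff hκ).1 ht
  have h3 := h.le i
  have h4 := h.lt_add_one i
  have h5 : ((n : ℤ) : ℝ) < 1 := by linarith
  have h6 : (-1 : ℝ) < (n : ℤ) := by linarith
  have : n = 0 := by
    have h1' : n < 1 := by exact_mod_cast h5
    have h2' : -1 < n := by exact_mod_cast h6
    omega
  exact ⟨i, by rw [hn, this]; simp⟩

theorem rr2_ne_zero (hκ : ∀ i, 0 < κ i) (h : IsLab κ b c) (i : Fin (2 * m)) :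
    rr2 κ b (c i) ≠ 0 := by
  intro h0
  have h1 := ofReal_rr2 (κ := κ) h.norm_lt (c i)
  rw [h0, Complex.ofReal_zero, eq_comm, mul_eq_zero] at h1
  have h2 : deriv (rc κ b) (circleCover (c i)) = 0 :=
    h1.resolve_right (mul_ne_zero Complex.two_pi_I_ne_zero (circleCover_ne_zero _))
  refine (h.pf_simple hκ).2 (circleCover (c i)) (mem_critSet.2 ⟨i, rfl⟩) ?_
  have h3 := (differentiableAt_rc (κ := κ)
    (nonpole_of_norm_eq h.norm_lt (norm_circleCover (c i)))).hasDerivAt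
  rwa [h2] at h3

end IsLab

end

/-! ### Signs of the derivative between critical points. -/

section

theorem eventually_pos_right_of_deriv_pos {f : ℝ → ℝ} {f' x : ℝ} (hf : HasDerivAt f f' x)
    (h0 : f x = 0) (hf' : 0 < f') : (∀ᶠ y in 𝓝[>] x, 0 < f y) ∧ ∀ᶠ y in 𝓝[<] x, f y < 0 := by
  have h1 := (hasDerivAt_iff_tendsto_slope.1 hf).eventually_const_lt hf'
  constructor
  · have h2 := h1.filter_mono (nhdsWithin_mono x fun y (hy : x < y) => ne_of_gt hy)
    filter_upwards [h2, self_mem_nhdsWithin] with y hy hxy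
    rw [slope_def_field, h0, sub_zero] at hy
    exact (div_pos_iff_of_pos_right (sub_pos.2 hxy)).1 hy
  · have h2 := h1.filter_mono (nhdsWithin_mono x fun y (hy : y < x) => ne_of_lt hy)
    filter_upwards [h2, self_mem_nhdsWithin] with y hy hxy
    rw [slope_def_field, h0, sub_zero] at hy
    by_contra hcon
    have := div_nonpos_of_nonneg_of_nonpos (not_lt.1 hcon) (sub_neg.2 hxy).le
    linarith

theorem eventually_neg_right_of_deriv_neg {f : ℝ → ℝ} {f' x : ℝ} (hf : HasDerivAt f f' x)
    (h0 : f x = 0) (hf' : f' < 0) : (∀ᶠ y in 𝓝[>] x, f y < 0) ∧ ∀ᶠ y in 𝓝[<] x, 0 < f y := by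
  have := eventually_pos_right_of_deriv_pos hf.neg (by simpa using h0) (neg_pos.2 hf')
  simpa using this

variable {m : ℕ} {κ : Fin (m + 1) → ℕ}

theorem sndIdx_le_of_fstIdx_lt {j : Fin m} {i : Fin (2 * m)} (h : fstIdx j < i) : sndIdx j ≤ i := by
  simp only [fstIdx, sndIdx, Fin.lt_def, Fin.le_def] at *
  omega

variable [NeZero m]

namespace IsLab

variable {b : Fin m → ℂ} {c : Fin (2 * m) → ℝ}

theorem rr_ne_zero_of_gap (hκ : ∀ i, 0 < κ i) (h : IsLab κ b c) {i : Fin (2 * m)} {t : ℝ}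
    (h1 : c i < t) (h2 : ∀ i', i < i' → t < c i') (h3 : t < c (fstIdx 0) + 1) : rr κ b t ≠ 0 := by
  intro h0
  obtain ⟨i', rfl⟩ := h.eq_of_rr_eq_zero hκ h0 ((h.le i).trans h1.le) h3
  exact lt_irrefl _ (h2 i' (h.strictMono.lt_iff_lt.1 h1))

/-- No zero lies between the two points, so the sign is constant; a positive sign would contradict
the descent recorded in `IsLab.desc`. -/
theorem rr_neg (hκ : ∀ i, 0 < κ i) (h : IsLab κ b c) {j : Fin m} {t : ℝ}
    (ht : t ∈ Ioo (c (fstIdx j)) (c (sndIdx j))) : rr κ b t < 0 := by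
  have hne : ∀ s ∈ Ioo (c (fstIdx j)) (c (sndIdx j)), rr κ b s ≠ 0 := fun s hs =>
    h.rr_ne_zero_of_gap hκ hs.1 (fun i' hi' => hs.2.trans_le
      (h.strictMono.monotone (sndIdx_le_of_fstIdx_lt hi'))) (hs.2.trans (h.lt_add_one _))
  rcases isPreconnected_Ioo.mapsTo_Ioi_or_Iio (continuous_rr h.norm_lt).continuousOn hne with h1 | h1
  · exfalso
    have h2 : StrictMonoOn (lr κ 0 b) (Icc (c (fstIdx j)) (c (sndIdx j))) := by
      refine strictMonoOn_of_deriv_pos (convex_Icc _ _)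
        (fun x _ => (hasDerivAt_lr 0 h.norm_lt x).continuousAt.continuousWithinAt) fun x hx => ?_
      rw [interior_Icc] at hx
      rw [(hasDerivAt_lr 0 h.norm_lt x).deriv]
      exact h1 hx
    have h3 := h.strictMono (fstIdx_lt_sndIdx j)
    exact lt_asymm (h2 (left_mem_Icc.2 h3.le) (right_mem_Icc.2 h3.le) h3) (h.desc j)
  · exact h1 ht

/-- The zero is simple, and a positive second derivative would make the lift increase just after the
point, where it descends. -/
theorem rr2_fst_neg (hκ : ∀ i, 0 < κ i) (h : IsLab κ b c) (j : Fin m) :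
    rr2 κ b (c (fstIdx j)) < 0 := by
  refine lt_of_le_of_ne (not_lt.1 fun hpos => ?_) (h.rr2_ne_zero hκ _)
  have h1 := (eventually_pos_right_of_deriv_pos (hasDerivAt_rr h.norm_lt _) (h.crit _) hpos).1
  have h2 := h1.and (Ioo_mem_nhdsGT (h.strictMono (fstIdx_lt_sndIdx j)))
  obtain ⟨t, ht, ht2⟩ := h2.exists
  exact lt_asymm ht (h.rr_neg hκ ht2)

theorem rr2_snd_pos (hκ : ∀ i, 0 < κ i) (h : IsLab κ b c) (j : Fin m) :
    0 < rr2 κ b (c (sndIdx j)) := by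
  refine lt_of_le_of_ne (not_lt.1 fun hneg => ?_) (h.rr2_ne_zero hκ _).symm
  have h1 := (eventually_neg_right_of_deriv_neg (hasDerivAt_rr h.norm_lt _) (h.crit _) hneg).2
  have h2 := h1.and (Ioo_mem_nhdsLT (h.strictMono (fstIdx_lt_sndIdx j)))
  obtain ⟨t, ht, ht2⟩ := h2.exists
  exact lt_asymm ht (h.rr_neg hκ ht2)

/-- The simple zero at the minimum makes the derivative positive just to its right, and no zero
intervenes up to the next maximum or the end of the period. -/
theorem rr_pos (hκ : ∀ i, 0 < κ i) (h : IsLab κ b c) {j : Fin m} {t : ℝ} (h1 : c (sndIdx j) < t)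
    (h2 : ∀ j', j < j' → t < c (fstIdx j')) (h3 : t < c (fstIdx 0) + 1) : 0 < rr κ b t := by
  have hlast : ∀ i', sndIdx j < i' → t < c i' := by
    intro i' hi'
    obtain ⟨j', rfl | rfl⟩ := eq_fstIdx_or_sndIdx i'
    · refine h2 j' ?_
      simp only [fstIdx, sndIdx, Fin.lt_def] at *; omega
    · refine (h2 j' ?_).trans (h.strictMono (fstIdx_lt_sndIdx j'))
      simp only [sndIdx, Fin.lt_def] at *; omega
  have hne : ∀ s ∈ Ioc (c (sndIdx j)) t, rr κ b s ≠ 0 := fun s hs =>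
    h.rr_ne_zero_of_gap hκ hs.1 (fun i' hi' => hs.2.trans_lt (hlast i' hi')) (hs.2.trans_lt h3)
  rcases isPreconnected_Ioc.mapsTo_Ioi_or_Iio (continuous_rr h.norm_lt).continuousOn hne with h4 | h4
  · exact h4 (right_mem_Ioc.2 h1)
  · have h5 := (eventually_pos_right_of_deriv_pos (hasDerivAt_rr h.norm_lt _) (h.crit _)
      (h.rr2_snd_pos hκ j)).1.and (Ioc_mem_nhdsGT h1)
    obtain ⟨s, hs, hs2⟩ := h5.exists
    exact absurd (h4 hs2) (not_lt.2 hs.le)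

/-- Translate `t` into the period starting at the first critical point and take the last critical
point before it; were that a minimum, the derivative would be positive. -/
theorem exists_arc_of_rr_neg (hκ : ∀ i, 0 < κ i) (h : IsLab κ b c) {t : ℝ} (ht : rr κ b t < 0) :
    ∃ j, ∃ n : ℤ, t - n ∈ Ioo (c (fstIdx j)) (c (sndIdx j)) := by
  set n := ⌊t - c (fstIdx 0)⌋ with hn
  set s := t - n with hs
  have hs0 : c (fstIdx 0) ≤ s := by linarith [Int.floor_le (t - c (fstIdx (0 : Fin m)))]
  have hs1 : s < c (fstIdx 0) + 1 := by linarith [Int.lt_floor_add_one (t - c (fstIdx (0 : Fin m)))]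
  have hrs : rr κ b s < 0 := by
    have := rr_add_int (κ := κ) b s n
    rw [hs, sub_add_cancel] at this
    rwa [hs, ← this]
  obtain ⟨i, hi, hmax⟩ := Finset.exists_max_image (Finset.univ.filter fun i => c i ≤ s) id
    ⟨fstIdx 0, by simpa using hs0⟩
  have hi' : c i ≤ s := by simpa using hi
  have hgap : ∀ i', i < i' → s < c i' := by
    intro i' hii'
    by_contra hcon
    exact absurd (hmax i' (by simpa using hcon)) (not_le.2 hii')
  have hlt : c i < s := by
    refine lt_of_le_of_ne hi' fun he => ?_
    rw [← he, h.crit] at hrs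
    exact lt_irrefl _ hrs
  obtain ⟨j, rfl | rfl⟩ := eq_fstIdx_or_sndIdx i
  · exact ⟨j, n, hlt, hgap _ (fstIdx_lt_sndIdx j)⟩
  · refine absurd (h.rr_pos hκ hlt (fun j' hj' => hgap _ ?_) hs1) (not_lt.2 hrs.le)
    simp only [fstIdx, sndIdx, Fin.lt_def] at *; omega

end IsLab

end

/-! ### Infinitesimal rigidity: deformations fixing the critical values. -/

section

variable {m : ℕ} {κ : Fin (m + 1) → ℕ}

/-- The variation of the lift with respect to the parameters `b`. -/
def lrVar (κ : Fin (m + 1) → ℕ) (b δ : Fin m → ℂ) (t : ℝ) : ℝ :=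
  1 / Real.pi * ∑ j : Fin m, (κ j.succ : ℝ) *
    (-(δ j * circleCover t) / (1 - b j * circleCover t)).im

theorem hasDerivAt_circleCover_comp {t : ℝ → ℝ} {t' s : ℝ} (ht : HasDerivAt t t' s) :
    HasDerivAt (fun s => circleCover (t s)) (2 * Real.pi * Complex.I * circleCover (t s) * t') s := by
  have h := (hasDerivAt_ce (t s)).scomp s ht.ofReal_comp
  refine h.congr_deriv ?_
  rw [smul_eq_mul, ce_ofReal]; ring

theorem _root_.HasDerivAt.complex_im {f : ℝ → ℂ} {f' : ℂ} {s : ℝ} (h : HasDerivAt f f' s) :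
    HasDerivAt (fun s => (f s).im) f'.im s :=
  (Complex.imCLM.hasFDerivAt (x := f s)).comp_hasDerivAt s h

theorem _root_.HasDerivAt.complex_re {f : ℝ → ℂ} {f' : ℂ} {s : ℝ} (h : HasDerivAt f f' s) :
    HasDerivAt (fun s => (f s).re) f'.re s :=
  (Complex.reCLM.hasFDerivAt (x := f s)).comp_hasDerivAt s h

theorem hasDerivAt_lr_comp {η t : ℝ → ℝ} {b : ℝ → Fin m → ℂ} {η' t' s : ℝ} {b' : Fin m → ℂ}
    (hη : HasDerivAt η η' s) (hb : ∀ j, HasDerivAt (fun s => b s j) (b' j) s)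
    (ht : HasDerivAt t t' s) (hb1 : ∀ j, ‖b s j‖ < 1) :
    HasDerivAt (fun s => lr κ (η s) (b s) (t s))
      (η' + lrVar κ (b s) b' (t s) + rr κ (b s) (t s) * t') s := by
  have hs : ∀ j, 1 - b s j * circleCover (t s) ∈ Complex.slitPlane := fun j =>
    slit_of_norm_lt (norm_mul_lt_one (hb1 j) (norm_circleCover _))
  have h1 : ∀ j, HasDerivAt (fun s => (κ j.succ : ℝ) *
      (Complex.log (1 - b s j * circleCover (t s))).im)
      ((κ j.succ : ℝ) * (-(b' j * circleCover (t s) + b s j *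
        (2 * Real.pi * Complex.I * circleCover (t s) * t')) / (1 - b s j * circleCover (t s))).im)
      s := fun j =>
    ((((hb j).mul (hasDerivAt_circleCover_comp ht)).const_sub 1).clog_real (hs j)).complex_im.const_mul
      _
  have h2 := ((hη.add (ht.const_mul (circleDegree κ : ℝ))).add
    ((HasDerivAt.fun_sum fun j (_ : j ∈ Finset.univ) => h1 j).const_mul (1 / Real.pi)))
  refine h2.congr_deriv ?_
  rw [lrVar, rr, add_assoc, add_assoc]
  congr 1
  rw [sub_mul, Finset.mul_sum, Finset.mul_sum, Finset.mul_sum, Finset.sum_mul, add_sub,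
    add_comm (∑ i, _), ← add_sub, ← Finset.sum_sub_distrib]
  congr 1
  refine Finset.sum_congr rfl fun j _ => ?_
  have h3 : -(b' j * circleCover (t s) + b s j *
      (2 * Real.pi * Complex.I * circleCover (t s) * t')) / (1 - b s j * circleCover (t s)) =
      -(b' j * circleCover (t s)) / (1 - b s j * circleCover (t s)) -
      ((2 * Real.pi * t' : ℝ) : ℂ) *
        (Complex.I * (b s j * circleCover (t s) / (1 - b s j * circleCover (t s)))) := by
    push_cast; ring
  rw [h3, Complex.sub_im, Complex.im_ofReal_mul, Complex.I_mul_im]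
  have := Real.pi_ne_zero
  field_simp

/-- For an infinitesimal rotation, b_j e^{2πit} depends only on the total angle, so the parameter
speed `x` and the speed `t'` of the point enter through their sum. -/
theorem hasDerivAt_rr_comp {t : ℝ → ℝ} {b : ℝ → Fin m → ℂ} {t' s x : ℝ}
    (hb : ∀ j, HasDerivAt (fun s => b s j) (2 * Real.pi * Complex.I * x * b s j) s)
    (ht : HasDerivAt t t' s) (hb1 : ∀ j, ‖b s j‖ < 1) :
    HasDerivAt (fun s => rr κ (b s) (t s)) (rr2 κ (b s) (t s) * (x + t')) s := by
  have key : ∀ {t : ℝ → ℝ} {b : ℝ → Fin m → ℂ} {t' s x : ℝ},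
    (∀ j, HasDerivAt (fun s => b s j) (2 * Real.pi * Complex.I * x * b s j) s) →
    HasDerivAt t t' s → (∀ j, ‖b s j‖ < 1) → HasDerivAt (fun s => rr κ (b s) (t s))
      ((-(2 * ∑ j : Fin m, (κ j.succ : ℝ) * (2 * Real.pi * Complex.I * (b s j * circleCover (t s)) /
        (1 - b s j * circleCover (t s)) ^ 2).re)) * (x + t')) s := by
    intro t b t' s x hb ht hb1
    have hs : ∀ j, 1 - b s j * circleCover (t s) ≠ 0 := fun j =>
      one_sub_ne_zero (norm_mul_lt_one (hb1 j) (norm_circleCover _))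
    have h1 : ∀ j, HasDerivAt (fun s => (κ j.succ : ℝ) *
        (b s j * circleCover (t s) / (1 - b s j * circleCover (t s))).re) ((κ j.succ : ℝ) *
          ((2 * Real.pi * Complex.I * (b s j * circleCover (t s)) /
        (1 - b s j * circleCover (t s)) ^ 2).re * (x + t'))) s := by
      intro j
      have h2 := (hb j).mul (hasDerivAt_circleCover_comp ht)
      have h3 := ((h2.div (h2.const_sub 1) (hs j)).complex_re).const_mul (κ j.succ : ℝ)
      refine h3.congr_deriv ?_
      rw [← Complex.re_mul_ofReal]
      congr 2
      have := hs j
      simp only [Pi.mul_apply]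
      push_cast
      field_simp
      ring
    have h2 := ((HasDerivAt.fun_sum fun j (_ : j ∈ Finset.univ) => h1 j).const_mul 2).const_sub
      (circleDegree κ : ℝ)
    refine h2.congr_deriv ?_
    rw [neg_mul, mul_assoc (2 : ℝ) _ (x + t'), Finset.sum_mul]
    congr 2
    exact Finset.sum_congr rfl fun j _ => (mul_assoc _ _ _).symm
  have h1 := key hb ht hb1
  -- Freezing the parameters identifies the explicit sum with the second derivative already named
  -- `rr2`.
  have h2 := key (t := id) (b := fun _ => b s) (t' := 1) (s := t s) (x := 0)
    (fun j => by simpa using hasDerivAt_const (t s) (b s j)) (hasDerivAt_id _) hb1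
  rw [zero_add, mul_one] at h2
  have h3 := (hasDerivAt_rr (κ := κ) hb1 (t s)).unique h2
  rw [h3]
  exact h1

/-- On the circle the conjugate of δz / (1 - bz) is conj δ / (z - conj b). The variation thus has
the same possible poles as the derivative `rr`, and the two can be compared by counting zeros. -/
theorem lrVar_eq_pf {b δ : Fin m → ℂ} (hb : ∀ j, ‖b j‖ < 1) (x : ℝ) (t : ℝ) :
    ((x + lrVar κ b δ t : ℝ) : ℂ) = pf b x (fun j => -(κ j.succ / (2 * Real.pi * Complex.I) * δ j))
      (fun j => κ j.succ / (2 * Real.pi * Complex.I) * star (δ j)) (circleCover t) := by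
  rw [pf, lrVar]
  push_cast
  rw [Finset.mul_sum]
  congr 1
  refine Finset.sum_congr rfl fun j _ => ?_
  have hz := circleCover_ne_zero t
  have hzz : (starRingEnd ℂ) (circleCover t) = (circleCover t)⁻¹ := by
    rw [← Complex.star_def, star_circleCover]
    refine eq_inv_of_mul_eq_one_left ?_
    rw [← circleCover_add]
    simp [circleCover]
  obtain ⟨h1, h2⟩ := nonpole_of_norm_eq hb (norm_circleCover t) j
  have h3 : (starRingEnd ℂ) (-(δ j * circleCover t) / (1 - b j * circleCover t)) =
      -(star (δ j) / (circleCover t - star (b j))) := by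
    rw [map_div₀, map_neg, map_mul, map_sub, map_mul, map_one, hzz, neg_div]
    congr 1
    have h4 : 1 - (starRingEnd ℂ) (b j) * (circleCover t)⁻¹ ≠ 0 := by
      intro h5
      apply h2
      have : circleCover t - star (b j) =
        circleCover t * (1 - (starRingEnd ℂ) (b j) * (circleCover t)⁻¹) := by
        field_simp; rfl
      rw [this, h5, mul_zero]
    rw [div_eq_div_iff h4 h2]
    simp only [Complex.star_def]
    field_simp
  have h4 := Complex.sub_conj (-(δ j * circleCover t) / (1 - b j * circleCover t))
  rw [h3] at h4
  have hpi : (Real.pi : ℂ) ≠ 0 := by exact_mod_cast Real.pi_ne_zero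
  have hI := Complex.I_ne_zero
  have h5 : (((-(δ j * circleCover t) / (1 - b j * circleCover t)).im : ℝ) : ℂ) =
      (-(δ j * circleCover t) / (1 - b j * circleCover t) -
        -(star (δ j) / (circleCover t - star (b j)))) / (2 * Complex.I) := by
    rw [h4]; push_cast; field_simp
  rw [h5]
  field_simp
  ring

variable [NeZero m]

/-- An infinitesimal deformation of the parameters which does not change the critical values is an
infinitesimal rotation. -/
theorem IsLab.exists_rotation {b : Fin m → ℂ} {c : Fin (2 * m) → ℝ} (hκ : ∀ i, 0 < κ i)
    (h : IsLab κ b c) {x : ℝ} {δ : Fin m → ℂ} (hx : ∀ i, x + lrVar κ b δ (c i) = 0) :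
    ∃ y : ℝ, (∀ j, δ j = 2 * Real.pi * Complex.I * y * b j) ∧ x = y * circleDegree κ := by
  classical
  have hpi : (Real.pi : ℂ) ≠ 0 := by exact_mod_cast Real.pi_ne_zero
  have hI := Complex.I_ne_zero
  obtain ⟨t, ht⟩ := not_forall.1 h.not_rr_eq_zero
  -- With this factor, variation minus `y` times derivative vanishes at `t` besides the 2m critical
  -- points: one zero too many, so all its coefficients are zero.
  set y : ℝ := (x + lrVar κ b δ t) / rr κ b t with hy
  have hinj := h.injective hκ
  have hG : ∀ s : ℝ, pf b ((x : ℂ) - y * circleDegree κ)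
      (fun j => -(κ j.succ / (2 * Real.pi * Complex.I) * δ j) - y * -(κ j.succ * b j))
      (fun j => κ j.succ / (2 * Real.pi * Complex.I) * star (δ j) - y * -(κ j.succ * star (b j)))
      (circleCover s) = ((x + lrVar κ b δ s - y * rr κ b s : ℝ) : ℂ) := by
    intro s
    rw [Complex.ofReal_sub, Complex.ofReal_mul, lrVar_eq_pf h.norm_lt, ← rc_circleCover s h.norm_lt,
      rc_eq_pf fun j => (nonpole_of_norm_eq h.norm_lt (norm_circleCover s) j).2]
    simp only [pf]
    rw [mul_add, Finset.mul_sum, add_sub_add_comm, ← Finset.sum_sub_distrib]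
    congr 1
    refine Finset.sum_congr rfl fun j _ => ?_
    ring
  have hnot : circleCover t ∉ critSet c := by
    intro hmem
    obtain ⟨i, hi⟩ := mem_critSet.1 hmem
    obtain ⟨n, hn⟩ := circleCover_eq_iff.1 hi
    have := h.crit i
    rw [hn, rr_add_int] at this
    exact ht this
  obtain ⟨h1, h2, -⟩ := pf_eq_zero_of_card h.norm_lt hinj.2 hinj.1
    (insert (circleCover t) (critSet c)) (c := (x : ℂ) - y * circleDegree κ)
    (p := fun j => -(κ j.succ / (2 * Real.pi * Complex.I) * δ j) - y * -(κ j.succ * b j))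
    (q := fun j => κ j.succ / (2 * Real.pi * Complex.I) * star (δ j) - y * -(κ j.succ * star (b j)))
    (fun z hz => by
      rcases Finset.mem_insert.1 hz with rfl | hz
      · refine ⟨nonpole_of_norm_eq h.norm_lt (norm_circleCover t), ?_⟩
        rw [hG t, hy, div_mul_cancel₀ _ ht, sub_self, Complex.ofReal_zero]
      · obtain ⟨i, rfl⟩ := mem_critSet.1 hz
        refine ⟨nonpole_of_norm_eq h.norm_lt (norm_circleCover _), ?_⟩
        rw [hG, hx i, h.crit i, mul_zero, sub_zero, Complex.ofReal_zero])
    (by rw [Finset.card_insert_of_notMem hnot, h.card_critSet, Fintype.card_fin]; omega)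
  refine ⟨y, fun j => ?_, ?_⟩
  · have h3 := h2 j
    have h4 : (κ j.succ : ℂ) ≠ 0 := by exact_mod_cast (hκ _).ne'
    field_simp at h3
    refine mul_left_cancel₀ h4 ?_
    linear_combination (-1 : ℂ) * h3
  · have h3 := sub_eq_zero.1 h1
    exact_mod_cast h3

end

/-! ### The product as a proper map to the disc, outside and inside the circle. -/

section

variable {m : ℕ} {κ : Fin (m + 1) → ℕ} {b : Fin m → ℂ}

theorem differentiableAt_bl {z : ℂ} (hz : ∀ j, z - star (b j) ≠ 0) :
    DifferentiableAt ℂ (bl κ 0 b) z := by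
  unfold bl
  refine ((differentiableAt_const _).mul (differentiableAt_id.pow _)).mul
    (DifferentiableAt.fun_finsetProd fun j _ => ?_)
  have h := hz j
  fun_prop (disch := assumption)

theorem eventually_nonpole {z : ℂ} (hz : ∀ j, z - star (b j) ≠ 0) :
    ∀ᶠ w in 𝓝 z, ∀ j, w - star (b j) ≠ 0 := by
  rw [eventually_all]
  intro j
  have h : ContinuousAt (fun w => w - star (b j)) z := by fun_prop
  exact h.eventually_ne (hz j)

theorem analyticAt_bl {z : ℂ} (hz : ∀ j, z - star (b j) ≠ 0) : AnalyticAt ℂ (bl κ 0 b) z := by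
  rw [Complex.analyticAt_iff_eventually_differentiableAt]
  filter_upwards [eventually_nonpole hz] with w hw
  exact differentiableAt_bl hw

/-- Off its zeros and poles, the critical points of the product are the zeros of `rc`, whose
position is known. -/
theorem deriv_bl {z : ℂ} (hz0 : z ≠ 0) (hz : ∀ j, 1 - b j * z ≠ 0 ∧ z - star (b j) ≠ 0) :
    deriv (bl κ 0 b) z = bl κ 0 b z * rc κ b z / z := by
  have hfac : ∀ j, (1 - b j * z) / (z - star (b j)) ≠ 0 := fun j => div_ne_zero (hz j).1 (hz j).2
  have hd : ∀ j, HasDerivAt (fun z => (1 - b j * z) / (z - star (b j)))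
      (((1 - b j * z) / (z - star (b j))) *
        (-(b j / (1 - b j * z)) - 1 / (z - star (b j)))) z := by
    intro j
    have h1 : HasDerivAt (fun z => 1 - b j * z) (-(b j * 1)) z :=
      ((hasDerivAt_id z).const_mul (b j)).const_sub 1
    have h2 : HasDerivAt (fun z => z - star (b j)) 1 z := (hasDerivAt_id z).sub_const _
    refine (h1.div h2 (hz j).2).congr_deriv ?_
    have h3 := (hz j).1
    have h4 := (hz j).2
    generalize 1 - b j * z = u at *
    generalize z - star (b j) = v at *
    field_simp
  have hl : ∀ j, logDeriv (fun z => ((1 - b j * z) / (z - star (b j))) ^ κ j.succ) z =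
      κ j.succ * (-(b j / (1 - b j * z)) - 1 / (z - star (b j))) := by
    intro j
    rw [logDeriv_fun_pow (hd j).differentiableAt, logDeriv_apply, (hd j).deriv,
      mul_div_cancel_left₀ _ (hfac j)]
  have hprod : logDeriv (fun z => ∏ j : Fin m, ((1 - b j * z) / (z - star (b j))) ^ κ j.succ) z =
      ∑ j : Fin m, κ j.succ * (-(b j / (1 - b j * z)) - 1 / (z - star (b j))) := by
    have h0 := logDeriv_prod (s := Finset.univ) (x := z)
      (f := fun (j : Fin m) (z : ℂ) => ((1 - b j * z) / (z - star (b j))) ^ κ j.succ)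
      (fun j _ => pow_ne_zero _ (hfac j)) (fun j _ => (hd j).differentiableAt.fun_pow _)
    rw [h0]
    exact Finset.sum_congr rfl fun j _ => hl j
  have hp0 : ∏ j : Fin m, ((1 - b j * z) / (z - star (b j))) ^ κ j.succ ≠ 0 :=
    Finset.prod_ne_zero_iff.2 fun j _ => pow_ne_zero _ (hfac j)
  have hz1 : circleCover 0 * z ^ κ 0 ≠ 0 := mul_ne_zero (circleCover_ne_zero 0) (pow_ne_zero _ hz0)
  have hlog : logDeriv (bl κ 0 b) z = rc κ b z / z := by
    have h1 : logDeriv (bl κ 0 b) z = logDeriv (fun z => circleCover 0 * z ^ κ 0) z +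
        logDeriv (fun z => ∏ j : Fin m, ((1 - b j * z) / (z - star (b j))) ^ κ j.succ) z := by
      refine logDeriv_mul z hz1 hp0 (by fun_prop) ?_
      exact DifferentiableAt.fun_finsetProd fun j _ => ((hd j).differentiableAt.pow _)
    have h2 : logDeriv (fun z => circleCover 0 * z ^ κ 0) z = κ 0 / z := by
      rw [logDeriv_const_mul z _ (circleCover_ne_zero 0), logDeriv_pow]
    rw [h1, h2, hprod, rc, sub_div, sub_eq_add_neg]
    congr 1
    rw [Finset.sum_div, ← Finset.sum_neg_distrib]
    refine Finset.sum_congr rfl fun j _ => ?_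
    have h3 := (hz j).1
    have h4 := (hz j).2
    generalize 1 - b j * z = u at *
    generalize z - star (b j) = v at *
    field_simp
    ring
  have hne : bl κ 0 b z ≠ 0 := mul_ne_zero hz1 hp0
  rw [logDeriv_apply, div_eq_iff hne] at hlog
  rw [hlog]; ring

/-- Numerator and denominator of the absolute value. -/
def absNum (κ : Fin (m + 1) → ℕ) (b : Fin m → ℂ) (z : ℂ) : ℝ :=
  ‖z‖ ^ κ 0 * ∏ j : Fin m, ‖1 - b j * z‖ ^ κ j.succ

/-- Denominator of the absolute value. -/
def absDen (κ : Fin (m + 1) → ℕ) (b : Fin m → ℂ) (z : ℂ) : ℝ :=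
  ∏ j : Fin m, ‖z - star (b j)‖ ^ κ j.succ

theorem continuous_absNum : Continuous (absNum κ b) := by unfold absNum; fun_prop

theorem continuous_absDen : Continuous (absDen κ b) := by unfold absDen; fun_prop

theorem norm_bl (η : ℝ) (z : ℂ) : ‖bl κ η b z‖ = absNum κ b z / absDen κ b z := by
  rw [bl, norm_mul, norm_mul, norm_circleCover, one_mul, norm_pow, norm_prod, absNum, absDen,
    mul_div_assoc, ← Finset.prod_div_distrib]
  congr 1
  exact Finset.prod_congr rfl fun j _ => by rw [norm_pow, norm_div, div_pow]

theorem absDen_pos {z : ℂ} (hz : ∀ j, z - star (b j) ≠ 0) : 0 < absDen κ b z :=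
  Finset.prod_pos fun j _ => pow_pos (norm_pos_iff.2 (hz j)) _

theorem absNum_eq_absDen {z : ℂ} (hb : ∀ j, ‖b j‖ < 1) (hz : ‖z‖ = 1) :
    absNum κ b z = absDen κ b z := by
  have h1 := absDen_pos (κ := κ) fun j => (nonpole_of_norm_eq hb hz j).2
  obtain ⟨t, rfl⟩ := exists_circleCover_eq hz
  have h2 : ‖bl κ 0 b (circleCover t)‖ = 1 := by rw [bl_circleCover 0 hb, norm_circleCover]
  rw [norm_bl, div_eq_one_iff_eq h1.ne'] at h2
  exact h2

theorem norm_bl_circle {z : ℂ} (hb : ∀ j, ‖b j‖ < 1) (hz : ‖z‖ = 1) : ‖bl κ 0 b z‖ = 1 := by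
  obtain ⟨t, rfl⟩ := exists_circleCover_eq hz
  rw [bl_circleCover 0 hb, norm_circleCover]

theorem nonpole_of_one_le {z : ℂ} (hb : ∀ j, ‖b j‖ < 1) (hz : 1 ≤ ‖z‖) (j : Fin m) :
    z - star (b j) ≠ 0 := by
  intro h
  rw [sub_eq_zero] at h
  rw [h, norm_star] at hz
  exact absurd (hb j) (not_lt.2 hz)

theorem bl_eq_zero {z : ℂ} (h : bl κ 0 b z = 0) :
    z = 0 ∨ ∃ j, 1 - b j * z = 0 ∨ z - star (b j) = 0 := by
  rw [bl, mul_eq_zero, mul_eq_zero, Finset.prod_eq_zero_iff] at h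
  rcases h with (h | h) | ⟨j, -, h⟩
  · exact absurd h (circleCover_ne_zero 0)
  · left
    by_contra hne
    exact pow_ne_zero _ hne h
  · right
    refine ⟨j, ?_⟩
    by_contra hne
    rw [← div_eq_zero_iff] at hne
    exact pow_ne_zero _ hne h

/-- The exterior points mapped into the unit disc. -/
def outSet (κ : Fin (m + 1) → ℕ) (b : Fin m → ℂ) : Set ℂ := {z | 1 < ‖z‖ ∧ ‖bl κ 0 b z‖ < 1}

/-- The interior points mapped into the unit disc. -/
def inSet (κ : Fin (m + 1) → ℕ) (b : Fin m → ℂ) : Set ℂ :=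
  {z | ‖z‖ < 1 ∧ (∀ j, z - star (b j) ≠ 0) ∧ ‖bl κ 0 b z‖ < 1}

theorem isOpen_outSet (hb : ∀ j, ‖b j‖ < 1) : IsOpen (outSet κ b) := by
  rw [isOpen_iff_mem_nhds]
  rintro z ⟨h1, h2⟩
  have h3 := (differentiableAt_bl (κ := κ) fun j => nonpole_of_one_le hb h1.le j).continuousAt
  filter_upwards [continuous_norm.continuousAt.eventually_const_lt h1,
    h3.norm.eventually_lt_const h2] with w hw1 hw2
  exact ⟨hw1, hw2⟩

theorem isOpen_inSet : IsOpen (inSet κ b) := by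
  rw [isOpen_iff_mem_nhds]
  rintro z ⟨h1, h2, h3⟩
  have h4 := (differentiableAt_bl (κ := κ) h2).continuousAt
  filter_upwards [continuous_norm.continuousAt.eventually_lt_const h1, eventually_nonpole h2,
    h4.norm.eventually_lt_const h3] with w hw1 hw2 hw3
  exact ⟨hw1, hw2, hw3⟩

/-- Far out each factor is at least |b_j|/4 in modulus, while z^{k₀} grows, as k₀ > 0. -/
theorem exists_bound_outSet (hκ : ∀ i, 0 < κ i) (hb : ∀ j, ‖b j‖ < 1) (hb0 : ∀ j, b j ≠ 0) :
    ∃ R : ℝ, ∀ z, 1 ≤ ‖z‖ → ‖bl κ 0 b z‖ ≤ 1 → ‖z‖ ≤ R := by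
  set C : ℝ := ∏ j : Fin m, (‖b j‖ / 4) ^ κ j.succ with hC
  have hCpos : 0 < C := Finset.prod_pos fun j _ => pow_pos (div_pos (norm_pos_iff.2 (hb0 j))
    (by norm_num)) _
  refine ⟨max (1 / C) (∑ j : Fin m, 2 / ‖b j‖), fun z hz hle => ?_⟩
  by_contra hcon
  rw [not_le, max_lt_iff] at hcon
  have h1 : ∀ j, ‖b j‖ / 4 ≤ ‖(1 - b j * z) / (z - star (b j))‖ := by
    intro j
    have hbj := norm_pos_iff.2 (hb0 j)
    have h2 : 2 / ‖b j‖ ≤ ‖z‖ := by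
      refine le_trans ?_ hcon.2.le
      exact Finset.single_le_sum (f := fun j => 2 / ‖b j‖) (fun i _ => by positivity)
        (Finset.mem_univ j)
    rw [div_le_iff₀ hbj] at h2
    have h3 : ‖b j‖ * ‖z‖ / 2 ≤ ‖1 - b j * z‖ := by
      have := norm_sub_norm_le (b j * z) 1
      rw [norm_mul, norm_one, norm_sub_rev] at this
      nlinarith
    have h4 : ‖z - star (b j)‖ ≤ 2 * ‖z‖ := by
      have := norm_sub_le z (star (b j))
      rw [norm_star] at this
      linarith [hb j]
    have h5 := norm_pos_iff.2 (nonpole_of_one_le hb hz j)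
    rw [norm_div, le_div_iff₀ h5]
    calc ‖b j‖ / 4 * ‖z - star (b j)‖ ≤ ‖b j‖ / 4 * (2 * ‖z‖) := by gcongr
      _ = ‖b j‖ * ‖z‖ / 2 := by ring
      _ ≤ _ := h3
  have h2 : ‖z‖ * C ≤ ‖bl κ 0 b z‖ := by
    rw [bl, norm_mul, norm_mul, norm_circleCover, one_mul, norm_pow, norm_prod]
    refine mul_le_mul ?_ ?_ hCpos.le (by positivity)
    · exact le_self_pow₀ hz (hκ 0).ne'
    · refine Finset.prod_le_prod (fun j _ => by positivity) fun j _ => ?_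
      rw [norm_pow]
      exact pow_le_pow_left₀ (by positivity) (h1 j) _
  have h3 := hcon.1
  rw [div_lt_iff₀ hCpos] at h3
  linarith

/-- Multiplying out the denominator gives a closed condition; points of the circle are excluded
automatically, since |B| = 1 > r there. -/
theorem isCompact_outSet (hκ : ∀ i, 0 < κ i) (hb : ∀ j, ‖b j‖ < 1) (hb0 : ∀ j, b j ≠ 0) {r : ℝ}
    (hr : r < 1) : IsCompact (outSet κ b ∩ {z | ‖bl κ 0 b z‖ ≤ r}) := by
  have h1 : outSet κ b ∩ {z | ‖bl κ 0 b z‖ ≤ r} =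
      {z | 1 ≤ ‖z‖} ∩ {z | absNum κ b z ≤ r * absDen κ b z} := by
    ext z
    constructor
    · rintro ⟨⟨h1, h2⟩, h3⟩
      refine ⟨h1.le, ?_⟩
      have h4 := absDen_pos (κ := κ) fun j => nonpole_of_one_le hb h1.le j
      change ‖bl κ 0 b z‖ ≤ r at h3
      rwa [norm_bl, div_le_iff₀ h4] at h3
    · rintro ⟨h1, h2⟩
      have h4 := absDen_pos (κ := κ) fun j => nonpole_of_one_le hb h1 j
      have h5 : ‖bl κ 0 b z‖ ≤ r := by rwa [norm_bl, div_le_iff₀ h4]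
      refine ⟨⟨lt_of_le_of_ne h1 fun h => ?_, h5.trans_lt hr⟩, h5⟩
      rw [norm_bl_circle hb h.symm] at h5
      linarith
  obtain ⟨R, hR⟩ := exists_bound_outSet hκ hb hb0
  refine (isCompact_closedBall (0 : ℂ) R).of_isClosed_subset ?_ ?_
  · rw [h1]
    exact (isClosed_le continuous_const continuous_norm).inter
      (isClosed_le continuous_absNum (continuous_const.mul continuous_absDen))
  · rintro z ⟨⟨h1, h2⟩, -⟩
    rw [mem_closedBall_zero_iff]
    exact hR z h1.le h2.le

theorem isCompact_inSet (hb : ∀ j, ‖b j‖ < 1) (hb0 : ∀ j, b j ≠ 0) (hκ : ∀ i, 0 < κ i) {r : ℝ}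
    (hr : r < 1) : IsCompact (inSet κ b ∩ {z | ‖bl κ 0 b z‖ ≤ r}) := by
  have h1 : inSet κ b ∩ {z | ‖bl κ 0 b z‖ ≤ r} =
      {z | ‖z‖ ≤ 1} ∩ {z | absNum κ b z ≤ r * absDen κ b z} := by
    ext z
    constructor
    · rintro ⟨⟨h1, h2, -⟩, h3⟩
      refine ⟨h1.le, ?_⟩
      have h4 := absDen_pos (κ := κ) h2
      change ‖bl κ 0 b z‖ ≤ r at h3
      rwa [norm_bl, div_le_iff₀ h4] at h3
    · rintro ⟨h1, h2⟩
      -- Division by zero gives `bl` the value 0 at a pole, so poles have to be excluded by the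
      -- cross-multiplied inequality: there the right side vanishes and the left side does not.
      have h3 : ∀ j, z - star (b j) ≠ 0 := by
        intro j hj
        have h4 : absDen κ b z = 0 :=
          Finset.prod_eq_zero (Finset.mem_univ j) (by rw [hj, norm_zero, zero_pow (hκ _).ne'])
        change absNum κ b z ≤ r * absDen κ b z at h2
        rw [h4, mul_zero] at h2
        have hz : z = star (b j) := sub_eq_zero.1 hj
        have hz0 : z ≠ 0 := by rw [hz]; exact star_ne_zero.2 (hb0 j)
        have hz1 : ‖z‖ < 1 := by rw [hz, norm_star]; exact hb j
        have h5 : 0 < absNum κ b z := by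
          refine mul_pos (pow_pos (norm_pos_iff.2 hz0) _) (Finset.prod_pos fun i _ => ?_)
          refine pow_pos (norm_pos_iff.2 (one_sub_ne_zero ?_)) _
          rw [norm_mul]
          calc ‖b i‖ * ‖z‖ ≤ 1 * ‖z‖ := by gcongr; exact (hb i).le
            _ < 1 := by rwa [one_mul]
        linarith
      have h4 := absDen_pos (κ := κ) h3
      have h5 : ‖bl κ 0 b z‖ ≤ r := by rwa [norm_bl, div_le_iff₀ h4]
      refine ⟨⟨lt_of_le_of_ne h1 fun h => ?_, h3, h5.trans_lt hr⟩, h5⟩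
      rw [norm_bl_circle hb h] at h5
      linarith
  refine (isCompact_closedBall (0 : ℂ) 1).of_isClosed_subset ?_ ?_
  · rw [h1]
    exact (isClosed_le continuous_norm continuous_const).inter
      (isClosed_le continuous_absNum (continuous_const.mul continuous_absDen))
  · rintro z ⟨⟨h1, -⟩, -⟩
    rw [mem_closedBall_zero_iff]
    exact h1.le

/-- The zeros outside the unit disc. -/
def outZeros (b : Fin m → ℂ) : Finset ℂ := by
  classical exact Finset.univ.image fun j => (b j)⁻¹

theorem mem_outZeros {z : ℂ} : z ∈ outZeros b ↔ ∃ j, (b j)⁻¹ = z := by simp [outZeros]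

/-- The multiplicities of the zeros outside the unit disc. -/
def outMult (κ : Fin (m + 1) → ℕ) (b : Fin m → ℂ) (z : ℂ) : ℕ := by
  classical exact ∑ j with (b j)⁻¹ = z, κ j.succ

theorem outMult_inv (hinj : Function.Injective b) (j : Fin m) :
    outMult κ b (b j)⁻¹ = κ j.succ := by
  classical
  rw [outMult, Finset.sum_eq_single_of_mem j (by simp)]
  intro i hi hij
  have := (Finset.mem_filter.1 hi).2
  exact absurd (hinj (inv_injective this)) hij

variable [NeZero m] {c : Fin (2 * m) → ℝ}

/-- All zeros of the logarithmic derivative are among the marked points of the circle. -/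
theorem IsLab.deriv_bl_ne_zero (hκ : ∀ i, 0 < κ i) (h : IsLab κ b c) {z : ℂ} (hz1 : ‖z‖ ≠ 1)
    (hp : ∀ j, z - star (b j) ≠ 0) (h0 : bl κ 0 b z ≠ 0) : deriv (bl κ 0 b) z ≠ 0 := by
  have hz0 : z ≠ 0 := by
    rintro rfl
    apply h0
    rw [bl, zero_pow (hκ 0).ne', mul_zero, zero_mul]
  have h1 : ∀ j, 1 - b j * z ≠ 0 := by
    intro j hj
    apply h0
    rw [bl, Finset.prod_eq_zero (Finset.mem_univ j), mul_zero]
    rw [hj, zero_div, zero_pow (hκ _).ne']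
  rw [deriv_bl hz0 fun j => ⟨h1 j, hp j⟩]
  refine div_ne_zero (mul_ne_zero h0 fun h2 => hz1 ?_) hz0
  obtain ⟨i, rfl⟩ := mem_critSet.1 ((h.pf_simple hκ).1 z (fun j => ⟨h1 j, hp j⟩) h2)
  exact norm_circleCover _

theorem IsLab.one_lt_norm_inv (hκ : ∀ i, 0 < κ i) (h : IsLab κ b c) (j : Fin m) :
    1 < ‖(b j)⁻¹‖ := by
  rw [norm_inv]
  exact (one_lt_inv₀ (norm_pos_iff.2 ((h.injective hκ).2 j))).2 (h.norm_lt j)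

theorem IsLab.discMap_outSet (hκ : ∀ i, 0 < κ i) (h : IsLab κ b c) :
    DiscMap (bl κ 0 b) (outSet κ b) (outZeros b) (outMult κ b) := by
  have hinj := h.injective hκ
  have hzero : ∀ j, bl κ 0 b (b j)⁻¹ = 0 := by
    intro j
    rw [bl, Finset.prod_eq_zero (Finset.mem_univ j), mul_zero]
    rw [mul_inv_cancel₀ (hinj.2 j), sub_self, zero_div, zero_pow (hκ _).ne']
  refine ⟨isOpen_outSet h.norm_lt, fun z hz => analyticAt_bl fun j =>
    nonpole_of_one_le h.norm_lt hz.1.le j, fun z hz => hz.2, fun r hr =>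
    isCompact_outSet hκ h.norm_lt hinj.2 hr, ?_, ?_, fun z hz h0 => h.deriv_bl_ne_zero hκ hz.1.ne'
      (fun j => nonpole_of_one_le h.norm_lt hz.1.le j) h0, ?_⟩
  · intro z hz
    obtain ⟨j, rfl⟩ := mem_outZeros.1 hz
    exact ⟨h.one_lt_norm_inv hκ j, by rw [hzero j]; simp⟩
  · intro z hz
    constructor
    · intro h0
      rcases bl_eq_zero h0 with h1 | ⟨j, h1 | h1⟩
      · have := hz.1
        rw [h1, norm_zero] at this
        linarith
      · refine mem_outZeros.2 ⟨j, ?_⟩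
        exact inv_eq_of_mul_eq_one_right (sub_eq_zero.1 h1).symm
      · exact absurd h1 (nonpole_of_one_le h.norm_lt hz.1.le j)
    · intro hz
      obtain ⟨j, rfl⟩ := mem_outZeros.1 hz
      exact hzero j
  · intro z hz
    obtain ⟨j, rfl⟩ := mem_outZeros.1 hz
    rw [outMult_inv hinj.1]
    have hj0 := hinj.2 j
    have hnp : ∀ i, (b j)⁻¹ - star (b i) ≠ 0 :=
      fun i => nonpole_of_one_le h.norm_lt (h.one_lt_norm_inv hκ j).le i
    refine ⟨hκ _, fun z => circleCover 0 * z ^ κ 0 * ((-b j / (z - star (b j))) ^ κ j.succ *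
      ∏ i ∈ Finset.univ.erase j, ((1 - b i * z) / (z - star (b i))) ^ κ i.succ), ?_, ?_, ?_⟩
    · refine (analyticAt_const.mul (analyticAt_id.pow _)).mul (AnalyticAt.mul ?_ ?_)
      · exact (analyticAt_const.div (analyticAt_id.sub analyticAt_const) (hnp j)).pow _
      · refine Finset.analyticAt_fun_prod _ fun i _ => ?_
        exact ((analyticAt_const.sub (analyticAt_const.mul analyticAt_id)).div
          (analyticAt_id.sub analyticAt_const) (hnp i)).pow _
    · refine mul_ne_zero (mul_ne_zero (circleCover_ne_zero 0) (pow_ne_zero _ (inv_ne_zero hj0)))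
        (mul_ne_zero (pow_ne_zero _ (div_ne_zero (neg_ne_zero.2 hj0) (hnp j)))
          (Finset.prod_ne_zero_iff.2 fun i hi => pow_ne_zero _ (div_ne_zero ?_ (hnp i))))
      intro h1
      have : b i = b j := by
        field_simp at h1
        exact (sub_eq_zero.1 (by simpa using h1)).symm
      exact Finset.ne_of_mem_erase hi (hinj.1 this)
    · refine Eventually.of_forall fun z => ?_
      rw [bl, ← Finset.mul_prod_erase _ _ (Finset.mem_univ j)]
      have h1 : (1 - b j * z) / (z - star (b j)) =
          (z - (b j)⁻¹) * (-b j / (z - star (b j))) := by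
        rw [← mul_div_assoc]
        congr 1
        field_simp
        ring
      rw [h1, mul_pow]
      ring

/-- The origin is the only zero in the disc, so the uniformization shows that the interior region is
connected, with connected collars near |B| = 1; this is the decisive input for `exists_touch`. -/
theorem IsLab.discMap_inSet (hκ : ∀ i, 0 < κ i) (h : IsLab κ b c) :
    DiscMap (bl κ 0 b) (inSet κ b) {0} (fun _ => κ 0) := by
  have hinj := h.injective hκ
  have hzero : bl κ 0 b 0 = 0 := by rw [bl, zero_pow (hκ 0).ne', mul_zero, zero_mul]
  have hnp : ∀ j, (0 : ℂ) - star (b j) ≠ 0 := fun j => by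
    rw [zero_sub]; exact neg_ne_zero.2 (star_ne_zero.2 (hinj.2 j))
  refine ⟨isOpen_inSet, fun z hz => analyticAt_bl hz.2.1, fun z hz => hz.2.2, fun r hr =>
    isCompact_inSet h.norm_lt hinj.2 hκ hr, ?_, ?_, fun z hz h0 => h.deriv_bl_ne_zero hκ hz.1.ne
      hz.2.1 h0, ?_⟩
  · intro z hz
    rw [Finset.mem_singleton] at hz
    subst hz
    exact ⟨by simp, hnp, by rw [hzero]; simp⟩
  · intro z hz
    rw [Finset.mem_singleton]
    constructor
    · intro h0
      rcases bl_eq_zero h0 with h1 | ⟨j, h1 | h1⟩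
      · exact h1
      · refine absurd h1 (one_sub_ne_zero ?_)
        rw [norm_mul]
        calc ‖b j‖ * ‖z‖ ≤ 1 * ‖z‖ := by gcongr; exact (h.norm_lt j).le
          _ < 1 := by rw [one_mul]; exact hz.1
      · exact absurd h1 (hz.2.1 j)
    · rintro rfl; exact hzero
  · intro z hz
    rw [Finset.mem_singleton] at hz
    subst hz
    refine ⟨hκ 0, fun z => circleCover 0 *
      ∏ i, ((1 - b i * z) / (z - star (b i))) ^ κ i.succ, ?_, ?_, ?_⟩
    · refine analyticAt_const.mul (Finset.analyticAt_fun_prod _ fun i _ => ?_)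
      exact ((analyticAt_const.sub (analyticAt_const.mul analyticAt_id)).div
          (analyticAt_id.sub analyticAt_const) (hnp i)).pow _
    · exact mul_ne_zero (circleCover_ne_zero 0) (Finset.prod_ne_zero_iff.2 fun i _ =>
        pow_ne_zero _ (div_ne_zero (by simp) (hnp i)))
    · refine Eventually.of_forall fun z => ?_
      rw [bl, sub_zero]
      ring

end

/-! ### Local behaviour at the circle: which components touch where. -/

section

theorem lt_of_hasDerivAt_pos {q q' : ℝ → ℝ} {L : ℝ} (hL : 0 < L)
    (h : ∀ s ∈ Icc 0 L, HasDerivAt q (q' s) s ∧ 0 < q' s) : q 0 < q L := by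
  refine strictMonoOn_of_deriv_pos (convex_Icc 0 L)
    (fun s hs => (h s hs).1.continuousAt.continuousWithinAt) (fun s hs => ?_)
    (left_mem_Icc.2 hL.le) (right_mem_Icc.2 hL.le) hL
  rw [interior_Icc] at hs
  rw [(h s (Ioo_subset_Icc_self hs)).1.deriv]
  exact (h s (Ioo_subset_Icc_self hs)).2

/-- Going up vertically from a point where `g` is real, Im `g` grows at the rate Re `g'`. -/
theorem mul_im_pos_of_vertical {g g' : ℂ → ℂ} {x y e : ℝ} (hy : y ≠ 0) (h0 : (g x).im = 0)
    (h : ∀ s ∈ Icc (0 : ℝ) 1, HasDerivAt g (g' (x + (s * y : ℝ) * Complex.I))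
      (x + (s * y : ℝ) * Complex.I) ∧ 0 < e * (g' (x + (s * y : ℝ) * Complex.I)).re) :
    0 < e * y * (g (x + y * Complex.I)).im := by
  have h1 := lt_of_hasDerivAt_pos (q := fun s : ℝ =>
      e * y * (g (x + (s * y : ℝ) * Complex.I)).im)
    (q' := fun s => y ^ 2 * (e * (g' (x + (s * y : ℝ) * Complex.I)).re)) one_pos fun s hs => by
      refine ⟨?_, mul_pos (by positivity) (h s hs).2⟩
      have h2 : HasDerivAt (fun s : ℝ => (x : ℂ) + (s * y : ℝ) * Complex.I) (y * Complex.I) s := by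
        have h3 : HasDerivAt (fun s : ℝ => ((s * y : ℝ) : ℂ)) ((1 * y : ℝ) : ℂ) s :=
          ((hasDerivAt_id s).mul_const y).ofReal_comp
        refine ((h3.mul_const Complex.I).const_add (x : ℂ)).congr_deriv ?_
        simp
      have h3 := ((h s hs).1.comp s h2).complex_im.const_mul (e * y)
      refine h3.congr_deriv ?_
      simp
      ring
  simpa [h0] using h1

theorem segment_mem_ball {t r s : ℝ} {τ : ℂ} (hτ : τ ∈ Metric.ball (t : ℂ) r)
    (hs : s ∈ Icc (0 : ℝ) 1) : (τ.re : ℂ) + (s * τ.im : ℝ) * Complex.I ∈ Metric.ball (t : ℂ) r := by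
  have h1 : (τ.re : ℂ) ∈ Metric.ball (t : ℂ) r := by
    rw [mem_ball_iff_norm] at *
    refine lt_of_le_of_lt ?_ hτ
    rw [← Complex.ofReal_sub, Complex.norm_real, Real.norm_eq_abs]
    simpa using Complex.abs_re_le_norm (τ - t)
  have h2 := (convex_ball (t : ℂ) r) h1 hτ (sub_nonneg.2 hs.2) hs.1 (by ring)
  convert h2 using 1
  apply Complex.ext <;> simp
  ring

theorem map_ce_nhds (τ : ℂ) : map ce (𝓝 τ) = 𝓝 (ce τ) := by
  have h : ContDiffAt ℂ 1 ce τ := by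
    unfold ce; fun_prop
  have h2 : HasStrictDerivAt ce (2 * Real.pi * Complex.I * ce τ) τ := by
    have := h.hasStrictDerivAt (by simp)
    rwa [(hasDerivAt_ce τ).deriv] at this
  exact h2.map_nhds_eq (mul_ne_zero Complex.two_pi_I_ne_zero (ce_ne_zero τ))

theorem eventually_exists_ce {t r : ℝ} (hr : 0 < r) :
    ∀ᶠ z in 𝓝 (circleCover t), ∃ τ ∈ Metric.ball (t : ℂ) r, ce τ = z := by
  rw [← ce_ofReal, ← map_ce_nhds]
  exact image_mem_map (Metric.ball_mem_nhds _ hr)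

variable {m : ℕ} {κ : Fin (m + 1) → ℕ} {b : Fin m → ℂ}

theorem norm_bl_ce_lt_one {τ : ℂ} (hτ : τ ∈ strip b) :
    ‖bl κ 0 b (ce τ)‖ < 1 ↔ 0 < (lc κ 0 b τ).im := by
  rw [bl_ce 0 hτ, norm_ce_lt_one]

theorem ce_mem_outSet {τ : ℂ} (hτ : τ ∈ strip b) :
    ce τ ∈ outSet κ b ↔ τ.im < 0 ∧ 0 < (lc κ 0 b τ).im := by
  rw [outSet, mem_ofPred_eq, one_lt_norm_ce, norm_bl_ce_lt_one hτ]

/-- The part of the strip on which the real part of the derivative of the lift has a given sign. -/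
def signStrip (κ : Fin (m + 1) → ℕ) (b : Fin m → ℂ) (e : ℝ) : Set ℂ :=
  {τ ∈ strip b | 0 < e * (rc κ b (ce τ)).re}

theorem nonpole_of_mem_strip {τ : ℂ} (hτ : τ ∈ strip b) (j : Fin m) :
    1 - b j * ce τ ≠ 0 ∧ ce τ - star (b j) ≠ 0 :=
  ⟨one_sub_ne_zero (hτ j).1, sub_star_ne_zero hτ j⟩

theorem isOpen_signStrip (e : ℝ) : IsOpen (signStrip κ b e) := by
  have h1 : ContinuousOn (fun τ => e * (rc κ b (ce τ)).re) (strip b) := by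
    refine continuousOn_const.mul (Complex.continuous_re.comp_continuousOn fun τ hτ => ?_)
    exact (hasDerivAt_rc_ce (nonpole_of_mem_strip hτ)).continuousAt.continuousWithinAt
  exact h1.isOpen_inter_preimage (isOpen_strip b) isOpen_Ioi

theorem ofReal_mem_signStrip {e t : ℝ} (hb : ∀ j, ‖b j‖ < 1) (h : 0 < e * rr κ b t) :
    (t : ℂ) ∈ signStrip κ b e := by
  refine ⟨ofReal_mem_strip hb t, ?_⟩
  rwa [ce_ofReal, rc_circleCover t hb, Complex.ofReal_re]

theorem im_lc_ofReal (hb : ∀ j, ‖b j‖ < 1) (t : ℝ) : (lc κ 0 b t).im = 0 := by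
  rw [lc_ofReal 0 t hb, Complex.ofReal_im]

theorem mul_im_lc_pos {e : ℝ} {τ : ℂ} (hb : ∀ j, ‖b j‖ < 1) (hτ : τ.im ≠ 0)
    (h : ∀ s ∈ Icc (0 : ℝ) 1, (τ.re : ℂ) + (s * τ.im : ℝ) * Complex.I ∈ signStrip κ b e) :
    0 < e * τ.im * (lc κ 0 b τ).im := by
  have := mul_im_pos_of_vertical (g := lc κ 0 b) (g' := fun τ => rc κ b (ce τ)) (e := e) (x := τ.re) hτ (im_lc_ofReal hb τ.re)
    fun s hs => ⟨hasDerivAt_lc 0 (h s hs).1, (h s hs).2⟩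
  rwa [Complex.re_add_im] at this

/-- Near a real point with positive derivative the lift preserves the upper and lower half-planes;
with negative derivative it exchanges them. As the exterior of the disc is Im τ < 0 and |B| < 1
means Im of the lift > 0, the exterior region lies along the descending arcs only. -/
theorem exists_ball_signStrip {e t : ℝ} (hb : ∀ j, ‖b j‖ < 1) (h : 0 < e * rr κ b t) :
    ∃ r > 0, (∀ τ ∈ Metric.ball (t : ℂ) r, τ ∈ strip b ∧
      (τ.im ≠ 0 → 0 < e * τ.im * (lc κ 0 b τ).im)) := by
  obtain ⟨r, hr, hsub⟩ := Metric.isOpen_iff.1 (isOpen_signStrip (κ := κ) (b := b) e) t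
    (ofReal_mem_signStrip hb h)
  exact ⟨r, hr, fun τ hτ => ⟨(hsub hτ).1, fun h0 => mul_im_lc_pos hb h0 fun s hs =>
    hsub (segment_mem_ball hτ hs)⟩⟩

/-- The component of the exterior basin containing a given zero. -/
def outComp (κ : Fin (m + 1) → ℕ) (b : Fin m → ℂ) (i : Fin m) : Set ℂ :=
  connectedComponentIn (outSet κ b) (b i)⁻¹

/-- The parameters of the circle points on the boundary of the component of a given zero. -/
def touch (κ : Fin (m + 1) → ℕ) (b : Fin m → ℂ) (i : Fin m) : Set ℝ :=
  {t | circleCover t ∈ closure (outComp κ b i)}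

theorem isClosed_touch (i : Fin m) : IsClosed (touch κ b i) :=
  isClosed_closure.preimage continuous_circleCover

theorem outComp_subset (i : Fin m) : outComp κ b i ⊆ outSet κ b := connectedComponentIn_subset _ _

theorem subset_outComp {S : Set ℂ} (hS : IsPreconnected S) (hsub : S ⊆ outSet κ b) {i : Fin m}
    {z : ℂ} (hz : z ∈ S) (hzi : z ∈ outComp κ b i) : S ⊆ outComp κ b i := by
  rw [outComp, connectedComponentIn_eq hzi]
  exact hS.subset_connectedComponentIn hz hsub

theorem touch_add_int {i : Fin m} {t : ℝ} (n : ℤ) : t + n ∈ touch κ b i ↔ t ∈ touch κ b i := by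
  rw [touch, mem_ofPred_eq, mem_ofPred_eq, circleCover_add_int]

variable [NeZero m] {c : Fin (2 * m) → ℝ}

namespace IsLab

theorem isOpen_outComp (h : IsLab κ b c) (i : Fin m) : IsOpen (outComp κ b i) :=
  (isOpen_outSet h.norm_lt).connectedComponentIn

theorem outComp_disjoint (hκ : ∀ i, 0 < κ i) (h : IsLab κ b c) {i j : Fin m} (hij : i ≠ j) :
    Disjoint (outComp κ b i) (outComp κ b j) := by
  obtain ⟨E, -, h2, -⟩ := (h.discMap_outSet hκ).exists_uniformization
  exact h2 _ (mem_outZeros.2 ⟨i, rfl⟩) _ (mem_outZeros.2 ⟨j, rfl⟩)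
    fun h3 => hij ((h.injective hκ).1 (inv_injective h3))

theorem exists_mem_outComp (hκ : ∀ i, 0 < κ i) (h : IsLab κ b c) {z : ℂ} (hz : z ∈ outSet κ b) :
    ∃ i, z ∈ outComp κ b i := by
  obtain ⟨E, -, -, h3⟩ := (h.discMap_outSet hκ).exists_uniformization
  obtain ⟨a, ha, hza⟩ := h3 z hz
  obtain ⟨i, rfl⟩ := mem_outZeros.1 ha
  exact ⟨i, hza⟩

theorem eq_of_mem_outComp (hκ : ∀ i, 0 < κ i) (h : IsLab κ b c) {i j : Fin m} {z : ℂ}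
    (hi : z ∈ outComp κ b i) (hj : z ∈ outComp κ b j) : i = j := by
  by_contra hij
  exact disjoint_left.1 (h.outComp_disjoint hκ hij) hi hj

theorem zero_mem_outComp (hκ : ∀ i, 0 < κ i) (h : IsLab κ b c) (i : Fin m) :
    (b i)⁻¹ ∈ outComp κ b i :=
  mem_connectedComponentIn ((h.discMap_outSet hκ).mem _ (mem_outZeros.2 ⟨i, rfl⟩))

theorem exists_near_of_touch {i : Fin m} {t r : ℝ} (hr : 0 < r) (ht : t ∈ touch κ b i) :
    ∃ τ ∈ Metric.ball (t : ℂ) r, ce τ ∈ outComp κ b i := by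
  have := mem_closure_iff_frequently.1 ht
  obtain ⟨z, hz, τ, hτ, rfl⟩ := (this.and_eventually (eventually_exists_ce hr)).exists
  exact ⟨τ, hτ, hz⟩

theorem rr_nonpos_of_touch (h : IsLab κ b c) {i : Fin m} {t : ℝ} (ht : t ∈ touch κ b i) :
    rr κ b t ≤ 0 := by
  by_contra hpos
  rw [not_le] at hpos
  obtain ⟨r, hr, hball⟩ := exists_ball_signStrip (e := 1) h.norm_lt (by rwa [one_mul])
  obtain ⟨τ, hτ, hmem⟩ := exists_near_of_touch hr ht
  obtain ⟨h1, h2⟩ := hball τ hτ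
  obtain ⟨h3, h4⟩ := (ce_mem_outSet h1).1 (outComp_subset i hmem)
  have := h2 h3.ne
  nlinarith

/-- The half-disc below the real line is convex and mapped into the exterior region, so it lies in
one component, namely the one that comes arbitrarily close to `t`. -/
theorem below_subset_outComp {i : Fin m} {t r : ℝ}
    (hr : 0 < r) (hball : ∀ τ ∈ Metric.ball (t : ℂ) r, τ ∈ strip b ∧
      (τ.im ≠ 0 → 0 < -1 * τ.im * (lc κ 0 b τ).im)) (ht : t ∈ touch κ b i) :
    ∀ τ ∈ Metric.ball (t : ℂ) r, τ.im < 0 → ce τ ∈ outComp κ b i := by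
  obtain ⟨τ, hτ, hmem⟩ := exists_near_of_touch hr ht
  have hout : ∀ τ ∈ Metric.ball (t : ℂ) r, τ.im < 0 → ce τ ∈ outSet κ b := by
    intro τ hτ him
    obtain ⟨h1, h2⟩ := hball τ hτ
    have := h2 him.ne
    exact (ce_mem_outSet h1).2 ⟨him, by nlinarith⟩
  have him := ((ce_mem_outSet (hball τ hτ).1).1 (outComp_subset i hmem)).1
  have hconv : Convex ℝ (Metric.ball (t : ℂ) r ∩ {τ | τ.im < 0}) :=
    (convex_ball _ _).inter (convex_halfSpace_im_lt 0)
  have := subset_outComp (hconv.isPreconnected.image ce continuous_ce.continuousOn)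
    (by rintro _ ⟨τ, hτ, rfl⟩; exact hout τ hτ.1 hτ.2) (mem_image_of_mem ce ⟨hτ, him⟩) hmem
  exact fun τ' h1 h2 => this (mem_image_of_mem ce ⟨h1, h2⟩)

theorem mem_touch_of_below {i : Fin m} {t r s : ℝ}
    (h : ∀ τ ∈ Metric.ball (t : ℂ) r, τ.im < 0 → ce τ ∈ outComp κ b i)
    (hs : (s : ℂ) ∈ Metric.ball (t : ℂ) r) : s ∈ touch κ b i := by
  have h1 : Tendsto (fun y : ℝ => ce ((s : ℂ) - y * Complex.I)) (𝓝[>] 0) (𝓝 (circleCover s)) := by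
    have h2 : Continuous (fun y : ℝ => ce ((s : ℂ) - y * Complex.I)) := by
      have := continuous_ce; fun_prop
    have h3 := h2.tendsto 0
    rw [Complex.ofReal_zero, zero_mul, sub_zero, ce_ofReal] at h3
    exact h3.mono_left nhdsWithin_le_nhds
  refine mem_closure_of_tendsto h1 ?_
  have h2 : Continuous (fun y : ℝ => ((s : ℂ) - y * Complex.I)) := by fun_prop
  have h3 : ∀ᶠ y : ℝ in 𝓝 0, ((s : ℂ) - y * Complex.I) ∈ Metric.ball (t : ℂ) r := by
    refine h2.continuousAt.eventually (Metric.isOpen_ball.mem_nhds ?_)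
    simpa using hs
  filter_upwards [nhdsWithin_le_nhds h3, self_mem_nhdsWithin] with y hy hy0
  exact h _ hy (by simpa using hy0)

/-- The whole half-disc below a descending point lies in one component, so that component and no
other touches at all nearby points. -/
theorem exists_touch_of_rr_neg (hκ : ∀ i, 0 < κ i) (h : IsLab κ b c) {t : ℝ} (ht : rr κ b t < 0) :
    ∃ i, ∃ r > 0, ∀ s ∈ Metric.ball t r, ∀ j, s ∈ touch κ b j ↔ j = i := by
  obtain ⟨r, hr, hball⟩ := exists_ball_signStrip (e := -1) h.norm_lt (by linarith)
  have hcast : ∀ s ∈ Metric.ball t r, (s : ℂ) ∈ Metric.ball (t : ℂ) r := by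
    intro s hs
    rw [mem_ball_iff_norm] at *
    rwa [← Complex.ofReal_sub, Complex.norm_real]
  have key : ∀ i, t ∈ touch κ b i → ∀ s ∈ Metric.ball t r, ∀ j, s ∈ touch κ b j ↔ j = i := by
    intro i hi s hs j
    have h1 := below_subset_outComp hr hball hi
    refine ⟨fun hj => ?_, fun hj => hj ▸ mem_touch_of_below h1 (hcast s hs)⟩
    obtain ⟨ε, hε, hsub⟩ := Metric.isOpen_iff.1 Metric.isOpen_ball (s : ℂ) (hcast s hs)
    obtain ⟨τ, hτ, hmem⟩ := exists_near_of_touch hε hj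
    have hτ2 := hsub hτ
    have him := ((ce_mem_outSet (hball τ hτ2).1).1 (outComp_subset j hmem)).1
    exact h.eq_of_mem_outComp hκ hmem (h1 τ hτ2 him)
  set τ : ℂ := (t : ℂ) - (r / 2 : ℝ) * Complex.I with hτdef
  have hτ : τ ∈ Metric.ball (t : ℂ) r := by
    rw [mem_ball_iff_norm, hτdef, sub_sub_cancel_left, norm_neg, norm_mul, Complex.norm_I, mul_one,
      Complex.norm_real, Real.norm_of_nonneg (by positivity)]
    linarith
  have him : τ.im < 0 := by rw [hτdef]; simp; exact hr
  obtain ⟨h1, h2⟩ := hball τ hτ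
  have hout : ∀ τ ∈ Metric.ball (t : ℂ) r, τ.im < 0 → ce τ ∈ outSet κ b := by
    intro τ hτ him
    obtain ⟨h1, h2⟩ := hball τ hτ
    have := h2 him.ne
    exact (ce_mem_outSet h1).2 ⟨him, by nlinarith⟩
  obtain ⟨i, hi⟩ := h.exists_mem_outComp hκ (hout τ hτ him)
  have hconv : Convex ℝ (Metric.ball (t : ℂ) r ∩ {τ | τ.im < 0}) :=
    (convex_ball _ _).inter (convex_halfSpace_im_lt 0)
  have hsub := subset_outComp (hconv.isPreconnected.image ce continuous_ce.continuousOn)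
    (by rintro _ ⟨τ, hτ, rfl⟩; exact hout τ hτ.1 hτ.2) (mem_image_of_mem ce ⟨hτ, him⟩) hi
  exact ⟨i, r, hr, key i (mem_touch_of_below (fun τ' h1 h2 => hsub (mem_image_of_mem ce ⟨h1, h2⟩))
    (Metric.mem_ball_self hr))⟩

/-- The touching component is locally constant along a descending arc. -/
theorem exists_arc_zero (hκ : ∀ i, 0 < κ i) (h : IsLab κ b c) (j : Fin m) :
    ∃ i, ∀ t ∈ Ioo (c (fstIdx j)) (c (sndIdx j)), ∀ j', t ∈ touch κ b j' ↔ j' = i := by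
  set N : Fin m → Set ℝ := fun i =>
    {t | ∃ r > 0, ∀ s ∈ Metric.ball t r, ∀ j, s ∈ touch κ b j ↔ j = i} with hN
  have ho : ∀ i ∈ (Finset.univ : Finset (Fin m)), IsOpen (N i) := by
    intro i _
    rw [Metric.isOpen_iff]
    rintro t ⟨r, hr, ht⟩
    refine ⟨r, hr, fun s hs => ?_⟩
    obtain ⟨ε, hε, hsub⟩ := Metric.isOpen_iff.1 Metric.isOpen_ball s hs
    exact ⟨ε, hε, fun x hx => ht x (hsub hx)⟩
  have hval : ∀ i t, t ∈ N i → ∀ j', t ∈ touch κ b j' ↔ j' = i := fun i t ⟨r, hr, ht⟩ =>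
    ht t (Metric.mem_ball_self hr)
  have hd : ∀ a ∈ (Finset.univ : Finset (Fin m)), ∀ b ∈ (Finset.univ : Finset (Fin m)), a ≠ b →
      Disjoint (N a) (N b) := by
    intro a _ a' _ hne
    rw [disjoint_left]
    intro t h1 h2
    exact hne ((hval a' t h2 a).1 ((hval a t h1 a).2 rfl))
  obtain ⟨t, ht⟩ := nonempty_Ioo.2 (h.strictMono (fstIdx_lt_sndIdx j))
  obtain ⟨i, hi⟩ := h.exists_touch_of_rr_neg hκ (h.rr_neg hκ ht)
  have := subset_of_mem_of_disjoint_cover ho hd isPreconnected_Ioo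
    (fun x hx => by
      obtain ⟨i, hi⟩ := h.exists_touch_of_rr_neg hκ (h.rr_neg hκ hx)
      exact ⟨i, Finset.mem_univ i, hi⟩) (Finset.mem_univ i) ht hi
  exact ⟨i, fun x hx => hval i x (this hx)⟩

/-- A component reaching a turning point could conceivably meet the circle only there. To exclude
this, start at a point of the component just below `t` and move horizontally towards the descending
side, left of a minimum (`e = 1`) and right of a maximum (`e = -1`). The sign of the second
derivative makes Im of the lift increase along this path, so it stays in the component. -/
theorem exists_touch_near_crit (h : IsLab κ b c) {e t : ℝ} (he : e = 1 ∨ e = -1)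
    (h2 : 0 < e * rr2 κ b t) {i : Fin m} (ht : t ∈ touch κ b i) :
    ∃ ρ > 0, ∀ δ ∈ Ioo 0 ρ, t - e * δ ∈ touch κ b i := by
  have hb := h.norm_lt
  set g' : ℂ → ℂ := fun τ => deriv (rc κ b) (ce τ) * (2 * Real.pi * Complex.I * ce τ) with hg'
  have hanal : ∀ᶠ τ in 𝓝 (t : ℂ), τ ∈ strip b ∧ 0 < e * (g' τ).re := by
    have h3 : ∀ᶠ τ in 𝓝 (t : ℂ), τ ∈ strip b :=
      (isOpen_strip b).mem_nhds (ofReal_mem_strip hb t)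
    have h4 : AnalyticAt ℂ (fun τ => rc κ b (ce τ)) t := by
      rw [Complex.analyticAt_iff_eventually_differentiableAt]
      filter_upwards [h3] with τ hτ
      exact (hasDerivAt_rc_ce (nonpole_of_mem_strip hτ)).differentiableAt
    have h5 : ContinuousAt (fun τ => e * (deriv (fun τ => rc κ b (ce τ)) τ).re) (t : ℂ) :=
      continuousAt_const.mul (Complex.continuous_re.continuousAt.comp h4.deriv.continuousAt)
    have h6 : deriv (fun τ => rc κ b (ce τ)) (t : ℂ) = rr2 κ b t := by
      rw [(hasDerivAt_rc_ce (nonpole_of_mem_strip (ofReal_mem_strip hb t))).deriv, ofReal_rr2 hb,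
        ce_ofReal]
    have h7 := h5.eventually_const_lt (u := 0) (by beta_reduce; rw [h6, Complex.ofReal_re]; exact h2)
    filter_upwards [h3, h7] with τ h8 h9
    refine ⟨h8, ?_⟩
    rwa [(hasDerivAt_rc_ce (nonpole_of_mem_strip h8)).deriv] at h9
  obtain ⟨r, hr, hball⟩ := Metric.eventually_nhds_iff_ball.1 hanal
  have hsign : ∀ τ ∈ Metric.ball (t : ℂ) r, τ.im < 0 → e * (rc κ b (ce τ)).im < 0 := by
    intro τ hτ him
    have := mul_im_pos_of_vertical (g := fun τ => rc κ b (ce τ)) (g' := g') (e := e) (x := τ.re)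
      him.ne (by rw [ce_ofReal, rc_circleCover _ hb, Complex.ofReal_im])
      fun s hs => ⟨hasDerivAt_rc_ce (nonpole_of_mem_strip (hball _ (segment_mem_ball hτ hs)).1),
        (hball _ (segment_mem_ball hτ hs)).2⟩
    rw [Complex.re_add_im] at this
    nlinarith
  refine ⟨r / 2, by positivity, fun δ hδ => ?_⟩
  have he2 : e * e = 1 := by rcases he with rfl | rfl <;> norm_num
  have hea : |e| = 1 := by rcases he with rfl | rfl <;> norm_num
  refine Metric.mem_closure_iff.2 fun ε hε => ?_
  obtain ⟨η, hη, hηε⟩ := Metric.continuousAt_iff.1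
    (continuous_ce.continuousAt (x := ((t - e * δ : ℝ) : ℂ))) ε hε
  obtain ⟨τ, hτ, hmem⟩ := exists_near_of_touch (lt_min hδ.1 hη) ht
  rw [mem_ball_iff_norm, lt_min_iff] at hτ
  have hre : |τ.re - t| < δ := by
    refine lt_of_le_of_lt ?_ hτ.1
    simpa using Complex.abs_re_le_norm (τ - t)
  have himn : |τ.im| < η := by
    refine lt_of_le_of_lt ?_ hτ.2
    simpa using Complex.abs_im_le_norm (τ - t)
  -- The length for which the path ends exactly below `t - e * δ`.
  set L := δ + e * (τ.re - t) with hL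
  have hLpos : 0 < L := by
    have : |e * (τ.re - t)| < δ := by rwa [abs_mul, hea, one_mul]
    linarith [(abs_lt.1 this).1]
  have hpath : ∀ s ∈ Icc 0 L, τ - (e * s : ℝ) ∈ Metric.ball (t : ℂ) r := by
    intro s hs
    rw [mem_ball_iff_norm]
    have h1 : τ - (e * s : ℝ) - t = (τ - t) - (e * s : ℝ) := by ring
    have h2 : ‖((e * s : ℝ) : ℂ)‖ = s := by
      rw [Complex.norm_real, Real.norm_eq_abs, abs_mul, hea, one_mul, abs_of_nonneg hs.1]
    -- the horizontal path stays close
    have h3 : ‖τ - (e * s : ℝ) - t‖ ≤ |τ.re - e * s - t| + |τ.im| := by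
      have := Complex.norm_le_abs_re_add_abs_im (τ - (e * s : ℝ) - t)
      simpa using this
    have h4 : |τ.im| ≤ ‖τ - t‖ := by simpa using Complex.abs_im_le_norm (τ - t)
    have h5 : |τ.re - e * s - t| ≤ δ := by
      have h6 : |e * (τ.re - e * s - t)| ≤ δ := by
        have h7 : e * (τ.re - e * s - t) = e * (τ.re - t) - s := by linear_combination (-s) * he2
        have h8 : |e * (τ.re - t)| < δ := by rwa [abs_mul, hea, one_mul]
        rw [h7, abs_le]
        constructor <;> linarith [(abs_lt.1 h8).1, (abs_lt.1 h8).2, hs.1, hs.2]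
      rwa [abs_mul, hea, one_mul] at h6
    linarith [hδ.2]
  obtain ⟨him, hlc⟩ := (ce_mem_outSet (hball τ (by
    have := hpath 0 ⟨le_rfl, hLpos.le⟩; simpa using this)).1).1 (outComp_subset i hmem)
  have himp : ∀ s : ℝ, (τ - (e * s : ℝ)).im = τ.im := fun s => by simp
  have hmono : ∀ s ∈ Icc 0 L, 0 < (lc κ 0 b (τ - (e * s : ℝ))).im := by
    intro s hs
    rcases eq_or_lt_of_le hs.1 with rfl | hs0
    · simpa using hlc
    have := lt_of_hasDerivAt_pos (q := fun s => (lc κ 0 b (τ - (e * s : ℝ))).im)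
      (q' := fun s => -(e * (rc κ b (ce (τ - (e * s : ℝ)))).im)) hs0 fun x hx => by
        have hx' := hpath x ⟨hx.1, hx.2.trans hs.2⟩
        have hsg := hsign _ hx' (by rw [himp]; exact him)
        refine ⟨?_, by linarith⟩
        have h3 : HasDerivAt (fun s : ℝ => τ - ((e * s : ℝ) : ℂ)) (-((e * 1 : ℝ) : ℂ)) x :=
          (((hasDerivAt_id x).const_mul e).ofReal_comp).const_sub τ
        refine (((hasDerivAt_lc 0 (hball _ hx').1).comp x h3).complex_im).congr_deriv ?_
        simp
        ring
    simp only [mul_zero, Complex.ofReal_zero, sub_zero] at this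
    exact hlc.trans this
  have hsub := subset_outComp (S := (fun s : ℝ => ce (τ - (e * s : ℝ))) '' Icc 0 L) (i := i)
    (κ := κ) (b := b)
    (isPreconnected_Icc.image _ (by have := continuous_ce; fun_prop)) (by
      rintro _ ⟨s, hs, rfl⟩
      exact (ce_mem_outSet (hball _ (hpath s hs)).1).2 ⟨by rw [himp]; exact him, hmono s hs⟩)
    ⟨0, ⟨le_rfl, hLpos.le⟩, by simp⟩ hmem
  refine ⟨_, hsub ⟨L, ⟨hLpos.le, le_rfl⟩, rfl⟩, ?_⟩
  rw [dist_comm, ← ce_ofReal]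
  refine hηε ?_
  rw [dist_eq_norm]
  have : τ - ((e * L : ℝ) : ℂ) - ((t - e * δ : ℝ) : ℂ) = (τ.im : ℂ) * Complex.I := by
    apply Complex.ext
    · simp
      rw [hL]; linear_combination (-(τ.re - t)) * he2
    · simp
  rw [this, norm_mul, Complex.norm_I, mul_one, Complex.norm_real]
  exact himn

theorem touch_arc_of_touch_fst (hκ : ∀ i, 0 < κ i) (h : IsLab κ b c) {i j : Fin m}
    (ht : c (fstIdx j) ∈ touch κ b i) : ∃ t ∈ Ioo (c (fstIdx j)) (c (sndIdx j)), t ∈ touch κ b i := by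
  obtain ⟨ρ, hρ, hmem⟩ := h.exists_touch_near_crit (e := -1) (Or.inr rfl)
    (by linarith [h.rr2_fst_neg hκ j]) ht
  have hlt := h.strictMono (fstIdx_lt_sndIdx j)
  set δ := min ρ (c (sndIdx j) - c (fstIdx j)) / 2 with hδ
  have h1 : 0 < min ρ (c (sndIdx j) - c (fstIdx j)) := lt_min hρ (sub_pos.2 hlt)
  have h2 := min_le_left ρ (c (sndIdx j) - c (fstIdx j))
  have h3 := min_le_right ρ (c (sndIdx j) - c (fstIdx j))
  exact ⟨_, ⟨by linarith, by linarith⟩, hmem δ ⟨by linarith, by linarith⟩⟩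

theorem touch_arc_of_touch_snd (hκ : ∀ i, 0 < κ i) (h : IsLab κ b c) {i j : Fin m}
    (ht : c (sndIdx j) ∈ touch κ b i) : ∃ t ∈ Ioo (c (fstIdx j)) (c (sndIdx j)), t ∈ touch κ b i := by
  obtain ⟨ρ, hρ, hmem⟩ := h.exists_touch_near_crit (e := 1) (Or.inl rfl)
    (by linarith [h.rr2_snd_pos hκ j]) ht
  have hlt := h.strictMono (fstIdx_lt_sndIdx j)
  set δ := min ρ (c (sndIdx j) - c (fstIdx j)) / 2 with hδ
  have h1 : 0 < min ρ (c (sndIdx j) - c (fstIdx j)) := lt_min hρ (sub_pos.2 hlt)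
  have h2 := min_le_left ρ (c (sndIdx j) - c (fstIdx j))
  have h3 := min_le_right ρ (c (sndIdx j) - c (fstIdx j))
  exact ⟨_, ⟨by linarith, by linarith⟩, hmem δ ⟨by linarith, by linarith⟩⟩

end IsLab
end

/-! ### Every exterior component reaches the circle; the permutation. -/

section

/-- Take `W` to be the image of a small ball under a local inverse: preimages of convex sets in `W`
are then images of convex sets, and closures correspond. -/
theorem exists_nhds_preimage {f : ℂ → ℂ} {p : ℂ} (hf : AnalyticAt ℂ f p) (hd : deriv f p ≠ 0)
    {O : Set ℂ} (hO : O ∈ 𝓝 p) : ∃ W ∈ 𝓝 p, W ⊆ O ∧ ∀ S : Set ℂ, Convex ℝ S →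
      IsPreconnected (W ∩ f ⁻¹' S) ∧ ∀ q ∈ W, f q ∈ closure S → q ∈ closure (W ∩ f ⁻¹' S) := by
  have hs : HasStrictDerivAt f (deriv f p) p := hf.hasStrictDerivAt
  have hs' : HasStrictFDerivAt f
      (ContinuousLinearEquiv.unitsEquivAut ℂ (Units.mk0 (deriv f p) hd) : ℂ →L[ℂ] ℂ) p :=
    hs.hasStrictFDerivAt_equiv hd
  set e := hs'.toOpenPartialHomeomorph f with he
  have hfe : ∀ z, e z = f z := fun z => by rw [he, hs'.toOpenPartialHomeomorph_coe]
  have hp : p ∈ e.source := hs'.mem_toOpenPartialHomeomorph_source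
  have h1 : e.symm ⁻¹' O ∈ 𝓝 (f p) := by
    have h2 : ContinuousAt e.symm (e p) := e.continuousAt_symm (e.map_source hp)
    rw [← hfe]
    refine h2 ?_
    rwa [e.left_inv hp]
  have h2 : e.target ∈ 𝓝 (f p) := by
    rw [← hfe]; exact e.open_target.mem_nhds (e.map_source hp)
  obtain ⟨s, hs0, hsub⟩ := Metric.mem_nhds_iff.1 (inter_mem h1 h2)
  have hB : Metric.ball (f p) s ⊆ e.target := fun z hz => (hsub hz).2
  have hW : ∀ S : Set ℂ, (e.symm '' Metric.ball (f p) s) ∩ f ⁻¹' S =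
      e.symm '' (Metric.ball (f p) s ∩ S) := by
    intro S
    ext z
    constructor
    · rintro ⟨⟨w, hw, rfl⟩, hz⟩
      refine ⟨w, ⟨hw, ?_⟩, rfl⟩
      rwa [mem_preimage, ← hfe, e.right_inv (hB hw)] at hz
    · rintro ⟨w, hw, rfl⟩
      refine ⟨⟨w, hw.1, rfl⟩, ?_⟩
      rw [mem_preimage, ← hfe, e.right_inv (hB hw.1)]
      exact hw.2
  have hc : ContinuousOn e.symm (Metric.ball (f p) s) := e.continuousOn_symm.mono hB
  refine ⟨e.symm '' Metric.ball (f p) s, ?_, ?_, fun S hS => ⟨?_, ?_⟩⟩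
  · refine (e.symm.isOpen_image_of_subset_source Metric.isOpen_ball hB).mem_nhds ?_
    exact ⟨f p, Metric.mem_ball_self hs0, by rw [← hfe, e.left_inv hp]⟩
  · rintro _ ⟨w, hw, rfl⟩; exact (hsub hw).1
  · rw [hW]
    exact ((convex_ball _ _).inter hS).isPreconnected.image _ (hc.mono inter_subset_left)
  · rintro _ ⟨w, hw, rfl⟩ hq
    rw [hW]
    rw [← hfe, e.right_inv (hB hw)] at hq
    exact ((hc.continuousAt (Metric.isOpen_ball.mem_nhds hw)).continuousWithinAt).mem_closure_image
      (Metric.isOpen_ball.inter_closure ⟨hw, hq⟩)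

/-- Reflection in the unit circle. -/
def reflect (z : ℂ) : ℂ := (star z)⁻¹

theorem reflect_reflect (z : ℂ) : reflect (reflect z) = z := by
  simp [reflect]

theorem norm_reflect (z : ℂ) : ‖reflect z‖ = ‖z‖⁻¹ := by
  rw [reflect, norm_inv, norm_star]

theorem continuousAt_reflect {z : ℂ} (hz : z ≠ 0) : ContinuousAt reflect z :=
  continuous_star.continuousAt.inv₀ (star_ne_zero.2 hz)

variable {m : ℕ} {κ : Fin (m + 1) → ℕ} {b : Fin m → ℂ}

theorem bl_reflect {z : ℂ} (hz : z ≠ 0) : bl κ 0 b (reflect z) = reflect (bl κ 0 b z) := by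
  have h0 : circleCover 0 = 1 := by simp [circleCover]
  have hz' : star z ≠ 0 := star_ne_zero.2 hz
  have h1 : ∀ j, (1 - b j * reflect z) / (reflect z - star (b j)) =
      (star ((1 - b j * z) / (z - star (b j))))⁻¹ := by
    intro j
    rw [Complex.star_def, map_div₀, inv_div, map_sub, map_sub, map_one, map_mul, ← Complex.star_def,
      star_star, reflect, eq_comm, ← mul_div_mul_right _ _ (inv_ne_zero hz')]
    rw [sub_mul, sub_mul, mul_assoc, mul_inv_cancel₀ hz', one_mul, mul_one]
  rw [bl, bl, h0, one_mul, one_mul, Finset.prod_congr rfl fun j _ => by rw [h1 j], reflect, reflect,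
    Complex.star_def, map_mul, map_pow, map_prod, mul_inv, inv_pow, ← Finset.prod_inv_distrib]
  congr 1
  refine Finset.prod_congr rfl fun j _ => ?_
  rw [map_pow, inv_pow]

theorem nonpole_of_bl_ne_zero (hκ : ∀ i, 0 < κ i) {z : ℂ} (h : bl κ 0 b z ≠ 0) (j : Fin m) :
    z - star (b j) ≠ 0 := by
  intro h1
  apply h
  rw [bl, Finset.prod_eq_zero (Finset.mem_univ j), mul_zero]
  rw [h1, div_zero, zero_pow (hκ _).ne']

variable [NeZero m] {c : Fin (2 * m) → ℝ}

namespace IsLab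

theorem exists_rr_pos (hκ : ∀ i, 0 < κ i) (h : IsLab κ b c) : ∃ t, 0 < rr κ b t := by
  have hm : m - 1 < m := Nat.sub_lt (NeZero.pos m) one_pos
  obtain ⟨t, h1, h2⟩ := exists_between (h.lt_add_one (sndIdx (⟨m - 1, hm⟩ : Fin m)))
  refine ⟨t, h.rr_pos hκ h1 (fun j' hj' => ?_) h2⟩
  have := j'.2
  simp only [Fin.lt_def] at hj'
  omega

/-- As `p` is not critical, {|B| < 1} is connected near `p` and has all nearby points with |B| = 1
in its closure; so all of it belongs to the component in question. -/
theorem mem_nhds_boundary (hκ : ∀ i, 0 < κ i) (h : IsLab κ b c) {i : Fin m} {p : ℂ}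
    (hp : p ∈ closure (outComp κ b i)) (hp1 : 1 < ‖p‖) (hbl : bl κ 0 b p ≠ 0) :
    ∃ W ∈ 𝓝 p, ∀ q ∈ W, ‖bl κ 0 b q‖ = 1 → q ∈ closure (outComp κ b i) \ outComp κ b i := by
  have hnp : ∀ j, p - star (b j) ≠ 0 := fun j => nonpole_of_one_le h.norm_lt hp1.le j
  obtain ⟨W, hW, hWO, hS⟩ := exists_nhds_preimage (analyticAt_bl (κ := κ) hnp)
    (h.deriv_bl_ne_zero hκ hp1.ne' hnp hbl)
    ((isOpen_lt continuous_const continuous_norm).mem_nhds hp1)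
  obtain ⟨h1, h2⟩ := hS _ (convex_ball (0 : ℂ) 1)
  have hout : W ∩ bl κ 0 b ⁻¹' Metric.ball 0 1 ⊆ outSet κ b := fun z hz =>
    ⟨hWO hz.1, mem_ball_zero_iff.1 hz.2⟩
  obtain ⟨z, hzW, hzi⟩ := mem_closure_iff_nhds.1 hp W hW
  have hsub := subset_outComp h1 hout ⟨hzW, mem_ball_zero_iff.2 (outComp_subset i hzi).2⟩ hzi
  refine ⟨W, hW, fun q hq hq1 => ⟨closure_mono hsub (h2 q hq ?_), fun hqi => ?_⟩⟩
  · rw [closure_ball _ one_ne_zero, mem_closedBall_zero_iff]; exact hq1.le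
  · exact absurd hq1 (outComp_subset i hqi).2.ne

theorem norm_bl_eq_one_of_boundary (hκ : ∀ i, 0 < κ i) (h : IsLab κ b c) {i : Fin m} {p : ℂ}
    (hp : p ∈ closure (outComp κ b i)) (hpi : p ∉ outComp κ b i) (hp1 : 1 < ‖p‖) :
    ‖bl κ 0 b p‖ = 1 := by
  have hc := (differentiableAt_bl (κ := κ) fun j =>
    nonpole_of_one_le h.norm_lt hp1.le j).continuousAt.norm
  refine le_antisymm ?_ (not_lt.1 fun hlt => hpi ?_)
  · have := mem_closure_iff_frequently.1 hp
    refine not_lt.1 fun hlt => ?_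
    obtain ⟨z, hz, hz1⟩ := (this.and_eventually (hc.eventually_const_lt hlt)).exists
    exact lt_asymm hz1 (outComp_subset i hz).2
  · obtain ⟨j, hj⟩ := h.exists_mem_outComp hκ (z := p) ⟨hp1, hlt⟩
    obtain ⟨z, hzj, hzi⟩ := mem_closure_iff_nhds.1 hp _ ((h.isOpen_outComp j).mem_nhds hj)
    rwa [h.eq_of_mem_outComp hκ hzi hzj]

theorem isCompact_closure_outComp (hκ : ∀ i, 0 < κ i) (h : IsLab κ b c) (i : Fin m) :
    IsCompact (closure (outComp κ b i)) := by
  obtain ⟨R, hR⟩ := exists_bound_outSet hκ h.norm_lt (h.injective hκ).2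
  refine (isCompact_closedBall (0 : ℂ) R).of_isClosed_subset isClosed_closure ?_
  refine closure_minimal (fun z hz => ?_) Metric.isClosed_closedBall
  rw [mem_closedBall_zero_iff]
  exact hR z (outComp_subset i hz).1.le (outComp_subset i hz).2.le

theorem boundary_nonempty (hκ : ∀ i, 0 < κ i) (h : IsLab κ b c) (i : Fin m) :
    (closure (outComp κ b i) \ outComp κ b i).Nonempty := by
  by_contra hcon
  rw [not_nonempty_iff_eq_empty, sdiff_eq_empty] at hcon
  have h1 : IsClopen (outComp κ b i) :=
    ⟨isClosed_of_closure_subset hcon, h.isOpen_outComp i⟩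
  rcases isClopen_iff.1 h1 with h2 | h2
  · have := h.zero_mem_outComp hκ i
    rw [h2] at this
    exact this
  · have h3 : (0 : ℂ) ∈ outComp κ b i := by rw [h2]; trivial
    have := (outComp_subset i h3).1
    simp at this
    linarith

/-- Every exterior component reaches the unit circle. -/
theorem exists_touch (hκ : ∀ i, 0 < κ i) (h : IsLab κ b c) (i : Fin m) :
    ∃ t, t ∈ touch κ b i := by
  by_contra hcon
  push Not at hcon
  -- If the component misses the circle, its whole boundary `L` lies in |z| > 1 on the level |B| =
  -- 1. The mirror image `L'` of `L` lies in the open disc on the same level, and it will split the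
  -- interior region.
  set A := closure (outComp κ b i) with hA
  set L := A \ outComp κ b i with hL
  have hA1 : ∀ z ∈ A, 1 < ‖z‖ := by
    intro z hz
    have h1 : 1 ≤ ‖z‖ := by
      have : A ⊆ {z | 1 ≤ ‖z‖} := closure_minimal (fun z hz => (outComp_subset i hz).1.le)
        (isClosed_le continuous_const continuous_norm)
      exact this hz
    refine lt_of_le_of_ne h1 fun h2 => ?_
    obtain ⟨t, rfl⟩ := exists_circleCover_eq h2.symm
    exact hcon t hz
  have hL1 : ∀ z ∈ L, ‖bl κ 0 b z‖ = 1 := fun z hz =>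
    h.norm_bl_eq_one_of_boundary hκ hz.1 hz.2 (hA1 z hz.1)
  have hLc : IsCompact L := (h.isCompact_closure_outComp hκ i).diff (h.isOpen_outComp i)
  have hL0 : ∀ z ∈ L, z ≠ 0 := by
    rintro z hz rfl
    have := hA1 0 hz.1
    simp at this
    linarith
  have hrefl : ∀ z, z ≠ 0 → ‖bl κ 0 b (reflect z)‖ = ‖bl κ 0 b z‖⁻¹ := fun z hz => by
    rw [bl_reflect hz, norm_reflect]
  set L' := reflect '' L with hL'
  have hLc' : IsCompact L' := hLc.image_of_continuousOn fun z hz =>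
    (continuousAt_reflect (hL0 z hz)).continuousWithinAt
  have hL1' : ∀ z ∈ L', ‖bl κ 0 b z‖ = 1 := by
    rintro _ ⟨z, hz, rfl⟩
    rw [hrefl z (hL0 z hz), hL1 z hz, inv_one]
  have hLlt : ∀ z ∈ L', ‖z‖ < 1 := by
    rintro _ ⟨z, hz, rfl⟩
    rw [norm_reflect]
    exact inv_lt_one_of_one_lt₀ (hA1 z hz.1)
  have hLnp : ∀ z ∈ L', ∀ j, z - star (b j) ≠ 0 := fun z hz =>
    nonpole_of_bl_ne_zero hκ (norm_pos_iff.1 (by rw [hL1' z hz]; exact one_pos))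
  -- `M` is the level |B| = 1 in the closed disc. Near `L'` it consists of points of `L'` only,
  -- which is the inclusion of `L'` in `G`; hence `L'` and the rest of `M` are disjoint compact
  -- sets.
  set M := {z : ℂ | ‖z‖ ≤ 1 ∧ absNum κ b z = absDen κ b z} with hM
  set G := interior {z | z ∈ M → z ∈ L'} with hG
  have hLG : L' ⊆ G := by
    intro z hz
    have hnp := hLnp z hz
    obtain ⟨p, hp, rfl⟩ := hz
    have hbl : bl κ 0 b p ≠ 0 := norm_pos_iff.1 (by rw [hL1 p hp]; exact one_pos)
    obtain ⟨W, hW, hWL⟩ := h.mem_nhds_boundary hκ hp.1 (hA1 p hp.1) hbl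
    have hne : reflect p ≠ 0 := inv_ne_zero (star_ne_zero.2 (hL0 p hp))
    rw [hG, mem_interior_iff_mem_nhds]
    have h1 : ∀ᶠ z in 𝓝 (reflect p), reflect z ∈ W := by
      refine (continuousAt_reflect hne).eventually ?_
      rwa [reflect_reflect]
    filter_upwards [h1, eventually_nonpole hnp, isOpen_ne.mem_nhds hne] with z h2 h3 h4 h5
    refine ⟨reflect z, hWL _ h2 ?_, reflect_reflect z⟩
    rw [hrefl z h4, norm_bl, h5.2, div_self (absDen_pos h3).ne', inv_one]
  have hMcl : IsClosed M := (isClosed_le continuous_norm continuous_const).inter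
    (isClosed_eq continuous_absNum continuous_absDen)
  have hMc : IsCompact M := (isCompact_closedBall (0 : ℂ) 1).of_isClosed_subset hMcl
    fun z hz => mem_closedBall_zero_iff.2 hz.1
  have hQc : IsCompact (M \ G) := hMc.diff isOpen_interior
  obtain ⟨P, Q, hP, hQ, hLP, hMQ, hPQ⟩ := SeparatedNhds.of_isCompact_isCompact hLc' hQc
    (disjoint_left.2 fun z h1 h2 => h2.2 (hLG h1))
  have hMPQ : M ⊆ P ∪ Q := by
    intro z hz
    by_cases hzG : z ∈ G
    · exact Or.inl (hLP (interior_subset hzG hz))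
    · exact Or.inr (hMQ ⟨hz, hzG⟩)
  set K := {z : ℂ | ‖z‖ ≤ 1 ∧ absNum κ b z ≤ absDen κ b z} \ (P ∪ Q) with hK
  have hKc : IsCompact K := by
    refine IsCompact.diff ?_ (hP.union hQ)
    refine (isCompact_closedBall (0 : ℂ) 1).of_isClosed_subset
      ((isClosed_le continuous_norm continuous_const).inter
        (isClosed_le continuous_absNum continuous_absDen))
      fun z hz => mem_closedBall_zero_iff.2 hz.1
  have hKlt : ∀ z ∈ K, absNum κ b z < absDen κ b z := fun z hz =>
    lt_of_le_of_ne hz.1.2 fun h1 => hz.2 (hMPQ ⟨hz.1.1, h1⟩)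
  have hnum : ∀ z, 0 ≤ absNum κ b z := fun z => by unfold absNum; positivity
  -- Away from the separating sets `P` and `Q`, compactness keeps |B| below some r < 1; so the
  -- collar just below |B| = 1 is contained in `P ∪ Q`.
  obtain ⟨r, hr, hKr⟩ : ∃ r < 1, ∀ z ∈ K, ‖bl κ 0 b z‖ ≤ r := by
    rcases K.eq_empty_or_nonempty with hKe | hKn
    · exact ⟨0, one_pos, fun z hz => by rw [hKe] at hz; exact hz.elim⟩
    · obtain ⟨z, hz, hmax⟩ := hKc.exists_isMaxOn hKn
        (f := fun z => absNum κ b z / absDen κ b z)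
        (continuous_absNum.continuousOn.div continuous_absDen.continuousOn
          fun z hz => ((hnum z).trans_lt (hKlt z hz)).ne')
      refine ⟨_, ?_, fun w hw => by rw [norm_bl]; exact hmax hw⟩
      exact (div_lt_one ((hnum z).trans_lt (hKlt z hz))).2 (hKlt z hz)
  set r' := max r (1 / 2) with hr'
  have hr'0 : 0 < r' := lt_max_of_lt_right (by norm_num)
  have hr'1 : r' < 1 := max_lt hr (by norm_num)
  obtain ⟨E, hE, -, hcov⟩ := (h.discMap_inSet hκ).exists_uniformization
  obtain ⟨hE1, -, hE3⟩ := hE 0 (Finset.mem_singleton_self 0)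
  -- The collar is the image of a vertical strip under the uniformization at the only interior zero,
  -- hence connected.
  set S := E 0 '' ({w | Real.log r' < w.re} ∩ {w | w.re < 0}) with hS
  have hSin : ∀ z, ‖z‖ < 1 → (∀ j, z - star (b j) ≠ 0) → r' < ‖bl κ 0 b z‖ → ‖bl κ 0 b z‖ < 1 →
      z ∈ S := by
    intro z h1 h2 h3 h4
    obtain ⟨a, ha, hza⟩ := hcov z ⟨h1, h2, h4⟩
    rw [Finset.mem_singleton.1 ha, hE3] at hza
    rcases hza with rfl | ⟨w, hw, rfl⟩
    · rw [bl, zero_pow (hκ 0).ne', mul_zero, zero_mul, norm_zero] at h3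
      linarith
    · refine ⟨w, ⟨?_, hw⟩, rfl⟩
      rw [hE1.map w hw, Complex.norm_exp] at h3
      exact (Real.log_lt_iff_lt_exp hr'0).2 h3
  have hSpre : IsPreconnected S := by
    refine (((convex_halfSpace_re_gt _).inter (convex_re_lt 0)).isPreconnected).image _
      (hE1.continuousOn.mono fun w hw => hw.2)
  have hSPQ : S ⊆ P ∪ Q := by
    rintro _ ⟨w, ⟨hw1, hw2⟩, rfl⟩
    have hin := hE1.mem w hw2
    by_contra hnot
    have h1 := hKr (E 0 w) ⟨⟨hin.1.le, ?_⟩, hnot⟩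
    · rw [hE1.map w hw2, Complex.norm_exp] at h1
      have h2 := (Real.log_lt_iff_lt_exp hr'0).1 hw1
      exact absurd (h2.trans_le h1) (not_lt.2 (le_max_left _ _))
    · have h3 := hin.2.2
      rw [norm_bl, div_lt_one (absDen_pos hin.2.1)] at h3
      exact h3.le
  -- Near `L'` there are points with |B| slightly less than 1.
  have hSP : (S ∩ P).Nonempty := by
    obtain ⟨p, hp⟩ := h.boundary_nonempty hκ i
    have hp' : reflect p ∈ L' := mem_image_of_mem _ hp
    have hbl : bl κ 0 b (reflect p) ≠ 0 := norm_pos_iff.1 (by rw [hL1' _ hp']; exact one_pos)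
    have han := analyticAt_bl (κ := κ) (hLnp _ hp')
    obtain ⟨W, hW, -, hWS⟩ := exists_nhds_preimage han
      (h.deriv_bl_ne_zero hκ (hLlt _ hp').ne (hLnp _ hp') hbl) univ_mem
    have hcl := (hWS _ (convex_ball (0 : ℂ) 1)).2 _ (mem_of_mem_nhds hW) (by
      rw [closure_ball _ one_ne_zero, mem_closedBall_zero_iff, hL1' _ hp'])
    have hev := (han.continuousAt.norm.eventually_const_lt (u := r') (by beta_reduce; rwa [hL1' _ hp'])).and
      ((eventually_nonpole (hLnp _ hp')).and ((hP.eventually_mem (hLP hp')).and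
        (continuous_norm.continuousAt.eventually_lt_const (hLlt _ hp'))))
    obtain ⟨z, hz, h1, h2, h3, h4⟩ := ((mem_closure_iff_frequently.1 hcl).and_eventually hev).exists
    exact ⟨z, hSin z h4 h2 h1 (mem_ball_zero_iff.1 hz.2), h3⟩
  -- At an ascending point of the circle the adjacent interior points satisfy |B| < 1, and the
  -- circle belongs to `Q`.
  have hSQ : (S ∩ Q).Nonempty := by
    obtain ⟨t, ht⟩ := h.exists_rr_pos hκ
    obtain ⟨ρ, hρ, hball⟩ := exists_ball_signStrip (e := 1) h.norm_lt (by rwa [one_mul])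
    have hnorm : ‖circleCover t‖ = 1 := norm_circleCover t
    have hnp : ∀ j, circleCover t - star (b j) ≠ 0 := fun j =>
      (nonpole_of_norm_eq h.norm_lt hnorm j).2
    have htM : circleCover t ∈ M := ⟨hnorm.le, absNum_eq_absDen h.norm_lt hnorm⟩
    have htQ : circleCover t ∈ Q := hMQ ⟨htM, fun hG' =>
      (hLlt _ (interior_subset hG' htM)).ne hnorm⟩
    have han := analyticAt_bl (κ := κ) hnp
    have hev := (han.continuousAt.norm.eventually_const_lt (u := r')
      (by beta_reduce; rwa [norm_bl_circle h.norm_lt hnorm])).and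
      ((eventually_nonpole hnp).and (hQ.eventually_mem htQ))
    have hpath : Tendsto (fun y : ℝ => ((t : ℂ) + y * Complex.I)) (𝓝[>] 0) (𝓝 (t : ℂ)) := by
      have h2 : Continuous (fun y : ℝ => ((t : ℂ) + y * Complex.I)) := by fun_prop
      have h3 := h2.tendsto 0
      rw [Complex.ofReal_zero, zero_mul, add_zero] at h3
      exact h3.mono_left nhdsWithin_le_nhds
    have h5 := (continuous_ce.tendsto (t : ℂ)).comp hpath
    rw [ce_ofReal] at h5
    obtain ⟨y, ⟨h1, h2, h3⟩, hy, hy0⟩ := ((h5.eventually hev).and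
      ((hpath.eventually (Metric.ball_mem_nhds _ hρ)).and self_mem_nhdsWithin)).exists
    have him : ((t : ℂ) + y * Complex.I).im = y := by simp
    obtain ⟨h6, h7⟩ := hball _ hy
    have hy0' : 0 < y := hy0
    have h8 := h7 (by rw [him]; exact hy0'.ne')
    rw [him] at h8
    have h9 : 0 < (lc κ 0 b ((t : ℂ) + y * Complex.I)).im := by
      rw [one_mul] at h8
      exact (mul_pos_iff_of_pos_left hy0').1 h8
    exact ⟨_, hSin _ (norm_ce_lt_one.2 (by rw [him]; exact hy0)) h2 h1
      ((norm_bl_ce_lt_one h6).2 h9), h3⟩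
  obtain ⟨z, -, h1, h2⟩ := hSpre P Q hP hQ hSPQ hSP hSQ
  exact disjoint_left.1 hPQ h1 h2

end IsLab

/-- The `j`-th descending arc bounds the component of the zero number `σ j`. -/
def IsType (κ : Fin (m + 1) → ℕ) (b : Fin m → ℂ) (c : Fin (2 * m) → ℝ)
    (σ : Equiv.Perm (Fin m)) : Prop :=
  ∀ j, ∀ t ∈ Ioo (c (fstIdx j)) (c (sndIdx j)), ∀ i, t ∈ touch κ b i ↔ i = σ j

namespace IsLab

/-- A touching point is never on an ascending arc; if it is a turning point, the component also
touches inside the neighbouring descending arc. -/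
theorem exists_arc_touch (hκ : ∀ i, 0 < κ i) (h : IsLab κ b c) (i : Fin m) :
    ∃ j, ∃ t ∈ Ioo (c (fstIdx j)) (c (sndIdx j)), t ∈ touch κ b i := by
  obtain ⟨t, ht⟩ := h.exists_touch hκ i
  rcases (h.rr_nonpos_of_touch ht).lt_or_eq with hneg | h0
  · obtain ⟨j, n, hn⟩ := h.exists_arc_of_rr_neg hκ hneg
    refine ⟨j, t - n, hn, ?_⟩
    have := touch_add_int (κ := κ) (b := b) (i := i) (t := t) (-n)
    push_cast at this
    exact this.2 ht
  · obtain ⟨k, n, rfl⟩ := (h.rr_eq_zero_iff hκ).1 h0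
    rw [touch_add_int] at ht
    obtain ⟨j, rfl | rfl⟩ := eq_fstIdx_or_sndIdx k
    · exact ⟨j, h.touch_arc_of_touch_fst hκ ht⟩
    · exact ⟨j, h.touch_arc_of_touch_snd hκ ht⟩

/-- Sending an arc to its component is surjective, as each component touches some arc, and there are
m arcs and m components. -/
theorem exists_isType (hκ : ∀ i, 0 < κ i) (h : IsLab κ b c) : ∃ σ, IsType κ b c σ := by
  choose f hf using h.exists_arc_zero hκ
  have hsurj : Function.Surjective f := by
    intro i
    obtain ⟨j, t, ht, hti⟩ := h.exists_arc_touch hκ i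
    exact ⟨j, ((hf j t ht i).1 hti).symm⟩
  exact ⟨Equiv.ofBijective f (Finite.surjective_iff_bijective.1 hsurj), hf⟩

theorem isType_unique (h : IsLab κ b c) {σ τ : Equiv.Perm (Fin m)} (h1 : IsType κ b c σ)
    (h2 : IsType κ b c τ) : σ = τ := by
  ext1 j
  obtain ⟨t, ht⟩ := nonempty_Ioo.2 (h.strictMono (fstIdx_lt_sndIdx j))
  exact (h2 j t ht _).1 ((h1 j t ht _).2 rfl)

theorem Icc_subset_touch (h : IsLab κ b c) {σ : Equiv.Perm (Fin m)} (hσ : IsType κ b c σ)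
    (j : Fin m) : Icc (c (fstIdx j)) (c (sndIdx j)) ⊆ touch κ b (σ j) := by
  rw [← closure_Ioo (h.strictMono (fstIdx_lt_sndIdx j)).ne]
  exact closure_minimal (fun t ht => (hσ j t ht _).2 rfl) (isClosed_touch _)

theorem fst_mem_touch_iff (hκ : ∀ i, 0 < κ i) (h : IsLab κ b c) {σ : Equiv.Perm (Fin m)}
    (hσ : IsType κ b c σ) {i j : Fin m} : c (fstIdx j) ∈ touch κ b i ↔ i = σ j := by
  constructor
  · intro hi
    obtain ⟨t, ht, hti⟩ := h.touch_arc_of_touch_fst hκ hi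
    exact (hσ j t ht i).1 hti
  · rintro rfl
    exact h.Icc_subset_touch hσ j (left_mem_Icc.2 (h.strictMono (fstIdx_lt_sndIdx j)).le)

theorem snd_mem_touch_iff (hκ : ∀ i, 0 < κ i) (h : IsLab κ b c) {σ : Equiv.Perm (Fin m)}
    (hσ : IsType κ b c σ) {i j : Fin m} : c (sndIdx j) ∈ touch κ b i ↔ i = σ j := by
  constructor
  · intro hi
    obtain ⟨t, ht, hti⟩ := h.touch_arc_of_touch_snd hκ hi
    exact (hσ j t ht i).1 hti
  · rintro rfl
    exact h.Icc_subset_touch hσ j (right_mem_Icc.2 (h.strictMono (fstIdx_lt_sndIdx j)).le)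

end IsLab
end

/-! ### The descent along an arc is bounded by the multiplicity. -/

section

variable {m : ℕ} {κ : Fin (m + 1) → ℕ} {b : Fin m → ℂ}

theorem exists_rect_signStrip {a₁ a₂ e : ℝ} (hb : ∀ j, ‖b j‖ < 1)
    (h : ∀ t ∈ Icc a₁ a₂, 0 < e * rr κ b t) : ∃ y > 0, ∀ τ : ℂ, τ.re ∈ Icc a₁ a₂ → |τ.im| < y →
      τ ∈ strip b ∧ (τ.im ≠ 0 → 0 < e * τ.im * (lc κ 0 b τ).im) := by
  have hc : IsCompact ((fun t : ℝ => (t : ℂ)) '' Icc a₁ a₂) :=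
    isCompact_Icc.image Complex.continuous_ofReal
  obtain ⟨y, hy, hsub⟩ := hc.exists_thickening_subset_open (isOpen_signStrip (κ := κ) (b := b) e)
    (by rintro _ ⟨t, ht, rfl⟩; exact ofReal_mem_signStrip hb (h t ht))
  have hmem : ∀ x y' : ℝ, x ∈ Icc a₁ a₂ → |y'| < y →
      (x : ℂ) + y' * Complex.I ∈ signStrip κ b e := by
    intro x y' hx hy'
    refine hsub (Metric.mem_thickening_iff.2 ⟨x, ⟨x, hx, rfl⟩, ?_⟩)
    rw [dist_eq_norm, add_sub_cancel_left, norm_mul, Complex.norm_I, mul_one, Complex.norm_real]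
    exact hy'
  refine ⟨y, hy, fun τ h1 h2 => ⟨?_, fun h0 => mul_im_lc_pos hb h0 fun s hs => ?_⟩⟩
  · have := (hmem τ.re τ.im h1 h2).1
    rwa [Complex.re_add_im] at this
  · refine hmem _ _ h1 (lt_of_le_of_lt ?_ h2)
    rw [abs_mul, abs_of_nonneg hs.1]
    exact mul_le_of_le_one_left (abs_nonneg _) hs.2

theorem map_lc_nhds {t : ℝ} (hb : ∀ j, ‖b j‖ < 1) (h : rr κ b t ≠ 0) :
    map (lc κ 0 b) (𝓝 (t : ℂ)) = 𝓝 (lr κ 0 b t : ℂ) := by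
  have h1 : AnalyticAt ℂ (lc κ 0 b) t := by
    rw [Complex.analyticAt_iff_eventually_differentiableAt]
    filter_upwards [(isOpen_strip b).mem_nhds (ofReal_mem_strip hb t)] with τ hτ
    exact (hasDerivAt_lc 0 hτ).differentiableAt
  have h2 := h1.hasStrictDerivAt
  rw [(hasDerivAt_lc 0 (ofReal_mem_strip hb t)).deriv, ce_ofReal, rc_circleCover t hb] at h2
  rw [h2.map_nhds_eq (Complex.ofReal_ne_zero.2 h), lc_ofReal 0 t hb]

variable [NeZero m] {c : Fin (2 * m) → ℝ}

namespace IsLab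

/-- The total descent along an arc is at most the multiplicity of the zero it belongs to. -/
theorem descent_le (hκ : ∀ i, 0 < κ i) (h : IsLab κ b c) {σ : Equiv.Perm (Fin m)}
    (hσ : IsType κ b c σ) (j : Fin m) :
    lr κ 0 b (c (fstIdx j)) - lr κ 0 b (c (sndIdx j)) ≤ κ (σ j).succ := by
  by_contra hcon
  rw [not_le] at hcon
  have hb := h.norm_lt
  have hlrc : Continuous (lr κ 0 b) :=
    continuous_iff_continuousAt.2 fun t => (hasDerivAt_lr 0 hb t).continuousAt
  have harc := h.strictMono (fstIdx_lt_sndIdx j)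
  set k : ℝ := ((κ (σ j).succ : ℕ) : ℝ) with hk
  have hk0 : 0 < k := Nat.cast_pos.2 (hκ _)
  have hc1 := h.le (fstIdx j)
  have hc2 := h.lt_add_one (sndIdx j)
  set c₁ := c (fstIdx j) with hc₁
  set c₂ := c (sndIdx j) with hc₂
  obtain ⟨t₁, ht₁, hft₁⟩ : ∃ t ∈ Ioo c₁ c₂, k < lr κ 0 b t - lr κ 0 b c₂ := by
    have h1 : ∀ᶠ t in 𝓝[>] c₁, k < lr κ 0 b t - lr κ 0 b c₂ :=
      nhdsWithin_le_nhds ((hlrc.sub continuous_const).continuousAt.eventually_const_lt hcon)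
    obtain ⟨t, h2, h3⟩ := (h1.and (Ioo_mem_nhdsGT harc)).exists
    exact ⟨t, h3, h2⟩
  -- If the descent exceeds `k`, the arc contains two points whose values differ by exactly `k`;
  -- these will be forced to coincide on the circle.
  obtain ⟨t₂, ht₂, hft₂⟩ := intermediate_value_Ioo' ht₁.2.le hlrc.continuousOn
    (show lr κ 0 b t₁ - k ∈ Ioo (lr κ 0 b c₂) (lr κ 0 b t₁) from ⟨by linarith, by linarith⟩)
  have hneg : ∀ t ∈ Ioo c₁ c₂, 0 < -1 * rr κ b t := fun t ht => by
    linarith [h.rr_neg hκ ht]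
  set a₁ := (c₁ + t₁) / 2 with ha₁
  set a₂ := (t₂ + c₂) / 2 with ha₂
  obtain ⟨y, hy, hrect⟩ := exists_rect_signStrip (e := -1) (a₁ := a₁) (a₂ := a₂) hb fun t ht =>
    hneg t ⟨by linarith [ht.1, ht₁.1], by linarith [ht.2, ht₂.2]⟩
  -- A thin rectangle under the arc, containing points below both `t₁` and `t₂`; it is mapped into
  -- the exterior region.
  set R : Set ℂ := ({τ | a₁ < τ.re} ∩ {τ | τ.re < a₂}) ∩ ({τ | -y < τ.im} ∩ {τ | τ.im < 0}) with hR
  have hRconv : Convex ℝ R := ((convex_halfSpace_re_gt _).inter (convex_halfSpace_re_lt _)).inter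
    ((convex_halfSpace_im_gt _).inter (convex_halfSpace_im_lt _))
  have hRmem : ∀ τ ∈ R, τ ∈ strip b ∧ τ.im < 0 ∧ 0 < (lc κ 0 b τ).im := by
    rintro τ ⟨⟨h1, h2⟩, h3, h4⟩
    change a₁ < τ.re at h1
    change τ.re < a₂ at h2
    change -y < τ.im at h3
    change τ.im < 0 at h4
    obtain ⟨h5, h6⟩ := hrect τ ⟨h1.le, h2.le⟩ (abs_lt.2 ⟨h3, h4.trans hy⟩)
    have := h6 h4.ne
    exact ⟨h5, h4, by nlinarith⟩
  have hRout : ∀ τ ∈ R, ce τ ∈ outSet κ b := fun τ hτ =>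
    (ce_mem_outSet (hRmem τ hτ).1).2 (hRmem τ hτ).2
  have hnear : ∀ r > 0, r ≤ y → r ≤ t₁ - a₁ → r ≤ a₂ - t₁ → ∀ τ ∈ Metric.ball (t₁ : ℂ) r,
      a₁ < τ.re ∧ τ.re < a₂ ∧ |τ.im| < y ∧ |τ.re - t₁| < r := by
    intro r hr h1 h2 h3 τ hτ
    rw [mem_ball_iff_norm] at hτ
    have h4 : |τ.re - t₁| < r := by
      refine lt_of_le_of_lt ?_ hτ
      simpa using Complex.abs_re_le_norm (τ - t₁)
    have h5 : |τ.im| < r := by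
      refine lt_of_le_of_lt ?_ hτ
      simpa using Complex.abs_im_le_norm (τ - t₁)
    have h6 := abs_lt.1 h4
    exact ⟨by linarith, by linarith, by linarith, h4⟩
  -- The last two bounds ensure that a point within `r` of `t₁` lies at horizontal distance strictly
  -- between 0 and 1 from `t₂`.
  obtain ⟨r, hr, hr1, hr2, hr3, hr4, hr5⟩ : ∃ r > 0, r ≤ y ∧ r ≤ t₁ - a₁ ∧ r ≤ a₂ - t₁ ∧
      r ≤ t₂ - t₁ ∧ r ≤ 1 - (t₂ - t₁) := by
    refine ⟨min (min y (t₁ - a₁)) (min (a₂ - t₁) (min (t₂ - t₁) (1 - (t₂ - t₁)))), ?_,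
      (min_le_left _ _).trans (min_le_left _ _), (min_le_left _ _).trans (min_le_right _ _),
      (min_le_right _ _).trans (min_le_left _ _),
      (min_le_right _ _).trans ((min_le_right _ _).trans (min_le_left _ _)),
      (min_le_right _ _).trans ((min_le_right _ _).trans (min_le_right _ _))⟩
    have := ht₁.1; have := ht₁.2; have := ht₂.1; have := ht₂.2
    refine lt_min (lt_min hy (by linarith)) (lt_min (by linarith) (lt_min (by linarith)
      (by linarith)))
  have hnear' := hnear r hr hr1 hr2 hr3
  obtain ⟨τ₀, hτ₀, hmem₀⟩ := exists_near_of_touch hr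
    ((hσ j t₁ ht₁ (σ j)).2 rfl)
  have hτ₀R : τ₀ ∈ R := by
    obtain ⟨h1, h2, h3, -⟩ := hnear' τ₀ hτ₀
    have h4 := (hrect τ₀ ⟨h1.le, h2.le⟩ h3).1
    exact ⟨⟨h1, h2⟩, (abs_lt.1 h3).1, ((ce_mem_outSet h4).1 (outComp_subset _ hmem₀)).1⟩
  have D := h.discMap_outSet hκ
  obtain ⟨E, hE, -, -⟩ := D.exists_uniformization
  obtain ⟨hE1, hE2, hE3⟩ := hE (b (σ j))⁻¹ (mem_outZeros.2 ⟨σ j, rfl⟩)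
  rw [outMult_inv (h.injective hκ).1] at hE2
  set E := E (b (σ j))⁻¹ with hEdef
  have hblne : ∀ τ ∈ R, bl κ 0 b (ce τ) ≠ 0 := fun τ hτ => by
    rw [bl_ce 0 (hRmem τ hτ).1]; exact ce_ne_zero _
  rw [outComp, hE3] at hmem₀
  obtain ⟨w, hw, hEw⟩ : ∃ w ∈ leftHalf, E w = ce τ₀ := by
    rcases hmem₀ with h1 | h1
    · refine absurd ?_ (hblne τ₀ hτ₀R)
      rw [h1]
      exact (D.eq_zero_iff _ (D.mem _ (mem_outZeros.2 ⟨σ j, rfl⟩))).2 (mem_outZeros.2 ⟨σ j, rfl⟩)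
    · exact h1
  obtain ⟨n, hn⟩ : ∃ n : ℤ, w = 2 * Real.pi * Complex.I * lc κ 0 b τ₀ +
      n * (2 * Real.pi * Complex.I) := by
    refine Complex.exp_eq_exp_iff_exists_int.1 ?_
    rw [← hE1.map w hw, hEw, bl_ce 0 (hRmem τ₀ hτ₀R).1]; rfl
  -- A logarithm of B on the rectangle, shifted by the multiple of 2πi that makes it the half-plane
  -- coordinate of the component.
  set v : ℂ → ℂ := fun τ => 2 * Real.pi * Complex.I * lc κ 0 b τ + n * (2 * Real.pi * Complex.I)
    with hv
  have hvleft : ∀ τ ∈ R, v τ ∈ leftHalf := by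
    intro τ hτ
    have h1 : (v τ).re = -(2 * Real.pi * (lc κ 0 b τ).im) := by simp [hv]
    change (v τ).re < 0
    rw [h1]
    have := mul_pos Real.pi_pos (hRmem τ hτ).2.2
    linarith
  have hvc : ContinuousOn v R := fun τ hτ =>
    (((hasDerivAt_lc 0 (hRmem τ hτ).1).continuousAt.const_mul _).add
      continuousAt_const).continuousWithinAt
  -- Both sides lift the same map through B and agree at `τ₀`.
  have heq : EqOn ce (fun τ => E (v τ)) R := by
    refine D.lift_unique hRconv.isPreconnected continuous_ce.continuousOn
      (hE1.continuousOn.comp hvc hvleft) (fun τ hτ => ⟨hRout τ hτ, hblne τ hτ⟩) (fun τ hτ => ?_)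
      hτ₀R (by rw [← hEw, hn])
    rw [hE1.map _ (hvleft τ hτ), bl_ce 0 (hRmem τ hτ).1, hv, Complex.exp_add,
      Complex.exp_int_mul_two_pi_mul_I, mul_one]
    rfl
  -- matching points near the two ends
  have hmap := map_lc_nhds (κ := κ) hb (h.rr_neg hκ ht₁).ne
  have himg : lc κ 0 b '' Metric.ball (t₁ : ℂ) r ∈ 𝓝 (lr κ 0 b t₁ : ℂ) := by
    rw [← hmap]; exact image_mem_map (Metric.ball_mem_nhds _ hr)
  have hpath : Tendsto (fun y : ℝ => ((t₂ : ℂ) - y * Complex.I)) (𝓝[>] 0) (𝓝 (t₂ : ℂ)) := by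
    have h2 : Continuous (fun y : ℝ => ((t₂ : ℂ) - y * Complex.I)) := by fun_prop
    have h3 := h2.tendsto 0
    rw [Complex.ofReal_zero, zero_mul, sub_zero] at h3
    exact h3.mono_left nhdsWithin_le_nhds
  have hlim : Tendsto (fun y : ℝ => lc κ 0 b ((t₂ : ℂ) - y * Complex.I) + k) (𝓝[>] 0)
      (𝓝 (lr κ 0 b t₁ : ℂ)) := by
    have h1 := (((hasDerivAt_lc (κ := κ) 0 (ofReal_mem_strip hb t₂)).continuousAt.tendsto.comp
      hpath).add_const (k : ℂ))
    rw [lc_ofReal 0 t₂ hb, hft₂, ← Complex.ofReal_add, sub_add_cancel] at h1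
    exact h1
  obtain ⟨s, ⟨τ₁, hτ₁, hlc⟩, hs⟩ := ((hlim.eventually himg).and (Ioo_mem_nhdsGT hy)).exists
  set τ₂ : ℂ := (t₂ : ℂ) - s * Complex.I with hτ₂
  have hτ₂re : τ₂.re = t₂ := by simp [hτ₂]
  have hτ₂im : τ₂.im = -s := by simp [hτ₂]
  have hτ₂R : τ₂ ∈ R := by
    refine ⟨⟨?_, ?_⟩, ?_, ?_⟩
    · change a₁ < τ₂.re; rw [hτ₂re]; linarith [ht₁.1, ht₂.1]
    · change τ₂.re < a₂; rw [hτ₂re]; linarith [ht₂.2]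
    · change -y < τ₂.im; rw [hτ₂im]; linarith [hs.2]
    · change τ₂.im < 0; rw [hτ₂im]; linarith [hs.1]
  obtain ⟨h1, h2, h3, h4⟩ := hnear' τ₁ hτ₁
  have him₁ : 0 < (lc κ 0 b τ₁).im := by
    rw [hlc, Complex.add_im, Complex.ofReal_im, add_zero]
    exact (hRmem τ₂ hτ₂R).2.2
  have hτ₁R : τ₁ ∈ R := by
    refine ⟨⟨h1, h2⟩, (abs_lt.1 h3).1, ?_⟩
    change τ₁.im < 0
    by_contra hge
    rw [not_lt] at hge
    rcases hge.eq_or_lt with h0 | h0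
    · have h5 : ((τ₁.re : ℝ) : ℂ) = τ₁ := Complex.ext (by simp) (by simp [← h0])
      rw [← h5, im_lc_ofReal hb] at him₁
      exact lt_irrefl _ him₁
    · have := (hrect τ₁ ⟨h1.le, h2.le⟩ h3).2 h0.ne'
      nlinarith [mul_pos h0 him₁]
  -- Lift values that differ by `k` give half-plane coordinates that differ by the period 2πi `k`.
  have hce : ce τ₁ = ce τ₂ := by
    rw [heq hτ₁R, heq hτ₂R]
    change E (v τ₁) = E (v τ₂)
    rw [← hE2 (v τ₂) (hvleft τ₂ hτ₂R)]
    congr 1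
    rw [hv]
    simp only
    rw [hlc, hk]
    push_cast
    ring
  obtain ⟨n', hn'⟩ := ce_eq_ce_iff.1 hce
  have hre := congrArg Complex.re hn'
  rw [Complex.add_re, hτ₂re, Complex.intCast_re] at hre
  have h5 := abs_lt.1 h4
  have h6 : ((n' : ℤ) : ℝ) < 0 := by linarith
  have h7 : (-1 : ℝ) < n' := by linarith
  have h8 : n' < 0 := by exact_mod_cast h6
  have h9 : -1 < n' := by exact_mod_cast h7
  omega

end IsLab
end

/-! ### Smooth dependence and openness of the type. -/

section

variable {m : ℕ} {κ : Fin (m + 1) → ℕ} {b : Fin m → ℂ}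

theorem contDiffAt_lr {X : Type*} [NormedAddCommGroup X] [NormedSpace ℝ X] {η t : X → ℝ}
    {β : X → Fin m → ℂ} {x : X} (hη : ContDiffAt ℝ ∞ η x)
    (hβ : ∀ j, ContDiffAt ℝ ∞ (fun x => β x j) x) (ht : ContDiffAt ℝ ∞ t x)
    (hb : ∀ j, ‖β x j‖ < 1) : ContDiffAt ℝ ∞ (fun x => lr κ (η x) (β x) (t x)) x := by
  unfold lr
  refine (hη.add (contDiffAt_const.mul ht)).add (contDiffAt_const.mul
    (ContDiffAt.sum fun j _ => contDiffAt_const.mul ?_))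
  have h1 : ContDiffAt ℝ ∞ (fun x => 1 - β x j * circleCover (t x)) x :=
    contDiffAt_const.sub ((hβ j).mul (contDiff_circleCover.contDiffAt.comp x ht))
  have h2 : ContDiffAt ℝ ∞ Complex.log (1 - β x j * circleCover (t x)) :=
    (Complex.contDiffAt_log (slit_of_norm_lt (norm_mul_lt_one (hb j)
      (norm_circleCover _)))).restrict_scalars ℝ
  exact Complex.imCLM.contDiff.contDiffAt.comp x (h2.comp x h1)

theorem contDiffAt_rr {X : Type*} [NormedAddCommGroup X] [NormedSpace ℝ X] {t : X → ℝ}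
    {β : X → Fin m → ℂ} {x : X} (hβ : ∀ j, ContDiffAt ℝ ∞ (fun x => β x j) x)
    (ht : ContDiffAt ℝ ∞ t x) (hb : ∀ j, ‖β x j‖ < 1) :
    ContDiffAt ℝ ∞ (fun x => rr κ (β x) (t x)) x := by
  unfold rr
  refine contDiffAt_const.sub (contDiffAt_const.mul
    (ContDiffAt.sum fun j _ => contDiffAt_const.mul ?_))
  have h0 : ContDiffAt ℝ ∞ (fun x => β x j * circleCover (t x)) x :=
    (hβ j).mul (contDiff_circleCover.contDiffAt.comp x ht)
  have h1 : ContDiffAt ℝ ∞ (fun x => (1 - β x j * circleCover (t x))⁻¹) x :=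
    (contDiffAt_const.sub h0).inv
      (one_sub_ne_zero (norm_mul_lt_one (hb j) (norm_circleCover _)))
  simp only [div_eq_mul_inv]
  exact Complex.reCLM.contDiff.contDiffAt.comp x (h0.mul h1)

theorem continuousAt_lr {p : ℝ × (Fin m → ℂ) × ℝ} (hb : ∀ j, ‖p.2.1 j‖ < 1) :
    ContinuousAt (fun p : ℝ × (Fin m → ℂ) × ℝ => lr κ p.1 p.2.1 p.2.2) p := by
  refine (contDiffAt_lr (η := fun p : ℝ × (Fin m → ℂ) × ℝ => p.1) (t := fun p => p.2.2)
    (β := fun p => p.2.1) (by fun_prop) (fun j => by fun_prop) (by fun_prop) hb).continuousAt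

theorem eventually_norm_lt (hb : ∀ j, ‖b j‖ < 1) : ∀ᶠ β in 𝓝 b, ∀ j, ‖β j‖ < 1 := by
  rw [eventually_all]
  intro j
  have h : ContinuousAt (fun β : Fin m → ℂ => ‖β j‖) b :=
    (continuous_apply j).norm.continuousAt
  exact h.eventually_lt_const (hb j)

theorem eventually_mem_outSet {z : ℂ} (hb : ∀ j, ‖b j‖ < 1) (hz : z ∈ outSet κ b) :
    ∀ᶠ p : (Fin m → ℂ) × ℂ in 𝓝 (b, z), p.2 ∈ outSet κ p.1 := by
  have h1 : ContinuousAt (fun p : (Fin m → ℂ) × ℂ => absNum κ p.1 p.2) (b, z) := by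
    unfold absNum; fun_prop
  have h2 : ContinuousAt (fun p : (Fin m → ℂ) × ℂ => absDen κ p.1 p.2) (b, z) := by
    unfold absDen; fun_prop
  have h3 := absDen_pos (κ := κ) fun j => nonpole_of_one_le hb hz.1.le j
  have h4 := hz.2
  rw [norm_bl, div_lt_one h3] at h4
  have h5 : ContinuousAt (fun p : (Fin m → ℂ) × ℂ => ‖p.2‖) (b, z) := by fun_prop
  filter_upwards [h1.eventually_lt h2 h4, h5.eventually_const_lt hz.1,
    continuousAt_fst.eventually (eventually_norm_lt hb)] with p h6 h7 h8
  refine ⟨h7, ?_⟩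
  rw [norm_bl, div_lt_one (absDen_pos fun j => nonpole_of_one_le h8 h7.le j)]
  exact h6

theorem eventually_mem_signStrip {e : ℝ} {τ : ℂ} (hτ : τ ∈ signStrip κ b e) :
    ∀ᶠ p : (Fin m → ℂ) × ℂ in 𝓝 (b, τ), p.2 ∈ signStrip κ p.1 e := by
  have hce := continuous_ce
  have h1 : ∀ j, ContinuousAt (fun p : (Fin m → ℂ) × ℂ => p.1 j * ce p.2) (b, τ) :=
    fun j => by fun_prop
  have h2 : ∀ j, ContinuousAt (fun p : (Fin m → ℂ) × ℂ => p.1 j * ce (-p.2)) (b, τ) :=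
    fun j => by fun_prop
  have h3 : ContinuousAt (fun p : (Fin m → ℂ) × ℂ => e * (rc κ p.1 (ce p.2)).re) (b, τ) := by
    refine continuousAt_const.mul (Complex.continuous_re.continuousAt.comp ?_)
    unfold rc
    refine continuousAt_const.sub (tendsto_finsetSum _ fun j _ => continuousAt_const.mul ?_)
    have h4 : ContinuousAt (fun p : (Fin m → ℂ) × ℂ => ce p.2) (b, τ) := by fun_prop
    have h5 : ContinuousAt (fun p : (Fin m → ℂ) × ℂ => star (p.1 j)) (b, τ) := by fun_prop
    exact ((h1 j).div (continuousAt_const.sub (h1 j)) (nonpole_of_mem_strip hτ.1 j).1).add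
      (h4.div (h4.sub h5) (nonpole_of_mem_strip hτ.1 j).2)
  have h4 : ∀ᶠ p : (Fin m → ℂ) × ℂ in 𝓝 (b, τ), ∀ j,
      ‖p.1 j * ce p.2‖ < 1 ∧ ‖p.1 j * ce (-p.2)‖ < 1 := by
    rw [eventually_all]
    intro j
    exact ((h1 j).norm.eventually_lt_const (hτ.1 j).1).and
      ((h2 j).norm.eventually_lt_const (hτ.1 j).2)
  filter_upwards [h4, h3.eventually_const_lt hτ.2] with p h5 h6
  exact ⟨h5, h6⟩

variable [NeZero m] {c : Fin (2 * m) → ℝ}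

namespace IsLab

/-- Join a point just below `t` to the zero by a compact path in the component. Under a small change
of parameters the path remains in the exterior region, as does the short vertical segment up to the
circle. -/
theorem eventually_mem_touch (hκ : ∀ i, 0 < κ i) (h : IsLab κ b c) {i : Fin m} {t : ℝ}
    (ht : rr κ b t < 0) (hti : t ∈ touch κ b i) : ∀ᶠ β in 𝓝 b, t ∈ touch κ β i := by
  have hb := h.norm_lt
  have hbi := (h.injective hκ).2 i
  obtain ⟨r, hr, hball⟩ := exists_ball_signStrip (e := -1) hb (by linarith)
  obtain ⟨r', hr', hsub'⟩ := Metric.isOpen_iff.1 (isOpen_signStrip (κ := κ) (b := b) (-1)) t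
    (ofReal_mem_signStrip hb (by linarith))
  have hbelow := below_subset_outComp hr hball hti
  set y := min r r' / 2 with hy
  have hy0 : 0 < y := by have := lt_min hr hr'; linarith
  have hyr : y < r := by have := min_le_left r r'; linarith
  have hyr' : y < r' := by have := min_le_right r r'; linarith
  have hpt : ∀ s : ℝ, 0 ≤ s → ∀ ρ, s < ρ → (t : ℂ) - s * Complex.I ∈ Metric.ball (t : ℂ) ρ := by
    intro s hs ρ hρ
    rw [mem_ball_iff_norm, sub_sub_cancel_left, norm_neg, norm_mul, Complex.norm_I, mul_one,
      Complex.norm_real, Real.norm_of_nonneg hs]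
    exact hρ
  have hz₀ : ce ((t : ℂ) - y * Complex.I) ∈ outComp κ b i :=
    hbelow _ (hpt y hy0.le r hyr) (by simp [hy0])
  have hz₁ := h.zero_mem_outComp hκ i
  have hconn : IsConnected (outComp κ b i) :=
    ⟨⟨_, hz₀⟩, isPreconnected_connectedComponentIn⟩
  obtain ⟨γ, hγ⟩ := (((h.isOpen_outComp i).isConnected_iff_isPathConnected).1 hconn).joinedIn
    _ hz₀ _ hz₁
  obtain ⟨s, hs, hsub⟩ := Metric.nhds_basis_closedBall.mem_iff.1
    ((h.isOpen_outComp i).mem_nhds hz₁)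
  -- The ball is added because the zero moves with the parameters and must remain attached to the
  -- path.
  set K : Set ℂ := range γ ∪ Metric.closedBall (b i)⁻¹ s with hK
  have hKc : IsCompact K := (isCompact_range γ.continuous).union (isCompact_closedBall _ _)
  have hKp : IsPreconnected K := by
    refine IsPreconnected.union (b i)⁻¹ ⟨1, γ.target⟩ (Metric.mem_closedBall_self hs.le)
      (isPreconnected_range γ.continuous) (convex_closedBall _ _).isPreconnected
  have hKsub : K ⊆ outComp κ b i := union_subset (by rintro _ ⟨x, rfl⟩; exact hγ x) hsub
  have ev1 : ∀ᶠ β in 𝓝 b, ∀ z ∈ K, z ∈ outSet κ β :=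
    hKc.eventually_forall_of_forall_eventually fun z hz =>
      eventually_mem_outSet hb (outComp_subset i (hKsub hz))
  have ev2 : ∀ᶠ β in 𝓝 b, (β i)⁻¹ ∈ Metric.closedBall (b i)⁻¹ s := by
    have h1 : ContinuousAt (fun β : Fin m → ℂ => (β i)⁻¹) b :=
      (continuous_apply i).continuousAt.inv₀ hbi
    exact h1.eventually (Metric.closedBall_mem_nhds _ hs)
  have ev3 : ∀ᶠ β in 𝓝 b, ∀ s ∈ Icc (0 : ℝ) y, (t : ℂ) - s * Complex.I ∈ signStrip κ β (-1) := by
    refine isCompact_Icc.eventually_forall_of_forall_eventually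
      (P := fun (β : Fin m → ℂ) (s : ℝ) => (t : ℂ) - s * Complex.I ∈ signStrip κ β (-1))
      fun s hs => ?_
    have h1 : ContinuousAt (fun p : (Fin m → ℂ) × ℝ => (p.1, (t : ℂ) - p.2 * Complex.I)) (b, s) := by
      fun_prop
    exact h1.eventually (eventually_mem_signStrip (hsub' (hpt s hs.1 r' (hs.2.trans_lt hyr'))))
  filter_upwards [ev1, ev2, ev3, eventually_norm_lt hb] with β h1 h2 h3 h4
  have hzK : ce ((t : ℂ) - y * Complex.I) ∈ K := Or.inl ⟨0, γ.source⟩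
  have hiK : (β i)⁻¹ ∈ K := Or.inr h2
  have h5 := subset_outComp (i := i) hKp h1 hiK (mem_connectedComponentIn (h1 _ hiK))
  have h6 : ∀ s ∈ Ioc (0 : ℝ) y, ce ((t : ℂ) - s * Complex.I) ∈ outSet κ β := by
    intro s hs
    have him : ((t : ℂ) - s * Complex.I).im = -s := by simp
    have hre : ((t : ℂ) - s * Complex.I).re = t := by simp
    refine (ce_mem_outSet (h3 s (Ioc_subset_Icc_self hs)).1).2 ⟨by rw [him]; linarith [hs.1], ?_⟩
    have h7 := mul_im_lc_pos (κ := κ) (e := -1) (τ := (t : ℂ) - s * Complex.I) h4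
      (by rw [him]; linarith [hs.1]) fun x hx => by
        rw [him, hre]
        have := h3 (x * s) ⟨mul_nonneg hx.1 hs.1.le,
          (mul_le_of_le_one_left hs.1.le hx.2).trans hs.2⟩
        convert this using 1
        push_cast
        ring
    rw [him] at h7
    nlinarith [hs.1]
  have h7 := subset_outComp (κ := κ) (b := β) (i := i)
    (S := (fun s : ℝ => ce ((t : ℂ) - s * Complex.I)) '' Ioc 0 y)
    (isPreconnected_Ioc.image _ (by have := continuous_ce; fun_prop))
    (by rintro _ ⟨s, hs, rfl⟩; exact h6 s hs) ⟨y, ⟨hy0, le_rfl⟩, rfl⟩ (h5 hzK)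
  have h8 : Tendsto (fun y : ℝ => ce ((t : ℂ) - y * Complex.I)) (𝓝[>] 0) (𝓝 (circleCover t)) := by
    have h2 : Continuous (fun y : ℝ => ce ((t : ℂ) - y * Complex.I)) := by
      have := continuous_ce; fun_prop
    have h3 := h2.tendsto 0
    rw [Complex.ofReal_zero, zero_mul, sub_zero, ce_ofReal] at h3
    exact h3.mono_left nhdsWithin_le_nhds
  refine mem_closure_of_tendsto h8 ?_
  filter_upwards [Ioc_mem_nhdsGT hy0] with s hs
  exact h7 ⟨s, hs, rfl⟩

/-- Apart from the critical equations, which are assumed, all conditions are strict inequalities. -/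
theorem eventually_isLab (h : IsLab κ b c) :
    ∀ᶠ p : (Fin m → ℂ) × (Fin (2 * m) → ℝ) in 𝓝 (b, c),
      (∀ i, rr κ p.1 (p.2 i) = 0) → IsLab κ p.1 p.2 := by
  have h1 : ∀ᶠ p : (Fin m → ℂ) × (Fin (2 * m) → ℝ) in 𝓝 (b, c), ∀ i j, i < j → p.2 i < p.2 j := by
    simp only [eventually_all]
    intro i j hij
    have h2 : ContinuousAt (fun p : (Fin m → ℂ) × (Fin (2 * m) → ℝ) => p.2 i) (b, c) := by fun_prop
    have h3 : ContinuousAt (fun p : (Fin m → ℂ) × (Fin (2 * m) → ℝ) => p.2 j) (b, c) := by fun_prop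
    exact h2.eventually_lt h3 (h.strictMono hij)
  have h2 : ∀ᶠ p : (Fin m → ℂ) × (Fin (2 * m) → ℝ) in 𝓝 (b, c), ∀ i,
      p.2 i < p.2 (fstIdx 0) + 1 := by
    rw [eventually_all]
    intro i
    have h2 : ContinuousAt (fun p : (Fin m → ℂ) × (Fin (2 * m) → ℝ) => p.2 i) (b, c) := by fun_prop
    have h3 : ContinuousAt (fun p : (Fin m → ℂ) × (Fin (2 * m) → ℝ) => p.2 (fstIdx 0) + 1) (b, c) := by
      fun_prop
    exact h2.eventually_lt h3 (h.lt_add_one i)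
  have h3 : ∀ᶠ p : (Fin m → ℂ) × (Fin (2 * m) → ℝ) in 𝓝 (b, c), ∀ j,
      lr κ 0 p.1 (p.2 (sndIdx j)) < lr κ 0 p.1 (p.2 (fstIdx j)) := by
    rw [eventually_all]
    intro j
    have h4 : ∀ i, ContinuousAt (fun p : (Fin m → ℂ) × (Fin (2 * m) → ℝ) => lr κ 0 p.1 (p.2 i))
        (b, c) := fun i =>
      (contDiffAt_lr contDiffAt_const (fun j => by fun_prop) (by fun_prop) h.norm_lt).continuousAt
    exact (h4 _).eventually_lt (h4 _) (h.desc j)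
  filter_upwards [h1, h2, h3, continuousAt_fst.eventually (eventually_norm_lt h.norm_lt)]
    with p h4 h5 h6 h7 h8
  exact ⟨h7, fun i j hij => h4 i j hij, h5, h8, h6⟩

/-- Labelled maps of a given type form an open set. -/
theorem eventually_isType (hκ : ∀ i, 0 < κ i) (h : IsLab κ b c) {σ : Equiv.Perm (Fin m)}
    (hσ : IsType κ b c σ) :
    ∀ᶠ p : (Fin m → ℂ) × (Fin (2 * m) → ℝ) in 𝓝 (b, c),
      (∀ i, rr κ p.1 (p.2 i) = 0) → IsLab κ p.1 p.2 ∧ IsType κ p.1 p.2 σ := by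
  -- One sample point on each arc determines the permutation, since the touching component is
  -- constant along an arc.
  have hex : ∀ j : Fin m, ∃ t, t ∈ Ioo (c (fstIdx j)) (c (sndIdx j)) := fun j =>
    nonempty_Ioo.2 (h.strictMono (fstIdx_lt_sndIdx j))
  choose t ht using hex
  have h1 : ∀ᶠ p : (Fin m → ℂ) × (Fin (2 * m) → ℝ) in 𝓝 (b, c), ∀ j,
      t j ∈ Ioo (p.2 (fstIdx j)) (p.2 (sndIdx j)) := by
    rw [eventually_all]
    intro j
    have h2 : ∀ i, ContinuousAt (fun p : (Fin m → ℂ) × (Fin (2 * m) → ℝ) => p.2 i) (b, c) :=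
      fun i => by fun_prop
    exact ((h2 _).eventually_lt_const (ht j).1).and ((h2 _).eventually_const_lt (ht j).2)
  have h2 : ∀ᶠ p : (Fin m → ℂ) × (Fin (2 * m) → ℝ) in 𝓝 (b, c), ∀ j,
      t j ∈ touch κ p.1 (σ j) := by
    rw [eventually_all]
    intro j
    have h3 := h.eventually_mem_touch hκ (h.rr_neg hκ (ht j)) ((hσ j _ (ht j) _).2 rfl)
    exact (continuousAt_fst (p := (b, c))).eventually h3
  filter_upwards [h.eventually_isLab, h1, h2] with p h3 h4 h5 h6
  have hlab := h3 h6
  refine ⟨hlab, ?_⟩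
  obtain ⟨τ, hτ⟩ := hlab.exists_isType hκ
  have : σ = τ := Equiv.ext fun j => (hτ j _ (h4 j) _).1 (h5 j)
  rwa [this]

end IsLab
end

/-! ### The inverse function theorem for critical values. -/

section

/-- In equal finite dimensions injectivity of the derivative suffices; it is stated along lines so
that the one-variable computations above apply directly. -/
theorem exists_smooth_local_inverse {X Y : Type*} [NormedAddCommGroup X] [NormedSpace ℝ X]
    [FiniteDimensional ℝ X] [NormedAddCommGroup Y] [NormedSpace ℝ Y] [FiniteDimensional ℝ Y]
    {f : X → Y} {p : X} (hf : ContDiffAt ℝ ∞ f p)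
    (hdim : Module.finrank ℝ X = Module.finrank ℝ Y)
    (hinj : ∀ v, HasDerivAt (fun s : ℝ => f (p + s • v)) 0 0 → v = 0) :
    ∃ g : Y → X, ContDiffAt ℝ ∞ g (f p) ∧ g (f p) = p ∧ (∀ᶠ x in 𝓝 p, g (f x) = x) ∧
      ∀ᶠ y in 𝓝 (f p), f (g y) = y := by
  have hfd : HasFDerivAt f (fderiv ℝ f p) p := (hf.differentiableAt (by simp)).hasFDerivAt
  have hker : Function.Injective (fderiv ℝ f p : X →ₗ[ℝ] Y) := by
    rw [← LinearMap.ker_eq_bot, LinearMap.ker_eq_bot']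
    intro v hv
    refine hinj v ?_
    have h1 : HasDerivAt (fun s : ℝ => p + s • v) v 0 := by
      have := ((hasDerivAt_id (0 : ℝ)).smul_const v).const_add p
      simpa using this
    have h2 : HasFDerivAt f (fderiv ℝ f p) (p + (0 : ℝ) • v) := by simpa using hfd
    have h3 := h2.comp_hasDerivAt (0 : ℝ) h1
    have h4 : (fderiv ℝ f p) v = 0 := hv
    rwa [h4] at h3
  set e := ((fderiv ℝ f p : X →ₗ[ℝ] Y).linearEquivOfInjective hker hdim).toContinuousLinearEquiv
  have he : HasFDerivAt f (e : X →L[ℝ] Y) p := by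
    refine hfd.congr_fderiv ?_
    ext v
    rfl
  have h1 : (∞ : WithTop ℕ∞) ≠ 0 := by simp
  refine ⟨hf.localInverse he h1, hf.to_localInverse he h1, ?_, ?_, ?_⟩
  · exact (hf.hasStrictFDerivAt' he h1).localInverse_apply_image
  · exact (hf.hasStrictFDerivAt' he h1).eventually_left_inverse
  · exact (hf.hasStrictFDerivAt' he h1).eventually_right_inverse

theorem exists_nhds_injOn_of_left_inverse {X Y : Type*} [TopologicalSpace X] {f : X → Y} {g : Y → X}
    {p : X} (h : ∀ᶠ x in 𝓝 p, g (f x) = x) : ∃ N ∈ 𝓝 p, InjOn f N :=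
  ⟨_, h, fun x hx y hy hxy => by
    have h1 : g (f x) = x := hx
    have h2 : g (f y) = y := hy
    rw [← h1, ← h2, hxy]⟩

variable {m : ℕ} [NeZero m] {κ : Fin (m + 1) → ℕ}

/-- Infinitesimal deformations fixing the critical values are rotations. -/
theorem IsLab.eq_rotation {η : ℝ → ℝ} {b : ℝ → Fin m → ℂ} {c : ℝ → Fin (2 * m) → ℝ} {η' : ℝ}
    {b' : Fin m → ℂ} {c' : Fin (2 * m) → ℝ} (hκ : ∀ i, 0 < κ i) (h : IsLab κ (b 0) (c 0))
    (hη : HasDerivAt η η' 0) (hb : ∀ j, HasDerivAt (fun s => b s j) (b' j) 0)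
    (hc : ∀ i, HasDerivAt (fun s => c s i) (c' i) 0)
    (hr : ∀ i, HasDerivAt (fun s => rr κ (b s) (c s i)) 0 0)
    (hl : ∀ i, HasDerivAt (fun s => lr κ (η s) (b s) (c s i)) 0 0) :
    ∃ y : ℝ, (∀ j, b' j = 2 * Real.pi * Complex.I * y * b 0 j) ∧ η' = y * circleDegree κ ∧
      ∀ i, c' i = -y := by
  -- At a critical point the motion of the point does not contribute to the change of the critical
  -- value.
  have h1 : ∀ i, η' + lrVar κ (b 0) b' (c 0 i) = 0 := by
    intro i
    have h2 := (hasDerivAt_lr_comp (κ := κ) hη hb (hc i) h.norm_lt).unique (hl i)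
    rwa [h.crit i, zero_mul, add_zero] at h2
  obtain ⟨y, hy1, hy2⟩ := h.exists_rotation hκ h1
  refine ⟨y, hy1, hy2, fun i => ?_⟩
  have h2 : ∀ j, HasDerivAt (fun s => b s j) (2 * Real.pi * Complex.I * y * b 0 j) 0 := fun j => by
    rw [← hy1 j]; exact hb j
  have h3 := (hasDerivAt_rr_comp (κ := κ) h2 (hc i) h.norm_lt).unique (hr i)
  have h4 := (mul_eq_zero.1 h3).resolve_left (h.rr2_ne_zero hκ i)
  linarith

/-- The critical data: derivatives at the marked points, values at the marked points, and the first
marked point. -/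
def xi (κ : Fin (m + 1) → ℕ) (p : ℝ × (Fin m → ℂ) × RealVec m) : (RealVec m × RealVec m) × ℝ :=
  ((fun i => rr κ p.2.1 (p.2.2 i), fun i => lr κ p.1 p.2.1 (p.2.2 i)), p.2.2 (fstIdx 0))

theorem contDiffAt_xi {p : ℝ × (Fin m → ℂ) × RealVec m} (hb : ∀ j, ‖p.2.1 j‖ < 1) :
    ContDiffAt ℝ ∞ (xi κ) p := by
  refine ContDiffAt.prodMk (ContDiffAt.prodMk (contDiffAt_pi.2 fun i => ?_)
    (contDiffAt_pi.2 fun i => ?_)) (by fun_prop)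
  · exact contDiffAt_rr (β := fun p : ℝ × (Fin m → ℂ) × RealVec m => p.2.1) (fun j => by fun_prop)
      (by fun_prop) hb
  · exact contDiffAt_lr (β := fun p : ℝ × (Fin m → ℂ) × RealVec m => p.2.1) (by fun_prop)
      (fun j => by fun_prop) (by fun_prop) hb

theorem _root_.HasDerivAt.prod_fst {X Y : Type*} [NormedAddCommGroup X] [NormedSpace ℝ X]
    [NormedAddCommGroup Y] [NormedSpace ℝ Y] {f : ℝ → X × Y} {f' : X × Y} {s : ℝ}
    (h : HasDerivAt f f' s) : HasDerivAt (fun s => (f s).1) f'.1 s :=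
  (hasFDerivAt_fst (p := f s)).comp_hasDerivAt s h

theorem _root_.HasDerivAt.prod_snd {X Y : Type*} [NormedAddCommGroup X] [NormedSpace ℝ X]
    [NormedAddCommGroup Y] [NormedSpace ℝ Y] {f : ℝ → X × Y} {f' : X × Y} {s : ℝ}
    (h : HasDerivAt f f' s) : HasDerivAt (fun s => (f s).2) f'.2 s :=
  (hasFDerivAt_snd (p := f s)).comp_hasDerivAt s h

theorem hasDerivAt_line {X : Type*} [NormedAddCommGroup X] [NormedSpace ℝ X] (p v : X) (s : ℝ) :
    HasDerivAt (fun s : ℝ => p + s • v) v s := by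
  have := ((hasDerivAt_id s).smul_const v).const_add p
  simpa using this

/-- A kernel vector is an infinitesimal rotation, and a rotation moves the first marked point, whose
position is part of the data; so the kernel is trivial. Both sides have dimension 4m + 1. -/
theorem IsLab.exists_xi_inverse (hκ : ∀ i, 0 < κ i) {p : ℝ × (Fin m → ℂ) × RealVec m}
    (h : IsLab κ p.2.1 p.2.2) :
    ∃ g, ContDiffAt ℝ ∞ g (xi κ p) ∧ g (xi κ p) = p ∧ (∀ᶠ x in 𝓝 p, g (xi κ x) = x) ∧
      ∀ᶠ y in 𝓝 (xi κ p), xi κ (g y) = y := by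
  refine exists_smooth_local_inverse (contDiffAt_xi h.norm_lt) ?_ fun v hv => ?_
  · have : Module.finrank ℝ (Fin m → ℂ) = m * 2 := by
      rw [Module.finrank_pi_fintype]; simp [Complex.finrank_real_complex]
    simp [this]
    ring
  · have h0 := hasDerivAt_line p v 0
    have hr := hasDerivAt_pi.1 hv.prod_fst.prod_fst
    have hl := hasDerivAt_pi.1 hv.prod_fst.prod_snd
    have hs := hv.prod_snd
    have hη := h0.prod_fst
    have hb := hasDerivAt_pi.1 h0.prod_snd.prod_fst
    have hc := hasDerivAt_pi.1 h0.prod_snd.prod_snd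
    have hp : p + (0 : ℝ) • v = p := by simp
    obtain ⟨y, hy1, hy2, hy3⟩ := IsLab.eq_rotation hκ (by rw [hp]; exact h) hη hb hc hr hl
    have h1 : v.2.2 (fstIdx 0) = 0 := (hc (fstIdx 0)).unique hs
    rw [hy3] at h1
    have hy0 : y = 0 := by linarith
    subst hy0
    refine Prod.ext ?_ (Prod.ext ?_ ?_)
    · rw [hy2]; simp
    · ext1 j; rw [hy1 j]; simp
    · ext1 i; rw [hy3 i]; simp

/-- The inverses of the zeros. -/
def zeroInv (μ : RealVec m) (j : Fin m) : ℂ := (radius μ j : ℂ)⁻¹ * circleCover (-angle μ j)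

/-- The rotation parameter in the coordinates given by the inverses of the zeros. -/
def etaShift (κ : Fin (m + 1) → ℕ) (μ : RealVec m) : ℝ :=
  eta0 μ + 2 * ∑ j : Fin m, (κ j.succ : ℝ) * angle μ j

theorem contDiff_radius (j : Fin m) : ContDiff ℝ ∞ fun μ : RealVec m => radius μ j := by
  unfold radius
  split_ifs <;> fun_prop

theorem contDiff_angle (j : Fin m) : ContDiff ℝ ∞ fun μ : RealVec m => angle μ j := by
  unfold angle
  split_ifs <;> fun_prop

theorem contDiff_etaShift : ContDiff ℝ ∞ (etaShift κ (m := m)) := by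
  unfold etaShift eta0
  have := contDiff_angle (m := m)
  fun_prop

theorem contDiffAt_zeroInv {μ : RealVec m} {j : Fin m} (h : radius μ j ≠ 0) :
    ContDiffAt ℝ ∞ (fun μ : RealVec m => zeroInv μ j) μ := by
  unfold zeroInv
  refine ContDiffAt.mul (ContDiffAt.inv ?_ (Complex.ofReal_ne_zero.2 h)) ?_
  · exact (Complex.ofRealCLM.contDiff.comp (contDiff_radius j)).contDiffAt
  · exact (contDiff_circleCover.comp (contDiff_angle j).neg).contDiffAt

theorem norm_zeroInv {μ : RealVec m} {j : Fin m} (h : 0 < radius μ j) :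
    ‖zeroInv μ j‖ = (radius μ j)⁻¹ := by
  rw [zeroInv, norm_mul, norm_circleCover, mul_one, norm_inv, Complex.norm_real,
    Real.norm_of_nonneg h.le]

theorem norm_zeroInv_lt_one {μ : RealVec m} {j : Fin m} (h : 1 < radius μ j) :
    ‖zeroInv μ j‖ < 1 := by
  rw [norm_zeroInv (one_pos.trans h)]
  exact inv_lt_one_of_one_lt₀ h

/-- The critical data in the original parameters. -/
def xiParam (κ : Fin (m + 1) → ℕ) (q : RealVec m × RealVec m) : RealVec m × RealVec m :=
  (fun i => rr κ (zeroInv q.1) (q.2 i), fun i => lr κ (etaShift κ q.1) (zeroInv q.1) (q.2 i))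

theorem contDiffAt_xiParam {q : RealVec m × RealVec m} (hq : ∀ j, 1 < radius q.1 j) :
    ContDiffAt ℝ ∞ (xiParam κ) q := by
  have h1 : ∀ j, ContDiffAt ℝ ∞ (fun q : RealVec m × RealVec m => zeroInv q.1 j) q := fun j =>
    (contDiffAt_zeroInv (one_pos.trans (hq j)).ne').comp q contDiffAt_fst
  have h2 : ContDiffAt ℝ ∞ (fun q : RealVec m × RealVec m => etaShift κ q.1) q :=
    (contDiff_etaShift.contDiffAt).comp q contDiffAt_fst
  have h3 := fun j => norm_zeroInv_lt_one (hq j)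
  refine ContDiffAt.prodMk (contDiffAt_pi.2 fun i => ?_) (contDiffAt_pi.2 fun i => ?_)
  · exact contDiffAt_rr (β := fun q : RealVec m × RealVec m => zeroInv q.1) h1 (by fun_prop) h3
  · exact contDiffAt_lr (β := fun q : RealVec m × RealVec m => zeroInv q.1) h2 h1 (by fun_prop) h3

/-- The logarithmic derivative separates the coordinates: the radius contributes the real part, the
angle the imaginary part. -/
theorem hasDerivAt_zeroInv_line {μ v : RealVec m} {j : Fin m} (h : radius μ j ≠ 0) :
    HasDerivAt (fun s : ℝ => zeroInv (μ + s • v) j)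
      (zeroInv μ j * (-(radius v j / radius μ j : ℝ) - 2 * Real.pi * Complex.I * angle v j)) 0 := by
  have hR : ∀ s : ℝ, radius (μ + s • v) j = radius μ j + s * radius v j := by
    intro s; unfold radius; split_ifs <;> simp
  have hA : ∀ s : ℝ, angle (μ + s • v) j = angle μ j + s * angle v j := by
    intro s; unfold angle; split_ifs <;> simp
  have h1 : HasDerivAt (fun s : ℝ => ((radius μ j + s * radius v j : ℝ) : ℂ)) (radius v j : ℂ) 0 := by
    have := ((hasDerivAt_mul_const (radius v j) (x := (0 : ℝ))).const_add (radius μ j)).ofReal_comp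
    exact this
  have h2 : HasDerivAt (fun s : ℝ => -(angle μ j + s * angle v j)) (-angle v j) 0 :=
    ((hasDerivAt_mul_const (angle v j) (x := (0 : ℝ))).const_add (angle μ j)).neg
  have h3 : ((radius μ j + 0 * radius v j : ℝ) : ℂ) ≠ 0 := by
    rw [zero_mul, add_zero]; exact Complex.ofReal_ne_zero.2 h
  have h4 := (h1.inv h3).mul (hasDerivAt_circleCover_comp h2)
  simp only [zeroInv, hR, hA]
  refine h4.congr_deriv ?_
  simp only [Pi.inv_apply, zero_mul, add_zero]
  have h5 : (radius μ j : ℂ) ≠ 0 := Complex.ofReal_ne_zero.2 h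
  push_cast
  field_simp
  ring

theorem etaShift_line (μ v : RealVec m) (s : ℝ) :
    etaShift κ (μ + s • v) = etaShift κ μ + s * etaShift κ v := by
  have hA : ∀ j, angle (μ + s • v) j = angle μ j + s * angle v j := by
    intro j; unfold angle; split_ifs <;> simp
  simp only [etaShift, hA, eta0, Pi.add_apply, Pi.smul_apply, smul_eq_mul, mul_add,
    Finset.sum_add_distrib]
  have : ∑ j : Fin m, (κ j.succ : ℝ) * (s * angle v j) =
      s * ∑ j : Fin m, (κ j.succ : ℝ) * angle v j := by
    rw [Finset.mul_sum]; exact Finset.sum_congr rfl fun j _ => by ring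
  rw [this]
  ring

theorem eq_zero_of_coordinates {v : RealVec m} (h0 : eta0 v = 0) (hr : ∀ j, radius v j = 0)
    (ha : ∀ j, angle v j = 0) : v = 0 := by
  ext1 i
  obtain ⟨j, rfl | rfl⟩ := eq_fstIdx_or_sndIdx i
  · by_cases hj : j = 0
    · subst hj; exact h0
    · have := hr j
      rwa [radius, if_neg hj] at this
  · by_cases hj : j = 0
    · subst hj
      have := hr 0
      rwa [radius, if_pos rfl] at this
    · have := ha j
      rwa [angle, if_neg hj] at this

/-- Here the rotation is excluded by the normalization η₁ = 0: a rotation leaves the radii fixed and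
turns all angles by the same amount, in particular the first one, which cannot move. -/
theorem IsLab.exists_xiParam_inverse (hκ : ∀ i, 0 < κ i) {q : RealVec m × RealVec m}
    (hq : ∀ j, 1 < radius q.1 j) (h : IsLab κ (zeroInv q.1) q.2) :
    ∃ g, ContDiffAt ℝ ∞ g (xiParam κ q) ∧ g (xiParam κ q) = q ∧
      (∀ᶠ x in 𝓝 q, g (xiParam κ x) = x) ∧ ∀ᶠ y in 𝓝 (xiParam κ q), xiParam κ (g y) = y := by
  refine exists_smooth_local_inverse (contDiffAt_xiParam hq) rfl fun v hv => ?_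
  have h0 := hasDerivAt_line q v 0
  have hr := hasDerivAt_pi.1 hv.prod_fst
  have hl := hasDerivAt_pi.1 hv.prod_snd
  have hc := hasDerivAt_pi.1 h0.prod_snd
  have hp : q + (0 : ℝ) • v = q := by simp
  have hη : HasDerivAt (fun s : ℝ => etaShift κ (q + s • v).1) (etaShift κ v.1) 0 := by
    have := (hasDerivAt_mul_const (etaShift κ v.1) (x := (0 : ℝ))).const_add (etaShift κ q.1)
    refine this.congr_of_eventuallyEq (Eventually.of_forall fun s => ?_)
    exact etaShift_line q.1 v.1 s
  have hb : ∀ j, HasDerivAt (fun s : ℝ => zeroInv (q + s • v).1 j) (zeroInv q.1 j *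
      (-(radius v.1 j / radius q.1 j : ℝ) - 2 * Real.pi * Complex.I * angle v.1 j)) 0 := fun j =>
    hasDerivAt_zeroInv_line (one_pos.trans (hq j)).ne'
  obtain ⟨y, hy1, hy2, hy3⟩ := IsLab.eq_rotation (c := fun s => (q + s • v).2) hκ
    (by rw [hp]; exact h) hη hb hc hr hl
  have key : ∀ j, radius v.1 j = 0 ∧ angle v.1 j = -y := by
    intro j
    have h1 := hy1 j
    rw [hp, mul_comm (zeroInv q.1 j)] at h1
    have h2 := mul_right_cancel₀ ((h.injective hκ).2 j) h1
    have hpos := one_pos.trans (hq j)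
    have h3 := congrArg Complex.re h2
    have h4 := congrArg Complex.im h2
    simp at h3 h4
    constructor
    · rcases h3 with h3 | h3
      · exact h3
      · exact absurd h3 hpos.ne'
    · have h5 : 2 * Real.pi * (angle v.1 j + y) = 0 := by linarith
      have h6 := (mul_eq_zero.1 h5).resolve_left (by positivity)
      linarith
  have hy0 : y = 0 := by
    have := (key 0).2
    rw [angle, if_pos rfl] at this
    linarith
  subst hy0
  have hang : ∀ j, angle v.1 j = 0 := fun j => by rw [(key j).2, neg_zero]
  refine Prod.ext (eq_zero_of_coordinates ?_ (fun j => (key j).1) hang) ?_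
  · rw [zero_mul, etaShift] at hy2
    simpa [hang] using hy2
  · ext1 i; rw [hy3 i]; simp

/-- Critical points depend smoothly on the parameters. -/
theorem IsLab.exists_smooth_critical (hκ : ∀ i, 0 < κ i) {μ c : RealVec m}
    (hμ : ∀ j, 1 < radius μ j) (h : IsLab κ (zeroInv μ) c) :
    ∃ γ : RealVec m → RealVec m, ContDiffAt ℝ ∞ γ μ ∧ γ μ = c ∧
      ∀ᶠ ν in 𝓝 μ, ∀ i, rr κ (zeroInv ν) (γ ν i) = 0 := by
  -- The implicit function theorem for the critical equations: the derivative in the critical points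
  -- is diagonal, with the nonzero second derivatives as entries.
  set f : RealVec m × RealVec m → RealVec m × RealVec m := fun q => (q.1, (xiParam κ q).1) with hf
  have hfc : ContDiffAt ℝ ∞ f (μ, c) :=
    contDiffAt_fst.prodMk (contDiffAt_fst.comp _ (contDiffAt_xiParam hμ))
  have hfμ : f (μ, c) = (μ, 0) := by
    refine Prod.ext rfl ?_
    ext1 i
    exact h.crit i
  obtain ⟨g, hg1, hg2, -, hg4⟩ := exists_smooth_local_inverse hfc rfl fun v hv => by
    have h1 : v.1 = 0 := (hasDerivAt_line (μ, c) v 0).prod_fst.unique hv.prod_fst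
    refine Prod.ext h1 ?_
    ext1 i
    have h2 := hasDerivAt_pi.1 hv.prod_snd i
    have h3 := (hasDerivAt_pi.1 (hasDerivAt_line (μ, c) v 0).prod_snd) i
    have h4 := hasDerivAt_rr_comp (κ := κ) (b := fun _ => zeroInv μ) (x := 0) (s := 0)
      (fun j => by simpa using hasDerivAt_const (0 : ℝ) (zeroInv μ j)) h3 h.norm_lt
    have h5 := h4.unique (h2.congr_of_eventuallyEq (Eventually.of_forall fun s => by
      simp [hf, xiParam, h1]))
    have h6 := (mul_eq_zero.1 h5).resolve_left (by simpa using h.rr2_ne_zero hκ i)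
    simpa using h6
  rw [hfμ] at hg1 hg2 hg4
  have h1 : ContDiff ℝ ∞ (fun ν : RealVec m => (ν, (0 : RealVec m))) := by fun_prop
  refine ⟨fun ν => (g (ν, 0)).2, contDiffAt_snd.comp μ (hg1.comp μ h1.contDiffAt), by
    simp only [hg2], ?_⟩
  filter_upwards [h1.continuous.continuousAt.eventually hg4] with ν hν i
  have h2 := congrArg Prod.fst hν
  have h3 := congrFun (congrArg Prod.snd hν) i
  simp only [hf, xiParam] at h2 h3
  rw [h2] at h3
  exact h3

end

/-! ### The value region and the position of the critical values in it. -/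

section

variable {m : ℕ} [NeZero m] {κ : Fin (m + 1) → ℕ} {b : Fin m → ℂ} {c : Fin (2 * m) → ℝ}
  {σ : Equiv.Perm (Fin m)}

/-- Splitting by parity turns the sign (-1)^i into descents within a pair and ascents between
consecutive pairs. -/
theorem mem_valueRegion_iff {v : RealVec m} : v ∈ valueRegion κ σ ↔
    ((∀ j, 0 < v (fstIdx j) - v (sndIdx j)) ∧
      (∀ j, v (fstIdx j) - v (sndIdx j) < κ (σ j).succ)) ∧
    (∀ j j' : Fin m, (j : ℕ) + 1 = j' → v (sndIdx j) < v (fstIdx j')) ∧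
    (∀ j : Fin m, (j : ℕ) + 1 = m → v (sndIdx j) - v (fstIdx 0) < circleDegree κ) := by
  constructor
  · rintro ⟨h1, h2, h3⟩
    refine ⟨⟨fun j => (h2 j).1, fun j => (h2 j).2⟩, fun j j' hj => ?_,
      fun j hj => by linarith [h3 j hj]⟩
    have h4 : 2 * (j : ℕ) + 1 + 1 < 2 * m := by have := j'.2; omega
    have h5 := h1 (2 * j + 1) h4
    have h6 : (-1 : ℝ) ^ (2 * (j : ℕ) + 1 + 1) = 1 := Even.neg_one_pow ⟨j + 1, by ring⟩
    have h7 : (⟨2 * (j : ℕ) + 1 + 1, h4⟩ : Fin (2 * m)) = fstIdx j' := by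
      simp only [fstIdx, Fin.mk.injEq]; omega
    rw [h6, one_mul, h7] at h5
    exact sub_pos.1 h5
  · rintro ⟨⟨h1, h2⟩, h3, h4⟩
    refine ⟨fun i hi => ?_, fun j => ⟨h1 j, h2 j⟩, fun j hj => by linarith [h4 j hj]⟩
    rcases Nat.even_or_odd i with he | ho
    · have h5 : (-1 : ℝ) ^ (i + 1) = -1 := Odd.neg_one_pow he.add_one
      obtain ⟨k, hk⟩ := he
      have h6 : (⟨i, by omega⟩ : Fin (2 * m)) = fstIdx ⟨k, by omega⟩ := by
        simp only [fstIdx, Fin.mk.injEq]; omega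
      have h7 : (⟨i + 1, hi⟩ : Fin (2 * m)) = sndIdx ⟨k, by omega⟩ := by
        simp only [sndIdx, Fin.mk.injEq]; omega
      have h8 := h1 ⟨k, by omega⟩
      rw [h5, h6, h7]
      linarith
    · have h5 : (-1 : ℝ) ^ (i + 1) = 1 := Even.neg_one_pow ho.add_one
      obtain ⟨k, hk⟩ := ho
      have h6 : (⟨i, by omega⟩ : Fin (2 * m)) = sndIdx ⟨k, by omega⟩ := by
        simp only [sndIdx, Fin.mk.injEq]; omega
      have h7 : (⟨i + 1, hi⟩ : Fin (2 * m)) = fstIdx ⟨k + 1, by omega⟩ := by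
        simp only [fstIdx, Fin.mk.injEq]; omega
      have h8 := h3 ⟨k, by omega⟩ ⟨k + 1, by omega⟩ rfl
      rw [h5, h6, h7]
      linarith

/-- As a finite intersection of open half-spaces the region is visibly convex and open. -/
theorem valueRegion_eq : valueRegion κ σ =
    ((⋂ j, {v : RealVec m | 0 < v (fstIdx j) - v (sndIdx j)}) ∩
      ⋂ j, {v : RealVec m | v (fstIdx j) - v (sndIdx j) < κ (σ j).succ}) ∩
    ((⋂ j : Fin m, ⋂ j' : Fin m, ⋂ _ : (j : ℕ) + 1 = j',
        {v : RealVec m | v (sndIdx j) - v (fstIdx j') < 0}) ∩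
      ⋂ j : Fin m, ⋂ _ : (j : ℕ) + 1 = m,
        {v : RealVec m | v (sndIdx j) - v (fstIdx 0) < circleDegree κ}) := by
  ext v
  rw [mem_valueRegion_iff]
  simp only [mem_inter_iff, mem_iInter, mem_ofPred_eq, sub_neg]

theorem isLinearMap_sub_apply (i j : Fin (2 * m)) :
    IsLinearMap ℝ (fun v : RealVec m => v i - v j) :=
  ⟨fun x y => by simp only [Pi.add_apply]; ring, fun a x => by
    simp only [Pi.smul_apply, smul_eq_mul]; ring⟩

theorem convex_valueRegion : Convex ℝ (valueRegion κ σ) := by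
  rw [valueRegion_eq]
  refine ((convex_iInter fun j => convex_halfSpace_gt (isLinearMap_sub_apply _ _) _).inter
    (convex_iInter fun j => convex_halfSpace_lt (isLinearMap_sub_apply _ _) _)).inter
    ((convex_iInter fun j => convex_iInter fun j' => convex_iInter fun _ =>
      convex_halfSpace_lt (isLinearMap_sub_apply _ _) _).inter
    (convex_iInter fun j => convex_iInter fun _ =>
      convex_halfSpace_lt (isLinearMap_sub_apply _ _) _))

theorem isOpen_valueRegion : IsOpen (valueRegion κ σ) := by
  rw [valueRegion_eq]
  have h : ∀ i j : Fin (2 * m), Continuous fun v : RealVec m => v i - v j := fun i j => by fun_prop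
  refine ((isOpen_iInter_of_finite fun j => isOpen_lt continuous_const (h _ _)).inter
    (isOpen_iInter_of_finite fun j => isOpen_lt (h _ _) continuous_const)).inter
    ((isOpen_iInter_of_finite fun j => isOpen_iInter_of_finite fun j' =>
      isOpen_iInter_of_finite fun _ => isOpen_lt (h _ _) continuous_const).inter
    (isOpen_iInter_of_finite fun j => isOpen_iInter_of_finite fun _ =>
      isOpen_lt (h _ _) continuous_const))

theorem add_const_mem_valueRegion {v : RealVec m} (x : ℝ) (hv : v ∈ valueRegion κ σ) :
    (fun i => v i + x) ∈ valueRegion κ σ := by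
  rw [mem_valueRegion_iff] at *
  obtain ⟨⟨h1, h2⟩, h3, h4⟩ := hv
  refine ⟨⟨fun j => ?_, fun j => ?_⟩, fun j j' hj => ?_, fun j hj => ?_⟩
  · linarith [h1 j]
  · linarith [h2 j]
  · linarith [h3 j j' hj]
  · linarith [h4 j hj]

theorem lr_eq_add (η : ℝ) (b : Fin m → ℂ) (t : ℝ) : lr κ η b t = η + lr κ 0 b t := by
  rw [lr, lr]; ring

theorem continuous_lr (η : ℝ) (hb : ∀ j, ‖b j‖ < 1) : Continuous (lr κ η b) :=
  continuous_iff_continuousAt.2 fun t => (hasDerivAt_lr η hb t).continuousAt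

theorem lr_strictMonoOn {η s t : ℝ} (hb : ∀ j, ‖b j‖ < 1) (h : ∀ x ∈ Ioo s t, 0 < rr κ b x) :
    StrictMonoOn (lr κ η b) (Icc s t) := by
  refine strictMonoOn_of_deriv_pos (convex_Icc s t) (continuous_lr η hb).continuousOn fun x hx => ?_
  rw [interior_Icc] at hx
  rw [(hasDerivAt_lr η hb x).deriv]
  exact h x hx

theorem lr_strictAntiOn {η s t : ℝ} (hb : ∀ j, ‖b j‖ < 1) (h : ∀ x ∈ Ioo s t, rr κ b x < 0) :
    StrictAntiOn (lr κ η b) (Icc s t) := by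
  refine strictAntiOn_of_deriv_neg (convex_Icc s t) (continuous_lr η hb).continuousOn fun x hx => ?_
  rw [interior_Icc] at hx
  rw [(hasDerivAt_lr η hb x).deriv]
  exact h x hx

namespace IsLab

theorem ascent (hκ : ∀ i, 0 < κ i) (h : IsLab κ b c) (η : ℝ) {j j' : Fin m}
    (hj : (j : ℕ) + 1 = j') : lr κ η b (c (sndIdx j)) < lr κ η b (c (fstIdx j')) := by
  have h1 : sndIdx j < fstIdx j' := by
    simp only [sndIdx, fstIdx, Fin.lt_def]; omega
  have h2 := h.strictMono h1
  refine lr_strictMonoOn h.norm_lt (fun x hx => h.rr_pos hκ hx.1 (fun i hi => ?_)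
    (hx.2.trans (h.lt_add_one _))) (left_mem_Icc.2 h2.le) (right_mem_Icc.2 h2.le) h2
  refine hx.2.trans_le (h.strictMono.monotone ?_)
  simp only [fstIdx, Fin.le_def, Fin.lt_def] at *
  omega

/-- The last ascent ends at the first maximum one period later, where the lift has gained `d`. -/
theorem ascent_last (hκ : ∀ i, 0 < κ i) (h : IsLab κ b c) (η : ℝ) {j : Fin m}
    (hj : (j : ℕ) + 1 = m) :
    lr κ η b (c (sndIdx j)) < lr κ η b (c (fstIdx 0)) + circleDegree κ := by
  have h1 := lr_add_int (κ := κ) η b (c (fstIdx 0)) 1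
  push_cast at h1
  rw [one_mul] at h1
  rw [← h1]
  have h2 := h.lt_add_one (sndIdx j)
  refine lr_strictMonoOn h.norm_lt (fun x hx => h.rr_pos hκ hx.1 (fun i hi => ?_)
    hx.2) (left_mem_Icc.2 h2.le) (right_mem_Icc.2 h2.le) h2
  have := i.2
  simp only [Fin.lt_def] at hi
  omega

/-- If the bound were attained, the local inverse of the critical data could raise the maximum
slightly with all other values fixed; the type persists, and the non-strict bound is violated. -/
theorem descent_lt (hκ : ∀ i, 0 < κ i) (h : IsLab κ b c) (hσ : IsType κ b c σ) (j : Fin m) :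
    lr κ 0 b (c (fstIdx j)) - lr κ 0 b (c (sndIdx j)) < κ (σ j).succ := by
  refine lt_of_le_of_ne (h.descent_le hκ hσ j) fun heq => ?_
  obtain ⟨g, hg1, hg2, -, hg4⟩ := IsLab.exists_xi_inverse (p := (0, b, c)) hκ h
  -- The direction that raises only the value at the maximum of arc `j`, keeping the critical
  -- equations and the first marked point.
  set e : (RealVec m × RealVec m) × ℝ := ((0, Pi.single (fstIdx j) 1), 0) with he
  have hpath : Tendsto (fun s : ℝ => xi κ (0, b, c) + s • e) (𝓝[>] 0) (𝓝 (xi κ (0, b, c))) := by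
    have h1 : Continuous fun s : ℝ => xi κ (0, b, c) + s • e := by fun_prop
    have h2 := h1.tendsto 0
    rw [zero_smul, add_zero] at h2
    exact h2.mono_left nhdsWithin_le_nhds
  have hg : Tendsto (fun s : ℝ => (g (xi κ (0, b, c) + s • e)).2) (𝓝[>] 0) (𝓝 (b, c)) := by
    have h1 := hg1.continuousAt.tendsto.comp hpath
    rw [hg2] at h1
    exact (continuous_snd.tendsto _).comp h1
  obtain ⟨s, ⟨h1, h2⟩, hs⟩ := (((hg.eventually (h.eventually_isType hκ hσ)).and
    (hpath.eventually hg4)).and self_mem_nhdsWithin).exists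
  have hs' : (0 : ℝ) < s := hs
  generalize g (xi κ (0, b, c) + s • e) = P at h1 h2
  have h3 : ∀ i, rr κ P.2.1 (P.2.2 i) = 0 := by
    intro i
    have := congrFun (congrArg (fun x => x.1.1) h2) i
    simp only [xi, he] at this
    simpa [h.crit i] using this
  have h4 : ∀ i, lr κ P.1 P.2.1
      (P.2.2 i) =
        lr κ 0 b (c i) + s * (Pi.single (fstIdx j) 1 : RealVec m) i := by
    intro i
    have := congrFun (congrArg (fun x => x.1.2) h2) i
    simpa [xi, he] using this
  obtain ⟨h5, h6⟩ := h1 h3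
  have h7 := h5.descent_le hκ h6 j
  have h8 := h4 (fstIdx j)
  have h9 := h4 (sndIdx j)
  rw [lr_eq_add] at h8 h9
  rw [Pi.single_eq_same] at h8
  rw [Pi.single_eq_of_ne (fstIdx_lt_sndIdx j).ne'] at h9
  linarith

/-- The critical values of a labelled map lie in the value region. -/
theorem values_mem (hκ : ∀ i, 0 < κ i) (h : IsLab κ b c) (hσ : IsType κ b c σ) (η : ℝ) :
    (fun i => lr κ η b (c i)) ∈ valueRegion κ σ := by
  rw [mem_valueRegion_iff]
  refine ⟨⟨fun j => ?_, fun j => ?_⟩, fun j j' hj => h.ascent hκ η hj, fun j hj => ?_⟩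
  · rw [lr_eq_add η, lr_eq_add η b (c (sndIdx j))]; linarith [h.desc j]
  · rw [lr_eq_add η, lr_eq_add η b (c (sndIdx j))]; linarith [h.descent_lt hκ hσ j]
  · linarith [h.ascent_last hκ η hj]

end IsLab
end

/-! ### Properness: a zero close to the circle forces a nearly maximal descent. -/

section

variable {m : ℕ} {κ : Fin (m + 1) → ℕ} {b : Fin m → ℂ}

theorem one_add_two_mul_re_div {u : ℂ} (hu : 1 - u ≠ 0) :
    1 + 2 * (u / (1 - u)).re = (1 - ‖u‖ ^ 2) / ‖1 - u‖ ^ 2 := by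
  have h1 : Complex.normSq (1 - u) ≠ 0 := fun h => hu (Complex.normSq_eq_zero.1 h)
  rw [Complex.sq_norm, Complex.sq_norm, Complex.div_re, eq_div_iff h1]
  field_simp
  simp [Complex.normSq_apply]
  ring

/-- The derivative is k₀ minus a weighted sum of Poisson kernels, each peaked in the direction of a
zero; all are positive, so a single peak already bounds it from above. -/
theorem rr_eq_sum_poisson (hb : ∀ j, ‖b j‖ < 1) (t : ℝ) : rr κ b t =
    κ 0 - ∑ j : Fin m, (κ j.succ : ℝ) * ((1 - ‖b j‖ ^ 2) / ‖1 - b j * circleCover t‖ ^ 2) := by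
  have h1 : ∀ j, (1 - ‖b j‖ ^ 2) / ‖1 - b j * circleCover t‖ ^ 2 =
      1 + 2 * (b j * circleCover t / (1 - b j * circleCover t)).re := fun j => by
    rw [one_add_two_mul_re_div (one_sub_ne_zero (norm_mul_lt_one (hb j) (norm_circleCover t))),
      norm_mul, norm_circleCover, mul_one]
  simp only [h1, rr, circleDegree, mul_add, mul_one, Finset.sum_add_distrib, Finset.mul_sum]
  push_cast
  rw [sub_sub]
  congr 2
  exact Finset.sum_congr rfl fun j _ => by ring

/-- Since 1 - cos x ≤ x²/2, the Poisson kernel dominates a Lorentz profile, whose primitive is an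
arctangent. -/
theorem norm_one_sub_mul_circleCover_sq_le {R s : ℝ} (h0 : 0 ≤ R) (h1 : R ≤ 1) :
    ‖1 - (R : ℂ) * circleCover s‖ ^ 2 ≤ (1 - R) ^ 2 + 4 * Real.pi ^ 2 * s ^ 2 := by
  have h2 : circleCover s = Complex.exp ((2 * Real.pi * s : ℝ) * Complex.I) := by
    rw [circleCover]; congr 1; push_cast; ring
  have h3 : (circleCover s).re = Real.cos (2 * Real.pi * s) := by
    rw [h2, Complex.exp_ofReal_mul_I_re]
  have h4 : (circleCover s).im = Real.sin (2 * Real.pi * s) := by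
    rw [h2, Complex.exp_ofReal_mul_I_im]
  rw [Complex.sq_norm, Complex.normSq_apply]
  simp only [Complex.sub_re, Complex.one_re, Complex.mul_re, Complex.ofReal_re, Complex.ofReal_im,
    zero_mul, sub_zero, Complex.sub_im, Complex.one_im, Complex.mul_im, add_zero, zero_sub, h3, h4]
  have h5 := Real.one_sub_sq_div_two_le_cos (x := 2 * Real.pi * s)
  have h6 := Real.sin_sq_add_cos_sq (2 * Real.pi * s)
  set C := Real.cos (2 * Real.pi * s)
  set S := Real.sin (2 * Real.pi * s)
  have h7 : (1 - R * C) * (1 - R * C) + -(R * S) * -(R * S) = (1 - R) ^ 2 + R * (2 * (1 - C)) := by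
    have : S ^ 2 = 1 - C ^ 2 := by linarith
    linear_combination R ^ 2 * this
  rw [h7]
  have h8 : 2 * (1 - C) ≤ 4 * Real.pi ^ 2 * s ^ 2 := by nlinarith
  have h9 : 0 ≤ 2 * (1 - C) := by linarith [Real.cos_le_one (2 * Real.pi * s)]
  nlinarith

variable {i : Fin m} {R θ : ℝ}

theorem rr_le_of_peak (hb : ∀ j, ‖b j‖ < 1) (hi : b i * circleCover θ = R) (h0 : 0 ≤ R) (h1 : R < 1)
    (t : ℝ) : rr κ b t ≤
      κ 0 - κ i.succ * ((1 - R ^ 2) / ((1 - R) ^ 2 + 4 * Real.pi ^ 2 * (t - θ) ^ 2)) := by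
  have hn : ‖b i‖ = R := by
    have := congrArg norm hi
    rwa [norm_mul, norm_circleCover, mul_one, Complex.norm_real, Real.norm_of_nonneg h0] at this
  have h2 : b i * circleCover t = R * circleCover (t - θ) := by
    rw [← hi, mul_assoc, ← circleCover_add]; congr 2; ring
  rw [rr_eq_sum_poisson hb]
  have hnn : ∀ j, 0 ≤ (1 - ‖b j‖ ^ 2) / ‖1 - b j * circleCover t‖ ^ 2 := fun j =>
    div_nonneg (by nlinarith [hb j, norm_nonneg (b j)]) (by positivity)
  have h3 : (κ i.succ : ℝ) * ((1 - ‖b i‖ ^ 2) / ‖1 - b i * circleCover t‖ ^ 2) ≤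
      ∑ j : Fin m, (κ j.succ : ℝ) * ((1 - ‖b j‖ ^ 2) / ‖1 - b j * circleCover t‖ ^ 2) :=
    Finset.single_le_sum (f := fun j => (κ j.succ : ℝ) *
      ((1 - ‖b j‖ ^ 2) / ‖1 - b j * circleCover t‖ ^ 2))
      (fun j _ => mul_nonneg (Nat.cast_nonneg _) (hnn j)) (Finset.mem_univ i)
  have h4 : (1 - R ^ 2) / ((1 - R) ^ 2 + 4 * Real.pi ^ 2 * (t - θ) ^ 2) ≤
      (1 - ‖b i‖ ^ 2) / ‖1 - b i * circleCover t‖ ^ 2 := by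
    rw [hn, h2]
    refine div_le_div_of_nonneg_left (by nlinarith) ?_
      (norm_one_sub_mul_circleCover_sq_le h0 h1.le)
    have := norm_pos_iff.2 (one_sub_ne_zero (norm_mul_lt_one (hb i) (norm_circleCover t)))
    rw [h2] at this
    positivity
  have h5 := mul_le_mul_of_nonneg_left h4 (Nat.cast_nonneg (α := ℝ) (κ i.succ))
  linarith

/-- The comparison function `G`, the lift corrected by k₀ t and by the arctangent primitive of the
peak, is nonincreasing; comparing the ends of the window gives the bound without integration. -/
theorem descent_of_peak (hb : ∀ j, ‖b j‖ < 1) (hi : b i * circleCover θ = R) (h0 : 0 ≤ R)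
    (h1 : R < 1) {w : ℝ} (hw : 0 ≤ w) :
    -(2 * κ 0 * w) + κ i.succ * ((1 + R) / Real.pi) * Real.arctan (2 * Real.pi * w / (1 - R)) ≤
      lr κ 0 b (θ - w) - lr κ 0 b (θ + w) := by
  set G : ℝ → ℝ := fun t => lr κ 0 b t - κ 0 * t +
    κ i.succ * ((1 + R) / (2 * Real.pi)) * Real.arctan (2 * Real.pi * (t - θ) / (1 - R)) with hG
  have hR : 0 < 1 - R := by linarith
  have hd : ∀ t, HasDerivAt G (rr κ b t - κ 0 + κ i.succ * ((1 - R ^ 2) /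
      ((1 - R) ^ 2 + 4 * Real.pi ^ 2 * (t - θ) ^ 2))) t := by
    intro t
    have h2 : HasDerivAt (fun t => 2 * Real.pi * (t - θ) / (1 - R)) (2 * Real.pi * 1 / (1 - R)) t :=
      (((hasDerivAt_id t).sub_const θ).const_mul (2 * Real.pi)).div_const _
    have h3 := ((hasDerivAt_lr (κ := κ) 0 hb t).sub ((hasDerivAt_id t).const_mul (κ 0 : ℝ))).add
      (h2.arctan.const_mul ((κ i.succ : ℝ) * ((1 + R) / (2 * Real.pi))))
    refine h3.congr_deriv ?_
    rw [mul_one]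
    congr 1
    have h4 : 0 < (1 - R) ^ 2 + 4 * Real.pi ^ 2 * (t - θ) ^ 2 := by positivity
    have h5 : 1 + (2 * Real.pi * (t - θ) / (1 - R)) ^ 2 =
        ((1 - R) ^ 2 + 4 * Real.pi ^ 2 * (t - θ) ^ 2) / (1 - R) ^ 2 := by
      field_simp; ring
    rw [h5]
    have := Real.pi_pos
    field_simp
    ring
  have hanti : Antitone G := antitone_of_deriv_nonpos (fun t => (hd t).differentiableAt) fun t => by
    rw [(hd t).deriv]
    linarith [rr_le_of_peak (κ := κ) hb hi h0 h1 t]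
  have h2 := hanti (show θ - w ≤ θ + w by linarith)
  simp only [hG] at h2
  have h3 : 2 * Real.pi * (θ + w - θ) / (1 - R) = 2 * Real.pi * w / (1 - R) := by ring
  have h4 : 2 * Real.pi * (θ - w - θ) / (1 - R) = -(2 * Real.pi * w / (1 - R)) := by ring
  rw [h3, h4, Real.arctan_neg] at h2
  have h5 : (κ i.succ : ℝ) * ((1 + R) / Real.pi) =
      2 * ((κ i.succ : ℝ) * ((1 + R) / (2 * Real.pi))) := by
    have := Real.pi_pos
    field_simp
  rw [h5]
  linarith

theorem norm_factor_le {x z : ℂ} (hx : ‖x‖ < 1) (hz : 1 ≤ ‖z‖) : ‖1 - x * z‖ ≤ ‖z - star x‖ := by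
  refine (sq_le_sq₀ (norm_nonneg _) (norm_nonneg _)).1 ?_
  have h1 : ‖z - star x‖ ^ 2 - ‖1 - x * z‖ ^ 2 = (1 - ‖x‖ ^ 2) * (‖z‖ ^ 2 - 1) := by
    simp only [Complex.sq_norm, Complex.normSq_apply, Complex.star_def]
    simp
    ring
  have h2 : 0 ≤ (1 - ‖x‖ ^ 2) * (‖z‖ ^ 2 - 1) :=
    mul_nonneg (by nlinarith [norm_nonneg x]) (by nlinarith)
  linarith

/-- Bernoulli's inequality gives (1 + s)^n (1 - ns) ≤ (1 - s²)^n ≤ 1 for s ≤ 1, so the growth of (1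
+ s)^n costs at most a factor 1/(1 - ns), which the quotient of the two linear terms outweighs when
1 - R is small. -/
theorem one_add_pow_mul_lt {n : ℕ} {R s : ℝ} (hR : 1 / 2 ≤ R) (hR1 : R < 1)
    (hn : 3 * n * (1 - R) < 1) (hs : 0 < s) (hs1 : R * s ≤ 1 - R) :
    (1 + s) ^ n * (1 - R - R * s) < 1 - R + s := by
  have h1 : s ≤ 2 * (1 - R) := by nlinarith
  have hn0 : (0 : ℝ) ≤ n := Nat.cast_nonneg n
  by_cases hs2 : 2 < s
  · linarith
  have hns : n * s ≤ 2 * (n * (1 - R)) := by nlinarith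
  have h2 : 1 - n * s ≤ (1 - s) ^ n := by
    have := one_add_mul_le_pow (a := -s) (by linarith) n
    rw [← sub_eq_add_neg] at this
    linarith
  have h3 : (1 + s) ^ n * (1 - n * s) ≤ 1 := by
    have hs3 : s ≤ 1 := by linarith
    calc (1 + s) ^ n * (1 - n * s) ≤ (1 + s) ^ n * (1 - s) ^ n := by gcongr
      _ = (1 - s ^ 2) ^ n := by rw [← mul_pow]; congr 1; ring
      _ ≤ 1 := pow_le_one₀ (by nlinarith) (by nlinarith)
  have h4 : 1 - R - R * s < (1 - R + s) * (1 - n * s) := by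
    have : n * (1 - R) + n * s < 1 := by linarith
    nlinarith
  calc (1 + s) ^ n * (1 - R - R * s) < (1 + s) ^ n * ((1 - R + s) * (1 - n * s)) := by gcongr
    _ = (1 - R + s) * ((1 + s) ^ n * (1 - n * s)) := by ring
    _ ≤ (1 - R + s) * 1 := mul_le_mul_of_nonneg_left h3 (by linarith)
    _ = _ := mul_one _

/-- On the ray from the circle to the zero the factor of index `i` is (1 - R - Rs) / (1 - R + s); it
beats z^{k₀}, and all other factors have modulus at most 1. -/
theorem radial_mem_outSet (hκ : ∀ i, 0 < κ i) (hb : ∀ j, ‖b j‖ < 1)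
    (hi : b i * circleCover θ = R) (hR : 1 / 2 ≤ R)
    (hR1 : R < 1) (hn : 3 * κ 0 * (1 - R) < 1) {s : ℝ} (hs : 0 < s) (hs1 : R * s ≤ 1 - R) :
    ((1 + s : ℝ) : ℂ) * circleCover θ ∈ outSet κ b := by
  set z : ℂ := ((1 + s : ℝ) : ℂ) * circleCover θ with hz
  have hzn : ‖z‖ = 1 + s := by
    rw [hz, norm_mul, norm_circleCover, mul_one, Complex.norm_real,
      Real.norm_of_nonneg (by linarith)]
  refine ⟨by rw [hzn]; linarith, ?_⟩
  have hz1 : 1 ≤ ‖z‖ := by rw [hzn]; linarith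
  have hnp := fun j => norm_pos_iff.2 (nonpole_of_one_le hb hz1 j)
  have h1 : ∀ j, ‖(1 - b j * z) / (z - star (b j))‖ ≤ 1 := fun j => by
    rw [norm_div, div_le_one (hnp j)]
    exact norm_factor_le (hb j) hz1
  have h2 : 1 - b i * z = ((1 - R - R * s : ℝ) : ℂ) := by
    rw [hz, mul_left_comm, hi]; push_cast; ring
  have h3 : ‖z - star (b i)‖ = 1 - R + s := by
    have h4 : star (b i) = R * circleCover θ := by
      have h5 : b i = R * circleCover (-θ) := by
        rw [← hi, mul_assoc, ← circleCover_add]; simp [circleCover]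
      rw [h5, star_mul', star_circleCover, neg_neg, Complex.star_def, Complex.conj_ofReal]
    rw [h4, hz, ← sub_mul, ← Complex.ofReal_sub, norm_mul, norm_circleCover, mul_one,
      Complex.norm_real, Real.norm_of_nonneg (by linarith)]
    ring
  have h4 : ‖(1 - b i * z) / (z - star (b i))‖ = (1 - R - R * s) / (1 - R + s) := by
    rw [norm_div, h3, h2, Complex.norm_real, Real.norm_of_nonneg (by linarith)]
  have hpos : 0 < 1 - R + s := by linarith
  rw [bl, norm_mul, norm_mul, norm_circleCover, one_mul, norm_pow, hzn, norm_prod,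
    ← Finset.mul_prod_erase _ _ (Finset.mem_univ i)]
  have h5 : ∏ j ∈ Finset.univ.erase i, ‖((1 - b j * z) / (z - star (b j))) ^ κ j.succ‖ ≤ 1 :=
    Finset.prod_le_one (fun j _ => norm_nonneg _) fun j _ => by
      rw [norm_pow]; exact pow_le_one₀ (norm_nonneg _) (h1 j)
  have h6 : ‖((1 - b i * z) / (z - star (b i))) ^ κ i.succ‖ ≤ (1 - R - R * s) / (1 - R + s) := by
    rw [norm_pow, ← h4]
    exact pow_le_of_le_one (norm_nonneg _) (h1 i) (hκ _).ne'
  calc (1 + s) ^ κ 0 * (‖((1 - b i * z) / (z - star (b i))) ^ κ i.succ‖ *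
        ∏ j ∈ Finset.univ.erase i, ‖((1 - b j * z) / (z - star (b j))) ^ κ j.succ‖)
      ≤ (1 + s) ^ κ 0 * ((1 - R - R * s) / (1 - R + s) * 1) := by
        refine mul_le_mul_of_nonneg_left (mul_le_mul h6 h5 ?_ ?_) (by positivity)
        · exact Finset.prod_nonneg fun j _ => norm_nonneg _
        · exact div_nonneg (by linarith) hpos.le
    _ < 1 := by
        rw [mul_one, ← mul_div_assoc, div_lt_one hpos]
        exact one_add_pow_mul_lt hR hR1 hn hs hs1

/-- The radial segment from the zero to the circle lies in the exterior region, so the component of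
this zero touches at the peak. This ties the large descent to the right multiplicity. -/
theorem touch_of_peak (hκ : ∀ i, 0 < κ i) (hb : ∀ j, ‖b j‖ < 1)
    (hi : b i * circleCover θ = R) (hR : 1 / 2 ≤ R) (hR1 : R < 1)
    (hn : 3 * κ 0 * (1 - R) < 1) : θ ∈ touch κ b i := by
  have hR0 : 0 < R := by linarith
  set s₀ := (1 - R) / R with hs₀
  have hs₀0 : 0 < s₀ := div_pos (by linarith) hR0
  have hmul : R * s₀ = 1 - R := by rw [hs₀]; field_simp
  set f : ℝ → ℂ := fun s => ((1 + s : ℝ) : ℂ) * circleCover θ with hf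
  have hfc : Continuous f := by rw [hf]; fun_prop
  have hout : ∀ s ∈ Ioc 0 s₀, f s ∈ outSet κ b := fun s hs =>
    radial_mem_outSet hκ hb hi hR hR1 hn hs.1 (by nlinarith [hs.2])
  have hend : f s₀ = (b i)⁻¹ := by
    refine eq_inv_of_mul_eq_one_left ?_
    rw [hf]
    simp only
    rw [mul_assoc, mul_comm (circleCover θ), hi, ← Complex.ofReal_mul, add_mul, one_mul,
      mul_comm s₀, hmul]
    simp
  have hsub := subset_outComp (i := i) (isPreconnected_Ioc.image f hfc.continuousOn)
    (by rintro _ ⟨s, hs, rfl⟩; exact hout s hs) ⟨s₀, ⟨hs₀0, le_rfl⟩, rfl⟩ (by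
      rw [hend]
      exact mem_connectedComponentIn (hend ▸ hout s₀ ⟨hs₀0, le_rfl⟩))
  have h1 : Tendsto f (𝓝[>] 0) (𝓝 (circleCover θ)) := by
    have h2 := hfc.tendsto 0
    have h3 : f 0 = circleCover θ := by simp [hf]
    rw [h3] at h2
    exact h2.mono_left nhdsWithin_le_nhds
  refine mem_closure_of_tendsto h1 ?_
  filter_upwards [Ioc_mem_nhdsGT hs₀0] with s hs
  exact hsub ⟨s, hs, rfl⟩

variable [NeZero m] {c : Fin (2 * m) → ℝ} {σ : Equiv.Perm (Fin m)}

/-- The window contains no critical point, so it lies inside one arc, which belongs to zero `i`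
because its centre does; the lift is monotone on that arc. -/
theorem IsLab.descent_ge_of_window (hκ : ∀ i, 0 < κ i) (h : IsLab κ b c) (hσ : IsType κ b c σ)
    {w : ℝ} (hw : 0 ≤ w) (hneg : ∀ t ∈ Icc (θ - w) (θ + w), rr κ b t < 0) (hθ : θ ∈ touch κ b i) :
    lr κ 0 b (θ - w) - lr κ 0 b (θ + w) ≤
      lr κ 0 b (c (fstIdx (σ.symm i))) - lr κ 0 b (c (sndIdx (σ.symm i))) := by
  obtain ⟨j, n, hj⟩ := h.exists_arc_of_rr_neg hκ (hneg θ ⟨by linarith, by linarith⟩)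
  have hθ' : θ - n ∈ touch κ b i := by
    have := touch_add_int (κ := κ) (b := b) (i := i) (t := θ) (-n)
    push_cast at this
    exact this.2 hθ
  have hij : i = σ j := (hσ j _ hj i).1 hθ'
  subst hij
  rw [Equiv.symm_apply_apply]
  have hneg' : ∀ t ∈ Icc (θ - n - w) (θ - n + w), rr κ b t ≠ 0 := fun t ht => by
    rw [← rr_add_int b t n]
    exact (hneg _ ⟨by linarith [ht.1], by linarith [ht.2]⟩).ne
  have h1 : c (fstIdx j) ≤ θ - n - w := by
    by_contra hlt
    rw [not_le] at hlt
    exact hneg' _ ⟨hlt.le, by linarith [hj.1]⟩ (h.crit _)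
  have h2 : θ - n + w ≤ c (sndIdx j) := by
    by_contra hlt
    rw [not_le] at hlt
    exact hneg' _ ⟨by linarith [hj.2], hlt.le⟩ (h.crit _)
  have hanti := (lr_strictAntiOn (η := 0) h.norm_lt fun x hx => h.rr_neg (j := j) hκ hx).antitoneOn
  have hle := h.strictMono.monotone (fstIdx_lt_sndIdx j).le
  have h3 := hanti (left_mem_Icc.2 hle) ⟨h1, by linarith⟩ h1
  have h4 := hanti ⟨by linarith, h2⟩ (right_mem_Icc.2 hle) h2
  have h5 := lr_add_int (κ := κ) 0 b (θ - n - w) n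
  have h6 := lr_add_int (κ := κ) 0 b (θ - n + w) n
  have h7 : θ - n - w + n = θ - w := by ring
  have h8 : θ - n + w + n = θ + w := by ring
  rw [h7] at h5
  rw [h8] at h6
  linarith

/-- As R = |b_i| tends to 1, the descent over a window of half-width M(1 - R) around the peak is at
least a quantity tending to k_i (2/π) arctan(2πM). For large M this exceeds k_i - ε. -/
theorem exists_radius_bound_single (hκ : ∀ i, 0 < κ i) {ε : ℝ} (hε : 0 < ε) (i : Fin m) :
    ∃ ρ < 1, ∀ b c σ, IsLab κ b c → IsType κ b c σ →
      (∀ j, lr κ 0 b (c (fstIdx j)) - lr κ 0 b (c (sndIdx j)) ≤ κ (σ j).succ - ε) →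
      ‖b i‖ ≤ ρ := by
  have hk : (1 : ℝ) ≤ κ i.succ := by exact_mod_cast hκ i.succ
  have hpi := Real.pi_pos
  obtain ⟨M, hM, hM0⟩ : ∃ M : ℝ, (κ i.succ : ℝ) - ε <
      κ i.succ * (2 / Real.pi) * Real.arctan (2 * Real.pi * M) ∧ 0 < M := by
    have h1 : Tendsto (fun M => (κ i.succ : ℝ) * (2 / Real.pi) * Real.arctan (2 * Real.pi * M))
        atTop (𝓝 (κ i.succ * (2 / Real.pi) * (Real.pi / 2))) := by
      refine Tendsto.const_mul _ ?_
      exact (Real.tendsto_arctan_atTop.mono_right nhdsWithin_le_nhds).comp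
        (tendsto_id.const_mul_atTop (by positivity))
    have h2 : (κ i.succ : ℝ) * (2 / Real.pi) * (Real.pi / 2) = κ i.succ := by field_simp
    rw [h2] at h1
    exact ((h1.eventually_const_lt (by linarith)).and (eventually_gt_atTop 0)).exists
  -- Three conditions on R near 1: `e1` makes the derivative negative on the window, `e2` puts the
  -- radial segment in the exterior region, `e3` makes the descent too large.
  have e1 : ∀ᶠ R : ℝ in 𝓝 1, (κ 0 : ℝ) * (1 - R) * (1 + 4 * Real.pi ^ 2 * M ^ 2) < 1 := by
    have : ContinuousAt (fun R : ℝ => (κ 0 : ℝ) * (1 - R) * (1 + 4 * Real.pi ^ 2 * M ^ 2)) 1 := by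
      fun_prop
    exact this.eventually_lt_const (by simp)
  have e2 : ∀ᶠ R : ℝ in 𝓝 1, 3 * (κ 0 : ℝ) * (1 - R) < 1 := by
    have : ContinuousAt (fun R : ℝ => 3 * (κ 0 : ℝ) * (1 - R)) 1 := by fun_prop
    exact this.eventually_lt_const (by simp)
  have e3 : ∀ᶠ R : ℝ in 𝓝 1, (κ i.succ : ℝ) - ε < -(2 * κ 0 * (M * (1 - R))) +
      κ i.succ * ((1 + R) / Real.pi) * Real.arctan (2 * Real.pi * M) := by
    have : ContinuousAt (fun R : ℝ => -(2 * κ 0 * (M * (1 - R))) +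
      κ i.succ * ((1 + R) / Real.pi) * Real.arctan (2 * Real.pi * M)) 1 := by fun_prop
    refine this.eventually_const_lt ?_
    have h2 : (1 + 1 : ℝ) = 2 := by norm_num
    beta_reduce
    rw [h2]
    simpa using hM
  have e4 : ∀ᶠ R : ℝ in 𝓝 1, 1 / 2 < R := eventually_gt_nhds (by norm_num)
  obtain ⟨ρ, hρ, hall⟩ := mem_nhdsLT_iff_exists_Ioo_subset.1
    (mem_nhdsWithin_of_mem_nhds (((e1.and e2).and (e3.and e4))) : _ ∈ 𝓝[<] (1 : ℝ))
  refine ⟨ρ, hρ, fun b c σ h hσ hd => ?_⟩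
  by_contra hlt
  rw [not_le] at hlt
  have hb := h.norm_lt
  obtain ⟨⟨h1, h2⟩, h3, h4⟩ := hall ⟨hlt, hb i⟩
  set R := ‖b i‖ with hR
  have hR1 : R < 1 := hb i
  have hbi : b i ≠ 0 := (h.injective hκ).2 i
  obtain ⟨θ, hθ⟩ : ∃ θ, circleCover θ = R / b i := by
    refine exists_circleCover_eq ?_
    rw [norm_div, Complex.norm_real, norm_norm, div_self (norm_ne_zero_iff.2 hbi)]
  have hi : b i * circleCover θ = R := by rw [hθ, mul_div_cancel₀ _ hbi]
  have hw : 0 ≤ M * (1 - R) := mul_nonneg hM0.le (by linarith)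
  have hw0 : 0 < 1 - R := by linarith
  have hneg : ∀ t ∈ Icc (θ - M * (1 - R)) (θ + M * (1 - R)), rr κ b t < 0 := by
    intro t ht
    refine (rr_le_of_peak hb hi (norm_nonneg _) hR1 t).trans_lt ?_
    have h5 : (t - θ) ^ 2 ≤ (M * (1 - R)) ^ 2 :=
      sq_le_sq' (by linarith [ht.1]) (by linarith [ht.2])
    have h6 : 0 < (1 - R) ^ 2 + 4 * Real.pi ^ 2 * (t - θ) ^ 2 := by positivity
    have h7 : (κ 0 : ℝ) < (1 - R ^ 2) / ((1 - R) ^ 2 + 4 * Real.pi ^ 2 * (t - θ) ^ 2) := by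
      rw [lt_div_iff₀ h6]
      have h8 : (1 - R) ^ 2 + 4 * Real.pi ^ 2 * (t - θ) ^ 2 ≤
          (1 - R) ^ 2 * (1 + 4 * Real.pi ^ 2 * M ^ 2) := by nlinarith [sq_nonneg Real.pi]
      have h9 : (κ 0 : ℝ) * ((1 - R) ^ 2 + 4 * Real.pi ^ 2 * (t - θ) ^ 2) ≤
          (1 - R) * (κ 0 * (1 - R) * (1 + 4 * Real.pi ^ 2 * M ^ 2)) := by
        calc _ ≤ (κ 0 : ℝ) * ((1 - R) ^ 2 * (1 + 4 * Real.pi ^ 2 * M ^ 2)) := by gcongr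
          _ = _ := by ring
      nlinarith
    nlinarith
  have h5 := h.descent_ge_of_window hκ hσ hw hneg (touch_of_peak hκ hb hi h4.le hR1 h2)
  have h6 := descent_of_peak (κ := κ) hb hi (norm_nonneg _) hR1 hw
  have h7 : 2 * Real.pi * (M * (1 - R)) / (1 - R) = 2 * Real.pi * M := by field_simp
  rw [h7] at h6
  have h8 := hd (σ.symm i)
  rw [Equiv.apply_symm_apply] at h8
  linarith

theorem exists_radius_bound (hκ : ∀ i, 0 < κ i) {ε : ℝ} (hε : 0 < ε) :
    ∃ ρ < 1, ∀ b c σ, IsLab κ b c → IsType κ b c σ →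
      (∀ j, lr κ 0 b (c (fstIdx j)) - lr κ 0 b (c (sndIdx j)) ≤ κ (σ j).succ - ε) →
      ∀ i, ‖b i‖ ≤ ρ := by
  choose ρ hρ h using fun i => exists_radius_bound_single (κ := κ) hκ hε i
  have hne : (Finset.univ : Finset (Fin m)).Nonempty := ⟨0, Finset.mem_univ 0⟩
  refine ⟨Finset.univ.sup' hne ρ, (Finset.sup'_lt_iff hne).2 fun i _ => hρ i,
    fun b c σ h1 h2 h3 i => (h i b c σ h1 h2 h3).trans (Finset.le_sup' ρ (Finset.mem_univ i))⟩

end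

/-! ### The critical value map is a covering; its sections. -/

section

theorem isLocalHomeomorph_of_isOpenMap {X Y : Type*} [TopologicalSpace X] [TopologicalSpace Y]
    {f : X → Y} (hc : Continuous f) (ho : IsOpenMap f) (hi : ∀ x, ∃ N ∈ 𝓝 x, InjOn f N) :
    IsLocalHomeomorph f := by
  rw [isLocalHomeomorph_iff_isOpenEmbedding_restrict]
  intro x
  obtain ⟨N, hN, hinj⟩ := hi x
  refine ⟨interior N, interior_mem_nhds.2 hN, ?_⟩
  exact IsOpenEmbedding.of_continuous_injective_isOpenMap (hc.comp continuous_subtype_val)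
    (injOn_iff_injective.1 (hinj.mono interior_subset))
    (ho.comp isOpen_interior.isOpenMap_subtype_val)

/-- A map with local inverses restricts to a local homeomorphism from a relatively open part of a
preimage. -/
theorem isLocalHomeomorph_restrict {E B : Type*} [TopologicalSpace E] [TopologicalSpace B]
    {p : E → B} {Y : Set E} {X : Set B} (hm : MapsTo p Y X) (hp : ContinuousOn p Y)
    (h : ∀ y ∈ Y, ∃ g : B → E, ContinuousAt g (p y) ∧ g (p y) = y ∧ (∀ᶠ x in 𝓝 y, g (p x) = x) ∧
      ∀ᶠ z in 𝓝 (p y), p (g z) = z)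
    (ho : ∀ y ∈ Y, ∀ᶠ x in 𝓝 y, p x ∈ X → x ∈ Y) : IsLocalHomeomorph (hm.restrict p Y X) := by
  refine isLocalHomeomorph_of_isOpenMap (hp.mapsToRestrict hm) ?_ ?_
  · rw [isOpenMap_iff_nhds_le]
    rintro ⟨y, hy⟩ S hS
    obtain ⟨g, hg1, hg2, -, hg4⟩ := h y hy
    rw [mem_map, mem_nhds_subtype] at hS
    obtain ⟨T, hT, hTS⟩ := hS
    rw [mem_nhds_subtype]
    have h1 : Tendsto g (𝓝 (p y)) (𝓝 y) := by
      have := hg1.tendsto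
      rwa [hg2] at this
    refine ⟨_, inter_mem hg4 (h1.eventually (inter_mem hT (ho y hy))), ?_⟩
    rintro ⟨z, hz⟩ ⟨h2, h3, h4⟩
    have h2' : p (g z) = z := h2
    have h5 : g z ∈ Y := h4 (by rw [h2']; exact hz)
    have h6 := hTS (show (⟨g z, h5⟩ : Y) ∈ Subtype.val ⁻¹' T from h3)
    have h7 : hm.restrict p Y X ⟨g z, h5⟩ = ⟨z, hz⟩ := Subtype.ext h2'
    rw [mem_preimage, h7] at h6
    exact h6
  · rintro ⟨y, hy⟩
    obtain ⟨g, -, -, hg3, -⟩ := h y hy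
    obtain ⟨N, hN, hinj⟩ := exists_nhds_injOn_of_left_inverse hg3
    refine ⟨Subtype.val ⁻¹' N, preimage_coe_mem_nhds_subtype.2 (mem_nhdsWithin_of_mem_nhds hN), ?_⟩
    intro a ha b hb hab
    exact Subtype.ext (hinj ha hb (congrArg Subtype.val hab))

variable {m : ℕ} [NeZero m] {κ : Fin (m + 1) → ℕ} {σ : Equiv.Perm (Fin m)} {x₀ : ℝ}

/-- Labelled maps of a given type with a given first critical point. -/
def labSet (κ : Fin (m + 1) → ℕ) (σ : Equiv.Perm (Fin m)) (x₀ : ℝ) :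
    Set (ℝ × (Fin m → ℂ) × RealVec m) :=
  {p | IsLab κ p.2.1 p.2.2 ∧ IsType κ p.2.1 p.2.2 σ ∧ p.2.2 (fstIdx 0) = x₀}

/-- The critical data of labelled maps. -/
def dataSet (κ : Fin (m + 1) → ℕ) (σ : Equiv.Perm (Fin m)) (x₀ : ℝ) :
    Set ((RealVec m × RealVec m) × ℝ) :=
  {q | q.1.1 = 0 ∧ q.1.2 ∈ valueRegion κ σ ∧ q.2 = x₀}

theorem mapsTo_xi (hκ : ∀ i, 0 < κ i) : MapsTo (xi κ) (labSet κ σ x₀) (dataSet κ σ x₀) :=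
  fun _ hp => ⟨funext hp.1.crit, hp.1.values_mem hκ hp.2.1 _, hp.2.2⟩

theorem locallyCompactSpace_dataSet : LocallyCompactSpace (dataSet κ σ x₀) := by
  have h1 : IsLocallyClosed (dataSet κ σ x₀) := by
    have h2 : dataSet κ σ x₀ = {q | q.1.2 ∈ valueRegion κ σ} ∩ {q | q.1.1 = 0 ∧ q.2 = x₀} := by
      ext q; simp only [dataSet, mem_ofPred_eq, mem_inter_iff]; tauto
    rw [h2]
    refine (IsOpen.isLocallyClosed ?_).inter (IsClosed.isLocallyClosed ?_)
    · exact isOpen_valueRegion.preimage (by fun_prop)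
    · exact (isClosed_eq (by fun_prop) continuous_const).inter
        (isClosed_eq (by fun_prop) continuous_const)
  exact h1.locallyCompactSpace

/-- Local inverses come from the inverse function theorem. They stay within labelled maps of the
given type because that is an open condition once the critical equations hold. -/
theorem isLocalHomeomorph_xi (hκ : ∀ i, 0 < κ i) :
    IsLocalHomeomorph ((mapsTo_xi (σ := σ) (x₀ := x₀) hκ).restrict _ _ _) := by
  refine isLocalHomeomorph_restrict _ (fun p hp =>
    (contDiffAt_xi hp.1.norm_lt).continuousAt.continuousWithinAt) (fun p hp => ?_) fun p hp => ?_
  · obtain ⟨g, h1, h2, h3, h4⟩ := IsLab.exists_xi_inverse hκ hp.1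
    exact ⟨g, h1.continuousAt, h2, h3, h4⟩
  · have h1 : ContinuousAt (fun p : ℝ × (Fin m → ℂ) × RealVec m => p.2) p := continuousAt_snd
    filter_upwards [h1.eventually (hp.1.eventually_isType hκ hp.2.1)] with q hq hqX
    obtain ⟨h2, h3⟩ := hq fun i => congrFun hqX.1 i
    exact ⟨h2, h3, hqX.2.2⟩

theorem exists_gap_of_isCompact {K : Set (RealVec m)} (hK : IsCompact K)
    (hKV : K ⊆ valueRegion κ σ) :
    ∃ ε > 0, ∀ v ∈ K, ∀ j, v (fstIdx j) - v (sndIdx j) ≤ κ (σ j).succ - ε := by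
  have h1 : ∀ j, ∃ ε > 0, ∀ v ∈ K, ε ≤ κ (σ j).succ - (v (fstIdx j) - v (sndIdx j)) := fun j =>
    hK.exists_forall_le' (by fun_prop) fun v hv => by linarith [((hKV hv).2.1 j).2]
  choose ε hε h2 using h1
  have hne : (Finset.univ : Finset (Fin m)).Nonempty := ⟨0, Finset.mem_univ 0⟩
  refine ⟨Finset.univ.inf' hne ε, (Finset.lt_inf'_iff hne).2 fun i _ => hε i, fun v hv j => ?_⟩
  linarith [h2 j v hv, Finset.inf'_le ε (Finset.mem_univ j)]

/-- Limits of labelled maps remain labelled as long as the values stay in the open region: colliding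
critical points would have equal values at consecutive indices, and closing up the period would make
the last inequality an equality. -/
theorem isLab_of_monotone {η : ℝ} {b : Fin m → ℂ} {c : RealVec m} (hb : ∀ j, ‖b j‖ < 1)
    (hc : Monotone c) (hc1 : ∀ i, c i ≤ c (fstIdx 0) + 1) (hr : ∀ i, rr κ b (c i) = 0)
    (hv : (fun i => lr κ η b (c i)) ∈ valueRegion κ σ) : IsLab κ b c := by
  have hinj : ∀ i j : Fin (2 * m), i < j → c i ≠ c j := by
    intro i j hij heq
    have h1 : (i : ℕ) + 1 < 2 * m := by have := j.2; have : (i : ℕ) < j := hij; omega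
    have h2 := hv.1 i h1
    have h3 : c ⟨i + 1, h1⟩ = c i := by
      refine le_antisymm ?_ (hc ?_)
      · rw [heq]; refine hc ?_
        simp only [Fin.le_def]; exact hij
      · simp only [Fin.le_def]; omega
    simp only [h3, Fin.eta, sub_self, mul_zero, lt_self_iff_false] at h2
  have hlt1 : ∀ i, c i < c (fstIdx 0) + 1 := by
    have hm : m - 1 < m := Nat.sub_lt (NeZero.pos m) one_pos
    have hlast : c (sndIdx ⟨m - 1, hm⟩) < c (fstIdx 0) + 1 := by
      refine lt_of_le_of_ne (hc1 _) fun heq => ?_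
      have h2 := hv.2.2 ⟨m - 1, hm⟩ (Nat.sub_add_cancel (NeZero.pos m))
      simp only [heq] at h2
      have h3 := lr_add_int (κ := κ) η b (c (fstIdx 0)) 1
      push_cast at h3
      linarith
    intro i
    refine lt_of_le_of_lt (hc ?_) hlast
    have := i.2
    simp only [sndIdx, Fin.le_def]
    omega
  refine ⟨hb, hc.strictMono_of_injective fun i j hij => ?_, hlt1, hr, fun j => ?_⟩
  · rcases lt_trichotomy i j with h | h | h
    · exact absurd hij (hinj i j h)
    · exact h
    · exact absurd hij.symm (hinj j i h)
  · have := (hv.2.1 j).1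
    simp only [lr_eq_add η] at this
    linarith

/-- Values in a compact part of the open region keep the descents away from the multiplicities,
hence the parameters away from the circle; the other coordinates are then bounded, and limits remain
labelled of the same type. -/
theorem isCompact_labSet (hκ : ∀ i, 0 < κ i) (K : Set ((RealVec m × RealVec m) × ℝ))
    (hKX : K ⊆ dataSet κ σ x₀) (hK : IsCompact K) : IsCompact (labSet κ σ x₀ ∩ xi κ ⁻¹' K) := by
  set K' : Set (RealVec m) := (fun q : (RealVec m × RealVec m) × ℝ => q.1.2) '' K with hK'
  have hKc' : IsCompact K' := hK.image (by fun_prop)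
  have hKV : K' ⊆ valueRegion κ σ := by rintro _ ⟨q, hq, rfl⟩; exact (hKX hq).2.1
  obtain ⟨ε, hε, hgap⟩ := exists_gap_of_isCompact hKc' hKV
  obtain ⟨ρ, hρ, hbound⟩ := exists_radius_bound (κ := κ) hκ hε
  set C : Set (ℝ × (Fin m → ℂ) × RealVec m) := {p | (∀ j, ‖p.2.1 j‖ ≤ ρ) ∧ Monotone p.2.2 ∧
    ∀ i, p.2.2 i ≤ p.2.2 (fstIdx 0) + 1} with hC
  have hCcl : IsClosed C := by
    have h1 : C = (⋂ j : Fin m, {p : ℝ × (Fin m → ℂ) × RealVec m | ‖p.2.1 j‖ ≤ ρ}) ∩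
        ((⋂ i : Fin (2 * m), ⋂ j : Fin (2 * m), ⋂ _ : i ≤ j,
          {p : ℝ × (Fin m → ℂ) × RealVec m | p.2.2 i ≤ p.2.2 j}) ∩
        ⋂ i : Fin (2 * m), {p : ℝ × (Fin m → ℂ) × RealVec m | p.2.2 i ≤ p.2.2 (fstIdx 0) + 1}) := by
      ext p
      simp only [hC, mem_ofPred_eq, mem_inter_iff, mem_iInter, Monotone]
    rw [h1]
    have h2 : ∀ j, Continuous fun p : ℝ × (Fin m → ℂ) × RealVec m => ‖p.2.1 j‖ := fun j => by
      have : Continuous fun p : ℝ × (Fin m → ℂ) × RealVec m => p.2.1 j := by fun_prop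
      exact this.norm
    refine (isClosed_iInter fun j => isClosed_le (h2 j) continuous_const).inter
      ((isClosed_iInter fun i => isClosed_iInter fun j => isClosed_iInter fun _ =>
        isClosed_le (by fun_prop) (by fun_prop)).inter
      (isClosed_iInter fun i => isClosed_le (by fun_prop) (by fun_prop)))
  have hCb : ∀ p ∈ C, ∀ j, ‖p.2.1 j‖ < 1 := fun p hp j => (hp.1 j).trans_lt hρ
  set S := C ∩ xi κ ⁻¹' K with hS
  have hScl : IsClosed S := ContinuousOn.preimage_isClosed_of_isClosed
    (fun p hp => (contDiffAt_xi (hCb p hp)).continuousAt.continuousWithinAt) hCcl hK.isClosed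
  have hSlab : ∀ p ∈ S, IsLab κ p.2.1 p.2.2 := fun p hp =>
    isLab_of_monotone (hCb p hp.1) hp.1.2.1 hp.1.2.2 (fun i => congrFun (hKX hp.2).1 i)
      (hKX hp.2).2.1
  -- A compact set containing `S`: the rotation parameter is not bounded in advance, but is
  -- recovered from the first critical value, whose position `x₀` is fixed.
  set T : Set (ℝ × (Fin m → ℂ) × RealVec m) :=
    (fun q : RealVec m × (Fin m → ℂ) × RealVec m =>
      (q.1 (fstIdx 0) - lr κ 0 q.2.1 x₀, q.2.1, q.2.2)) ''
      (K' ×ˢ ((pi univ fun _ : Fin m => Metric.closedBall (0 : ℂ) ρ) ×ˢ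
        (pi univ fun _ : Fin (2 * m) => Icc x₀ (x₀ + 1)))) with hT
  have hTc : IsCompact T := by
    refine IsCompact.image_of_continuousOn (hKc'.prod ((isCompact_univ_pi fun _ =>
      isCompact_closedBall _ _).prod (isCompact_univ_pi fun _ => isCompact_Icc))) fun q hq => ?_
    have hb : ∀ j, ‖q.2.1 j‖ < 1 := fun j =>
      (mem_closedBall_zero_iff.1 (hq.2.1 j trivial)).trans_lt hρ
    have h1 : ContinuousAt (fun q : RealVec m × (Fin m → ℂ) × RealVec m => lr κ 0 q.2.1 x₀) q :=
      (contDiffAt_lr (β := fun q : RealVec m × (Fin m → ℂ) × RealVec m => q.2.1) contDiffAt_const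
        (fun j => by fun_prop) contDiffAt_const hb).continuousAt
    have h2 : ContinuousAt (fun q : RealVec m × (Fin m → ℂ) × RealVec m => q.1 (fstIdx 0)) q := by
      fun_prop
    exact ((h2.sub h1).prodMk continuousAt_snd).continuousWithinAt
  have hST : S ⊆ T := by
    intro p hp
    refine ⟨((xi κ p).1.2, p.2.1, p.2.2), ⟨⟨_, hp.2, rfl⟩, ?_, ?_⟩, ?_⟩
    · exact fun j _ => mem_closedBall_zero_iff.2 (hp.1.1 j)
    · intro i _
      have h1 : p.2.2 (fstIdx 0) = x₀ := (hKX hp.2).2.2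
      have h2 := hp.1.2.1 (fstIdx_zero_le i)
      have h3 := hp.1.2.2 i
      rw [h1] at h2 h3
      exact ⟨h2, h3⟩
    · refine Prod.ext ?_ rfl
      have h1 : p.2.2 (fstIdx 0) = x₀ := (hKX hp.2).2.2
      simp only [xi, h1]
      rw [lr_eq_add p.1]
      ring
  have hSc : IsCompact S := hTc.of_isClosed_subset hScl hST
  have hsub : labSet κ σ x₀ ∩ xi κ ⁻¹' K ⊆ S := by
    rintro p ⟨hp, hpK⟩
    refine ⟨⟨hbound _ _ σ hp.1 hp.2.1 fun j => ?_, hp.1.strictMono.monotone,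
      fun i => (hp.1.lt_add_one i).le⟩, hpK⟩
    have := hgap _ ⟨_, hpK, rfl⟩ j
    simp only [xi, lr_eq_add p.1] at this
    linarith
  refine hSc.of_isClosed_subset (isClosed_of_closure_subset fun p hp => ?_) hsub
  have hpS : p ∈ S := closure_minimal hsub hScl hp
  have hlab := hSlab p hpS
  -- The limit has some type, shared by nearby labelled maps; therefore it is σ.
  obtain ⟨τ, hτ⟩ := hlab.exists_isType hκ
  have h1 : ContinuousAt (fun p : ℝ × (Fin m → ℂ) × RealVec m => p.2) p := continuousAt_snd
  obtain ⟨q, hq, hq'⟩ := ((mem_closure_iff_frequently.1 hp).and_eventually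
    (h1.eventually (hlab.eventually_isType hκ hτ))).exists
  obtain ⟨h2, h3⟩ := hq' hq.1.1.crit
  have h4 := h2.isType_unique hq.1.2.1 h3
  exact ⟨⟨hlab, by rwa [h4], (hKX hpS.2).2.2⟩, hpS.2⟩

/-- Convexity of the value region is what allows it to be lifted as a whole. -/
theorem exists_section (hκ : ∀ i, 0 < κ i) {p : ℝ × (Fin m → ℂ) × RealVec m}
    (hp : p ∈ labSet κ σ x₀) : ∃ s : RealVec m → ℝ × (Fin m → ℂ) × RealVec m,
      ContinuousOn s (valueRegion κ σ) ∧ MapsTo s (valueRegion κ σ) (labSet κ σ x₀) ∧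
      (∀ v ∈ valueRegion κ σ, ∀ i, lr κ (s v).1 (s v).2.1 ((s v).2.2 i) = v i) ∧
      s (fun i => lr κ p.1 p.2.1 (p.2.2 i)) = p := by
  have := locallyCompactSpace_dataSet (κ := κ) (σ := σ) (x₀ := x₀)
  have hX := mapsTo_xi hκ hp
  obtain ⟨s, h1, h2, h3, h4⟩ := exists_lift_of_proper (mapsTo_xi hκ) (isLocalHomeomorph_xi hκ)
    (isCompact_labSet hκ) (convex_valueRegion (κ := κ) (σ := σ)) isOpen_valueRegion
    (h := fun v => (((0 : RealVec m), v), x₀)) (by fun_prop) (fun v hv => ⟨rfl, hv, rfl⟩)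
    hX.2.1 hp (by
      refine Prod.ext (Prod.ext hX.1 rfl) hX.2.2)
  exact ⟨s, h1, h2, fun v hv i => congrFun (congrArg (fun q => q.1.2) (h3 v hv)) i, h4⟩

end

/-! ### Normalizing the rotation: sections into the parameter space. -/

section

variable {m : ℕ} {κ : Fin (m + 1) → ℕ}

/-- Rotating all zeros reparametrizes the circle; the lift keeps its values if η absorbs the term d
x. -/
theorem lr_rotate (η x : ℝ) (b : Fin m → ℂ) (t : ℝ) :
    lr κ (η + circleDegree κ * x) (fun j => b j * circleCover x) t = lr κ η b (t + x) := by
  simp only [lr, circleCover_add, mul_assoc, mul_comm (circleCover t)]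
  ring

theorem rr_rotate (x : ℝ) (b : Fin m → ℂ) (t : ℝ) :
    rr κ (fun j => b j * circleCover x) t = rr κ b (t + x) := by
  simp only [rr, circleCover_add, mul_assoc, mul_comm (circleCover t)]

/-- A continuous choice of arguments of a nonvanishing function on a convex open set. -/
theorem exists_continuousOn_arg {F : Type*} [NormedAddCommGroup F] [NormedSpace ℝ F] {A : Set F}
    (hA : Convex ℝ A) (hAo : IsOpen A) {f : F → ℂ} (hf : ContinuousOn f A)
    (hf0 : ∀ x ∈ A, f x ≠ 0) {a : F} (ha : a ∈ A) {θ₀ : ℝ}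
    (hθ₀ : f a = ‖f a‖ * circleCover θ₀) :
    ∃ θ : F → ℝ, ContinuousOn θ A ∧ (∀ x ∈ A, f x = ‖f x‖ * circleCover (θ x)) ∧ θ a = θ₀ := by
  have hsc : IsSimplyConnected A := by
    have : ContractibleSpace A := hA.contractibleSpace ⟨a, ha⟩
    exact inferInstanceAs (SimplyConnectedSpace A)
  obtain ⟨L, hL1, hL2⟩ := Complex.exists_continuousOn_eqOn_exp_comp hsc hAo hf
    (by rintro ⟨x, hx, h0⟩; exact hf0 x hx h0)
  have hpi := Real.pi_pos
  have h1 : ∀ x ∈ A, f x = ‖f x‖ * circleCover ((L x).im / (2 * Real.pi)) := by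
    intro x hx
    have h2 : f x = Complex.exp (L x) := (hL2 hx).symm
    rw [h2, Complex.norm_exp, circleCover, Complex.ofReal_exp, ← Complex.exp_add]
    congr 1
    have h3 : 2 * (Real.pi : ℂ) * Complex.I * (((L x).im / (2 * Real.pi) : ℝ) : ℂ) =
        (L x).im * Complex.I := by
      push_cast
      have : (Real.pi : ℂ) ≠ 0 := Complex.ofReal_ne_zero.2 hpi.ne'
      field_simp
    rw [h3, Complex.re_add_im]
  have h2 : ((‖f a‖ : ℝ) : ℂ) ≠ 0 := Complex.ofReal_ne_zero.2 (norm_ne_zero_iff.2 (hf0 a ha))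
  have h3 : circleCover θ₀ = circleCover ((L a).im / (2 * Real.pi)) :=
    mul_left_cancel₀ h2 (hθ₀.symm.trans (h1 a ha))
  -- The continuous argument is determined up to an integer, adjusted to the prescribed value at
  -- `a`.
  obtain ⟨n, hn⟩ := circleCover_eq_iff.1 h3
  refine ⟨fun x => (L x).im / (2 * Real.pi) + n, ?_, fun x hx => ?_, hn.symm⟩
  · exact ((Complex.continuous_im.comp_continuousOn hL1).div_const _).add continuousOn_const
  · rw [circleCover_add_int]; exact h1 x hx

variable [NeZero m] {σ : Equiv.Perm (Fin m)}

theorem IsLab.rotate {b : Fin m → ℂ} {c : RealVec m} (h : IsLab κ b c) (x : ℝ) :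
    IsLab κ (fun j => b j * circleCover x) (fun i => c i - x) := by
  refine ⟨fun j => ?_, fun i j hij => ?_, fun i => ?_, fun i => ?_, fun j => ?_⟩
  · rw [norm_mul, norm_circleCover, mul_one]; exact h.norm_lt j
  · exact sub_lt_sub_right (h.strictMono hij) x
  · linarith [h.lt_add_one i]
  · rw [rr_rotate, sub_add_cancel]; exact h.crit i
  · have h1 : ∀ t, lr κ 0 (fun j => b j * circleCover x) (t - x) =
        lr κ 0 b t - circleDegree κ * x := fun t => by
      have h2 := lr_rotate (κ := κ) (-(circleDegree κ * x)) x b (t - x)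
      rw [neg_add_cancel, sub_add_cancel, lr_eq_add (-_)] at h2
      linarith
    rw [h1, h1]
    linarith [h.desc j]

/-- The type is constant along connected families of labelled maps. -/
theorem isType_of_isPreconnected {A : Type*} [TopologicalSpace A] {S : Set A} (hκ : ∀ i, 0 < κ i)
    (hSo : IsOpen S) (hS : IsPreconnected S) {β : A → Fin m → ℂ} {c : A → RealVec m}
    (hβ : ContinuousOn β S) (hc : ContinuousOn c S) (h : ∀ x ∈ S, IsLab κ (β x) (c x)) {a : A}
    (ha : a ∈ S) (hσ : IsType κ (β a) (c a) σ) : ∀ x ∈ S, IsType κ (β x) (c x) σ := by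
  set N : Equiv.Perm (Fin m) → Set A := fun τ => {x ∈ S | IsType κ (β x) (c x) τ} with hN
  have := subset_of_mem_of_disjoint_cover (N := N) (Z := Finset.univ) (fun τ _ => ?_) ?_ hS ?_
    (Finset.mem_univ σ) ha ⟨ha, hσ⟩
  · exact fun x hx => (this hx).2
  · rw [isOpen_iff_mem_nhds]
    rintro x ⟨hx, hτ⟩
    have h1 : ContinuousAt (fun x => (β x, c x)) x :=
      (hβ.continuousAt (hSo.mem_nhds hx)).prodMk (hc.continuousAt (hSo.mem_nhds hx))
    filter_upwards [hSo.mem_nhds hx, h1.eventually ((h x hx).eventually_isType hκ hτ)] with y hy hy'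
    exact ⟨hy, (hy' (h y hy).crit).2⟩
  · intro τ _ τ' _ hne
    rw [disjoint_left]
    exact fun x h1 h2 => hne ((h x h1.1).isType_unique h1.2 h2.2)
  · intro x hx
    obtain ⟨τ, hτ⟩ := (h x hx).exists_isType hκ
    exact ⟨τ, Finset.mem_univ τ, hx, hτ⟩

/-- The parameter vector with given rotation parameter, moduli and angles. -/
def mkParam (e : ℝ) (r a : Fin m → ℝ) : RealVec m := fun i =>
  if (i : ℕ) % 2 = 0 then (if (i : ℕ) = 0 then e else r ⟨i / 2, by omega⟩)
  else if (i : ℕ) = 1 then r 0 else a ⟨i / 2, by omega⟩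

theorem eta0_mkParam (e : ℝ) (r a : Fin m → ℝ) : eta0 (mkParam e r a) = e := by
  simp [eta0, mkParam, fstIdx]

theorem radius_mkParam (e : ℝ) (r a : Fin m → ℝ) (j : Fin m) : radius (mkParam e r a) j = r j := by
  unfold radius
  split_ifs with h
  · subst h; simp [mkParam, sndIdx]
  · have h1 : (j : ℕ) ≠ 0 := fun h2 => h (Fin.ext h2)
    simp [mkParam, fstIdx, h1]

theorem angle_mkParam (e : ℝ) (r : Fin m → ℝ) {a : Fin m → ℝ} (ha : a 0 = 0) (j : Fin m) :
    angle (mkParam e r a) j = a j := by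
  unfold angle
  split_ifs with h
  · subst h; exact ha.symm
  · have h1 : (j : ℕ) ≠ 0 := fun h2 => h (Fin.ext h2)
    have h2 : (2 * (j : ℕ) + 1) % 2 = 1 := by omega
    have h3 : (2 * (j : ℕ) + 1) / 2 = j := by omega
    simp [mkParam, sndIdx, h1, h2, h3]

theorem ext_coordinates {μ ν : RealVec m} (h0 : eta0 μ = eta0 ν) (hr : ∀ j, radius μ j = radius ν j)
    (ha : ∀ j, angle μ j = angle ν j) : μ = ν := by
  rw [← sub_eq_zero]
  refine eq_zero_of_coordinates ?_ (fun j => ?_) fun j => ?_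
  · exact sub_eq_zero.2 h0
  · have := hr j
    unfold radius at *
    split_ifs at * <;> exact sub_eq_zero.2 this
  · have := ha j
    unfold angle at *
    split_ifs at *
    · rfl
    · exact sub_eq_zero.2 this

theorem continuousOn_mkParam {F : Type*} [TopologicalSpace F] {A : Set F} {e : F → ℝ}
    {r a : F → Fin m → ℝ} (he : ContinuousOn e A) (hr : ∀ j, ContinuousOn (fun x => r x j) A)
    (ha : ∀ j, ContinuousOn (fun x => a x j) A) :
    ContinuousOn (fun x => mkParam (e x) (r x) (a x)) A := by
  refine continuousOn_pi.2 fun i => ?_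
  unfold mkParam
  split_ifs
  · exact he
  · exact hr _
  · exact hr _
  · exact ha _

/-- The section of the critical value map through a labelled parameter. -/
theorem exists_param_section (hκ : ∀ i, 0 < κ i) {μ₀ c₀ : RealVec m} (hμ₀ : ∀ j, 1 < radius μ₀ j)
    (h : IsLab κ (zeroInv μ₀) c₀) (hσ : IsType κ (zeroInv μ₀) c₀ σ) :
    ∃ s C : RealVec m → RealVec m, ContinuousOn s (valueRegion κ σ) ∧
      ContinuousOn C (valueRegion κ σ) ∧
      (∀ v ∈ valueRegion κ σ, (∀ j, 1 < radius (s v) j) ∧ IsLab κ (zeroInv (s v)) (C v) ∧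
        IsType κ (zeroInv (s v)) (C v) σ ∧
        ∀ i, lr κ (etaShift κ (s v)) (zeroInv (s v)) (C v i) = v i) ∧
      s (fun i => lr κ (etaShift κ μ₀) (zeroInv μ₀) (c₀ i)) = μ₀ ∧
      C (fun i => lr κ (etaShift κ μ₀) (zeroInv μ₀) (c₀ i)) = c₀ := by
  set V := valueRegion κ σ with hV
  set v₀ : RealVec m := fun i => lr κ (etaShift κ μ₀) (zeroInv μ₀) (c₀ i) with hv₀
  have hv₀V : v₀ ∈ V := h.values_mem hκ hσ _
  obtain ⟨s, hs1, hs2, hs3, hs4⟩ := exists_section (x₀ := c₀ (fstIdx 0)) hκ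
    (p := (etaShift κ μ₀, zeroInv μ₀, c₀)) ⟨h, hσ, rfl⟩
  have hs4' : s v₀ = (etaShift κ μ₀, zeroInv μ₀, c₀) := hs4
  have hβ : ContinuousOn (fun v => (s v).2.1) V := (continuous_fst.comp continuous_snd).comp_continuousOn hs1
  have hβj : ∀ j, ContinuousOn (fun v => (s v).2.1 j) V := fun j => continuousOn_pi.1 hβ j
  have hγ : ContinuousOn (fun v => (s v).2.2) V := (continuous_snd.comp continuous_snd).comp_continuousOn hs1
  have hη : ContinuousOn (fun v => (s v).1) V := continuous_fst.comp_continuousOn hs1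
  have hne : ∀ v ∈ V, ∀ j, (s v).2.1 j ≠ 0 := fun v hv => ((hs2 hv).1.injective hκ).2
  -- Continuous arguments of the b_j over the whole convex region, starting from those of `μ₀`.
  have hex : ∀ j, ∃ θ : RealVec m → ℝ, ContinuousOn θ V ∧
      (∀ v ∈ V, (s v).2.1 j = ‖(s v).2.1 j‖ * circleCover (θ v)) ∧ θ v₀ = -angle μ₀ j := fun j =>
    exists_continuousOn_arg convex_valueRegion isOpen_valueRegion (hβj j)
      (fun v hv => hne v hv j) hv₀V (by
        rw [hs4']
        simp only
        rw [norm_zeroInv (one_pos.trans (hμ₀ j)), zeroInv, Complex.ofReal_inv])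
  choose θ hθ1 hθ2 hθ3 using hex
  -- Rotating by -θ₀ makes b_1 positive, so the angles become θ₀ - θ_j. The first entry is chosen so
  -- that `etaShift` of the result is the value compensating the rotation.
  set S : RealVec m → RealVec m := fun v => mkParam
    ((s v).1 - circleDegree κ * θ 0 v - 2 * ∑ j : Fin m, (κ j.succ : ℝ) * (θ 0 v - θ j v))
    (fun j => ‖(s v).2.1 j‖⁻¹) (fun j => θ 0 v - θ j v) with hS
  have hang : ∀ v j, angle (S v) j = θ 0 v - θ j v := fun v j => angle_mkParam _ _ (sub_self _) j
  have hrad : ∀ v j, radius (S v) j = ‖(s v).2.1 j‖⁻¹ := fun v j => radius_mkParam _ _ _ j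
  have heta : ∀ v, etaShift κ (S v) = (s v).1 + circleDegree κ * (-θ 0 v) := fun v => by
    rw [etaShift, eta0_mkParam]
    simp only [hang]
    ring
  have hinv : ∀ v ∈ V, zeroInv (S v) = fun j => (s v).2.1 j * circleCover (-θ 0 v) := by
    intro v hv
    ext1 j
    rw [zeroInv, hrad, hang, Complex.ofReal_inv, inv_inv, hθ2 j v hv, norm_mul, norm_circleCover,
      mul_one, Complex.norm_real, norm_norm, mul_assoc, ← circleCover_add]
    congr 2
    ring
  set C : RealVec m → RealVec m := fun v i => (s v).2.2 i - (-θ 0 v) with hC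
  have hScont : ContinuousOn S V := by
    refine continuousOn_mkParam ((hη.sub (continuousOn_const.mul (hθ1 0))).sub
      (continuousOn_const.mul ?_)) (fun j => ?_) fun j => (hθ1 0).sub (hθ1 j)
    · exact continuousOn_finsetSum _ fun j _ => continuousOn_const.mul ((hθ1 0).sub (hθ1 j))
    · exact (hβj j).norm.inv₀ fun v hv => norm_ne_zero_iff.2 (hne v hv j)
  have hCcont : ContinuousOn C V := continuousOn_pi.2 fun i =>
    (continuousOn_pi.1 hγ i).sub (hθ1 0).neg
  have hradlt : ∀ v ∈ V, ∀ j, 1 < radius (S v) j := fun v hv j => by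
    rw [hrad]
    exact (one_lt_inv₀ (norm_pos_iff.2 (hne v hv j))).2 ((hs2 hv).1.norm_lt j)
  have hlab : ∀ v ∈ V, IsLab κ (zeroInv (S v)) (C v) := fun v hv => by
    rw [hinv v hv]
    exact (hs2 hv).1.rotate _
  have hS0 : S v₀ = μ₀ := by
    have h0 : θ 0 v₀ = 0 := by rw [hθ3, angle, if_pos rfl, neg_zero]
    have ha : ∀ j, θ 0 v₀ - θ j v₀ = angle μ₀ j := fun j => by rw [h0, hθ3]; ring
    refine ext_coordinates ?_ (fun j => ?_) fun j => ?_
    · have hsum : ∑ j : Fin m, (κ j.succ : ℝ) * (θ 0 v₀ - θ j v₀) =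
          ∑ j : Fin m, (κ j.succ : ℝ) * angle μ₀ j :=
        Finset.sum_congr rfl fun j _ => by rw [ha j]
      simp only [hS]
      rw [eta0_mkParam, hsum, h0, hs4']
      simp [etaShift]
    · rw [hrad, hs4']
      simp only
      rw [norm_zeroInv (one_pos.trans (hμ₀ j)), inv_inv]
    · rw [hang, ha]
  have hC0 : C v₀ = c₀ := by
    have h0 : θ 0 v₀ = 0 := by rw [hθ3, angle, if_pos rfl, neg_zero]
    ext1 i
    simp only [hC, hs4', h0, neg_zero, sub_zero]
  have hzc : ContinuousOn (fun v => zeroInv (S v)) V := continuousOn_pi.2 fun j v hv =>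
    ((contDiffAt_zeroInv (one_pos.trans (hradlt v hv j)).ne').continuousAt.comp_continuousWithinAt
      (hScont v hv))
  -- The type is known at the base point and is carried along the connected region; invariance under
  -- rotation need not be checked separately.
  have htype := isType_of_isPreconnected hκ isOpen_valueRegion
    (convex_valueRegion (κ := κ) (σ := σ)).isPreconnected hzc hCcont hlab hv₀V
    (by rw [hS0, hC0]; exact hσ)
  refine ⟨S, C, hScont, hCcont, fun v hv => ⟨hradlt v hv, hlab v hv, htype v hv, fun i => ?_⟩,
    hS0, hC0⟩
  rw [heta, hinv v hv, lr_rotate, hC, sub_add_cancel]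
  exact hs3 v hv i

end

/-! ### Labellings from local extrema. -/

section

variable {m : ℕ} {κ : Fin (m + 1) → ℕ}

theorem not_isLocalMax_of_strictMonoOn_right {f : ℝ → ℝ} {x y : ℝ} (hxy : x < y)
    (h : StrictMonoOn f (Icc x y)) : ¬ IsLocalMax f x := by
  intro hm
  have h1 : ∀ᶠ t in 𝓝[>] x, f t ≤ f x := hm.filter_mono nhdsWithin_le_nhds
  obtain ⟨t, ht, ht'⟩ := (h1.and (Ioo_mem_nhdsGT hxy)).exists
  exact (h (left_mem_Icc.2 hxy.le) (Ioo_subset_Icc_self ht') ht'.1).not_ge ht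

theorem not_isLocalMax_of_strictAntiOn_left {f : ℝ → ℝ} {x y : ℝ} (hxy : x < y)
    (h : StrictAntiOn f (Icc x y)) : ¬ IsLocalMax f y := by
  intro hm
  have h1 : ∀ᶠ t in 𝓝[<] y, f t ≤ f y := hm.filter_mono nhdsWithin_le_nhds
  obtain ⟨t, ht, ht'⟩ := (h1.and (Ioo_mem_nhdsLT hxy)).exists
  exact (h (Ioo_subset_Icc_self ht') (right_mem_Icc.2 hxy.le) ht'.2).not_ge ht

theorem not_isLocalMin_of_strictAntiOn_right {f : ℝ → ℝ} {x y : ℝ} (hxy : x < y)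
    (h : StrictAntiOn f (Icc x y)) : ¬ IsLocalMin f x := fun hm =>
  not_isLocalMax_of_strictMonoOn_right hxy h.neg hm.neg

theorem not_isLocalMin_of_strictMonoOn_left {f : ℝ → ℝ} {x y : ℝ} (hxy : x < y)
    (h : StrictMonoOn f (Icc x y)) : ¬ IsLocalMin f y := fun hm =>
  not_isLocalMax_of_strictAntiOn_left hxy h.neg hm.neg

theorem pos_or_neg_of_ne_zero {f : ℝ → ℝ} (hf : Continuous f) {x y : ℝ}
    (h : ∀ t ∈ Ioo x y, f t ≠ 0) : (∀ t ∈ Ioo x y, 0 < f t) ∨ ∀ t ∈ Ioo x y, f t < 0 := by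
  by_contra! hcon
  obtain ⟨⟨s, hs, hs'⟩, t, ht, ht'⟩ := hcon
  obtain ⟨u, hu, hu'⟩ := isPreconnected_Ioo.intermediate_value hs ht hf.continuousOn ⟨hs', ht'⟩
  exact h u hu hu'

variable [NeZero m] {σ : Equiv.Perm (Fin m)}

/-- Between consecutive critical points, a local maximum is followed by a descent. -/
theorem rr_neg_of_isLocalMax {b : Fin m → ℂ} (hb : ∀ j, ‖b j‖ < 1) {x y : ℝ} (hxy : x < y)
    (h : ∀ t ∈ Ioo x y, rr κ b t ≠ 0) (hx : IsLocalMax (lr κ 0 b) x) :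
    ∀ t ∈ Ioo x y, rr κ b t < 0 :=
  (pos_or_neg_of_ne_zero (continuous_rr hb) h).resolve_left fun hpos =>
    not_isLocalMax_of_strictMonoOn_right hxy (lr_strictMonoOn hb hpos) hx

theorem isLocalMin_of_isLocalMax {b : Fin m → ℂ} (hb : ∀ j, ‖b j‖ < 1) {x y : ℝ} (hxy : x < y)
    (h : ∀ t ∈ Ioo x y, rr κ b t ≠ 0) (hx : IsLocalMax (lr κ 0 b) x)
    (hy : IsLocalExtr (lr κ 0 b) y) : IsLocalMin (lr κ 0 b) y :=
  hy.resolve_right (not_isLocalMax_of_strictAntiOn_left hxy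
    (lr_strictAntiOn hb (rr_neg_of_isLocalMax hb hxy h hx)))

theorem isLocalMax_of_isLocalMin {b : Fin m → ℂ} (hb : ∀ j, ‖b j‖ < 1) {x y : ℝ} (hxy : x < y)
    (h : ∀ t ∈ Ioo x y, rr κ b t ≠ 0) (hx : IsLocalMin (lr κ 0 b) x)
    (hy : IsLocalExtr (lr κ 0 b) y) : IsLocalMax (lr κ 0 b) y := by
  have hpos := (pos_or_neg_of_ne_zero (continuous_rr hb) h).resolve_right fun hneg =>
    not_isLocalMin_of_strictAntiOn_right hxy (lr_strictAntiOn hb hneg) hx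
  exact hy.resolve_left (not_isLocalMin_of_strictMonoOn_left hxy (lr_strictMonoOn hb hpos))

theorem rr_eq_zero_of_isLocalExtr {b : Fin m → ℂ} (hb : ∀ j, ‖b j‖ < 1) {t : ℝ}
    (h : IsLocalExtr (lr κ 0 b) t) : rr κ b t = 0 :=
  h.hasDerivAt_eq_zero (hasDerivAt_lr 0 hb t)

/-- Points of the circle can be listed in cyclic order, starting from any one of them. -/
theorem exists_sorted {n : ℕ} (S : Finset ℂ) (hS : ∀ z ∈ S, ‖z‖ = 1) (hn : S.card = n)
    (hpos : 0 < n) {t₀ : ℝ} (ht₀ : circleCover t₀ ∈ S) :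
    ∃ c : Fin n → ℝ, StrictMono c ∧ c ⟨0, hpos⟩ = t₀ ∧ (∀ i, c i < t₀ + 1) ∧
      (∀ i, circleCover (c i) ∈ S) ∧ ∀ z ∈ S, ∃ i, circleCover (c i) = z := by
  classical
  have hex : ∀ z ∈ S, ∃ t ∈ Ico t₀ (t₀ + 1), circleCover t = z := by
    intro z hz
    obtain ⟨t, rfl⟩ := exists_circleCover_eq (hS z hz)
    obtain ⟨k, hk, -⟩ := existsUnique_add_zsmul_mem_Ico (one_pos : (0 : ℝ) < 1) t t₀
    rw [zsmul_eq_mul, mul_one] at hk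
    exact ⟨t + k, hk, circleCover_add_int t k⟩
  choose! f hf1 hf2 using hex
  have hinj : InjOn f S := fun x hx y hy hxy => by rw [← hf2 x hx, ← hf2 y hy, hxy]
  set T : Finset ℝ := S.image f with hT
  have hcard : T.card = n := by rw [hT, Finset.card_image_of_injOn hinj, hn]
  have hmem : ∀ i, ∃ z ∈ S, f z = T.orderEmbOfFin hcard i := fun i => Finset.mem_image.1 (T.orderEmbOfFin_mem hcard i)
  have hf0 : f (circleCover t₀) = t₀ := by
    obtain ⟨k, hk⟩ := circleCover_eq_iff.1 (hf2 _ ht₀)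
    have h1 := hf1 _ ht₀
    have h2 : ((k : ℤ) : ℝ) < 1 := by linarith [h1.2]
    have h3 : (0 : ℝ) ≤ (k : ℤ) := by linarith [h1.1]
    have : k = 0 := by
      have h2' : k < 1 := by exact_mod_cast h2
      have h3' : 0 ≤ k := by exact_mod_cast h3
      omega
    rw [hk, this]; simp
  have hrange : ∀ z ∈ S, ∃ i, T.orderEmbOfFin hcard i = f z := fun z hz => by
    have : f z ∈ (T : Set ℝ) := by simpa [hT] using ⟨z, hz, rfl⟩
    rwa [← Finset.range_orderEmbOfFin T hcard] at this
  refine ⟨T.orderEmbOfFin hcard, (T.orderEmbOfFin hcard).strictMono, ?_, fun i => ?_, fun i => ?_,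
    fun z hz => ?_⟩
  · obtain ⟨i, hi⟩ := hrange _ ht₀
    refine le_antisymm ?_ ?_
    · rw [← hf0, ← hi]
      exact (T.orderEmbOfFin hcard).monotone (Nat.zero_le _)
    · obtain ⟨z, hz, h⟩ := hmem ⟨0, hpos⟩
      rw [← h]
      exact (hf1 z hz).1
  · obtain ⟨z, hz, h⟩ := hmem i
    rw [← h]
    exact (hf1 z hz).2
  · obtain ⟨z, hz, h⟩ := hmem i
    rw [← h, hf2 z hz]
    exact hz
  · obtain ⟨i, hi⟩ := hrange z hz
    exact ⟨i, by rw [hi, hf2 z hz]⟩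

/-- If the derivative of the lift has `2m` zeros, these are all its zeros. -/
theorem mem_of_rr_eq_zero (hκ : ∀ i, 0 < κ i) {b : Fin m → ℂ} (hb : ∀ j, ‖b j‖ < 1)
    (S : Finset ℂ) (hS : ∀ z ∈ S, ‖z‖ = 1 ∧ rc κ b z = 0) (hcard : S.card = 2 * m)
    (h0 : ¬ ∀ t, rr κ b t = 0) {t : ℝ} (ht : rr κ b t = 0) : circleCover t ∈ S := by
  classical
  by_contra hmem
  have h1 : (insert (circleCover t) S).card = 2 * m + 1 := by
    rw [Finset.card_insert_of_notMem hmem, hcard]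
  -- A further zero would give 2m + 1 of them, more than the count allows unless the derivative
  -- vanishes identically.
  have h2 := (rr_eq_zero_or_injective hκ hb (insert (circleCover t) S) (fun z hz => by
    rcases Finset.mem_insert.1 hz with rfl | hz
    · exact ⟨norm_circleCover t, by rw [rc_circleCover t hb, ht, Complex.ofReal_zero]⟩
    · exact hS z hz) (by omega)).resolve_left h0
  omega

theorem two_mul_pos_of_neZero : 0 < 2 * m := Nat.mul_pos two_pos (NeZero.pos m)

theorem gap_of_sorted {b : Fin m → ℂ} {c : Fin (2 * m) → ℝ} (hc : StrictMono c)
    (hlt : ∀ i, c i < c (fstIdx 0) + 1) (hz : ∀ t, rr κ b t = 0 → ∃ i, ∃ n : ℤ, t = c i + n)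
    {i i' : Fin (2 * m)} (hi : (i' : ℕ) = i + 1) : ∀ t ∈ Ioo (c i) (c i'), rr κ b t ≠ 0 := by
  intro t ht h0
  obtain ⟨k, n, rfl⟩ := hz t h0
  have h1 := hc.monotone (fstIdx_zero_le k)
  have h2 := hc.monotone (fstIdx_zero_le i)
  have h3 := hlt k
  have h4 := hlt i'
  have h5 : ((n : ℤ) : ℝ) < 1 := by linarith [ht.2]
  have h6 : (-1 : ℝ) < (n : ℤ) := by linarith [ht.1]
  have : n = 0 := by
    have h1' : n < 1 := by exact_mod_cast h5
    have h2' : -1 < n := by exact_mod_cast h6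
    omega
  rw [this, Int.cast_zero, add_zero] at ht
  have h7 := hc.lt_iff_lt.1 ht.1
  have h8 := hc.lt_iff_lt.1 ht.2
  rw [Fin.lt_def] at h7 h8
  omega

/-- A cyclically ordered list of all the local extrema, starting at a maximum, is a labelling. -/
theorem isLab_of_isLocalExtr (hκ : ∀ i, 0 < κ i) {b : Fin m → ℂ} (hb : ∀ j, ‖b j‖ < 1)
    {c : Fin (2 * m) → ℝ} (hc : StrictMono c) (hlt : ∀ i, c i < c (fstIdx 0) + 1)
    (hext : ∀ i, IsLocalExtr (lr κ 0 b) (c i)) (h0 : ¬ ∀ t, rr κ b t = 0)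
    (hmax : IsLocalMax (lr κ 0 b) (c (fstIdx 0))) : IsLab κ b c := by
  classical
  have hcrit := fun i => rr_eq_zero_of_isLocalExtr hb (hext i)
  have hcard : (critSet c).card = 2 * m := by
    rw [critSet, Finset.card_image_of_injective _ (circleCover_injOn_of_lt hc.injective fun i =>
      ⟨hc.monotone (fstIdx_zero_le i), hlt i⟩)]
    simp
  have hz : ∀ t, rr κ b t = 0 → ∃ i, ∃ n : ℤ, t = c i + n := by
    intro t ht
    obtain ⟨i, hi⟩ := mem_critSet.1 (mem_of_rr_eq_zero hκ hb (critSet c) (fun z hz => by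
      obtain ⟨i, rfl⟩ := mem_critSet.1 hz
      exact ⟨norm_circleCover _, by rw [rc_circleCover _ hb, hcrit i, Complex.ofReal_zero]⟩)
      hcard h0 ht)
    exact ⟨i, circleCover_eq_iff.1 hi.symm⟩
  have hgap := fun {i i'} => gap_of_sorted (i := i) (i' := i') hc hlt hz
  -- Consecutive extrema alternate, since the lift is strictly monotone between them; so the first
  -- maximum fixes the kind of all.
  have hall : ∀ (n : ℕ) (hn : n < m), IsLocalMax (lr κ 0 b) (c (fstIdx ⟨n, hn⟩)) := by
    intro n
    induction n with
    | zero => intro hn; exact hmax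
    | succ n ih =>
      intro hn
      have h1 := ih (by omega)
      have h2 := isLocalMin_of_isLocalMax hb (hc (fstIdx_lt_sndIdx _)) (hgap rfl) h1
        (hext (sndIdx ⟨n, by omega⟩))
      exact isLocalMax_of_isLocalMin hb (hc (by rw [Fin.lt_def]; simp [sndIdx, fstIdx]; omega))
        (hgap (by simp [sndIdx, fstIdx]; omega)) h2 (hext _)
  refine ⟨hb, hc, hlt, hcrit, fun j => ?_⟩
  have h1 := hc (fstIdx_lt_sndIdx j)
  exact lr_strictAntiOn hb (rr_neg_of_isLocalMax hb h1 (hgap rfl) (hall j j.2))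
    (left_mem_Icc.2 h1.le) (right_mem_Icc.2 h1.le) h1

theorem rr_eq_deriv_deriv {b : Fin m → ℂ} (hb : ∀ j, ‖b j‖ < 1) (t : ℝ) :
    deriv (deriv (lr κ 0 b)) t = rr2 κ b t := by
  have : deriv (lr κ 0 b) = rr κ b := funext fun t => (hasDerivAt_lr 0 hb t).deriv
  rw [this, (hasDerivAt_rr hb t).deriv]

namespace IsLab

variable {b : Fin m → ℂ} {c : Fin (2 * m) → ℝ}

theorem isLocalMax (hκ : ∀ i, 0 < κ i) (h : IsLab κ b c) (j : Fin m) :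
    IsLocalMax (lr κ 0 b) (c (fstIdx j)) := by
  have hd := hasDerivAt_lr (κ := κ) 0 h.norm_lt (c (fstIdx j))
  refine isLocalMax_of_deriv_deriv_neg ?_ ?_ hd.continuousAt
  · rw [rr_eq_deriv_deriv h.norm_lt]; exact h.rr2_fst_neg hκ j
  · rw [hd.deriv, h.crit]

theorem isLocalMin (hκ : ∀ i, 0 < κ i) (h : IsLab κ b c) (j : Fin m) :
    IsLocalMin (lr κ 0 b) (c (sndIdx j)) := by
  have hd := hasDerivAt_lr (κ := κ) 0 h.norm_lt (c (sndIdx j))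
  refine isLocalMin_of_deriv_deriv_pos ?_ ?_ hd.continuousAt
  · rw [rr_eq_deriv_deriv h.norm_lt]; exact h.rr2_snd_pos hκ j
  · rw [hd.deriv, h.crit]

theorem isLocalExtr (hκ : ∀ i, 0 < κ i) (h : IsLab κ b c) (i : Fin (2 * m)) :
    IsLocalExtr (lr κ 0 b) (c i) := by
  obtain ⟨j, rfl | rfl⟩ := eq_fstIdx_or_sndIdx i
  · exact Or.inr (h.isLocalMax hκ j)
  · exact Or.inl (h.isLocalMin hκ j)

end IsLab

theorem isLocalMax_lr_iff {b : Fin m → ℂ} (x : ℝ) {t : ℝ} {F : ℝ → ℝ}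
    (hF : ∀ t, F t = lr κ 0 b t + x) : IsLocalMax F t ↔ IsLocalMax (lr κ 0 b) t := by
  simp only [IsLocalMax, IsMaxFilter, hF, add_le_add_iff_right]

theorem isLocalMin_lr_iff {b : Fin m → ℂ} (x : ℝ) {t : ℝ} {F : ℝ → ℝ}
    (hF : ∀ t, F t = lr κ 0 b t + x) : IsLocalMin F t ↔ IsLocalMin (lr κ 0 b) t := by
  simp only [IsLocalMin, IsMinFilter, hF, add_le_add_iff_right]

theorem isLocalExtr_lr_iff {b : Fin m → ℂ} (x : ℝ) {t : ℝ} {F : ℝ → ℝ}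
    (hF : ∀ t, F t = lr κ 0 b t + x) : IsLocalExtr F t ↔ IsLocalExtr (lr κ 0 b) t := by
  simp only [IsLocalExtr, IsExtrFilter]
  exact or_congr (isLocalMin_lr_iff x hF) (isLocalMax_lr_iff x hF)

theorem isLocalExtr_lr_add_int {b : Fin m → ℂ} {t : ℝ} (n : ℤ) :
    IsLocalExtr (lr κ 0 b) (t + n) ↔ IsLocalExtr (lr κ 0 b) t := by
  have hm : map (fun s : ℝ => s + n) (𝓝 t) = 𝓝 (t + n) := (Homeomorph.addRight (n : ℝ)).map_nhds_eq t
  simp only [IsLocalExtr, IsExtrFilter, IsMinFilter, IsMaxFilter, ← hm, eventually_map, lr_add_int,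
    add_le_add_iff_right]

end

/-! ### From the original parameters to the reciprocals of the zeros and back. -/

section

variable {m : ℕ} {κ : Fin (m + 1) → ℕ} [NeZero m] {μ : RealVec m}

theorem zeroInv_eq (j : Fin m) : zeroInv μ j = (zeroPt μ j)⁻¹ := by
  rw [zeroInv, zeroPt, mul_inv, ← ce_ofReal, Complex.ofReal_neg, ce_neg, ce_ofReal]

theorem zeroPt_ne_zero (hμ : ∀ j, 1 < radius μ j) (j : Fin m) : zeroPt μ j ≠ 0 :=
  mul_ne_zero (Complex.ofReal_ne_zero.2 (one_pos.trans (hμ j)).ne') (circleCover_ne_zero _)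

theorem circleCover_nsmul (x : ℝ) (n : ℕ) : circleCover (n * x) = circleCover x ^ n := by
  rw [circleCover, circleCover, ← Complex.exp_nat_mul]
  congr 1
  push_cast
  ring

theorem circleCover_sum {ι : Type*} (s : Finset ι) (f : ι → ℝ) :
    circleCover (∑ i ∈ s, f i) = ∏ i ∈ s, circleCover (f i) := by
  classical
  induction s using Finset.induction_on with
  | empty => simp [circleCover]
  | insert a s ha ih => rw [Finset.sum_insert ha, Finset.prod_insert ha, circleCover_add, ih]

/-- The Blaschke-type product in terms of the inverses of its zeros. -/
theorem bl_zeroInv (hμ : ∀ j, 1 < radius μ j) (z : ℂ) :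
    bl κ (etaShift κ μ) (zeroInv μ) z = blaschke κ μ z := by
  have h1 : circleCover (2 * ∑ j : Fin m, (κ j.succ : ℝ) * angle μ j) =
      ∏ j : Fin m, circleCover (2 * angle μ j) ^ κ j.succ := by
    rw [Finset.mul_sum, circleCover_sum]
    refine Finset.prod_congr rfl fun j _ => ?_
    rw [← circleCover_nsmul]
    congr 1
    ring
  have h2 : ∀ j, circleCover (2 * angle μ j) * ((1 - zeroInv μ j * z) / (z - star (zeroInv μ j))) =
      (z - zeroPt μ j) / (1 - star (zeroPt μ j) * z) := by
    intro j
    have ha := zeroPt_ne_zero hμ j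
    have hs : star (zeroPt μ j) ≠ 0 := star_ne_zero.2 ha
    -- The two forms of a factor differ by the constant a / conj a = e^{4πiη_j}, which is the source
    -- of the 2 in `etaShift`.
    have h3 : circleCover (2 * angle μ j) * star (zeroPt μ j) = zeroPt μ j := by
      rw [zeroPt, StarMul.star_mul, star_circleCover, two_mul, circleCover_add]
      have h4 : circleCover (angle μ j) * circleCover (-angle μ j) = 1 := by
        rw [← circleCover_add, add_neg_cancel]; simp [circleCover]
      have h5 : star (radius μ j : ℂ) = radius μ j := Complex.conj_ofReal _
      rw [h5]
      linear_combination (circleCover (angle μ j) * (radius μ j : ℂ)) * h4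
    have h4 : 1 - zeroInv μ j * z = -((z - zeroPt μ j) * (zeroPt μ j)⁻¹) := by
      rw [zeroInv_eq]; field_simp; ring
    have h5 : z - star (zeroInv μ j) = -((1 - star (zeroPt μ j) * z) * (star (zeroPt μ j))⁻¹) := by
      rw [zeroInv_eq, star_inv₀]; field_simp; ring
    rw [h4, h5, neg_div_neg_eq, mul_div_mul_comm, mul_left_comm]
    have h6 : circleCover (2 * angle μ j) * ((zeroPt μ j)⁻¹ / (star (zeroPt μ j))⁻¹) = 1 := by
      field_simp
      exact h3
    rw [h6, mul_one]
  rw [bl, blaschke, etaShift, circleCover_add, h1, mul_right_comm _ (∏ j, _) (z ^ κ 0),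
    mul_assoc _ (∏ j, _) (∏ j, _), ← Finset.prod_mul_distrib]
  congr 1
  refine Finset.prod_congr rfl fun j _ => ?_
  rw [← mul_pow, h2]

theorem norm_blaschke (hμ : ∀ j, 1 < radius μ j) (z : ℂ) :
    ‖blaschke κ μ z‖ = ‖bl κ 0 (zeroInv μ) z‖ := by
  rw [← bl_zeroInv hμ, norm_bl, norm_bl]

theorem outerDomain_eq (hμ : ∀ j, 1 < radius μ j) (j : Fin m) :
    outerDomain κ μ j = outComp κ (zeroInv μ) j := by
  rw [outerDomain, outComp, outSet, zeroInv_eq, inv_inv]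
  simp only [norm_blaschke hμ]

theorem isCircleLift_lr (hμ : ∀ j, 1 < radius μ j) :
    IsCircleLift (blaschke κ μ) (lr κ (etaShift κ μ) (zeroInv μ)) :=
  ⟨continuous_lr _ fun j => norm_zeroInv_lt_one (hμ j), fun t => by
    rw [← bl_zeroInv hμ, bl_circleCover _ fun j => norm_zeroInv_lt_one (hμ j)]⟩

/-- Two lifts of the same map differ by an integer. -/
theorem IsCircleLift.exists_eq_add {g : ℂ → ℂ} {F G : ℝ → ℝ} (hF : IsCircleLift g F)
    (hG : IsCircleLift g G) : ∃ l : ℤ, ∀ t, F t = G t + l := by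
  have h1 : ∀ t, ∃ l : ℤ, F t = G t + l := fun t =>
    circleCover_eq_iff.1 ((hF.2 t).symm.trans (hG.2 t))
  choose l hl using h1
  have h2 : Continuous fun t => ((l t : ℤ) : ℝ) := by
    have : (fun t => ((l t : ℤ) : ℝ)) = fun t => F t - G t := funext fun t => by rw [hl t]; ring
    rw [this]
    exact hF.1.sub hG.1
  have h3 : Continuous l := Int.isClosedEmbedding_coe_real.isEmbedding.continuous_iff.2 h2
  exact ⟨l 0, fun t => by rw [hl t, PreconnectedSpace.constant inferInstance h3 (x := t) (y := 0)]⟩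

theorem IsCircleLift.exists_eq_lr (hμ : ∀ j, 1 < radius μ j) {F : ℝ → ℝ}
    (hF : IsCircleLift (blaschke κ μ) F) :
    ∃ l : ℤ, ∀ t, F t = lr κ (etaShift κ μ) (zeroInv μ) t + l :=
  hF.exists_eq_add (isCircleLift_lr hμ)

theorem IsCircleLift.exists_eq_lr_zero (hμ : ∀ j, 1 < radius μ j) {F : ℝ → ℝ}
    (hF : IsCircleLift (blaschke κ μ) F) :
    ∃ x : ℝ, ∀ t, F t = lr κ 0 (zeroInv μ) t + x := by
  obtain ⟨l, hl⟩ := hF.exists_eq_lr hμ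
  exact ⟨etaShift κ μ + l, fun t => by rw [hl, lr_eq_add]; ring⟩

theorem circleCover_injOn_Ico (x : ℝ) : InjOn circleCover (Ico x (x + 1)) := by
  intro s hs t ht hst
  obtain ⟨k, hk⟩ := circleCover_eq_iff.1 hst
  have h1 : ((k : ℤ) : ℝ) < 1 := by linarith [hs.2, ht.1]
  have h2 : (-1 : ℝ) < (k : ℤ) := by linarith [ht.2, hs.1]
  have : k = 0 := by
    have h1' : k < 1 := by exact_mod_cast h1
    have h2' : -1 < k := by exact_mod_cast h2
    omega
  rw [hk, this]; simp

theorem IsLab.mem_multimodalParams (hκ : ∀ i, 0 < κ i) (hμ : ∀ j, 1 < radius μ j)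
    {c : RealVec m} (h : IsLab κ (zeroInv μ) c) : μ ∈ multimodalParams κ := by
  refine ⟨hμ, _, isCircleLift_lr hμ, ?_⟩
  have h1 : ∀ t, IsLocalExtr (lr κ (etaShift κ μ) (zeroInv μ)) t ↔
      circleCover t ∈ critSet c := by
    intro t
    rw [isLocalExtr_lr_iff (etaShift κ μ) fun t => by rw [lr_eq_add, add_comm], mem_critSet]
    constructor
    · intro ht
      obtain ⟨i, n, rfl⟩ := (h.rr_eq_zero_iff hκ).1 (rr_eq_zero_of_isLocalExtr h.norm_lt ht)
      exact ⟨i, (circleCover_add_int _ _).symm⟩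
    · rintro ⟨i, hi⟩
      obtain ⟨n, rfl⟩ := circleCover_eq_iff.1 hi.symm
      exact (isLocalExtr_lr_add_int n).2 (h.isLocalExtr hκ i)
  simp only [h1]
  have h2 : circleCover '' {t ∈ Ico (0 : ℝ) 1 | circleCover t ∈ critSet c} = (critSet c : Set ℂ) := by
    refine subset_antisymm (by rintro _ ⟨t, ht, rfl⟩; exact ht.2) fun z hz => ?_
    obtain ⟨t, rfl⟩ := exists_circleCover_eq (h.critSet_zero z hz).1
    obtain ⟨k, hk, -⟩ := existsUnique_add_zsmul_mem_Ico (one_pos : (0 : ℝ) < 1) t 0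
    rw [zsmul_eq_mul, mul_one, zero_add] at hk
    exact ⟨t + k, ⟨hk, by rw [circleCover_add_int]; exact hz⟩, circleCover_add_int t k⟩
  have h3 : InjOn circleCover {t ∈ Ico (0 : ℝ) 1 | circleCover t ∈ critSet c} := by
    refine (circleCover_injOn_Ico 0).mono fun t ht => ?_
    rw [zero_add]; exact ht.1
  rw [← h3.encard_image, h2, encard_coe_eq_coe_finsetCard, h.card_critSet]

/-- A labelling of a multimodal map. -/
theorem exists_isLab_of_mem (hκ : ∀ i, 0 < κ i) (hμ : μ ∈ multimodalParams κ) :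
    ∃ c : RealVec m, IsLab κ (zeroInv μ) c := by
  classical
  obtain ⟨hr, F, hF, hcard⟩ := hμ
  set b := zeroInv μ with hb
  have hb1 : ∀ j, ‖b j‖ < 1 := fun j => norm_zeroInv_lt_one (hr j)
  obtain ⟨x, hx⟩ := hF.exists_eq_lr_zero hr
  set E : Set ℝ := {t ∈ Ico (0 : ℝ) 1 | IsLocalExtr F t} with hE
  have hfin : E.Finite := finite_of_encard_eq_coe hcard
  have hinj : InjOn circleCover E := by
    refine (circleCover_injOn_Ico 0).mono fun t ht => ?_
    rw [zero_add]; exact ht.1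
  set S : Finset ℂ := hfin.toFinset.image circleCover with hS
  have hScard : S.card = 2 * m := by
    rw [hS, Finset.card_image_of_injOn (by rwa [Finite.coe_toFinset])]
    have := hfin.encard_eq_coe_toFinset_card
    rw [hcard] at this
    exact_mod_cast this.symm
  have hmem : ∀ t, circleCover t ∈ S → IsLocalExtr (lr κ 0 b) t := by
    intro t ht
    obtain ⟨s, hs, hst⟩ := Finset.mem_image.1 ht
    obtain ⟨n, rfl⟩ := circleCover_eq_iff.1 hst.symm
    rw [isLocalExtr_lr_add_int, ← isLocalExtr_lr_iff x hx]
    exact ((Finite.mem_toFinset _).1 hs).2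
  have hnorm : ∀ z ∈ S, ‖z‖ = 1 := fun z hz => by
    obtain ⟨s, hs, rfl⟩ := Finset.mem_image.1 hz
    exact norm_circleCover s
  have hzero : ∀ z ∈ S, ‖z‖ = 1 ∧ rc κ b z = 0 := fun z hz => by
    obtain ⟨t, rfl⟩ := exists_circleCover_eq (hnorm z hz)
    exact ⟨norm_circleCover t, by
      rw [rc_circleCover t hb1, rr_eq_zero_of_isLocalExtr hb1 (hmem t hz), Complex.ofReal_zero]⟩
  -- A constant lift would have every point as a local extremum, infinitely many per period.
  have h0 : ¬ ∀ t, rr κ b t = 0 := by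
    intro h0
    have h1 : ∀ s t, lr κ 0 b s = lr κ 0 b t := fun s t => is_const_of_deriv_eq_zero
      (fun t => (hasDerivAt_lr 0 hb1 t).differentiableAt)
      (fun t => by rw [(hasDerivAt_lr 0 hb1 t).deriv, h0 t]) s t
    have h2 : E = Ico 0 1 := by
      refine subset_antisymm (fun t ht => ht.1) fun t ht => ⟨ht, ?_⟩
      rw [isLocalExtr_lr_iff x hx]
      exact Or.inl (Eventually.of_forall fun s => (h1 t s).le)
    rw [h2] at hfin
    exact Ico_infinite (zero_lt_one' ℝ) hfin
  have hm := two_mul_pos_of_neZero (m := m)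
  have hsort : ∀ t₀, circleCover t₀ ∈ S → ∃ c : RealVec m, StrictMono c ∧ c (fstIdx 0) = t₀ ∧
      (∀ i, c i < c (fstIdx 0) + 1) ∧ ∀ i, IsLocalExtr (lr κ 0 b) (c i) := by
    intro t₀ ht₀
    obtain ⟨c, h1, h2, h3, h4, -⟩ := exists_sorted S hnorm hScard hm ht₀
    have h5 : c (fstIdx 0) = t₀ := h2
    exact ⟨c, h1, h5, fun i => h5 ▸ h3 i, fun i => hmem _ (h4 i)⟩
  obtain ⟨z, hz⟩ : S.Nonempty := Finset.card_pos.1 (hScard ▸ hm)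
  obtain ⟨t₀, rfl⟩ := exists_circleCover_eq (hnorm z hz)
  -- If the extremum at hand is a minimum, the next one in cyclic order is a maximum.
  obtain ⟨t₁, ht₁, hmax⟩ : ∃ t, circleCover t ∈ S ∧ IsLocalMax (lr κ 0 b) t := by
    rcases (hmem t₀ hz).symm with hmax | hmin
    · exact ⟨t₀, hz, hmax⟩
    · obtain ⟨c, h1, h2, h3, h4, h5⟩ := exists_sorted S hnorm hScard hm hz
      have h6 : c (fstIdx 0) = t₀ := h2
      have hgap := gap_of_sorted (i := fstIdx 0) (i' := sndIdx 0) (κ := κ) (b := b) h1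
        (fun i => h6 ▸ h3 i) (fun t ht => by
          obtain ⟨i, hi⟩ := h5 _ (mem_of_rr_eq_zero hκ hb1 S hzero hScard h0 ht)
          exact ⟨i, circleCover_eq_iff.1 hi.symm⟩) rfl
      exact ⟨c (sndIdx 0), h4 _, isLocalMax_of_isLocalMin hb1 (h1 (fstIdx_lt_sndIdx 0)) hgap
        (h6 ▸ hmin) (hmem _ (h4 _))⟩
  obtain ⟨c, h1, h2, h3, h4⟩ := hsort t₁ ht₁
  exact ⟨c, isLab_of_isLocalExtr hκ hb1 h1 h3 h4 h0 (h2 ▸ hmax)⟩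

namespace IsLab

variable {b : Fin m → ℂ} {c c' : RealVec m} {σ τ : Equiv.Perm (Fin m)}

/-- The labelling can be started at any of the maxima. -/
theorem exists_start (hκ : ∀ i, 0 < κ i) (h : IsLab κ b c) (j : Fin m) :
    ∃ c' : RealVec m, IsLab κ b c' ∧ c' (fstIdx 0) = c (fstIdx j) := by
  obtain ⟨c', h1, h2, h3, h4, -⟩ := exists_sorted (critSet c) (fun z hz => (h.critSet_zero z hz).1)
    h.card_critSet two_mul_pos_of_neZero (mem_critSet.2 ⟨fstIdx j, rfl⟩)
  have h5 : c' (fstIdx 0) = c (fstIdx j) := h2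
  refine ⟨c', isLab_of_isLocalExtr hκ h.norm_lt h1 (fun i => h5 ▸ h3 i) (fun i => ?_)
    h.not_rr_eq_zero (h5 ▸ h.isLocalMax hκ j), h5⟩
  obtain ⟨k, hk⟩ := mem_critSet.1 (h4 i)
  obtain ⟨n, hn⟩ := circleCover_eq_iff.1 hk.symm
  rw [hn, isLocalExtr_lr_add_int]
  exact h.isLocalExtr hκ k

theorem add_int (h : IsLab κ b c) (n : ℤ) : IsLab κ b fun i => c i + n :=
  ⟨h.norm_lt, fun i j hij => add_lt_add_left (h.strictMono hij) _,
    fun i => by linarith [h.lt_add_one i], fun i => by rw [rr_add_int, h.crit],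
    fun j => by rw [lr_add_int, lr_add_int]; linarith [h.desc j]⟩

theorem _root_.BlaschkeFamily.IsType.add_int (h : IsType κ b c σ) (n : ℤ) :
    IsType κ b (fun i => c i + n) σ := fun j t ht i => by
  have := h j (t - n) ⟨by linarith [ht.1], by linarith [ht.2]⟩ i
  rw [← this, ← touch_add_int (t := t - n) n, sub_add_cancel]

theorem eq_of_start_eq (hκ : ∀ i, 0 < κ i) (h : IsLab κ b c) (h' : IsLab κ b c')
    (h0 : c' (fstIdx 0) = c (fstIdx 0)) : c' = c := by
  refine (h'.strictMono.range_inj h.strictMono).1 (subset_antisymm ?_ ?_)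
  · rintro _ ⟨i, rfl⟩
    obtain ⟨k, hk⟩ := h.eq_of_rr_eq_zero hκ (h'.crit i) (h0 ▸ h'.le i) (h0 ▸ h'.lt_add_one i)
    exact ⟨k, hk.symm⟩
  · rintro _ ⟨i, rfl⟩
    obtain ⟨k, hk⟩ := h'.eq_of_rr_eq_zero hκ (h.crit i) (h0 ▸ h.le i) (h0 ▸ h.lt_add_one i)
    exact ⟨k, hk.symm⟩

/-- A labelling whose first pair belongs to the first zero is unique up to translation. -/
theorem eq_add_int (hκ : ∀ i, 0 < κ i) (h : IsLab κ b c) (hσ : IsType κ b c σ)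
    (h' : IsLab κ b c') (hτ : IsType κ b c' τ) (h0 : τ 0 = σ 0) :
    τ = σ ∧ ∃ n : ℤ, c' = fun i => c i + n := by
  obtain ⟨i, n, hn⟩ := (h.rr_eq_zero_iff hκ).1 (h'.crit (fstIdx 0))
  have ht : c i ∈ touch κ b (σ 0) := by
    rw [← touch_add_int n, ← hn, ← h0]
    exact (h'.fst_mem_touch_iff hκ hτ).2 rfl
  -- The first point of the second labelling touches the component of the common first zero, so it
  -- comes from the arc of index 0 or from a minimum; the sign of the second derivative rules out a
  -- minimum.
  have hc : c' = fun i => c i + n := by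
    refine (h.add_int n).eq_of_start_eq hκ h' ?_
    obtain ⟨j, rfl | rfl⟩ := eq_fstIdx_or_sndIdx i
    · rw [hn, σ.injective ((h.fst_mem_touch_iff hκ hσ).1 ht)]
    · exfalso
      have h1 := h'.isLocalMax hκ 0
      have h2 := (h.add_int n).isLocalMin hκ j
      have h3 := h'.rr2_fst_neg hκ 0
      have h4 := (h.add_int n).rr2_snd_pos hκ j
      rw [← hn] at h4
      exact h3.not_gt h4
  refine ⟨?_, n, hc⟩
  subst hc
  exact h'.isType_unique hτ (hσ.add_int n)

/-- The component is open and disjoint from the circle, so for circle points the frontier and the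
closure agree. -/
theorem mem_frontier_iff (hμ : ∀ j, 1 < radius μ j) (h : IsLab κ (zeroInv μ) c) {i : Fin m}
    {t : ℝ} : circleCover t ∈ frontier (outerDomain κ μ i) ↔ t ∈ touch κ (zeroInv μ) i := by
  rw [outerDomain_eq hμ, (h.isOpen_outComp i).frontier_eq]
  refine ⟨fun ht => ht.1, fun ht => ⟨ht, fun h1 => ?_⟩⟩
  have := (outComp_subset i h1).1
  rw [norm_circleCover] at this
  exact this.false

end IsLab

/-- A labelling whose first pair belongs to the first zero. -/
theorem exists_isLab_isType (hκ : ∀ i, 0 < κ i) (hμ : μ ∈ multimodalParams κ) :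
    ∃ (c : RealVec m) (σ : Equiv.Perm (Fin m)), IsLab κ (zeroInv μ) c ∧
      IsType κ (zeroInv μ) c σ ∧ σ 0 = 0 := by
  obtain ⟨c, h⟩ := exists_isLab_of_mem hκ hμ
  obtain ⟨σ, hσ⟩ := h.exists_isType hκ
  -- Restart the list at the maximum of the arc that belongs to the first zero.
  obtain ⟨c', h', hc'⟩ := h.exists_start hκ (σ.symm 0)
  obtain ⟨τ, hτ⟩ := h'.exists_isType hκ
  refine ⟨c', τ, h', hτ, ((h'.fst_mem_touch_iff hκ hτ).1 ?_).symm⟩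
  rw [hc', h.fst_mem_touch_iff hκ hσ, Equiv.apply_symm_apply]

end

/-! ### The critical values as global coordinates on a component. -/

section

variable {m : ℕ} {κ : Fin (m + 1) → ℕ} [NeZero m] {μ : RealVec m} {σ τ : Equiv.Perm (Fin m)}

/-- Changing the rotation parameter. -/
def shiftParam (μ : RealVec m) (y : ℝ) : RealVec m := fun i =>
  if i = fstIdx 0 then μ i + y else μ i

theorem zeroInv_shiftParam (μ : RealVec m) (y : ℝ) : zeroInv (shiftParam μ y) = zeroInv μ := by
  have h1 : ∀ j : Fin m, j ≠ 0 → fstIdx j ≠ fstIdx 0 := fun j hj h => hj (Fin.ext (by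
    simpa [fstIdx] using h))
  have h2 : ∀ j : Fin m, sndIdx j ≠ fstIdx 0 := fun j h => by
    have := congrArg Fin.val h
    simp [sndIdx, fstIdx] at this
  ext1 j
  rw [zeroInv, zeroInv]
  by_cases hj : j = 0
  · simp [radius, angle, hj, shiftParam, h2]
  · simp [radius, angle, hj, shiftParam, h1 j hj, h2]

theorem radius_shiftParam (μ : RealVec m) (y : ℝ) (j : Fin m) :
    radius (shiftParam μ y) j = radius μ j := by
  have h2 : sndIdx (0 : Fin m) ≠ fstIdx 0 := fun h => by
    have := congrArg Fin.val h
    simp [sndIdx, fstIdx] at this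
  by_cases hj : j = 0
  · simp [radius, hj, shiftParam, h2]
  · have h1 : fstIdx j ≠ fstIdx 0 := fun h => hj (Fin.ext (by simpa [fstIdx] using h))
    simp [radius, hj, shiftParam, h1]

theorem etaShift_shiftParam (μ : RealVec m) (y : ℝ) :
    etaShift κ (shiftParam μ y) = etaShift κ μ + y := by
  have h1 : ∀ j, angle (shiftParam μ y) j = angle μ j := fun j => by
    have h2 : sndIdx j ≠ fstIdx 0 := fun h => by
      have := congrArg Fin.val h
      simp [sndIdx, fstIdx] at this
    simp [angle, shiftParam, h2]
  simp only [etaShift, h1, eta0, shiftParam, if_true]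
  ring

theorem continuous_shiftParam (μ : RealVec m) : Continuous (shiftParam μ) := by
  refine continuous_pi fun i => ?_
  unfold shiftParam
  split_ifs <;> fun_prop

theorem shiftParam_zero (μ : RealVec m) : shiftParam μ 0 = μ := by
  ext1 i
  simp [shiftParam]

theorem xiParam_eq {q q' : RealVec m × RealVec m} (h : IsLab κ (zeroInv q.1) q.2)
    (h' : IsLab κ (zeroInv q'.1) q'.2) (hv : ∀ i, lr κ (etaShift κ q.1) (zeroInv q.1) (q.2 i) =
      lr κ (etaShift κ q'.1) (zeroInv q'.1) (q'.2 i)) : xiParam κ q = xiParam κ q' :=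
  Prod.ext (funext fun i => (h.crit i).trans (h'.crit i).symm) (funext hv)

/-- Labelled families with the same critical values that agree at a point agree. -/
theorem eqOn_of_values_eq {A : Type*} [TopologicalSpace A] (hκ : ∀ i, 0 < κ i) {S : Set A}
    (hS : IsPreconnected S) {p q : A → RealVec m × RealVec m} (hp : ContinuousOn p S)
    (hq : ContinuousOn q S) (hr : ∀ x ∈ S, ∀ j, 1 < radius (p x).1 j)
    (hlp : ∀ x ∈ S, IsLab κ (zeroInv (p x).1) (p x).2)
    (hlq : ∀ x ∈ S, IsLab κ (zeroInv (q x).1) (q x).2)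
    (hv : ∀ x ∈ S, ∀ i, lr κ (etaShift κ (p x).1) (zeroInv (p x).1) ((p x).2 i) =
      lr κ (etaShift κ (q x).1) (zeroInv (q x).1) ((q x).2 i)) {a : A} (ha : a ∈ S)
    (hpq : p a = q a) : EqOn p q S := by
  refine eqOn_of_locally_injOn (p := xiParam κ) hS hp hq (fun x hx => ?_)
    (fun x hx => xiParam_eq (hlp x hx) (hlq x hx) (hv x hx)) ha hpq
  obtain ⟨g, -, -, hg, -⟩ := (hlp x hx).exists_xiParam_inverse hκ (hr x hx)
  exact exists_nhds_injOn_of_left_inverse hg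

/-- A continuous family of labelled parameters with prescribed critical values. -/
structure IsSection (κ : Fin (m + 1) → ℕ) (σ : Equiv.Perm (Fin m)) (s C : RealVec m → RealVec m) :
    Prop where
  continuousOn : ContinuousOn s (valueRegion κ σ)
  continuousOn_crit : ContinuousOn C (valueRegion κ σ)
  one_lt_radius : ∀ v ∈ valueRegion κ σ, ∀ j, 1 < radius (s v) j
  isLab : ∀ v ∈ valueRegion κ σ, IsLab κ (zeroInv (s v)) (C v)
  isType : ∀ v ∈ valueRegion κ σ, IsType κ (zeroInv (s v)) (C v) σ
  value : ∀ v ∈ valueRegion κ σ, ∀ i, lr κ (etaShift κ (s v)) (zeroInv (s v)) (C v i) = v i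

namespace IsSection

variable {s C : RealVec m → RealVec m}

/-- Changing η₀ alone translates all critical values by a constant and keeps the labelling;
uniqueness of lifts identifies this family with the section. -/
theorem add_const (hκ : ∀ i, 0 < κ i) (hs : IsSection κ σ s C) {v : RealVec m}
    (hv : v ∈ valueRegion κ σ) (x : ℝ) : s (fun i => v i + x) = shiftParam (s v) x := by
  have hmem : ∀ y : ℝ, (fun i => v i + y) ∈ valueRegion κ σ := fun y =>
    add_const_mem_valueRegion y hv
  have hc : Continuous fun y : ℝ => (fun i => v i + y : RealVec m) := by fun_prop
  have hlab : ∀ y, IsLab κ (zeroInv (shiftParam (s v) y)) (C v) := fun y => by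
    rw [zeroInv_shiftParam]; exact hs.isLab v hv
  have := eqOn_of_values_eq hκ (S := univ) isPreconnected_univ
    (p := fun y : ℝ => (shiftParam (s v) y, C v))
    (q := fun y : ℝ => (s fun i => v i + y, C fun i => v i + y)) (a := 0)
    ((continuous_shiftParam _).prodMk continuous_const).continuousOn
    (ContinuousOn.prodMk (hs.continuousOn.comp hc.continuousOn fun y _ => hmem y)
      (hs.continuousOn_crit.comp hc.continuousOn fun y _ => hmem y))
    (fun y _ j => by rw [radius_shiftParam]; exact hs.one_lt_radius v hv j)
    (fun y _ => hlab y) (fun y _ => hs.isLab _ (hmem y)) (fun y _ i => by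
      rw [hs.value _ (hmem y)]
      simp only
      rw [zeroInv_shiftParam, etaShift_shiftParam, lr_eq_add, ← hs.value v hv i,
        lr_eq_add (etaShift κ (s v))]
      ring) (mem_univ _) (by simp [shiftParam_zero])
  exact (congrArg Prod.fst (this (mem_univ x))).symm

/-- Two labellings of one parameter differ by an integer n, so their values differ by the constant n
d. By `add_const` such a difference changes η₀ by n d; as the parameter is the same, n d = 0. -/
theorem injOn (hκ : ∀ i, 0 < κ i) (hs : IsSection κ σ s C) : InjOn s (valueRegion κ σ) := by
  intro v hv w hw h
  have h1 := hs.isLab w hw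
  have h2 := hs.isType w hw
  rw [← h] at h1 h2
  obtain ⟨-, n, hn⟩ := (hs.isLab v hv).eq_add_int hκ (hs.isType v hv) h1 h2 rfl
  have h3 : w = fun i => v i + n * circleDegree κ := by
    ext1 i
    rw [← hs.value w hw i, ← h, hn, lr_add_int, hs.value v hv i]
  have h4 := hs.add_const hκ hv (n * circleDegree κ)
  rw [← h3, ← h] at h4
  have h5 := congrFun h4 (fstIdx 0)
  simp only [shiftParam, if_true, left_eq_add] at h5
  rw [h3, h5]
  simp

theorem mem_multimodalParams (hκ : ∀ i, 0 < κ i) (hs : IsSection κ σ s C) {v : RealVec m}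
    (hv : v ∈ valueRegion κ σ) : s v ∈ multimodalParams κ :=
  (hs.isLab v hv).mem_multimodalParams hκ (hs.one_lt_radius v hv)

end IsSection

/-- The critical values of a labelled family of parameters. -/
def critVal (κ : Fin (m + 1) → ℕ) (c : RealVec m → RealVec m) (μ : RealVec m) : RealVec m :=
  fun i => lr κ (etaShift κ μ) (zeroInv μ) (c μ i)

theorem contDiffAt_critVal {n : WithTop ℕ∞} (hn : n ≤ ∞) {c : RealVec m → RealVec m}
    (hr : ∀ j, 1 < radius μ j) (hc : ContDiffAt ℝ n c μ) : ContDiffAt ℝ n (critVal κ c) μ := by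
  have h1 := (contDiffAt_xiParam (κ := κ) (q := (μ, c μ)) hr).snd.of_le hn
  exact ContDiffAt.comp μ (f := fun ν => (ν, c ν)) h1 (contDiffAt_id.prodMk hc)

/-- Locally, labellings of multimodal maps depend smoothly on the parameter. -/
theorem exists_smooth_isLab (hκ : ∀ i, 0 < κ i) {c : RealVec m} (hr : ∀ j, 1 < radius μ j)
    (h : IsLab κ (zeroInv μ) c) (hτ : IsType κ (zeroInv μ) c τ) :
    ∃ O ∈ 𝓝 μ, IsPreconnected O ∧ ∃ γ : RealVec m → RealVec m, ContDiffAt ℝ ∞ γ μ ∧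
      ContinuousOn γ O ∧ ∀ ν ∈ O, (∀ j, 1 < radius ν j) ∧ IsLab κ (zeroInv ν) (γ ν) ∧
        IsType κ (zeroInv ν) (γ ν) τ := by
  obtain ⟨γ, h1, h2, h3⟩ := h.exists_smooth_critical hκ hr
  have h4 : ∀ᶠ ν in 𝓝 μ, ∀ j, 1 < radius ν j := eventually_all.2 fun j =>
    continuousAt_const.eventually_lt (contDiff_radius j).continuous.continuousAt (hr j)
  have h5 : ∀ᶠ ν in 𝓝 μ, ContDiffAt ℝ 1 γ ν := (h1.of_le (by simp)).eventually (by simp)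
  have h6 : ContinuousAt (fun ν => (zeroInv ν, γ ν)) μ := by
    refine ContinuousAt.prodMk (continuousAt_pi.2 fun j => ?_) h1.continuousAt
    exact (contDiffAt_zeroInv (one_pos.trans (hr j)).ne').continuousAt
  subst h2
  have h7 := h6.eventually (h.eventually_isType hκ hτ)
  obtain ⟨ε, hε, hball⟩ := Metric.eventually_nhds_iff_ball.1 (((h3.and h4).and h5).and h7)
  refine ⟨Metric.ball μ ε, Metric.ball_mem_nhds μ hε, (convex_ball μ ε).isPreconnected, γ, h1,
    fun ν hν => (hball ν hν).1.2.continuousAt.continuousWithinAt, fun ν hν => ?_⟩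
  obtain ⟨⟨⟨h3, h4⟩, -⟩, h7⟩ := hball ν hν
  exact ⟨h4, h7 h3⟩

theorem continuousOn_critVal {O : Set (RealVec m)} {γ : RealVec m → RealVec m}
    (hr : ∀ ν ∈ O, ∀ j, 1 < radius ν j) (hγ : ContinuousOn γ O) : ContinuousOn (critVal κ γ) O := by
  intro ν hν
  have h1 := (contDiffAt_xiParam (κ := κ) (q := (ν, γ ν)) (hr ν hν)).snd.continuousAt
  exact ContinuousAt.comp_continuousWithinAt (f := fun ν => (ν, γ ν)) (x := ν) h1
    (continuousWithinAt_id.prodMk (hγ ν hν))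

/-- Where a labelled family meets a section, it is contained in it. -/
theorem IsSection.eq_of_mem (hκ : ∀ i, 0 < κ i) {s C : RealVec m → RealVec m}
    (hs : IsSection κ σ s C) {O : Set (RealVec m)} (hO : IsPreconnected O)
    {γ : RealVec m → RealVec m} (hγ : ContinuousOn γ O)
    (h : ∀ ν ∈ O, (∀ j, 1 < radius ν j) ∧ IsLab κ (zeroInv ν) (γ ν) ∧
      IsType κ (zeroInv ν) (γ ν) τ) (h0 : τ 0 = σ 0) {v : RealVec m} (hv : v ∈ valueRegion κ σ)
    (hvO : s v ∈ O) : ∃ n : ℤ, ∀ ν ∈ O,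
      critVal κ (fun ν i => γ ν i + n) ν ∈ valueRegion κ σ ∧
      s (critVal κ (fun ν i => γ ν i + n) ν) = ν ∧
      C (critVal κ (fun ν i => γ ν i + n) ν) = fun i => γ ν i + n := by
  obtain ⟨-, h2, h3⟩ := h _ hvO
  obtain ⟨hστ, n, hn⟩ := h2.eq_add_int hκ h3 (hs.isLab v hv) (hs.isType v hv) h0.symm
  subst hστ
  set γ' : RealVec m → RealVec m := fun ν i => γ ν i + n with hγ'
  have hγc : ContinuousOn γ' O := continuousOn_pi.2 fun i =>
    (continuousOn_pi.1 hγ i).add continuousOn_const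
  have hlab : ∀ ν ∈ O, IsLab κ (zeroInv ν) (γ' ν) := fun ν hν => (h ν hν).2.1.add_int n
  have hmem : ∀ ν ∈ O, critVal κ γ' ν ∈ valueRegion κ σ := fun ν hν =>
    (hlab ν hν).values_mem hκ ((h ν hν).2.2.add_int n) _
  have hc := continuousOn_critVal (κ := κ) (fun ν hν => (h ν hν).1) hγc
  have hv0 : critVal κ γ' (s v) = v := by
    ext1 i
    rw [← hs.value v hv i, hn]
    rfl
  -- With the integer translation chosen to match at `s v`, the family and the section evaluated at
  -- its values have the same critical data, hence agree on the connected set.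
  have := eqOn_of_values_eq hκ hO (p := fun ν => (ν, γ' ν))
    (q := fun ν => (s (critVal κ γ' ν), C (critVal κ γ' ν))) (a := s v)
    (continuousOn_id.prodMk hγc)
    ((hs.continuousOn.comp hc hmem).prodMk (hs.continuousOn_crit.comp hc hmem))
    (fun ν hν => (h ν hν).1) hlab (fun ν hν => hs.isLab _ (hmem ν hν))
    (fun ν hν i => by rw [hs.value _ (hmem ν hν)]; rfl) hvO (by rw [hv0, hn])
  refine ⟨n, fun ν hν => ⟨hmem ν hν, ?_, ?_⟩⟩
  · exact (congrArg Prod.fst (this hν)).symm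
  · exact (congrArg Prod.snd (this hν)).symm

/-- The critical values are smooth coordinates on each component of the multimodal parameters. -/
theorem exists_smooth_coordinates (hκ : ∀ i, 0 < κ i) {μ₀ : RealVec m}
    (hμ₀ : μ₀ ∈ multimodalParams κ) :
    ∃ (σ : Equiv.Perm (Fin m)) (c s : RealVec m → RealVec m), σ 0 = 0 ∧
      IsOpen (connectedComponentIn (multimodalParams κ) μ₀) ∧
      (∀ μ ∈ connectedComponentIn (multimodalParams κ) μ₀, ContDiffAt ℝ ∞ c μ ∧
        IsLab κ (zeroInv μ) (c μ) ∧ IsType κ (zeroInv μ) (c μ) σ ∧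
        critVal κ c μ ∈ valueRegion κ σ ∧ s (critVal κ c μ) = μ) ∧
      (∀ v ∈ valueRegion κ σ, s v ∈ connectedComponentIn (multimodalParams κ) μ₀ ∧
        critVal κ c (s v) = v) ∧ ContDiffOn ℝ ∞ s (valueRegion κ σ) := by
  set U := connectedComponentIn (multimodalParams κ) μ₀ with hU
  obtain ⟨c₀, σ, h, hσ, hσ0⟩ := exists_isLab_isType hκ hμ₀
  obtain ⟨s, C, hs1, hs2, hs3, hs4, -⟩ := exists_param_section hκ hμ₀.1 h hσ
  have hs : IsSection κ σ s C := ⟨hs1, hs2, fun v hv => (hs3 v hv).1, fun v hv => (hs3 v hv).2.1,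
    fun v hv => (hs3 v hv).2.2.1, fun v hv => (hs3 v hv).2.2.2⟩
  set V := valueRegion κ σ with hV
  have hVo : IsOpen V := isOpen_valueRegion
  have hv₀ : _ ∈ V := h.values_mem hκ hσ (etaShift κ μ₀)
  -- Around any multimodal parameter there is a neighbourhood contained in the image of the section
  -- as soon as it meets that image. This yields both openness and relative closedness.
  have hloc : ∀ μ ∈ multimodalParams κ, ∃ O ∈ 𝓝 μ, ∃ γ : RealVec m → RealVec m,
      ContDiffAt ℝ ∞ γ μ ∧ ∀ v ∈ V, s v ∈ O → ∃ n : ℤ, ∀ ν ∈ O,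
        critVal κ (fun ν i => γ ν i + n) ν ∈ V ∧ s (critVal κ (fun ν i => γ ν i + n) ν) = ν ∧
        C (critVal κ (fun ν i => γ ν i + n) ν) = fun i => γ ν i + n := by
    intro μ hμ
    obtain ⟨c, τ, h1, h2, h3⟩ := exists_isLab_isType hκ hμ
    obtain ⟨O, hO, hOp, γ, hγ1, hγ2, hγ3⟩ := exists_smooth_isLab hκ hμ.1 h1 h2
    exact ⟨O, hO, γ, hγ1, fun v hv hvO => hs.eq_of_mem hκ hOp hγ2 hγ3 (h3.trans hσ0.symm) hv hvO⟩
  have hTU : s '' V ⊆ U := by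
    have h1 : IsPreconnected (s '' V) := convex_valueRegion.isPreconnected.image s hs1
    refine h1.subset_connectedComponentIn ⟨_, hv₀, hs4⟩ ?_
    rintro _ ⟨v, hv, rfl⟩
    exact hs.mem_multimodalParams hκ hv
  have hUD : U ⊆ multimodalParams κ := connectedComponentIn_subset _ _
  have hTo : IsOpen (s '' V) := by
    rw [isOpen_iff_mem_nhds]
    rintro _ ⟨v, hv, rfl⟩
    obtain ⟨O, hO, γ, -, h1⟩ := hloc _ (hs.mem_multimodalParams hκ hv)
    obtain ⟨n, hn⟩ := h1 v hv (mem_of_mem_nhds hO)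
    filter_upwards [hO] with ν hν
    exact ⟨_, (hn ν hν).1, (hn ν hν).2.1⟩
  -- The image is open, nonempty and relatively closed in the connected set `U`.
  have hUT : U ⊆ s '' V := by
    refine isPreconnected_connectedComponentIn.subset_of_closure_inter_subset hTo
      ⟨μ₀, mem_connectedComponentIn hμ₀, _, hv₀, hs4⟩ ?_
    rintro μ ⟨hμ1, hμ2⟩
    obtain ⟨O, hO, γ, -, h1⟩ := hloc μ (hUD hμ2)
    obtain ⟨_, hvO, v, hv, rfl⟩ := mem_closure_iff_nhds.1 hμ1 O hO
    obtain ⟨n, hn⟩ := h1 v hv hvO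
    exact ⟨_, (hn μ (mem_of_mem_nhds hO)).1, (hn μ (mem_of_mem_nhds hO)).2.1⟩
  have hUeq : s '' V = U := subset_antisymm hTU hUT
  -- The inverse of the section is the critical value map, and composing it with `C` gives a
  -- globally consistent choice of critical points.
  set g := Function.invFunOn s V with hg
  have hg1 : ∀ μ ∈ U, g μ ∈ V ∧ s (g μ) = μ := fun μ hμ =>
    ⟨Function.invFunOn_mem (hUT hμ), Function.invFunOn_eq (hUT hμ)⟩
  have hg2 : ∀ v ∈ V, g (s v) = v := (hs.injOn hκ).leftInvOn_invFunOn
  have hcv : ∀ μ ∈ U, critVal κ (fun μ => C (g μ)) μ = g μ := by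
    intro μ hμ
    ext1 i
    have := hs.value _ (hg1 μ hμ).1 i
    rwa [(hg1 μ hμ).2] at this
  refine ⟨σ, fun μ => C (g μ), s, hσ0, hUeq ▸ hTo, fun μ hμ => ⟨?_, ?_, ?_, ?_, ?_⟩,
    fun v hv => ⟨hTU ⟨v, hv, rfl⟩, ?_⟩, fun v hv => ContDiffAt.contDiffWithinAt ?_⟩
  · obtain ⟨O, hO, γ, hγ, h1⟩ := hloc μ (hUD hμ)
    obtain ⟨v, hv, rfl⟩ := hUT hμ
    obtain ⟨n, hn⟩ := h1 v hv (mem_of_mem_nhds hO)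
    have h2 : ContDiffAt ℝ ∞ (fun ν => (fun i => γ ν i + n : RealVec m)) (s v) :=
      contDiffAt_pi.2 fun i => (contDiffAt_pi.1 hγ i).add contDiffAt_const
    refine h2.congr_of_eventuallyEq ?_
    filter_upwards [hO] with ν hν
    obtain ⟨h3, h4, h5⟩ := hn ν hν
    rw [← h5]
    congr 1
    conv_lhs => rw [← h4]
    exact hg2 _ h3
  · have := hs.isLab _ (hg1 μ hμ).1
    rwa [(hg1 μ hμ).2] at this
  · have := hs.isType _ (hg1 μ hμ).1
    rwa [(hg1 μ hμ).2] at this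
  · rw [hcv μ hμ]; exact (hg1 μ hμ).1
  · rw [hcv μ hμ]; exact (hg1 μ hμ).2
  · rw [hcv _ (hTU ⟨v, hv, rfl⟩), hg2 v hv]
  -- The section was only known to be continuous; locally it agrees with the smooth inverse of the
  -- critical data restricted to vanishing derivatives.
  · obtain ⟨G, hG1, hG2, hG3, -⟩ :=
      (hs.isLab v hv).exists_xiParam_inverse (q := (s v, C v)) hκ (hs.one_lt_radius v hv)
    have hxi : ∀ w ∈ V, xiParam κ (s w, C w) = (0, w) := fun w hw =>
      Prod.ext (funext fun i => (hs.isLab w hw).crit i) (funext fun i => hs.value w hw i)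
    rw [hxi v hv] at hG1
    have h1 : ContDiffAt ℝ ∞ (fun w : RealVec m => (G (0, w)).1) v :=
      (ContDiffAt.comp v (f := fun w : RealVec m => ((0 : RealVec m), w)) hG1
        (contDiffAt_const.prodMk contDiffAt_id)).fst
    refine h1.congr_of_eventuallyEq ?_
    have h2 : ContinuousAt (fun w => (s w, C w)) v :=
      (hs1.continuousAt (hVo.mem_nhds hv)).prodMk (hs2.continuousAt (hVo.mem_nhds hv))
    filter_upwards [hVo.mem_nhds hv, h2.eventually hG3] with w hw hw'
    rw [hxi w hw] at hw'
    rw [hw']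

end

/-! ### Arbitrary lifts and labellings; existence and uniqueness of the permutation. -/

section

variable {m : ℕ} {κ : Fin (m + 1) → ℕ} [NeZero m] {σ : Equiv.Perm (Fin m)} {U : Set (RealVec m)}

theorem isLiftFamily_lr (hU : ∀ μ ∈ U, ∀ j, 1 < radius μ j) :
    IsLiftFamily κ U fun μ => lr κ (etaShift κ μ) (zeroInv μ) := by
  refine ⟨?_, fun μ hμ => isCircleLift_lr (hU μ hμ)⟩
  rintro ⟨μ, t⟩ ⟨hμ, -⟩
  refine ContinuousAt.continuousWithinAt ?_
  have h1 := continuousAt_lr (κ := κ) (p := (etaShift κ μ, zeroInv μ, t))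
    fun j => norm_zeroInv_lt_one (hU μ hμ j)
  refine ContinuousAt.comp (f := fun p : RealVec m × ℝ => (etaShift κ p.1, zeroInv p.1, p.2))
    (x := (μ, t)) h1 ?_
  refine ContinuousAt.prodMk ?_ (ContinuousAt.prodMk ?_ continuousAt_snd)
  · exact contDiff_etaShift.continuous.continuousAt.comp continuousAt_fst
  · refine continuousAt_pi.2 fun j => ?_
    exact (contDiffAt_zeroInv (one_pos.trans (hU μ hμ j)).ne').continuousAt.comp_of_eq
      continuousAt_fst rfl

theorem isCriticalLabelling_of_isLab (hκ : ∀ i, 0 < κ i) (hU : ∀ μ ∈ U, ∀ j, 1 < radius μ j)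
    {c : RealVec m → RealVec m} (hc : ContinuousOn c U) (h : ∀ μ ∈ U, IsLab κ (zeroInv μ) (c μ))
    (hσ : ∀ μ ∈ U, IsType κ (zeroInv μ) (c μ) σ) (h0 : σ 0 = 0) :
    IsCriticalLabelling κ U σ (fun μ => lr κ (etaShift κ μ) (zeroInv μ)) fun i μ => c μ i where
  continuousOn := continuousOn_pi.1 hc
  strictMono μ hμ := (h μ hμ).strictMono
  lt_add_one μ hμ := (h μ hμ).lt_add_one
  isLocalMax μ hμ j := (isLocalMax_lr_iff (etaShift κ μ) fun t => by rw [lr_eq_add, add_comm]).2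
    ((h μ hμ).isLocalMax hκ j)
  isLocalMin μ hμ j := (isLocalMin_lr_iff (etaShift κ μ) fun t => by rw [lr_eq_add, add_comm]).2
    ((h μ hμ).isLocalMin hκ j)
  perm_zero := h0
  fst_mem_frontier μ hμ j := ((h μ hμ).mem_frontier_iff (hU μ hμ)).2
    (((h μ hμ).fst_mem_touch_iff hκ (hσ μ hμ)).2 rfl)
  snd_mem_frontier μ hμ j := ((h μ hμ).mem_frontier_iff (hU μ hμ)).2
    (((h μ hμ).snd_mem_touch_iff hκ (hσ μ hμ)).2 rfl)

/-- The 2m local extrema in cyclic order form a labelling, and the frontier condition at the maxima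
already determines its type. -/
theorem IsCriticalLabelling.isLab (hκ : ∀ i, 0 < κ i) (hU : U ⊆ multimodalParams κ)
    {F : RealVec m → ℝ → ℝ} {C : Fin (2 * m) → RealVec m → ℝ} (hF : IsLiftFamily κ U F)
    (hC : IsCriticalLabelling κ U σ F C) {μ : RealVec m} (hμ : μ ∈ U) :
    IsLab κ (zeroInv μ) (fun i => C i μ) ∧ IsType κ (zeroInv μ) (fun i => C i μ) σ := by
  have hr := (hU hμ).1
  obtain ⟨x, hx⟩ := (hF.isCircleLift μ hμ).exists_eq_lr_zero hr
  obtain ⟨c, hc⟩ := exists_isLab_of_mem hκ (hU hμ)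
  have h1 : IsLab κ (zeroInv μ) (fun i => C i μ) := by
    refine isLab_of_isLocalExtr hκ (fun j => norm_zeroInv_lt_one (hr j)) (hC.strictMono μ hμ)
      (hC.lt_add_one μ hμ) (fun i => ?_) hc.not_rr_eq_zero
      ((isLocalMax_lr_iff x hx).1 (hC.isLocalMax μ hμ 0))
    obtain ⟨j, rfl | rfl⟩ := eq_fstIdx_or_sndIdx i
    · exact Or.inr ((isLocalMax_lr_iff x hx).1 (hC.isLocalMax μ hμ j))
    · exact Or.inl ((isLocalMin_lr_iff x hx).1 (hC.isLocalMin μ hμ j))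
  obtain ⟨τ, hτ⟩ := h1.exists_isType hκ
  have h2 : σ = τ := Equiv.ext fun j =>
    (h1.fst_mem_touch_iff hκ hτ).1 ((h1.mem_frontier_iff hr).1 (hC.fst_mem_frontier μ hμ j))
  exact ⟨h1, h2 ▸ hτ⟩

/-- The target is invariant under the translation, so composing with it preserves the diffeomorphism
property. -/
theorem isDiffeoBetween_of_eq_add {E : Type*} [NormedAddCommGroup E] [NormedSpace ℝ E]
    {f φ s : E → E} {U W : Set E} (hU : IsOpen U) (hW : IsOpen W) (hφ : MapsTo φ U W)
    (hs : MapsTo s W U) (hinv : InvOn s φ U W) (hφc : ContDiffOn ℝ ∞ φ U)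
    (hsc : ContDiffOn ℝ ∞ s W) {x : E} (hW1 : ∀ v, v + x ∈ W ↔ v ∈ W)
    (hf : ∀ μ ∈ U, f μ = φ μ + x) : IsDiffeoBetween f U W := by
  have hW2 : ∀ v ∈ W, v - x ∈ W := fun v hv => by rwa [← hW1, sub_add_cancel]
  have hfm : MapsTo f U W := fun μ hμ => by rw [hf μ hμ, hW1]; exact hφ hμ
  have hsm : MapsTo (fun v => s (v - x)) W U := fun v hv => hs (hW2 v hv)
  have hi : InvOn (fun v => s (v - x)) f U W := by
    refine ⟨fun μ hμ => ?_, fun v hv => ?_⟩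
    · simp only [hf μ hμ, add_sub_cancel_right]
      exact hinv.1 hμ
    · rw [hf _ (hsm hv), hinv.2 (hW2 v hv), sub_add_cancel]
  exact ⟨hU, hW, hi.bijOn hfm hsm, (hφc.add contDiffOn_const).congr hf, _, hi,
    hsc.comp (contDiff_id.sub contDiff_const).contDiffOn hW2⟩

theorem exists_const_of_int {X : Type*} [TopologicalSpace X] {S : Set X} (hS : IsPreconnected S)
    {f : X → ℝ} (hf : ContinuousOn f S) (h : ∀ x ∈ S, ∃ k : ℤ, f x = k) :
    ∃ k : ℤ, ∀ x ∈ S, f x = k := by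
  choose! k hk using h
  have hkc : ContinuousOn k S := by
    rw [Int.isClosedEmbedding_coe_real.isInducing.continuousOn_iff]
    exact hf.congr fun x hx => (hk x hx).symm
  rcases S.eq_empty_or_nonempty with rfl | ⟨a, ha⟩
  · exact ⟨0, fun x hx => hx.elim⟩
  · exact ⟨k a, fun x hx => by rw [hk x hx, hS.constant hkc hx ha]⟩

/-- The critical values of any labelled lift family differ from given ones by a constant. -/
theorem IsCriticalLabelling.exists_eq_add (hκ : ∀ i, 0 < κ i) (hU : U ⊆ multimodalParams κ)
    (hUp : IsPreconnected U) {c : RealVec m → RealVec m} (hc : ContinuousOn c U)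
    (h : ∀ μ ∈ U, IsLab κ (zeroInv μ) (c μ)) (hσ : ∀ μ ∈ U, IsType κ (zeroInv μ) (c μ) σ)
    {F : RealVec m → ℝ → ℝ} {C : Fin (2 * m) → RealVec m → ℝ} (hF : IsLiftFamily κ U F)
    (hC : IsCriticalLabelling κ U σ F C) :
    ∃ x : ℝ, ∀ μ ∈ U, criticalValues F C μ = critVal κ c μ + fun _ => x := by
  have h1 : ∀ μ ∈ U, ∃ k : ℤ, ∀ i, F μ (C i μ) = critVal κ c μ i + k := by
    intro μ hμ
    obtain ⟨h2, h3⟩ := hC.isLab hκ hU hF hμ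
    obtain ⟨-, n, hn⟩ := (h μ hμ).eq_add_int hκ (hσ μ hμ) h2 h3 rfl
    obtain ⟨l, hl⟩ := (hF.isCircleLift μ hμ).exists_eq_lr (hU hμ).1
    refine ⟨n * circleDegree κ + l, fun i => ?_⟩
    rw [hl, show C i μ = c μ i + n from congrFun hn i, lr_add_int, critVal]
    push_cast
    ring
  have h2 : ContinuousOn (fun μ => F μ (C (fstIdx 0) μ)) U :=
    hF.continuousOn.comp (continuousOn_id.prodMk (hC.continuousOn _)) fun μ hμ => ⟨hμ, mem_univ _⟩
  have h3 : ContinuousOn (fun μ => critVal κ c μ (fstIdx 0)) U :=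
    continuousOn_pi.1 (continuousOn_critVal (fun μ hμ => (hU hμ).1) hc) _
  -- At each parameter the two value vectors differ by one integer in all coordinates; by continuity
  -- of the first coordinate this integer is constant on the connected set.
  obtain ⟨k, hk⟩ := exists_const_of_int hUp (h2.sub h3) fun μ hμ => by
    obtain ⟨k, hk⟩ := h1 μ hμ
    exact ⟨k, by rw [Pi.sub_apply, hk, add_sub_cancel_left]⟩
  refine ⟨k, fun μ hμ => ?_⟩
  obtain ⟨k', hk'⟩ := h1 μ hμ
  have h4 := hk μ hμ
  rw [Pi.sub_apply, hk', add_sub_cancel_left] at h4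
  ext1 i
  rw [criticalValues, hk', h4]
  rfl

theorem exists_unique_type (hκ : ∀ i, 0 < κ i) (hU : ∃ μ₀ ∈ multimodalParams κ,
    U = connectedComponentIn (multimodalParams κ) μ₀) :
    ∃! σ : Equiv.Perm (Fin m),
      (∃ F C, IsLiftFamily κ U F ∧ IsCriticalLabelling κ U σ F C) ∧
      ∀ F C, IsLiftFamily κ U F → IsCriticalLabelling κ U σ F C →
        IsDiffeoBetween (criticalValues F C) U (valueRegion κ σ) := by
  obtain ⟨μ₀, hμ₀, rfl⟩ := hU
  obtain ⟨σ, c, s, h0, hUo, h, hs, hsc⟩ := exists_smooth_coordinates hκ hμ₀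
  set U := connectedComponentIn (multimodalParams κ) μ₀ with hU
  have hUD : U ⊆ multimodalParams κ := connectedComponentIn_subset _ _
  have hUp : IsPreconnected U := isPreconnected_connectedComponentIn
  have hr : ∀ μ ∈ U, ∀ j, 1 < radius μ j := fun μ hμ => (hUD hμ).1
  have hc : ContinuousOn c U := fun μ hμ => (h μ hμ).1.continuousAt.continuousWithinAt
  have hl : ∀ μ ∈ U, IsLab κ (zeroInv μ) (c μ) := fun μ hμ => (h μ hμ).2.1
  have ht : ∀ μ ∈ U, IsType κ (zeroInv μ) (c μ) σ := fun μ hμ => (h μ hμ).2.2.1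
  refine ⟨σ, ⟨⟨_, _, isLiftFamily_lr hr, isCriticalLabelling_of_isLab hκ hr hc hl ht h0⟩,
    fun F C hF hC => ?_⟩, ?_⟩
  · obtain ⟨x, hx⟩ := hC.exists_eq_add hκ hUD hUp hc hl ht hF
    refine isDiffeoBetween_of_eq_add (φ := critVal κ c) (s := s) (x := fun _ => x) hUo
      isOpen_valueRegion (fun μ hμ => (h μ hμ).2.2.2.1) (fun v hv => (hs v hv).1)
      ⟨fun μ hμ => (h μ hμ).2.2.2.2, fun v hv => (hs v hv).2⟩
      (fun μ hμ => (contDiffAt_critVal le_rfl (hr μ hμ) (h μ hμ).1).contDiffWithinAt) hsc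
      (fun v => ⟨fun hv => ?_, fun hv => add_const_mem_valueRegion x hv⟩) hx
    have := add_const_mem_valueRegion (-x) hv
    simpa using this
  -- For uniqueness the existence half suffices: at `μ₀` any admissible labelling is an integer
  -- translate of the given one, hence has the same type.
  · rintro τ ⟨⟨F, C, hF, hC⟩, -⟩
    have hμU : μ₀ ∈ U := mem_connectedComponentIn hμ₀
    obtain ⟨h1, h2⟩ := hC.isLab hκ hUD hF hμU
    exact ((hl μ₀ hμU).eq_add_int hκ (ht μ₀ hμU) h1 h2 (hC.perm_zero.trans h0.symm)).1

end

end BlaschkeFamily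
end

theorem mainTheorem4 (m : ℕ) [NeZero m] (κ : Fin (m + 1) → ℕ) (hκ : ∀ i, 0 < κ i)
    (U : Set (BlaschkeFamily.RealVec m))
    (hU : ∃ μ₀ ∈ BlaschkeFamily.multimodalParams κ,
      U = connectedComponentIn (BlaschkeFamily.multimodalParams κ) μ₀) :
    ∃! σ : Equiv.Perm (Fin m),
      (∃ F C, BlaschkeFamily.IsLiftFamily κ U F ∧
        BlaschkeFamily.IsCriticalLabelling κ U σ F C) ∧
      ∀ F C, BlaschkeFamily.IsLiftFamily κ U F →
        BlaschkeFamily.IsCriticalLabelling κ U σ F C →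
        BlaschkeFamily.IsDiffeoBetween (BlaschkeFamily.criticalValues F C) U
          (BlaschkeFamily.valueRegion κ σ) := by
  exact BlaschkeFamily.exists_unique_type hκ hU
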